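/- Notation. For an odd, positive, square-free integer $d$ let $\chi_{8d}$ be the real primitive Dirichlet character modulo $8d$ given by the Kronecker symbol $\chi_{8d}(n)=\left(\frac{8d}{n}\right)$, and let $L(s,\chi_{8d})$ be its (analytically continued) Dirichlet $L$-function. For real $X\ge 2$ put $$P_X(\chi_{8d})=\exp\bigg(\sum_{2\le n\le X}\frac{\Lambda(n)\chi_{8d}(n)}{n^{1/2}\log n}\bigg),$$ where $\Lambda$ is von Mangoldt's function. Write $\sum^{\flat}_{0<d\le D}$ for a sum over the odd, square-free integers $d\in(0,D]$, let $D^{*}$ be the number of such $d$, and let $\gamma$ be Euler's constant. Theorem. Let $\delta>0$. As $X,D\to\infty$ (through real values, in any manner) subject to $X\ll(\log D)^{2-\delta}$, $$\frac{1}{D^{*}}\sum_{0<d\le D}^{\flat}L(\tfrac12,\chi_{8d})\,P_X(\chi_{8d})^{-1}\sim\frac{1}{\sqrt2}\,\frac{\log D}{e^{\gamma}\log X}.$$ -/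

import Mathlib

open Filter Asymptotics
open scoped NumberTheorySymbols

/-- Oddness is preserved under reduction modulo `8 * d`. -/
theorem odd_mod_eight_mul (d n : ℕ) : Odd (n % (8 * d)) ↔ Odd n := by
  rw [Nat.odd_iff, Nat.odd_iff, Nat.mod_mod_of_dvd n (Dvd.intro (4 * d) (by ring))]

/-- For odd `n` the Jacobi symbol `(8d / n)` depends only on `n` modulo `8 * d`. -/
theorem jacobiSym_eight_mul_mod (d n : ℕ) (hn : Odd n) :
    J((8 * d : ℕ) | n % (8 * d)) = J((8 * d : ℕ) | n) := by
  have key : ∀ m : ℕ, Odd m → J((8 * d : ℕ) | m) = J((2 * d : ℕ) | m) := by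
    intro m hm
    have h1 : ((8 * d : ℕ) : ℤ) = 2 ^ 2 * ((2 * d : ℕ) : ℤ) := by push_cast; ring
    rw [h1, jacobiSym.mul_left, jacobiSym.sq_one', one_mul]
    exact hm.coprime_two_left
  rw [key _ ((odd_mod_eight_mul d n).2 hn), key n hn, jacobiSym.mod_right _ hn]
  congr 2
  rw [Int.natAbs_natCast]
  ring

/-- The real Dirichlet character `χ_{8d}` modulo `8d`, that is, the Kronecker symbol
`n ↦ (8d / n)`: it is the Jacobi symbol `(8d / n)` for odd `n ≥ 0`, and `0` for even `n`. -/
noncomputable def chi8 (d : ℕ) : DirichletCharacter ℂ (8 * d) where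
  toFun x := if Odd x.val then ((J((8 * d : ℕ) | x.val) : ℤ) : ℂ) else 0
  map_one' := by
    have h : (1 : ZMod (8 * d)).val = 1 := ZMod.val_one'' (by omega)
    simp [h]
  map_mul' x y := by
    by_cases hx : Odd x.val
    · by_cases hy : Odd y.val
      · have hxy : Odd (x.val * y.val) := hx.mul hy
        have h2 : Odd (x * y).val := by
          rw [ZMod.val_mul, odd_mod_eight_mul]; exact hxy
        have : NeZero x.val := ⟨hx.pos.ne'⟩
        have : NeZero y.val := ⟨hy.pos.ne'⟩
        simp only [if_pos hx, if_pos hy, if_pos h2]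
        rw [ZMod.val_mul, jacobiSym_eight_mul_mod d _ hxy, jacobiSym.mul_right]
        push_cast
        ring
      · have h2 : ¬ Odd (x * y).val := by
          rw [ZMod.val_mul, odd_mod_eight_mul, Nat.odd_mul]; tauto
        simp [hy, h2]
    · have h2 : ¬ Odd (x * y).val := by
        rw [ZMod.val_mul, odd_mod_eight_mul, Nat.odd_mul]; tauto
      simp [hx, h2]
  map_nonunit' x hx := by
    split_ifs with hodd
    · have h0 : NeZero x.val := ⟨hodd.pos.ne'⟩
      have hz : J((8 * d : ℕ) | x.val) = 0 := by
        rw [jacobiSym.eq_zero_iff_not_coprime, Int.gcd_natCast_natCast]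
        intro hc
        apply hx
        rcases Nat.eq_zero_or_pos d with rfl | hd
        · have h1 : x.val = 1 := (Nat.gcd_zero_left _).symm.trans hc
          exact Int.isUnit_iff_natAbs_eq.2 h1
        · have : NeZero (8 * d) := ⟨by omega⟩
          rw [← ZMod.natCast_zmod_val x, ZMod.isUnit_iff_coprime]
          exact Nat.Coprime.symm hc
      rw [hz, Int.cast_zero]
    · rfl

/-- The central value `L(1/2, χ_{8d})`, for `d ≥ 1`, of the analytically continued Dirichlet
`L`-function. The value at `d = 0` is a placeholder, as there is no modulus `0`. -/
noncomputable def centralValue (d : ℕ) : ℂ :=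
  if h : d = 0 then 0
  else
    haveI : NeZero (8 * d) := ⟨mul_ne_zero (by norm_num) h⟩
    DirichletCharacter.LFunction (chi8 d) (1 / 2)

/-- `P_X(χ_{8d}) = exp (∑_{n ≤ X} Λ(n) χ_{8d}(n) / (n^{1/2} log n))`. The sum starts at `n = 2`
because `Λ(1) = 0`. -/
noncomputable def eulerPart (X : ℝ) (d : ℕ) : ℂ :=
  Complex.exp (∑ n ∈ Finset.Icc 2 ⌊X⌋₊,
    ((ArithmeticFunction.vonMangoldt n / (Real.sqrt n * Real.log n) : ℝ) : ℂ) *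
      chi8 d (n : ZMod (8 * d)))

open scoped Classical in
/-- The odd, positive, square-free integers `d` in `(0, D]`. -/
noncomputable def oddSquarefree (D : ℝ) : Finset ℕ :=
  {d ∈ Finset.Ioc 0 ⌊D⌋₊ | Odd d ∧ Squarefree d}

/-- The average `(1 / D*) ∑ L(1/2, χ_{8d}) P_X(χ_{8d})⁻¹` over the odd, square-free `d` in
`(0, D]`, where `D*` is the number of such `d`. -/
noncomputable def averageLP (X D : ℝ) : ℂ :=
  (1 / ((oddSquarefree D).card : ℂ)) *
    ∑ d ∈ oddSquarefree D, centralValue d * (eulerPart X d)⁻¹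

/-!
The average is computed as a twisted first moment of the central values. Four ideas carry it.

The central value is twice a smoothed sum of length `√(8d)`: this is the approximate functional
equation `centralValue_eq`. It rests on the functional equation `chiTheta_eq` of the theta series of
`χ_{8d}`, whose root number is `1` because of the evaluation of the Gauss sum in `finiteFT_chiZ`; the
sign of the quadratic Gauss sum comes from the theta function itself (`quadGauss_one_mul`).

The reciprocal `P_X⁻¹` is a Dirichlet series in `χ_{8d}(l) l^{-1/2}` with multiplicative
coefficients of absolute value at most `1`, supported on integers `l` without prime factors above
`X` (`summable_and_eulerPart_inv_eq_tsum`). Rankin's trick (`tsum_eulerInvCoeff_rpow_le`) bounds its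
part beyond `Z = D^{1/64}` by `Z^{-η} exp(O(X^{1/2 + η}))`. For `X ≪ (log D)^{2 - δ}` this saves a
power of `D`, which suffices next to the bound `O(D^{1 + ε})` for the first absolute moment
(`exists_sum_abs_smoothSum_le`). This is the only place where the size of `X` matters in an
essential way.

For `l ≤ Z` the terms of the twisted moment for which `n l` is not a square are negligible by the
Pólya–Vinogradov inequality (`exists_abs_offDiagonal_le`). The remaining terms give
`½ log(8d) ∏_{p ∣ 2d} (1 - 1/p)` times an Euler product over the primes `p ∤ 2d`
(`diagonal_eq`, `exists_abs_moment_sub_le`).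

The local factor of that Euler product at `p` is `∑_j a_j p^{-⌈j/2⌉}`, where `∑_j a_j z^j` is
`exp(-∑_{k ≤ K} z^k / k)` with `p^K ≤ X < p^{K+1}`. As this series agrees with `1 - z` up to degree
`K`, the local factor is nearly `1 - 1/p` for `p ≤ √X`. For `√X < p ≤ X` one has `K = 1`, and the
factor is `1 - 1/p + 1/(2p) + O(p^{-2})`, nearly `√(1 - 1/p)`
(`abs_diagFactor_div_sub_one_le`). On average over `d` the Euler product may thus be replaced by
the square root of the product of `∏_{p ≤ √X} (1 - 1/p)` and `∏_{p ≤ X} (1 - 1/p)`, which is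
asymptotic to `√2 e^{-γ} / log X` by Mertens' third theorem (`exists_abs_sum_main_sub_le`,
`tendsto_modelProduct_mul_log`). Together with the factor `½` of the diagonal this produces the
constant `1/√2`.
-/

/-! ### Quadratic Gauss sums by means of the theta function -/

/-- As `Im τ → ∞`, the theta function with real first argument tends to its constant term. -/
theorem tendsto_jacobiTheta₂_one {β : Type*} {l : Filter β} (a : ℝ) (τ : β → ℂ)
    (hτ : Tendsto (fun x => (τ x).im) l atTop) :
    Tendsto (fun x => jacobiTheta₂ a (τ x)) l (nhds 1) := by
  have h1 : (∑' n : ℤ, if n = 0 then (1 : ℂ) else 0) = 1 := tsum_ite_eq 0 _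
  rw [← h1]
  refine tendsto_tsum_of_dominated_convergence
    (bound := fun n : ℤ => (|n| ^ 0 : ℝ) * Real.exp (-Real.pi * (1 * n ^ 2 - 2 * 0 * |n|)))
    (by simpa using summable_pow_mul_jacobiTheta₂_term_bound 0 one_pos 0) ?_ ?_
  · intro n
    split_ifs with hn
    · subst hn
      simpa [jacobiTheta₂_term] using tendsto_const_nhds
    · rw [tendsto_zero_iff_norm_tendsto_zero]
      simp only [norm_jacobiTheta₂_term, Complex.ofReal_im, mul_zero, sub_zero]
      refine Real.tendsto_exp_atBot.comp ?_
      refine Tendsto.const_mul_atTop_of_neg ?_ hτ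
      have : (0 : ℝ) < (n : ℝ) ^ 2 := by positivity
      nlinarith [Real.pi_pos]
  · filter_upwards [hτ.eventually_ge_atTop 1] with x hx n
    simpa using norm_jacobiTheta₂_term_le (S := 0) (z := a) one_pos (by simp) hx n

theorem re_cpow_half_pos {σ : ℂ} (hσ : 0 < σ.re) : 0 < (σ ^ (1 / 2 : ℂ)).re := by
  have : σ ^ (1 / 2 : ℂ) = σ ^ (2⁻¹ : ℂ) := by norm_num
  rw [this, Complex.cpow_inv_two_re]
  have := norm_nonneg σ
  positivity

theorem cpow_half_sq (σ : ℂ) : (σ ^ (1 / 2 : ℂ)) ^ 2 = σ := by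
  simp

theorem cpow_half_eq {σ x : ℂ} (hx : 0 < x.re) (h : x ^ 2 = σ) : σ ^ (1 / 2 : ℂ) = x := by
  rw [← h, one_div, Complex.sq_cpow_two_inv hx]

/-- Poisson summation for a Gaussian of complex width along an arithmetic progression. -/
theorem hasSum_gaussian_progression (σ : ℂ) (hσ : 0 < σ.re) (M : ℕ) (hM : 0 < M) (r : ℝ) :
    HasSum (fun m : ℤ => Complex.exp (-Real.pi * σ * (r + M * m) ^ 2))
      (1 / (M * σ ^ (1 / 2 : ℂ)) *
        jacobiTheta₂ ((r / M : ℝ) : ℂ) (Complex.I / (M ^ 2 * σ))) := by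
  have hσ0 : σ ≠ 0 := by rintro rfl; simp at hσ
  have hM0 : (M : ℂ) ≠ 0 := by exact_mod_cast hM.ne'
  have hc : σ ^ (1 / 2 : ℂ) ≠ 0 := by simp [Complex.cpow_eq_zero_iff, hσ0]
  have hτ : -1 / (Complex.I / (M ^ 2 * σ)) = Complex.I * (M ^ 2 * σ) := by
    field_simp; simp
  have him : 0 < (Complex.I * (M ^ 2 * σ)).im := by
    have : (Complex.I * (M ^ 2 * σ)).im = (M : ℝ) ^ 2 * σ.re := by
      have : Complex.I * ((M : ℂ) ^ 2 * σ) = Complex.I * (((M ^ 2 : ℝ) : ℂ) * σ) := by push_cast; ring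
      rw [this, Complex.I_mul_im, Complex.re_ofReal_mul]
    rw [this]; positivity
  have hpow : (-Complex.I * (Complex.I / (M ^ 2 * σ))) ^ (1 / 2 : ℂ)
      = 1 / (M * σ ^ (1 / 2 : ℂ)) := by
    apply cpow_half_eq
    · rw [one_div, Complex.inv_re]
      have h1 : 0 < ((M : ℂ) * σ ^ (1 / 2 : ℂ)).re := by
        have := re_cpow_half_pos hσ
        rw [← Complex.ofReal_natCast, Complex.re_ofReal_mul]
        positivity
      exact div_pos h1 (Complex.normSq_pos.2 (mul_ne_zero hM0 hc))
    · rw [div_pow, mul_pow, cpow_half_sq]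
      field_simp
      simp
  rw [jacobiTheta₂_functional_equation, hτ, hpow]
  have := (hasSum_jacobiTheta₂_term (((r / M : ℝ) : ℂ) / (Complex.I / (M ^ 2 * σ))) him)
  have := (this.mul_left (Complex.exp (-Real.pi * Complex.I * ((r / M : ℝ) : ℂ) ^ 2 /
    (Complex.I / (M ^ 2 * σ)))))
  rw [← (Equiv.neg ℤ).hasSum_iff] at this
  have hv : (1 / (M * σ ^ (1 / 2 : ℂ))) * (1 / (1 / (M * σ ^ (1 / 2 : ℂ)))) = 1 := by field_simp
  rw [← mul_assoc, ← mul_assoc, hv, one_mul]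
  refine this.congr_fun ?_
  intro m
  simp only [Function.comp, Equiv.neg_apply, jacobiTheta₂_term, ← Complex.exp_add]
  congr 1
  push_cast
  field_simp
  ring_nf
  simp only [Complex.I_sq]
  ring

/-- A series over the integers, summed class by class modulo `M`. -/
theorem hasSum_int_of_progressions {g : ℤ → ℂ} {M : ℕ} (hM : 0 < M) {S : ℕ → ℂ}
    (h : ∀ r < M, HasSum (fun m : ℤ => g (r + M * m)) (S r)) :
    HasSum g (∑ r ∈ Finset.range M, S r) := by
  have h1 : ∀ r ∈ Finset.range M,
      HasSum (fun n : ℤ => if n % M = r then g n else 0) (S r) := by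
    intro r hr
    have hr' := Finset.mem_range.1 hr
    have inj : Function.Injective (fun m : ℤ => (r : ℤ) + M * m) := by
      intro a b hab
      have : (M : ℤ) ≠ 0 := by exact_mod_cast hM.ne'
      simpa [hM.ne'] using hab
    rw [← inj.hasSum_iff]
    · refine (h r hr').congr_fun ?_
      intro m
      have : ((r : ℤ) + M * m) % M = r := by
        rw [Int.add_mul_emod_self_left]
        exact Int.emod_eq_of_lt (by positivity) (by exact_mod_cast hr')
      simp [this]
    · intro n hn
      rw [if_neg]
      intro hnr
      exact hn ⟨n / M, by dsimp only; rw [← hnr]; exact Int.emod_add_mul_ediv n M⟩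
  refine (hasSum_sum h1).congr_fun ?_
  intro n
  have h0 : 0 ≤ n % (M : ℤ) := Int.emod_nonneg _ (by exact_mod_cast hM.ne')
  have h2 : n % (M : ℤ) < M := Int.emod_lt_of_pos _ (by exact_mod_cast hM)
  lift n % (M : ℤ) to ℕ using h0 with k hk
  have h3 : k < M := by exact_mod_cast h2
  simp [h3]

/-- The additive character `a ↦ exp(2πia/N)`. -/
noncomputable def eN (N : ℕ) (a : ℤ) : ℂ := Complex.exp (2 * Real.pi * Complex.I * (a / N))

theorem eN_add (N : ℕ) (a b : ℤ) : eN N (a + b) = eN N a * eN N b := by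
  rw [eN, eN, eN, ← Complex.exp_add]
  congr 1
  push_cast
  ring

theorem eN_mul_self {N : ℕ} (hN : N ≠ 0) (a : ℤ) : eN N (N * a) = 1 := by
  have hN' : (N : ℂ) ≠ 0 := by exact_mod_cast hN
  rw [eN, Complex.exp_eq_one_iff]
  exact ⟨a, by push_cast; field_simp⟩

theorem eN_mul_left {m n : ℕ} (hm : m ≠ 0) (hn : n ≠ 0) (a : ℤ) : eN (m * n) (m * a) = eN n a := by
  have hm' : (m : ℂ) ≠ 0 := by exact_mod_cast hm
  have hn' : (n : ℂ) ≠ 0 := by exact_mod_cast hn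
  rw [eN, eN]
  congr 1
  push_cast
  field_simp

theorem eN_mul_right {m n : ℕ} (hm : m ≠ 0) (hn : n ≠ 0) (a : ℤ) : eN (m * n) (n * a) = eN m a := by
  rw [mul_comm m n, eN_mul_left hn hm]

theorem eN_congr {N : ℕ} (hN : N ≠ 0) {a b : ℤ} (h : a ≡ b [ZMOD N]) : eN N a = eN N b := by
  obtain ⟨k, hk⟩ := h.dvd
  have : b = a + N * k := by linarith
  rw [this, eN_add, eN_mul_self hN, mul_one]

theorem norm_eN (N : ℕ) (a : ℤ) : ‖eN N a‖ = 1 := by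
  have : eN N a = Complex.exp ((2 * Real.pi * (a / N) : ℝ) * Complex.I) := by
    rw [eN]; congr 1; push_cast; ring
  rw [this, Complex.norm_exp_ofReal_mul_I]

/-- The quadratic Gauss sum `∑_{n mod N} exp(2πicn²/N)`. -/
noncomputable def quadGauss (N : ℕ) (c : ℤ) : ℂ := ∑ n ∈ Finset.range N, eN N (c * n ^ 2)

/-- Gauss's evaluation, obtained by comparing the behaviour of `θ` at `2 / N + iε` and at
`-1 / (2 / N + iε)` as `ε → 0`. -/
theorem quadGauss_one_mul {N : ℕ} (hN : 0 < N) :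
    quadGauss N 1 * (-Complex.I * (2 / N)) ^ (1 / 2 : ℂ) = 1 + (-Complex.I) ^ N := by
  have hN0 : (N : ℂ) ≠ 0 := by exact_mod_cast hN.ne'
  have hNr : (0 : ℝ) < N := by exact_mod_cast hN
  set l : Filter ℝ := nhdsWithin 0 (Set.Ioi 0) with hl
  -- `τ ε` approaches the cusp `2 / N` vertically, and `σ ε` measures the distance of `-1 / τ ε`
  -- from the cusp `-N / 2`.
  let τ : ℝ → ℂ := fun ε => 2 / N + Complex.I * ε
  let u : ℝ → ℂ := fun ε => 1 + Complex.I * ε * N / 2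
  let σ : ℝ → ℂ := fun ε => (N ^ 2 / 4) * ε / u ε
  have hu_re : ∀ ε, (u ε).re = 1 := by
    intro ε
    have : u ε = 1 + ((ε * N / 2 : ℝ) : ℂ) * Complex.I := by simp only [u]; push_cast; ring
    rw [this]; simp
  have hu0 : ∀ ε, u ε ≠ 0 := fun ε h => by simpa [h] using hu_re ε
  -- the theta value as a combination of theta values near the cusp at infinity
  have key1 : ∀ ε : ℝ, 0 < ε → jacobiTheta₂ 0 (τ ε) = ∑ r ∈ Finset.range N,
      eN N (1 * r ^ 2) * (1 / (N * (ε : ℂ) ^ (1 / 2 : ℂ)) *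
        jacobiTheta₂ ((r / N : ℝ) : ℂ) (Complex.I / (N ^ 2 * ε))) := by
    intro ε hε
    have him : 0 < (τ ε).im := by
      have : τ ε = ((2 / N : ℝ) : ℂ) + ε * Complex.I := by simp only [τ]; push_cast; ring
      rw [this]; simpa using hε
    refine (hasSum_jacobiTheta₂_term 0 him).unique ?_
    refine hasSum_int_of_progressions hN fun r _ => ?_
    have := (hasSum_gaussian_progression ε (by simpa using hε) N hN r).mul_left (eN N (1 * r ^ 2))
    refine this.congr_fun fun m => ?_
    have : eN N (1 * r ^ 2) = eN N (((r : ℤ) + N * m) ^ 2) := by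
      apply eN_congr hN.ne'
      rw [one_mul]
      exact ((Int.modEq_iff_dvd.2 ⟨m, by ring⟩ : (r : ℤ) ≡ r + N * m [ZMOD N])).pow 2
    rw [this, eN, jacobiTheta₂_term, ← Complex.exp_add]
    congr 1
    simp only [τ]
    push_cast
    field_simp
    ring_nf
    simp only [Complex.I_sq]
    ring
  have hτu : ∀ ε : ℝ, τ ε = 2 / N * u ε := by
    intro ε; simp only [τ, u]; field_simp
  have hστ : ∀ ε : ℝ, -1 / τ ε = -(N / 2) + Complex.I * σ ε := by
    intro ε
    have := hu0 ε
    rw [hτu]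
    simp only [σ]
    field_simp
    simp only [u]
    ring
  have hσre : ∀ ε : ℝ, 0 < ε → 0 < (σ ε).re := by
    intro ε hε
    have : σ ε = ((N ^ 2 / 4 * ε : ℝ) : ℂ) * (u ε)⁻¹ := by
      simp only [σ]; push_cast; rw [div_eq_mul_inv]
    rw [this, Complex.re_ofReal_mul, Complex.inv_re, hu_re]
    have := Complex.normSq_pos.2 (hu0 ε)
    positivity
  have hI : Complex.exp (-(Real.pi / 2 * Complex.I)) = -Complex.I := by
    rw [Complex.exp_neg, Complex.exp_pi_div_two_mul_I, Complex.inv_I]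
  -- the same at `-1 / τ ε`, where the classes modulo `2` suffice
  have key2 : ∀ ε : ℝ, 0 < ε → jacobiTheta₂ 0 (-1 / τ ε) = ∑ s ∈ Finset.range 2,
      (-Complex.I) ^ (N * s) * (1 / ((2 : ℕ) * (σ ε) ^ (1 / 2 : ℂ)) *
        jacobiTheta₂ ((s / (2 : ℕ) : ℝ) : ℂ) (Complex.I / ((2 : ℕ) ^ 2 * σ ε))) := by
    intro ε hε
    have him : 0 < (-1 / τ ε).im := by
      have : -1 / τ ε = ((-(N / 2) : ℝ) : ℂ) + Complex.I * σ ε := by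
        rw [hστ]; push_cast; ring
      rw [this, Complex.add_im, Complex.ofReal_im, Complex.I_mul_im, zero_add]
      exact hσre ε hε
    refine (hasSum_jacobiTheta₂_term 0 him).unique ?_
    refine hasSum_int_of_progressions two_pos fun s hs => ?_
    have := (hasSum_gaussian_progression (σ ε) (hσre ε hε) 2 two_pos s).mul_left
      ((-Complex.I) ^ (N * s))
    refine this.congr_fun fun m => ?_
    obtain ⟨k, hk⟩ : ∃ k : ℤ, ((s : ℤ) + 2 * m) ^ 2 = s + 4 * k := by
      interval_cases s
      · exact ⟨m ^ 2, by push_cast; ring⟩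
      · exact ⟨m ^ 2 + m, by push_cast; ring⟩
    have hk' : ((s : ℂ) + 2 * m) ^ 2 = s + 4 * k := by exact_mod_cast hk
    rw [jacobiTheta₂_term, hστ, ← hI, ← Complex.exp_nat_mul, ← Complex.exp_add,
      ← Complex.exp_periodic.int_mul (N * k)]
    congr 1
    push_cast
    rw [hk']
    ring_nf
    simp only [Complex.I_sq]
    ring
  -- separate the singular factor `ε ^ (1 / 2)`, common to both expansions
  have hσs : ∀ ε : ℝ, 0 < ε → (σ ε) ^ (1 / 2 : ℂ) =
      (ε : ℂ) ^ (1 / 2 : ℂ) * (N / 2) / (u ε) ^ (1 / 2 : ℂ) := by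
    intro ε hε
    apply cpow_half_eq
    · have h1 : (ε : ℂ) ^ (1 / 2 : ℂ) = ((ε ^ (1 / 2 : ℝ) : ℝ) : ℂ) := by
        rw [Complex.ofReal_cpow hε.le]; norm_num
      have h2 : (ε : ℂ) ^ (1 / 2 : ℂ) * (N / 2) / (u ε) ^ (1 / 2 : ℂ) =
          ((ε ^ (1 / 2 : ℝ) * (N / 2) : ℝ) : ℂ) * ((u ε) ^ (1 / 2 : ℂ))⁻¹ := by
        rw [h1]; push_cast; rw [div_eq_mul_inv]
      rw [h2, Complex.re_ofReal_mul, Complex.inv_re]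
      have h3 := re_cpow_half_pos (σ := u ε) (by rw [hu_re]; norm_num)
      have h4 : (u ε) ^ (1 / 2 : ℂ) ≠ 0 := by intro h; rw [h] at h3; simp at h3
      have := Complex.normSq_pos.2 h4
      positivity
    · rw [div_pow, mul_pow, cpow_half_sq, cpow_half_sq]
      simp only [σ]
      ring
  -- insert both expansions into the functional equation; `ε ^ (1 / 2)` cancels
  have eq : ∀ ε : ℝ, 0 < ε → (∑ r ∈ Finset.range N, eN N (1 * r ^ 2) *
        jacobiTheta₂ ((r / N : ℝ) : ℂ) (Complex.I / (N ^ 2 * ε))) *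
        (-Complex.I * τ ε) ^ (1 / 2 : ℂ) = (u ε) ^ (1 / 2 : ℂ) * ∑ s ∈ Finset.range 2,
      (-Complex.I) ^ (N * s) *
        jacobiTheta₂ ((s / (2 : ℕ) : ℝ) : ℂ) (Complex.I / ((2 : ℕ) ^ 2 * σ ε)) := by
    intro ε hε
    have hε0 : (ε : ℂ) ≠ 0 := by exact_mod_cast hε.ne'
    have hτ0 : τ ε ≠ 0 := by
      rw [hτu]; exact mul_ne_zero (div_ne_zero two_ne_zero hN0) (hu0 ε)
    have e1 : (ε : ℂ) ^ (1 / 2 : ℂ) ≠ 0 := by simp [Complex.cpow_eq_zero_iff, hε0]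
    have e2 : (u ε) ^ (1 / 2 : ℂ) ≠ 0 := by simp [Complex.cpow_eq_zero_iff, hu0 ε]
    have e3 : (-Complex.I * τ ε) ^ (1 / 2 : ℂ) ≠ 0 := by simp [Complex.cpow_eq_zero_iff, hτ0]
    have h := jacobiTheta₂_functional_equation 0 (τ ε)
    rw [zero_div, key1 ε hε, key2 ε hε, hσs ε hε] at h
    have a1 : ∀ r ∈ Finset.range N, eN N (1 * r ^ 2) * (1 / (N * (ε : ℂ) ^ (1 / 2 : ℂ)) *
        jacobiTheta₂ ((r / N : ℝ) : ℂ) (Complex.I / (N ^ 2 * ε))) =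
        (1 / (N * (ε : ℂ) ^ (1 / 2 : ℂ))) * (eN N (1 * r ^ 2) *
        jacobiTheta₂ ((r / N : ℝ) : ℂ) (Complex.I / (N ^ 2 * ε))) := fun r _ => by ring
    have a2 : ∀ s ∈ Finset.range 2, (-Complex.I) ^ (N * s) *
        (1 / ((2 : ℕ) * ((ε : ℂ) ^ (1 / 2 : ℂ) * (N / 2) / (u ε) ^ (1 / 2 : ℂ))) *
        jacobiTheta₂ ((s / (2 : ℕ) : ℝ) : ℂ) (Complex.I / ((2 : ℕ) ^ 2 * σ ε))) =
        (1 / ((2 : ℕ) * ((ε : ℂ) ^ (1 / 2 : ℂ) * (N / 2) / (u ε) ^ (1 / 2 : ℂ)))) *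
        ((-Complex.I) ^ (N * s) *
        jacobiTheta₂ ((s / (2 : ℕ) : ℝ) : ℂ) (Complex.I / ((2 : ℕ) ^ 2 * σ ε))) :=
      fun r _ => by ring
    rw [Finset.sum_congr rfl a1, Finset.sum_congr rfl a2, ← Finset.mul_sum, ← Finset.mul_sum] at h
    have hz : Complex.exp (-Real.pi * Complex.I * 0 ^ 2 / τ ε) = 1 := by simp
    rw [hz] at h
    generalize (∑ r ∈ Finset.range N, eN N (1 * r ^ 2) *
        jacobiTheta₂ ((r / N : ℝ) : ℂ) (Complex.I / (N ^ 2 * ε))) = A at h ⊢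
    generalize (∑ s ∈ Finset.range 2, (-Complex.I) ^ (N * s) *
        jacobiTheta₂ ((s / (2 : ℕ) : ℝ) : ℂ) (Complex.I / ((2 : ℕ) ^ 2 * σ ε))) = B at h ⊢
    generalize (u ε) ^ (1 / 2 : ℂ) = U at h e2 ⊢
    generalize (-Complex.I * τ ε) ^ (1 / 2 : ℂ) = V at h e3 ⊢
    generalize (ε : ℂ) ^ (1 / 2 : ℂ) = Z at h e1 ⊢
    field_simp at h
    push_cast at h
    have h2 : (2 : ℂ) ≠ 0 := two_ne_zero
    linear_combination h / 2
  -- let `ε → 0`, when all theta values tend to `1`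
  have hεl : Tendsto (fun ε : ℝ => ε) l (nhds 0) := tendsto_nhdsWithin_of_tendsto_nhds tendsto_id
  have hεl' : Tendsto (fun ε : ℝ => (ε : ℂ)) l (nhds 0) :=
    (Complex.continuous_ofReal.tendsto' 0 0 (by simp)).comp hεl
  have hul : Tendsto u l (nhds 1) := by
    have : Tendsto (fun ε : ℝ => 1 + Complex.I * (ε : ℂ) * N / 2) l
        (nhds (1 + Complex.I * 0 * N / 2)) :=
      tendsto_const_nhds.add (((tendsto_const_nhds.mul hεl').mul tendsto_const_nhds).div_const _)
    simpa using this
  have hτl : Tendsto τ l (nhds (2 / N)) := by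
    have : Tendsto (fun ε : ℝ => 2 / N + Complex.I * (ε : ℂ)) l (nhds (2 / N + Complex.I * 0)) :=
      tendsto_const_nhds.add (tendsto_const_nhds.mul hεl')
    simpa using this
  have hinv : Tendsto (fun ε : ℝ => ε⁻¹) l atTop := tendsto_inv_nhdsGT_zero
  have lim1 : Tendsto (fun ε : ℝ => (∑ r ∈ Finset.range N, eN N (1 * r ^ 2) *
        jacobiTheta₂ ((r / N : ℝ) : ℂ) (Complex.I / (N ^ 2 * ε))) *
        (-Complex.I * τ ε) ^ (1 / 2 : ℂ)) l
      (nhds ((∑ r ∈ Finset.range N, eN N (1 * r ^ 2) * 1) *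
        (-Complex.I * (2 / N)) ^ (1 / 2 : ℂ))) := by
    refine Tendsto.mul (tendsto_finsetSum _ fun r _ => tendsto_const_nhds.mul ?_) ?_
    · refine tendsto_jacobiTheta₂_one _ _ ?_
      have : ∀ ε : ℝ, (Complex.I / (N ^ 2 * ε)).im = (N ^ 2 : ℝ)⁻¹ * ε⁻¹ := by
        intro ε
        have : Complex.I / ((N : ℂ) ^ 2 * ε) = (((N ^ 2 : ℝ)⁻¹ * ε⁻¹ : ℝ) : ℂ) * Complex.I := by
          push_cast; rw [div_eq_mul_inv, mul_inv]; ring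
        rw [this, Complex.im_ofReal_mul, Complex.I_im, mul_one]
      simp only [this]
      exact hinv.const_mul_atTop (by positivity)
    · refine (tendsto_const_nhds.mul hτl).cpow tendsto_const_nhds ?_
      right
      have : -Complex.I * (2 / (N : ℂ)) = ((2 / N : ℝ) : ℂ) * (-Complex.I) := by push_cast; ring
      rw [this, Complex.im_ofReal_mul]
      have : (0 : ℝ) < 2 / N := by positivity
      simp [this.ne']
  have lim2 : Tendsto (fun ε : ℝ => (u ε) ^ (1 / 2 : ℂ) * ∑ s ∈ Finset.range 2,
      (-Complex.I) ^ (N * s) *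
        jacobiTheta₂ ((s / (2 : ℕ) : ℝ) : ℂ) (Complex.I / ((2 : ℕ) ^ 2 * σ ε))) l
      (nhds (1 ^ (1 / 2 : ℂ) * ∑ s ∈ Finset.range 2, (-Complex.I) ^ (N * s) * 1)) := by
    refine Tendsto.mul ?_ (tendsto_finsetSum _ fun r _ => tendsto_const_nhds.mul ?_)
    · exact hul.cpow tendsto_const_nhds (by left; simp)
    · refine tendsto_jacobiTheta₂_one _ _ ?_
      have : ∀ᶠ ε : ℝ in l, (N ^ 2 : ℝ)⁻¹ * ε⁻¹ = (Complex.I / ((2 : ℕ) ^ 2 * σ ε)).im := by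
        filter_upwards [self_mem_nhdsWithin] with ε hε
        have hε0 : (ε : ℂ) ≠ 0 := by exact_mod_cast (ne_of_gt hε : ε ≠ 0)
        have h1 : Complex.I / (((2 : ℕ) : ℂ) ^ 2 * σ ε) =
            (((N ^ 2 : ℝ)⁻¹ * ε⁻¹ : ℝ) : ℂ) * (Complex.I * u ε) := by
          have := hu0 ε
          simp only [σ]; push_cast; field_simp; norm_num
        rw [h1, Complex.im_ofReal_mul, Complex.I_mul_im, hu_re, mul_one]
      refine Tendsto.congr' this ?_
      exact hinv.const_mul_atTop (by positivity)
  have := tendsto_nhds_unique (lim1.congr' (by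
    filter_upwards [self_mem_nhdsWithin] with ε hε using eq ε hε)) lim2
  simpa [quadGauss, Finset.sum_range_succ] using this

/-- The quadratic Gauss sum of odd modulus, including its sign. -/
theorem quadGauss_one {N : ℕ} (hN : Odd N) :
    quadGauss N 1 = (if N % 4 = 1 then 1 else Complex.I) * Real.sqrt N := by
  have hpos := hN.pos
  have hNr : (0 : ℝ) < N := by exact_mod_cast hpos
  have h := quadGauss_one_mul hpos
  have hs : ((Real.sqrt N : ℝ) : ℂ) ^ 2 = N := by
    rw [← Complex.ofReal_pow, Real.sq_sqrt hNr.le]; simp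
  have hs0 : ((Real.sqrt N : ℝ) : ℂ) ≠ 0 := by
    simpa using (Real.sqrt_pos.2 hNr).ne'
  have hc : (-Complex.I * (2 / N)) ^ (1 / 2 : ℂ) = (1 - Complex.I) / Real.sqrt N := by
    apply cpow_half_eq
    · have : (1 - Complex.I) / ((Real.sqrt N : ℝ) : ℂ) =
          (((Real.sqrt N)⁻¹ : ℝ) : ℂ) * (1 - Complex.I) := by
        push_cast; rw [div_eq_mul_inv, mul_comm]
      rw [this, Complex.re_ofReal_mul]
      simpa using hNr
    · rw [div_pow, hs]
      ring_nf
      simp only [Complex.I_sq]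
      ring
  rw [hc] at h
  have hI : (1 - Complex.I) * (1 + Complex.I) = 2 := by
    ring_nf; simp only [Complex.I_sq]; ring
  have h1 : (1 - Complex.I) ≠ 0 := by
    intro h0; rw [h0, zero_mul] at hI; norm_num at hI
  have hpow : (-Complex.I) ^ N = if N % 4 = 1 then -Complex.I else Complex.I := by
    have h4 : (-Complex.I) ^ 4 = 1 := by rw [neg_pow, Complex.I_pow_four]; norm_num
    rw [← Nat.div_add_mod N 4, pow_add, pow_mul, h4, one_pow, one_mul]
    have : N % 4 = 1 ∨ N % 4 = 3 := by obtain ⟨k, rfl⟩ := hN; omega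
    rcases this with h | h
    · simp [h]
    · simp only [h, Nat.mul_add_mod_self_left]
      norm_num
      rw [pow_succ, neg_sq, Complex.I_sq]
      ring
  rw [hpow] at h
  field_simp at h
  apply mul_right_cancel₀ h1
  rw [h]
  split_ifs
  · ring
  · ring_nf; simp only [Complex.I_sq]; ring

/-! ### Gauss sums of real characters -/

/-- Summation over a complete residue system modulo `m * n` by the Chinese remainder theorem. -/
theorem sum_range_mul_of_coprime {m n : ℕ} (hm : 0 < m) (hn : 0 < n) (h : m.Coprime n)
    (F : ℕ → ℂ) (hF : ∀ a, F (a % (m * n)) = F a) :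
    ∑ a ∈ Finset.range (m * n), F a =
      ∑ x ∈ Finset.range m, ∑ y ∈ Finset.range n, F (n * x + m * y) := by
  rw [← Finset.sum_product']
  set g : ℕ × ℕ → ℕ := fun z => (n * z.1 + m * z.2) % (m * n) with hg
  have inj : Set.InjOn g ↑(Finset.range m ×ˢ Finset.range n) := by
    rintro ⟨x, y⟩ h1 ⟨x', y'⟩ h2 hxy
    simp only [Finset.coe_product, Finset.coe_range, Set.mem_prod, Set.mem_Iio] at h1 h2
    have hxy' : n * x + m * y ≡ n * x' + m * y' [MOD m * n] := hxy
    have e1 : n * x ≡ n * x' [MOD m] := by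
      have := hxy'.of_mul_right n
      have a1 : n * x + m * y ≡ n * x [MOD m] := by simp [Nat.ModEq]
      have a2 : n * x' + m * y' ≡ n * x' [MOD m] := by simp [Nat.ModEq]
      exact a1.symm.trans (this.trans a2)
    have e2 : m * y ≡ m * y' [MOD n] := by
      have := hxy'.of_mul_left m
      have a1 : n * x + m * y ≡ m * y [MOD n] := by simp [Nat.ModEq]
      have a2 : n * x' + m * y' ≡ m * y' [MOD n] := by simp [Nat.ModEq]
      exact a1.symm.trans (this.trans a2)
    have f1 := Nat.ModEq.cancel_left_of_coprime h e1
    have f2 := Nat.ModEq.cancel_left_of_coprime h.symm e2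
    rw [Nat.ModEq, Nat.mod_eq_of_lt h1.1, Nat.mod_eq_of_lt h2.1] at f1
    rw [Nat.ModEq, Nat.mod_eq_of_lt h1.2, Nat.mod_eq_of_lt h2.2] at f2
    exact Prod.ext f1 f2
  have himg : (Finset.range m ×ˢ Finset.range n).image g = Finset.range (m * n) := by
    apply Finset.eq_of_subset_of_card_le
    · intro a ha
      obtain ⟨z, -, rfl⟩ := Finset.mem_image.1 ha
      exact Finset.mem_range.2 (Nat.mod_lt _ (by positivity))
    · rw [Finset.card_image_of_injOn inj]; simp
  rw [← himg, Finset.sum_image inj]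
  exact Finset.sum_congr rfl fun z _ => hF _

/-- The finite Fourier transform modulo `N` of an integer valued arithmetic function. -/
noncomputable def finiteFT (N : ℕ) (f : ℕ → ℤ) (c : ℤ) : ℂ :=
  ∑ n ∈ Finset.range N, (f n : ℂ) * eN N (c * n)

theorem eN_mul_mod {N : ℕ} (hN : N ≠ 0) (c : ℤ) (a : ℕ) :
    eN N (c * (a % N : ℕ)) = eN N (c * a) := by
  apply eN_congr hN
  push_cast
  exact (Int.mod_modEq _ _).mul_left c

/-- The Chinese remainder theorem splits the transform of a function that separates into residues
modulo `m` and modulo `n`. -/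
theorem finiteFT_mul {m n : ℕ} (hm : 0 < m) (hn : 0 < n) (h : m.Coprime n) (f g k : ℕ → ℤ)
    (hf : ∀ a, f (a % (m * n)) = f a) (hfg : ∀ x y, f (n * x + m * y) = g x * k y) (c : ℤ) :
    finiteFT (m * n) f c = finiteFT m g c * finiteFT n k c := by
  rw [finiteFT, sum_range_mul_of_coprime hm hn h, finiteFT, finiteFT, Finset.sum_mul_sum]
  · refine Finset.sum_congr rfl fun x _ => Finset.sum_congr rfl fun y _ => ?_
    rw [hfg]
    have : c * ((n * x + m * y : ℕ) : ℤ) = n * (c * x) + m * (c * y) := by push_cast; ring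
    rw [this, eN_add, eN_mul_right hm.ne' hn.ne', eN_mul_left hm.ne' hn.ne']
    push_cast
    ring
  · intro a
    rw [hf, eN_mul_mod (by positivity)]

theorem quadGauss_mul {m n : ℕ} (hm : 0 < m) (hn : 0 < n) (h : m.Coprime n) (c : ℤ) :
    quadGauss (m * n) c = quadGauss m (c * n) * quadGauss n (c * m) := by
  have h1 := sum_range_mul_of_coprime hm hn h (fun a => eN (m * n) (c * (a : ℤ) ^ 2)) (by
    intro a
    apply eN_congr (by positivity)
    push_cast
    exact ((Int.mod_modEq _ _).pow 2).mul_left c)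
  rw [quadGauss, h1, quadGauss, quadGauss, Finset.sum_mul_sum]
  refine Finset.sum_congr rfl fun x _ => Finset.sum_congr rfl fun y _ => ?_
  have : c * ((n * x + m * y : ℕ) : ℤ) ^ 2 =
      n * (c * n * x ^ 2) + (m * (c * m * y ^ 2) + (m * n : ℕ) * (2 * c * x * y)) := by
    push_cast; ring
  rw [this, eN_add, eN_add, eN_mul_right hm.ne' hn.ne', eN_mul_left hm.ne' hn.ne',
    eN_mul_self (by positivity), mul_one]

theorem jacobiSym_natCast_mod (d a : ℕ) : J((a % d : ℕ) | d) = J(a | d) := by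
  rw [jacobiSym.mod_left a d]
  push_cast
  rfl

/-- The two Jacobi symbols in front account for the reparametrisation `a = n * x + m * y` of the
residues; they match the same factors in the multiplicativity of the quadratic Gauss sums. -/
theorem finiteFT_jacobi_mul {m n : ℕ} (hm : 0 < m) (hn : 0 < n) (h : m.Coprime n) (c : ℤ) :
    finiteFT (m * n) (fun a => J(a | m * n)) c = J(n | m) * J(m | n) *
      (finiteFT m (fun a => J(a | m)) c * finiteFT n (fun a => J(a | n)) c) := by
  have : NeZero m := ⟨hm.ne'⟩
  have : NeZero n := ⟨hn.ne'⟩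
  have e1 : ∀ x y : ℕ, J((n * x + m * y : ℕ) | m) = J(n | m) * J(x | m) := by
    intro x y
    rw [← jacobiSym_natCast_mod, Nat.add_mul_mod_self_left, jacobiSym_natCast_mod]
    push_cast
    exact jacobiSym.mul_left _ _ _
  have e2 : ∀ x y : ℕ, J((n * x + m * y : ℕ) | n) = J(m | n) * J(y | n) := by
    intro x y
    rw [← jacobiSym_natCast_mod, Nat.mul_add_mod_self_left, jacobiSym_natCast_mod]
    push_cast
    exact jacobiSym.mul_left _ _ _
  rw [finiteFT_mul hm hn h _ (fun x => J(n | m) * J(x | m)) (fun y => J(m | n) * J(y | n))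
    (fun a => jacobiSym_natCast_mod _ _) (fun x y => by rw [jacobiSym.mul_right, e1, e2])]
  simp only [finiteFT, Finset.mul_sum, Finset.sum_mul]
  refine Finset.sum_congr rfl fun x _ => Finset.sum_congr rfl fun y _ => ?_
  push_cast
  ring

theorem sum_range_natCast_zmod (N : ℕ) [NeZero N] (F : ZMod N → ℂ) :
    ∑ n ∈ Finset.range N, F (n : ZMod N) = ∑ x : ZMod N, F x := by
  refine Finset.sum_nbij' (fun n => (n : ZMod N)) ZMod.val ?_ ?_ ?_ ?_ ?_
  · simp
  · intro x _; exact Finset.mem_range.2 (ZMod.val_lt x)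
  · intro n hn; exact ZMod.val_cast_of_lt (Finset.mem_range.1 hn)
  · intro x _; exact ZMod.natCast_zmod_val x
  · simp

theorem eN_eq_stdAddChar (N : ℕ) [NeZero N] (a : ℤ) : eN N a = ZMod.stdAddChar (a : ZMod N) := by
  rw [ZMod.stdAddChar_coe, eN]
  congr 1
  ring

/-- For a prime modulus both sums are twisted Gauss sums of the quadratic character. -/
theorem finiteFT_jacobi_prime {p : ℕ} (hp : p.Prime) (hp2 : p ≠ 2) :
    (∀ c : ℤ, finiteFT p (fun a => J(a | p)) c = J(c | p) * quadGauss p 1) ∧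
    (∀ c : ℤ, ¬ (p : ℤ) ∣ c → quadGauss p c = J(c | p) * quadGauss p 1) := by
  have : Fact p.Prime := ⟨hp⟩
  have hchar : ringChar (ZMod p) ≠ 2 := by rwa [ZMod.ringChar_zmod_n]
  set χ : MulChar (ZMod p) ℂ := (quadraticChar (ZMod p)).ringHomComp (Int.castRingHom ℂ) with hχ
  set ψ : AddChar (ZMod p) ℂ := ZMod.stdAddChar with hψ
  have hχJ : ∀ a : ℤ, ((J(a | p) : ℤ) : ℂ) = χ (a : ZMod p) := by
    intro a
    rw [← jacobiSym.legendreSym.to_jacobiSym, legendreSym]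
    simp [hχ]
  have hχ1 : χ ≠ 1 := by
    obtain ⟨a, ha⟩ := quadraticChar_exists_neg_one hchar
    intro h
    have h1 : χ a = -1 := by simp [hχ, ha]
    have ha0 : IsUnit a := by
      by_contra h0
      rw [MulChar.map_nonunit _ h0] at ha
      norm_num at ha
    rw [h, MulChar.one_apply ha0] at h1
    norm_num at h1
  have hT : ∀ c : ℤ, finiteFT p (fun a => J(a | p)) c = gaussSum χ (ψ.mulShift (c : ZMod p)) := by
    intro c
    rw [finiteFT, gaussSum, ← sum_range_natCast_zmod]
    refine Finset.sum_congr rfl fun n _ => ?_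
    rw [hχJ, eN_eq_stdAddChar, AddChar.mulShift_apply]
    push_cast
    rfl
  have hTmul : ∀ c : ℤ, gaussSum χ (ψ.mulShift (c : ZMod p)) = J(c | p) * gaussSum χ ψ := by
    intro c
    rw [hχJ]
    by_cases h0 : (c : ZMod p) = 0
    · rw [h0, AddChar.mulShift_zero, gaussSum_one_right hχ1, MulChar.map_nonunit _ (by simp),
        zero_mul]
    · have h1 := gaussSum_mulShift χ ψ (Units.mk0 _ h0)
      rw [Units.val_mk0] at h1
      have h2 : χ (c : ZMod p) * χ (c : ZMod p) = 1 := by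
        have := quadraticChar_sq_one h0
        simp only [hχ, MulChar.ringHomComp_apply, eq_intCast]
        rw [← sq]
        exact_mod_cast this
      rw [← h1, ← mul_assoc, h2, one_mul]
  -- the residue `a` has `χ a + 1` square roots
  have hG : ∀ c : ℤ, (c : ZMod p) ≠ 0 →
      quadGauss p c = gaussSum χ (ψ.mulShift (c : ZMod p)) := by
    intro c hc
    have e1 : quadGauss p c = ∑ x : ZMod p, ψ (c * x ^ 2) := by
      rw [quadGauss, ← sum_range_natCast_zmod]
      refine Finset.sum_congr rfl fun n _ => ?_
      rw [eN_eq_stdAddChar]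
      push_cast
      rfl
    have e2 : ∑ x : ZMod p, ψ (c * x ^ 2) = ∑ a : ZMod p, (χ a + 1) * ψ (c * a) := by
      rw [← Finset.sum_fiberwise (s := Finset.univ) (g := fun x : ZMod p => x ^ 2)]
      refine Finset.sum_congr rfl fun a _ => ?_
      have e3 : ∀ x ∈ Finset.univ.filter (fun x : ZMod p => x ^ 2 = a),
          ψ (c * x ^ 2) = ψ (c * a) := by
        intro x hx
        rw [(Finset.mem_filter.1 hx).2]
      rw [Finset.sum_congr rfl e3, Finset.sum_const, nsmul_eq_mul]
      congr 1
      have := quadraticChar_card_sqrts hchar a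
      have h3 : (Finset.univ.filter (fun x : ZMod p => x ^ 2 = a)) =
          {x : ZMod p | x ^ 2 = a}.toFinset := by ext; simp
      rw [h3, hχ]
      simp only [MulChar.ringHomComp_apply, eq_intCast]
      exact_mod_cast this
    have e4 : ∑ a : ZMod p, ψ (c * a) = 0 := by
      have : ψ.mulShift (c : ZMod p) ≠ 1 := ZMod.isPrimitive_stdAddChar p hc
      exact AddChar.sum_eq_zero_of_ne_one this
    rw [e1, e2]
    simp only [add_mul, one_mul, Finset.sum_add_distrib, e4, add_zero]
    rfl
  have hG1 : quadGauss p 1 = gaussSum χ ψ := by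
    rw [hG 1 (by simp)]; simp
  refine ⟨fun c => by rw [hT, hTmul, hG1], fun c hc => ?_⟩
  rw [hG c (by rwa [Ne, ZMod.intCast_zmod_eq_zero_iff_dvd]), hTmul, hG1]

/-- The Jacobi symbol modulo an odd square-free `d` is an eigenfunction of the finite Fourier
transform, the eigenvalue being the quadratic Gauss sum. -/
theorem finiteFT_jacobi {d : ℕ} (hd : Odd d) (hsq : Squarefree d) :
    (∀ c : ℤ, finiteFT d (fun a => J(a | d)) c = J(c | d) * quadGauss d 1) ∧
    (∀ c : ℤ, IsCoprime c d → quadGauss d c = J(c | d) * quadGauss d 1) := by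
  induction d using Nat.recOnPosPrimePosCoprime with
  | zero => simp at hd
  | one => simp [finiteFT, quadGauss, eN]
  | prime_pow p k hp hk =>
    have hk1 : k = 1 :=
      (Nat.squarefree_pow_iff hp.ne_one hk.ne').1 hsq |>.2
    subst hk1
    rw [pow_one] at hd ⊢
    have h1 := finiteFT_jacobi_prime hp (by rintro rfl; exact absurd hd (by decide))
    refine ⟨h1.1, fun c hc => h1.2 c ?_⟩
    intro h
    have := hc.isUnit_of_dvd' h dvd_rfl
    rw [Int.isUnit_iff_natAbs_eq] at this
    exact hp.ne_one (by simpa using this)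
  | coprime m n hm hn hmn ihm ihn =>
    obtain ⟨hm1, hm2⟩ := ihm (Nat.odd_mul.1 hd).1 (Nat.squarefree_mul hmn |>.1 hsq).1
    obtain ⟨hn1, hn2⟩ := ihn (Nat.odd_mul.1 hd).2 (Nat.squarefree_mul hmn |>.1 hsq).2
    have : NeZero m := ⟨by omega⟩
    have : NeZero n := ⟨by omega⟩
    have hcop : IsCoprime (m : ℤ) n := Nat.isCoprime_iff_coprime.2 hmn
    have hG : quadGauss (m * n) 1 = J(n | m) * J(m | n) * (quadGauss m 1 * quadGauss n 1) := by
      rw [quadGauss_mul (by omega) (by omega) hmn, one_mul, one_mul, hm2 _ hcop.symm, hn2 _ hcop]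
      ring
    constructor
    · intro c
      rw [finiteFT_jacobi_mul (by omega) (by omega) hmn, hG, hm1, hn1, jacobiSym.mul_right]
      push_cast
      ring
    · intro c hc
      have hcm : IsCoprime c m := by push_cast at hc; exact hc.of_mul_right_left
      have hcn : IsCoprime c n := by push_cast at hc; exact hc.of_mul_right_right
      rw [quadGauss_mul (by omega) (by omega) hmn, hG, hm2 _ (hcm.mul_left hcop.symm),
        hn2 _ (hcn.mul_left hcop), jacobiSym.mul_right, jacobiSym.mul_left, jacobiSym.mul_left]
      push_cast
      ring

theorem norm_quadGauss_one {N : ℕ} (hN : Odd N) : ‖quadGauss N 1‖ = Real.sqrt N := by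
  rw [quadGauss_one hN, norm_mul, Complex.norm_real, Real.norm_of_nonneg (Real.sqrt_nonneg _)]
  split_ifs <;> simp

/-- The values of the character `χ_{8d}` as integers. -/
def chiZ (d n : ℕ) : ℤ := if Odd n then J((8 * d : ℕ) | n) else 0

theorem chi8_natCast (d n : ℕ) : chi8 d (n : ZMod (8 * d)) = (chiZ d n : ℂ) := by
  change (if Odd (n : ZMod (8 * d)).val then ((J((8 * d : ℕ) | (n : ZMod (8 * d)).val) : ℤ) : ℂ)
    else 0) = _
  rw [ZMod.val_natCast, chiZ]
  by_cases hn : Odd n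
  · rw [if_pos ((odd_mod_eight_mul d n).2 hn), if_pos hn, jacobiSym_eight_mul_mod d n hn]
  · rw [if_neg (fun h => hn ((odd_mod_eight_mul d n).1 h)), if_neg hn]; simp

/-- The even part of the conductor of `χ_{8d}`: a character modulo `8` with
`χ_{8d} n = chiTwo d n * (n / d)`. -/
def chiTwo (d : ℕ) : MulChar (ZMod 8) ℤ := if d % 4 = 1 then ZMod.χ₈ else ZMod.χ₈'

theorem chiZ_eq_mul {d : ℕ} (hd : Odd d) (n : ℕ) : chiZ d n = chiTwo d n * J(n | d) := by
  rw [chiZ]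
  split_ifs with hn
  · have h8 : J((8 * d : ℕ) | n) = ZMod.χ₈ n * J(d | n) := by
      have : ((8 * d : ℕ) : ℤ) = 2 ^ 2 * (2 * (d : ℤ)) := by push_cast; ring
      rw [this, jacobiSym.mul_left, jacobiSym.sq_one' (show Int.gcd 2 n = 1 from hn.coprime_two_left), one_mul,
        jacobiSym.mul_left, jacobiSym.at_two hn]
    rw [h8, chiTwo]
    split_ifs with h4
    · rw [jacobiSym.quadratic_reciprocity_one_mod_four h4 hn]
    · have h43 : d % 4 = 3 := by obtain ⟨k, rfl⟩ := hd; omega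
      have hn4 : n % 4 = 1 ∨ n % 4 = 3 := by obtain ⟨k, rfl⟩ := hn; omega
      have e : ∀ m : ℕ, ZMod.χ₈ (m : ZMod 8) = ZMod.χ₈ ((m % 8 : ℕ) : ZMod 8) ∧
          ZMod.χ₈' (m : ZMod 8) = ZMod.χ₈' ((m % 8 : ℕ) : ZMod 8) := by
        intro m
        rw [ZMod.natCast_mod]
        simp
      rcases hn4 with h | h
      · rw [← jacobiSym.quadratic_reciprocity_one_mod_four h hd]
        have h8 : n % 8 = 1 ∨ n % 8 = 5 := by omega
        rw [(e n).1, (e n).2]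
        rcases h8 with h | h <;> rw [h] <;> congr 1
      · rw [jacobiSym.quadratic_reciprocity_three_mod_four h43 h]
        have h8 : n % 8 = 3 ∨ n % 8 = 7 := by omega
        rw [(e n).1, (e n).2, mul_neg, ← neg_mul]
        rcases h8 with h | h <;> rw [h] <;> congr 1
  · have : ¬ IsUnit (n : ZMod 8) := by
      rw [ZMod.isUnit_iff_coprime]
      intro h
      exact hn (Nat.coprime_two_right.1 (Nat.Coprime.coprime_dvd_right (by norm_num) h))
    rw [MulChar.map_nonunit _ this, zero_mul]

theorem eN_eight_one : eN 8 1 = (1 + Complex.I) / Real.sqrt 2 := by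
  have h : eN 8 1 = Complex.exp ((Real.pi / 4 : ℝ) * Complex.I) := by
    rw [eN]; congr 1; push_cast; ring
  have h2 : ((Real.sqrt 2 : ℝ) : ℂ) ^ 2 = 2 := by
    rw [← Complex.ofReal_pow, Real.sq_sqrt (by norm_num)]; simp
  have h0 : ((Real.sqrt 2 : ℝ) : ℂ) ≠ 0 := by intro h0; rw [h0] at h2; norm_num at h2
  rw [h, Complex.exp_mul_I, ← Complex.ofReal_cos, ← Complex.ofReal_sin, Real.cos_pi_div_four,
    Real.sin_pi_div_four]
  push_cast
  field_simp
  rw [h2]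

theorem eN_natCast (N k : ℕ) : eN N k = eN N 1 ^ k := by
  rw [eN, eN, ← Complex.exp_nat_mul]
  congr 1
  push_cast
  ring

theorem chiTwo_natCast_mod (d c : ℕ) :
    chiTwo d (c : ZMod 8) = chiTwo d ((c % 8 : ℕ) : ZMod 8) := by
  rw [ZMod.natCast_mod]

/-- The Gauss sums of the two primitive real characters modulo `8`, one even and one odd, evaluated
by means of powers of the root of unity `exp(2πi/8)`. -/
theorem finiteFT_chiTwo (d c : ℕ) :
    finiteFT 8 (fun x => chiTwo d (x : ZMod 8)) c =
      chiTwo d (c : ZMod 8) * ((if d % 4 = 1 then 1 else Complex.I) * Real.sqrt 8) := by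
  have h2 : ((Real.sqrt 2 : ℝ) : ℂ) ^ 2 = 2 := by
    rw [← Complex.ofReal_pow, Real.sq_sqrt (by norm_num)]; simp
  have h0 : ((Real.sqrt 2 : ℝ) : ℂ) ≠ 0 := by intro h0; rw [h0] at h2; norm_num at h2
  have h8 : ((Real.sqrt 8 : ℝ) : ℂ) = 2 * Real.sqrt 2 := by
    have : (8 : ℝ) = 2 ^ 2 * 2 := by norm_num
    rw [this, Real.sqrt_mul (by norm_num), Real.sqrt_sq (by norm_num)]
    push_cast; rfl
  -- `z` is the root of unity `exp(2πi/8) = (1 + i) / √2`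
  have hz : ∃ z : ℂ, eN 8 1 = z ∧ z ^ 2 = Complex.I ∧ z * 2 = (1 + Complex.I) * Real.sqrt 2 := by
    refine ⟨_, rfl, ?_, ?_⟩
    · rw [eN_eight_one, div_pow, h2]; ring_nf; simp only [Complex.I_sq]; ring
    · rw [eN_eight_one, ← h2]; field_simp
  obtain ⟨z, hz1, hz2, hz3⟩ := hz
  have hz3' : z ^ 3 = z * Complex.I := by rw [← hz2]; ring
  have hz4 : z ^ 4 = -1 := by
    rw [show z ^ 4 = (z ^ 2) ^ 2 by ring, hz2, Complex.I_sq]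
  have hz8 : z ^ 8 = 1 := by rw [show z ^ 8 = (z ^ 4) ^ 2 by ring, hz4]; norm_num
  have hred : ∀ k : ℕ, z ^ k = z ^ (k % 8) := fun k => by
    conv_lhs => rw [← Nat.div_add_mod k 8, pow_add, pow_mul, hz8, one_pow, one_mul]
  have he : ∀ x : ℕ, eN 8 ((c : ℤ) * x) = z ^ ((c % 8) * x % 8) := by
    intro x
    have : ((c : ℤ) * x) = ((c * x : ℕ) : ℤ) := by push_cast; ring
    rw [this, eN_natCast, hz1, hred, Nat.mod_mul_mod]
  rw [finiteFT, chiTwo_natCast_mod]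
  simp only [he]
  have hlt : c % 8 < 8 := Nat.mod_lt _ (by norm_num)
  have hI := Complex.I_sq
  generalize c % 8 = r at hlt
  rw [h8, chiTwo]
  have hz5 : z ^ 5 = -z := by rw [pow_succ, hz4]; ring
  have hz6 : z ^ 6 = -Complex.I := by rw [show z ^ 6 = z ^ 4 * z ^ 2 by ring, hz4, hz2]; ring
  have hz7 : z ^ 7 = -z * Complex.I := by rw [show z ^ 7 = z ^ 4 * z ^ 3 by ring, hz4, hz3']; ring
  have v0 : ZMod.χ₈ 0 = 0 ∧ ZMod.χ₈ 1 = 1 ∧ ZMod.χ₈ 2 = 0 ∧ ZMod.χ₈ 3 = -1 ∧ ZMod.χ₈ 4 = 0 ∧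
      ZMod.χ₈ 5 = -1 ∧ ZMod.χ₈ 6 = 0 ∧ ZMod.χ₈ 7 = 1 := by decide
  have v1 : ZMod.χ₈' 0 = 0 ∧ ZMod.χ₈' 1 = 1 ∧ ZMod.χ₈' 2 = 0 ∧ ZMod.χ₈' 3 = 1 ∧ ZMod.χ₈' 4 = 0 ∧
      ZMod.χ₈' 5 = -1 ∧ ZMod.χ₈' 6 = 0 ∧ ZMod.χ₈' 7 = -1 := by decide
  obtain ⟨a0, a1, a2, a3, a4, a5, a6, a7⟩ := v0
  obtain ⟨b0, b1, b2, b3, b4, b5, b6, b7⟩ := v1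
  have hzI : z * Complex.I * 2 = (Complex.I - 1) * Real.sqrt 2 := by
    linear_combination Complex.I * hz3 + (Real.sqrt 2 : ℂ) * hI
  -- for each residue of `c` modulo `8` this is an identity between powers of `z`
  split_ifs
  · interval_cases r <;>
      simp only [Finset.sum_range_succ, Finset.sum_range_zero, Nat.cast_ofNat, Nat.cast_zero,
        Nat.cast_one, a0, a1, a2, a3, a4, a5, a6, a7] <;> norm_num [hz2, hz3', hz4, hz5, hz6, hz7] <;>
      first | linear_combination hz3 - hzI | linear_combination hzI - hz3
  · interval_cases r <;>
      simp only [Finset.sum_range_succ, Finset.sum_range_zero, Nat.cast_ofNat, Nat.cast_zero,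
        Nat.cast_one, b0, b1, b2, b3, b4, b5, b6, b7] <;> norm_num [hz2, hz3', hz4, hz5, hz6, hz7] <;>
      first | linear_combination hz3 + hzI | linear_combination -hzI - hz3

/-- The character `χ_{8d}` is its own finite Fourier transform, up to the factor `√(8d)`. The Gauss
sums of its `2`-part and of its odd part are both real, or both purely imaginary, according to `d`
modulo `4`; in the latter case the sign of the product is compensated by
`chiTwo d d * (8 / d) = -1`. -/
theorem finiteFT_chiZ {d : ℕ} (hd : Odd d) (hsq : Squarefree d) (c : ℕ) :
    finiteFT (8 * d) (chiZ d) c = chiZ d c * Real.sqrt (8 * d) := by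
  have hcop : Nat.Coprime 8 d := by
    have : Nat.Coprime (2 ^ 3) d := Nat.Coprime.pow_left 3 hd.coprime_two_left
    simpa using this
  have key := finiteFT_mul (m := 8) (n := d) (by norm_num) hd.pos hcop (chiZ d)
    (fun x => chiTwo d (d : ZMod 8) * chiTwo d (x : ZMod 8)) (fun y => J(8 | d) * J(y | d)) ?_ ?_ c
  · rw [key]
    have e1 : finiteFT 8 (fun x => chiTwo d (d : ZMod 8) * chiTwo d (x : ZMod 8)) c =
        chiTwo d (d : ZMod 8) * finiteFT 8 (fun x => chiTwo d (x : ZMod 8)) c := by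
      simp only [finiteFT, Finset.mul_sum]
      refine Finset.sum_congr rfl fun x _ => ?_
      push_cast; ring
    have e2 : finiteFT d (fun y => J(8 | d) * J(y | d)) c =
        J(8 | d) * finiteFT d (fun y => J(y | d)) c := by
      simp only [finiteFT, Finset.mul_sum]
      refine Finset.sum_congr rfl fun x _ => ?_
      push_cast; ring
    rw [e1, e2, finiteFT_chiTwo, (finiteFT_jacobi hd hsq).1, quadGauss_one hd, chiZ_eq_mul hd,
      Real.sqrt_mul (by norm_num)]
    have e3 : J(8 | d) = ZMod.χ₈ d := by
      have : (8 : ℤ) = 2 ^ 2 * 2 := by norm_num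
      rw [this, jacobiSym.mul_left, jacobiSym.sq_one' (show Int.gcd 2 d = 1 from hd.coprime_two_left), one_mul,
        jacobiSym.at_two hd]
    -- this sign compensates `i ^ 2 = -1` when `d ≡ 3` modulo `4`
    have e4 : chiTwo d (d : ZMod 8) * ZMod.χ₈ d = if d % 4 = 1 then 1 else -1 := by
      rw [chiTwo_natCast_mod, show (d : ZMod 8) = ((d % 8 : ℕ) : ZMod 8) by simp, chiTwo]
      have h8 : d % 8 = 1 ∨ d % 8 = 3 ∨ d % 8 = 5 ∨ d % 8 = 7 := by
        obtain ⟨k, rfl⟩ := hd; omega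
      rcases h8 with h | h | h | h
      · rw [if_pos (by omega), if_pos (by omega), h]; decide
      · rw [if_neg (by omega), if_neg (by omega), h]; decide
      · rw [if_pos (by omega), if_pos (by omega), h]; decide
      · rw [if_neg (by omega), if_neg (by omega), h]; decide
    have e5 : ((chiTwo d (d : ZMod 8) : ℤ) : ℂ) * (ZMod.χ₈ d : ℤ) = if d % 4 = 1 then 1 else -1 := by
      rw [← Int.cast_mul, e4]; split_ifs <;> simp
    rw [e3]
    push_cast
    rw [show ∀ a b c d e f g h : ℂ, a * (b * (c * d)) * (e * (f * (g * h))) =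
      (a * e) * (c * g) * (b * f) * (d * h) by intros; ring, e5]
    split_ifs
    · ring
    · ring_nf; simp only [Complex.I_sq]; ring
  · intro a
    rw [chiZ, chiZ]
    by_cases ha : Odd a
    · rw [if_pos ((odd_mod_eight_mul d a).2 ha), if_pos ha, jacobiSym_eight_mul_mod d a ha]
    · rw [if_neg (fun h => ha ((odd_mod_eight_mul d a).1 h)), if_neg ha]
  · intro x y
    have : NeZero d := ⟨hd.pos.ne'⟩
    rw [chiZ_eq_mul hd, ← jacobiSym_natCast_mod, Nat.mul_add_mod_self_left, jacobiSym_natCast_mod]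
    have h8 : ((d * x + 8 * y : ℕ) : ZMod 8) = d * x := by
      push_cast
      rw [show (8 : ZMod 8) = 0 from rfl, zero_mul, add_zero]
    rw [h8, map_mul]
    push_cast
    rw [jacobiSym.mul_left]

/-! ### The weight of the approximate functional equation -/

/-- The normalised incomplete Gamma function `Γ(1/4, πx²) / Γ(1/4)`, which weighs the terms of the
approximate functional equation. -/
noncomputable def gammaWeight (x : ℝ) : ℝ :=
  (∫ u in Set.Ioi (Real.pi * x ^ 2), Real.exp (-u) * u ^ ((1 / 4 : ℝ) - 1)) / Real.Gamma (1 / 4)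

theorem gamma_quarter_pos : 0 < Real.Gamma (1 / 4) := Real.Gamma_pos_of_pos (by norm_num)

theorem integrableOn_gamma_quarter {a : ℝ} (ha : 0 ≤ a) :
    MeasureTheory.IntegrableOn (fun u : ℝ => Real.exp (-u) * u ^ ((1 / 4 : ℝ) - 1)) (Set.Ioi a) :=
  (Real.GammaIntegral_convergent (by norm_num : (0 : ℝ) < 1 / 4)).mono_set
    (Set.Ioi_subset_Ioi ha)

theorem gammaWeight_nonneg (x : ℝ) : 0 ≤ gammaWeight x := by
  refine div_nonneg (MeasureTheory.setIntegral_nonneg measurableSet_Ioi fun u hu => ?_)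
    gamma_quarter_pos.le
  have : 0 < u := lt_of_le_of_lt (by positivity) hu
  positivity

theorem gammaWeight_zero : gammaWeight 0 = 1 := by
  rw [gammaWeight]
  have := Real.Gamma_eq_integral (by norm_num : (0 : ℝ) < 1 / 4)
  rw [show Real.pi * (0 : ℝ) ^ 2 = 0 by ring, ← this, div_self gamma_quarter_pos.ne']

theorem gammaWeight_antitoneOn : AntitoneOn gammaWeight (Set.Ici 0) := by
  intro x hx y hy hxy
  have hx' : (0 : ℝ) ≤ x := hx
  refine div_le_div_of_nonneg_right ?_ gamma_quarter_pos.le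
  refine MeasureTheory.setIntegral_mono_set (integrableOn_gamma_quarter (by positivity)) ?_ ?_
  · filter_upwards [MeasureTheory.self_mem_ae_restrict measurableSet_Ioi] with u hu
    have : 0 < u := lt_of_le_of_lt (by positivity) hu
    simp only [Pi.zero_apply]
    positivity
  · refine (Set.Ioi_subset_Ioi ?_).eventuallyLE
    gcongr

theorem gammaWeight_le_one {x : ℝ} (hx : 0 ≤ x) : gammaWeight x ≤ 1 := by
  rw [← gammaWeight_zero]
  exact gammaWeight_antitoneOn (by simp) hx hx

/-- The weight decays faster than any power: on the range of integration `u ≥ πx²` the factor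
`u ^ (-k/2)` may be pulled out at the price of a larger Gamma value. -/
theorem exists_gammaWeight_le_rpow (k : ℝ) (hk : 0 < k) :
    ∃ C : ℝ, 0 < C ∧ ∀ x : ℝ, 0 < x → gammaWeight x ≤ C * x ^ (-k) := by
  have hg : 0 < Real.Gamma (1 / 4 + k / 2) := Real.Gamma_pos_of_pos (by positivity)
  refine ⟨Real.pi ^ (-(k / 2)) * Real.Gamma (1 / 4 + k / 2) / Real.Gamma (1 / 4),
    by have := gamma_quarter_pos; positivity, fun x hx => ?_⟩
  have ha : 0 < Real.pi * x ^ 2 := by positivity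
  have hint : MeasureTheory.IntegrableOn
      (fun u : ℝ => Real.exp (-u) * u ^ ((1 / 4 + k / 2 : ℝ) - 1)) (Set.Ioi 0) :=
    Real.GammaIntegral_convergent (by positivity)
  have h1 : ∫ u in Set.Ioi (Real.pi * x ^ 2), Real.exp (-u) * u ^ ((1 / 4 : ℝ) - 1) ≤
      (Real.pi * x ^ 2) ^ (-(k / 2)) * Real.Gamma (1 / 4 + k / 2) := by
    rw [Real.Gamma_eq_integral (by positivity : 0 < 1 / 4 + k / 2),
      ← MeasureTheory.integral_const_mul]
    calc _ ≤ ∫ u in Set.Ioi (Real.pi * x ^ 2), (Real.pi * x ^ 2) ^ (-(k / 2)) *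
          (Real.exp (-u) * u ^ ((1 / 4 + k / 2 : ℝ) - 1)) := by
          refine MeasureTheory.setIntegral_mono_on (integrableOn_gamma_quarter ha.le)
            ((hint.mono_set (Set.Ioi_subset_Ioi ha.le)).const_mul _) measurableSet_Ioi ?_
          intro u hu
          have hu0 : 0 < u := ha.trans hu
          have e : u ^ ((1 / 4 : ℝ) - 1) = u ^ (-(k / 2)) * u ^ ((1 / 4 + k / 2 : ℝ) - 1) := by
            rw [← Real.rpow_add hu0]; congr 1; ring
          have h2 : u ^ (-(k / 2)) ≤ (Real.pi * x ^ 2) ^ (-(k / 2)) :=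
            Real.rpow_le_rpow_of_nonpos ha (le_of_lt hu) (by linarith)
          rw [e]
          have : 0 ≤ Real.exp (-u) * u ^ ((1 / 4 + k / 2 : ℝ) - 1) := by positivity
          nlinarith
      _ ≤ _ := by
          refine MeasureTheory.setIntegral_mono_set (hint.const_mul _) ?_
            (Set.Ioi_subset_Ioi ha.le).eventuallyLE
          filter_upwards [MeasureTheory.self_mem_ae_restrict measurableSet_Ioi] with u hu
          have : (0 : ℝ) < u := hu
          simp only [Pi.zero_apply]
          positivity
  have h2 : (Real.pi * x ^ 2) ^ (-(k / 2)) = Real.pi ^ (-(k / 2)) * x ^ (-k) := by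
    rw [Real.mul_rpow Real.pi_pos.le (by positivity), ← Real.rpow_natCast, ← Real.rpow_mul hx.le]
    congr 2
    push_cast; ring
  rw [gammaWeight, div_le_iff₀ gamma_quarter_pos]
  rw [h2] at h1
  refine h1.trans (le_of_eq ?_)
  field_simp [gamma_quarter_pos.ne']

/-- Near `0` the weight differs from `1` by `∫_0^{πx²} e^{-u} u^{-3/4} du / Γ(1/4)`, which is at
most a multiple of `√x`. -/
theorem exists_one_sub_gammaWeight_le :
    ∃ C : ℝ, 0 < C ∧ ∀ x : ℝ, 0 ≤ x → 1 - gammaWeight x ≤ C * Real.sqrt x := by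
  refine ⟨4 * Real.pi ^ (1 / 4 : ℝ) / Real.Gamma (1 / 4), by have := gamma_quarter_pos; positivity,
    fun x hx => ?_⟩
  have ha : 0 ≤ Real.pi * x ^ 2 := by positivity
  have hG := Real.Gamma_eq_integral (by norm_num : (0 : ℝ) < 1 / 4)
  have hint := integrableOn_gamma_quarter le_rfl
  have hsplit : Real.Gamma (1 / 4) =
      (∫ u in Set.Ioc 0 (Real.pi * x ^ 2), Real.exp (-u) * u ^ ((1 / 4 : ℝ) - 1)) +
      ∫ u in Set.Ioi (Real.pi * x ^ 2), Real.exp (-u) * u ^ ((1 / 4 : ℝ) - 1) := by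
    rw [hG, ← MeasureTheory.setIntegral_union (Set.Ioc_disjoint_Ioi le_rfl) measurableSet_Ioi
      (hint.mono_set Set.Ioc_subset_Ioi_self) (hint.mono_set (Set.Ioi_subset_Ioi ha)),
      Set.Ioc_union_Ioi_eq_Ioi ha]
  have h1 : ∫ u in Set.Ioc 0 (Real.pi * x ^ 2), Real.exp (-u) * u ^ ((1 / 4 : ℝ) - 1) ≤
      4 * (Real.pi * x ^ 2) ^ (1 / 4 : ℝ) := by
    have hi : MeasureTheory.IntegrableOn (fun u : ℝ => u ^ ((1 / 4 : ℝ) - 1))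
        (Set.Ioc 0 (Real.pi * x ^ 2)) := by
      rw [← intervalIntegrable_iff_integrableOn_Ioc_of_le ha]
      exact intervalIntegral.intervalIntegrable_rpow' (by norm_num)
    calc _ ≤ ∫ u in Set.Ioc 0 (Real.pi * x ^ 2), u ^ ((1 / 4 : ℝ) - 1) := by
          refine MeasureTheory.setIntegral_mono_on (hint.mono_set Set.Ioc_subset_Ioi_self) hi
            measurableSet_Ioc fun u hu => ?_
          have h0 : (0 : ℝ) < u := hu.1
          have h1 : Real.exp (-u) ≤ 1 := Real.exp_le_one_iff.2 (by linarith)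
          have : 0 ≤ u ^ ((1 / 4 : ℝ) - 1) := by positivity
          nlinarith
      _ = _ := by
          rw [← intervalIntegral.integral_of_le ha, integral_rpow (by left; norm_num)]
          rw [show (1 / 4 : ℝ) - 1 + 1 = 1 / 4 by norm_num, Real.zero_rpow (by norm_num)]
          ring
  have h2 : (Real.pi * x ^ 2) ^ (1 / 4 : ℝ) = Real.pi ^ (1 / 4 : ℝ) * Real.sqrt x := by
    rw [Real.mul_rpow Real.pi_pos.le (by positivity), ← Real.rpow_natCast, ← Real.rpow_mul hx,
      Real.sqrt_eq_rpow]
    norm_num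
  have hg := gamma_quarter_pos
  have h3 : 1 - gammaWeight x =
      (∫ u in Set.Ioc 0 (Real.pi * x ^ 2), Real.exp (-u) * u ^ ((1 / 4 : ℝ) - 1)) /
        Real.Gamma (1 / 4) := by
    rw [gammaWeight, eq_div_iff hg.ne', sub_mul, div_mul_cancel₀ _ hg.ne', one_mul]
    linarith
  rw [h3, div_le_iff₀ hg]
  refine h1.trans (le_of_eq ?_)
  rw [h2]
  field_simp

/-- The weight at `n / Y` trades powers of `n` for powers of `Y`, up to a convergence factor. -/
theorem exists_rpow_mul_gammaWeight_le (b ε : ℝ) (hb : b ≤ 1) (hε : 0 < ε) :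
    ∃ C : ℝ, 0 < C ∧ ∀ Y : ℝ, 0 < Y → ∀ n : ℕ, 0 < n →
      (n : ℝ) ^ (-b) * gammaWeight (n / Y) ≤ C * Y ^ (1 - b + ε) * (n : ℝ) ^ (-(1 + ε)) := by
  obtain ⟨C, hC, h⟩ := exists_gammaWeight_le_rpow (1 - b + ε) (by linarith)
  refine ⟨C, hC, fun Y hY n hn => ?_⟩
  have hn' : (0 : ℝ) < n := by exact_mod_cast hn
  have h1 := h (n / Y) (by positivity)
  rw [Real.div_rpow hn'.le hY.le, Real.rpow_neg hY.le, div_inv_eq_mul] at h1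
  calc _ ≤ (n : ℝ) ^ (-b) * (C * ((n : ℝ) ^ (-(1 - b + ε)) * Y ^ (1 - b + ε))) := by gcongr
    _ = C * Y ^ (1 - b + ε) * ((n : ℝ) ^ (-b) * (n : ℝ) ^ (-(1 - b + ε))) := by ring
    _ = _ := by
      rw [← Real.rpow_add hn']
      congr 2
      ring

/-! ### The approximate functional equation -/

theorem chiZ_zero (d : ℕ) : chiZ d 0 = 0 := by simp [chiZ]

theorem abs_chiZ_le_one (d n : ℕ) : |chiZ d n| ≤ 1 := by
  rw [chiZ]
  split_ifs
  · rcases jacobiSym.trichotomy ((8 * d : ℕ) : ℤ) n with h | h | h <;> rw [h] <;> simp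
  · simp

theorem norm_chiZ_le_one (d n : ℕ) : ‖(chiZ d n : ℂ)‖ ≤ 1 := by
  rw [Complex.norm_intCast]
  exact_mod_cast abs_chiZ_le_one d n

theorem eN_neg (N : ℕ) (a : ℤ) : eN N (-a) = (starRingEnd ℂ) (eN N a) := by
  rw [eN, eN, ← Complex.exp_conj]
  congr 1
  simp only [map_mul, map_div₀, Complex.conj_ofReal, Complex.conj_I, map_natCast, map_intCast,
    map_ofNat]
  push_cast
  ring

/-- Extension of `finiteFT_chiZ` to negative frequencies; negating the frequency conjugates the
transform of a real function. -/
theorem finiteFT_chiZ_int {d : ℕ} (hd : Odd d) (hsq : Squarefree d) (c : ℤ) :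
    finiteFT (8 * d) (chiZ d) c = chiZ d c.natAbs * Real.sqrt (8 * d) := by
  rcases Int.natAbs_eq c with h | h
  · conv_lhs => rw [h]
    exact finiteFT_chiZ hd hsq _
  · have h1 := finiteFT_chiZ hd hsq c.natAbs
    have h2 : finiteFT (8 * d) (chiZ d) c =
        (starRingEnd ℂ) (finiteFT (8 * d) (chiZ d) (c.natAbs : ℤ)) := by
      rw [finiteFT, finiteFT, map_sum]
      refine Finset.sum_congr rfl fun n _ => ?_
      rw [map_mul, ← eN_neg, map_intCast]
      congr 2
      conv_lhs => rw [h]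
      ring
    rw [h2, h1, map_mul, map_intCast, Complex.conj_ofReal]

/-- The character `χ_{8d}` is even, so that it extends to the integers through `natAbs`. -/
theorem chiZ_natAbs_congr {d : ℕ} (hd : Odd d) (hsq : Squarefree d) {a b : ℤ}
    (h : a ≡ b [ZMOD (8 * d : ℕ)]) : chiZ d a.natAbs = chiZ d b.natAbs := by
  have hd0 : (0 : ℝ) < d := by exact_mod_cast hd.pos
  have h1 : finiteFT (8 * d) (chiZ d) a = finiteFT (8 * d) (chiZ d) b := by
    rw [finiteFT, finiteFT]
    refine Finset.sum_congr rfl fun n _ => ?_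
    rw [eN_congr (by have := hd.pos; positivity) (h.mul_right n)]
  rw [finiteFT_chiZ_int hd hsq, finiteFT_chiZ_int hd hsq] at h1
  have h2 : ((Real.sqrt (8 * d) : ℝ) : ℂ) ≠ 0 := by
    have : 0 < Real.sqrt (8 * d) := by positivity
    exact_mod_cast this.ne'
  exact_mod_cast mul_right_cancel₀ h2 h1

/-- The theta series of `χ_{8d}`. -/
noncomputable def chiTheta (d : ℕ) (t : ℝ) : ℂ :=
  ∑' n : ℕ, (chiZ d n : ℂ) * Real.exp (-(Real.pi * n ^ 2 / (8 * d)) * t)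

theorem summable_exp_neg_sq {c : ℝ} (hc : 0 < c) :
    Summable fun n : ℕ => Real.exp (-(c * n ^ 2)) := by
  refine Summable.of_nonneg_of_le (fun n => (Real.exp_pos _).le) (fun n => ?_)
    (Real.summable_exp_nat_mul_iff.2 (neg_lt_zero.2 hc))
  rw [Real.exp_le_exp]
  have : (n : ℝ) ≤ n ^ 2 := by
    rcases Nat.eq_zero_or_pos n with rfl | h
    · simp
    · have : (1 : ℝ) ≤ n := by exact_mod_cast h
      nlinarith
  nlinarith

theorem hasSum_chiTheta {d : ℕ} (hd : 0 < d) {t : ℝ} (ht : 0 < t) :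
    HasSum (fun n : ℕ => (chiZ d n : ℂ) * Real.exp (-(Real.pi * n ^ 2 / (8 * d)) * t))
      (chiTheta d t) := by
  have hd0 : (0 : ℝ) < d := by exact_mod_cast hd
  refine Summable.hasSum ?_
  refine Summable.of_norm_bounded
    (summable_exp_neg_sq (c := Real.pi / (8 * d) * t) (by have := Real.pi_pos; positivity)) ?_
  intro n
  rw [norm_mul, Complex.norm_real, Real.norm_of_nonneg (Real.exp_pos _).le]
  refine (mul_le_of_le_one_left (Real.exp_pos _).le (norm_chiZ_le_one d n)).trans (le_of_eq ?_)
  congr 1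
  ring

/-- The theta series as a sum over all integers, as needed for Poisson summation. -/
theorem hasSum_int_chiTheta {d : ℕ} (hd : 0 < d) {t : ℝ} (ht : 0 < t) :
    HasSum (fun n : ℤ => (chiZ d n.natAbs : ℂ) * Real.exp (-(Real.pi * n ^ 2 / (8 * d)) * t))
      (2 * chiTheta d t) := by
  have h := hasSum_chiTheta hd ht
  have h2 := HasSum.of_nat_of_neg (f := fun n : ℤ => (chiZ d n.natAbs : ℂ) *
    Real.exp (-(Real.pi * n ^ 2 / (8 * d)) * t)) (g := chiTheta d t) (g' := chiTheta d t)
    (by simpa using h) (by simpa using h)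
  simpa [chiZ_zero, two_mul] using h2

/-- Poisson summation in each residue class modulo `8d`. -/
theorem two_mul_chiTheta_eq {d : ℕ} (hd : Odd d) (hsq : Squarefree d) {t : ℝ} (ht : 0 < t) :
    2 * chiTheta d t = ∑ r ∈ Finset.range (8 * d), (chiZ d r : ℂ) *
      (1 / ((8 * d : ℕ) * ((t / (8 * d) : ℝ) : ℂ) ^ (1 / 2 : ℂ)) *
        jacobiTheta₂ ((r / (8 * d : ℕ) : ℝ) : ℂ)
          (Complex.I / ((8 * d : ℕ) ^ 2 * ((t / (8 * d) : ℝ) : ℂ)))) := by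
  have hd0 : (0 : ℝ) < d := by exact_mod_cast hd.pos
  refine (hasSum_int_chiTheta hd.pos ht).unique ?_
  refine hasSum_int_of_progressions (by have := hd.pos; positivity) fun r _ => ?_
  have := (hasSum_gaussian_progression ((t / (8 * d) : ℝ) : ℂ)
    (by rw [Complex.ofReal_re]; positivity) (8 * d) (by have := hd.pos; positivity) r).mul_left
      (chiZ d r : ℂ)
  refine this.congr_fun fun m => ?_
  have h1 : chiZ d (r + (8 * d : ℕ) * m : ℤ).natAbs = chiZ d r := by
    have := chiZ_natAbs_congr hd hsq (a := r + (8 * d : ℕ) * m) (b := r)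
      (by simp [Int.ModEq])
    simpa using this
  rw [h1]
  congr 1
  push_cast
  congr 1
  ring

/-- The same with the constants collected; the theta values now sit at height `1 / (8dt)`. -/
theorem two_mul_chiTheta_eq' {d : ℕ} (hd : Odd d) (hsq : Squarefree d) {t : ℝ} (ht : 0 < t) :
    2 * chiTheta d t = ((1 / (Real.sqrt (8 * d) * Real.sqrt t) : ℝ) : ℂ) *
      ∑ r ∈ Finset.range (8 * d), (chiZ d r : ℂ) *
        jacobiTheta₂ ((r / (8 * d : ℕ) : ℝ) : ℂ) (Complex.I * ((1 / (8 * d * t) : ℝ) : ℂ)) := by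
  have hd0 : (0 : ℝ) < d := by exact_mod_cast hd.pos
  have hdc : (d : ℂ) ≠ 0 := by exact_mod_cast hd.pos.ne'
  have htc : (t : ℂ) ≠ 0 := by exact_mod_cast ht.ne'
  rw [two_mul_chiTheta_eq hd hsq ht, Finset.mul_sum]
  refine Finset.sum_congr rfl fun r _ => ?_
  have e1 : (((t / (8 * d) : ℝ) : ℂ)) ^ (1 / 2 : ℂ) =
      ((Real.sqrt t / Real.sqrt (8 * d) : ℝ) : ℂ) := by
    rw [← Real.sqrt_div' _ (by positivity), Real.sqrt_eq_rpow, Complex.ofReal_cpow (by positivity)]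
    norm_num
  have e2 : Complex.I / ((8 * d : ℕ) ^ 2 * ((t / (8 * d) : ℝ) : ℂ)) =
      Complex.I * ((1 / (8 * d * t) : ℝ) : ℂ) := by
    push_cast; field_simp
  have e3 : (1 : ℂ) / ((8 * d : ℕ) * ((Real.sqrt t / Real.sqrt (8 * d) : ℝ) : ℂ)) =
      ((1 / (Real.sqrt (8 * d) * Real.sqrt t) : ℝ) : ℂ) := by
    have h1 : (8 * (d : ℝ)) = Real.sqrt (8 * d) * Real.sqrt (8 * d) :=
      (Real.mul_self_sqrt (by positivity)).symm
    have h2 : 0 < Real.sqrt (8 * d) := by positivity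
    have h3 : 0 < Real.sqrt t := by positivity
    have h4 : 1 / ((8 * (d : ℝ)) * (Real.sqrt t / Real.sqrt (8 * d))) =
        1 / (Real.sqrt (8 * d) * Real.sqrt t) := by
      conv_lhs => rw [h1]
      field_simp
      rw [Real.sq_sqrt (by positivity)]
    rw [← h4]
    push_cast
    rfl
  rw [e1, e2, e3]
  ring

/-- The functional equation of the theta series, with root number `1`. -/
theorem chiTheta_eq {d : ℕ} (hd : Odd d) (hsq : Squarefree d) {t : ℝ} (ht : 0 < t) :
    chiTheta d t = ((1 / Real.sqrt t : ℝ) : ℂ) * chiTheta d (1 / t) := by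
  have hd0 : (0 : ℝ) < d := by exact_mod_cast hd.pos
  have hdc : (d : ℂ) ≠ 0 := by exact_mod_cast hd.pos.ne'
  have htc : (t : ℂ) ≠ 0 := by exact_mod_cast ht.ne'
  have him : 0 < (Complex.I * ((1 / (8 * d * t) : ℝ) : ℂ)).im := by
    rw [Complex.I_mul_im, Complex.ofReal_re]; positivity
  have h1 := hasSum_sum (s := Finset.range (8 * d)) fun (r : ℕ) _ =>
    (hasSum_jacobiTheta₂_term ((r / (8 * d : ℕ) : ℝ) : ℂ) him).mul_left (chiZ d r : ℂ)
  have h2 := (hasSum_int_chiTheta hd.pos (t := 1 / t) (by positivity)).mul_left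
    ((Real.sqrt (8 * d) : ℝ) : ℂ)
  have h3 := h1.unique (h2.congr_fun fun m => ?_)
  · have h4 := two_mul_chiTheta_eq' hd hsq ht
    rw [h3] at h4
    have h5 : ((Real.sqrt (8 * d) : ℝ) : ℂ) ≠ 0 := by
      have : 0 < Real.sqrt (8 * d) := by positivity
      exact_mod_cast this.ne'
    have h6 : ((Real.sqrt t : ℝ) : ℂ) ≠ 0 := by
      have : 0 < Real.sqrt t := by positivity
      exact_mod_cast this.ne'
    push_cast at h4 ⊢
    field_simp at h4 ⊢
    exact h4
  · have h4 := finiteFT_chiZ_int hd hsq m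
    rw [← mul_assoc, mul_comm ((Real.sqrt (8 * d) : ℝ) : ℂ), ← h4, finiteFT, Finset.sum_mul]
    refine Finset.sum_congr rfl fun r _ => ?_
    rw [jacobiTheta₂_term, eN, mul_assoc (chiZ d r : ℂ), Complex.ofReal_exp, ← Complex.exp_add]
    congr 2
    push_cast
    field_simp
    ring_nf
    simp only [Complex.I_sq]
    ring

theorem continuousOn_chiTheta {d : ℕ} (hd : Odd d) (hsq : Squarefree d) :
    ContinuousOn (chiTheta d) (Set.Ioi 0) := by
  have hd0 : (0 : ℝ) < d := by exact_mod_cast hd.pos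
  have h : ContinuousOn (fun t : ℝ => (1 / 2 : ℂ) *
      (((1 / (Real.sqrt (8 * d) * Real.sqrt t) : ℝ) : ℂ) *
      ∑ r ∈ Finset.range (8 * d), (chiZ d r : ℂ) *
        jacobiTheta₂ ((r / (8 * d : ℕ) : ℝ) : ℂ) (Complex.I * ((1 / (8 * d * t) : ℝ) : ℂ))))
      (Set.Ioi 0) := by
    refine continuousOn_const.mul (ContinuousOn.mul ?_ ?_)
    · refine Complex.continuous_ofReal.comp_continuousOn ?_
      refine continuousOn_const.div (by fun_prop) fun t ht => ?_
      have : (0 : ℝ) < t := ht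
      positivity
    · refine continuousOn_finsetSum _ fun r _ => continuousOn_const.mul fun t ht => ?_
      have ht' : (0 : ℝ) < t := ht
      refine ContinuousAt.continuousWithinAt ?_
      have him : 0 < (Complex.I * ((1 / (8 * d * t) : ℝ) : ℂ)).im := by
        rw [Complex.I_mul_im, Complex.ofReal_re]; positivity
      refine (differentiableAt_jacobiTheta₂_snd _ him).continuousAt.comp
        (f := fun t : ℝ => Complex.I * ((1 / (8 * d * t) : ℝ) : ℂ)) ?_
      refine continuousAt_const.mul (Complex.continuous_ofReal.continuousAt.comp ?_)
      exact continuousAt_const.div (by fun_prop) (by positivity)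
  refine h.congr fun t ht => ?_
  beta_reduce
  rw [← two_mul_chiTheta_eq' hd hsq ht]
  ring

theorem exists_norm_chiTheta_le {d : ℕ} (hd : Odd d) : ∃ C : ℝ, ∀ t : ℝ, 1 ≤ t →
    ‖chiTheta d t‖ ≤ C * Real.exp (-(Real.pi / (16 * d)) * t) := by
  have hd0 : (0 : ℝ) < d := by exact_mod_cast hd.pos
  have hs := summable_exp_neg_sq (c := Real.pi / (16 * d)) (by have := Real.pi_pos; positivity)
  refine ⟨∑' n : ℕ, Real.exp (-(Real.pi / (16 * d) * n ^ 2)), fun t ht => ?_⟩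
  rw [← tsum_mul_right]
  refine tsum_of_norm_bounded (hs.mul_right _).hasSum fun n => ?_
  rw [norm_mul, Complex.norm_real, Real.norm_of_nonneg (Real.exp_pos _).le, ← Real.exp_add]
  rcases Nat.eq_zero_or_pos n with rfl | hn
  · rw [chiZ_zero]; simp; positivity
  refine (mul_le_of_le_one_left (Real.exp_pos _).le (norm_chiZ_le_one d n)).trans ?_
  rw [Real.exp_le_exp]
  have h1 : (1 : ℝ) ≤ (n : ℝ) ^ 2 := by
    have : (1 : ℝ) ≤ n := by exact_mod_cast hn
    nlinarith
  have h2 : (n : ℝ) ^ 2 + t ≤ 2 * (n ^ 2 * t) := by nlinarith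
  have h3 : 0 < Real.pi / (16 * d) := by have := Real.pi_pos; positivity
  have h4 : Real.pi * n ^ 2 / (8 * d) * t = Real.pi / (16 * d) * (2 * (n ^ 2 * t)) := by
    field_simp; norm_num
  nlinarith

theorem chiTheta_isBigO {d : ℕ} (hd : Odd d) (r : ℝ) :
    (fun t => chiTheta d t - 0) =O[atTop] fun t : ℝ => t ^ r := by
  have hd0 : (0 : ℝ) < d := by exact_mod_cast hd.pos
  obtain ⟨C, hC⟩ := exists_norm_chiTheta_le hd
  have h1 : (fun t => chiTheta d t - 0) =O[atTop]
      fun t : ℝ => Real.exp (-(Real.pi / (16 * d)) * t) := by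
    refine IsBigO.of_bound C ?_
    filter_upwards [eventually_ge_atTop 1] with t ht
    rw [sub_zero, Real.norm_of_nonneg (Real.exp_pos _).le]
    exact hC t ht
  exact h1.trans (isLittleO_exp_neg_mul_rpow_atTop
    (by have := Real.pi_pos; positivity) r).isBigO

/-- The theta series of `χ_{8d}` as a functional equation datum. -/
noncomputable def chiFEPair {d : ℕ} (hd : Odd d) (hsq : Squarefree d) : WeakFEPair ℂ where
  f := chiTheta d
  g := chiTheta d
  k := 1 / 2
  ε := 1
  f₀ := 0
  g₀ := 0
  hf_int := (continuousOn_chiTheta hd hsq).locallyIntegrableOn measurableSet_Ioi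
  hg_int := (continuousOn_chiTheta hd hsq).locallyIntegrableOn measurableSet_Ioi
  hk := by norm_num
  hε := one_ne_zero
  h_feq := fun x hx => by
    have hx' : (0 : ℝ) < x := hx
    rw [chiTheta_eq hd hsq (t := 1 / x) (by positivity), one_div_one_div, one_mul, smul_eq_mul,
      ← Real.sqrt_eq_rpow, Real.sqrt_div zero_le_one, Real.sqrt_one, one_div_one_div]
  hf_top := fun r => chiTheta_isBigO hd r
  hg_top := fun r => chiTheta_isBigO hd r

/-- The sum of `χ_{8d}` over a period is its Fourier transform at `0`, which vanishes because
`χ_{8d}(0) = 0`; a principal character would have a positive sum. -/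
theorem chi8_ne_one {d : ℕ} (hd : Odd d) (hsq : Squarefree d) : chi8 d ≠ 1 := by
  intro h
  have h0 := finiteFT_chiZ_int hd hsq 0
  rw [Int.natAbs_zero, chiZ_zero, Int.cast_zero, zero_mul, finiteFT] at h0
  have h1 : ∑ n ∈ Finset.range (8 * d), chiZ d n = 0 := by
    have : ((∑ n ∈ Finset.range (8 * d), chiZ d n : ℤ) : ℂ) = 0 := by
      rw [← h0]
      push_cast
      exact Finset.sum_congr rfl fun n _ => by simp [eN]
    exact_mod_cast this
  have h2 : ∀ n : ℕ, 0 ≤ chiZ d n := by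
    intro n
    have h3 := chi8_natCast d n
    rw [h] at h3
    by_cases hu : IsUnit (n : ZMod (8 * d))
    · rw [MulChar.one_apply hu] at h3
      have : chiZ d n = 1 := by exact_mod_cast h3.symm
      omega
    · rw [MulChar.map_nonunit _ hu] at h3
      have : chiZ d n = 0 := by exact_mod_cast h3.symm
      omega
  have h4 : chiZ d 1 = 1 := by simp [chiZ]
  have h5 : chiZ d 1 ≤ ∑ n ∈ Finset.range (8 * d), chiZ d n :=
    Finset.single_le_sum (f := chiZ d) (fun n _ => h2 n)
      (Finset.mem_range.2 (by have := hd.pos; omega))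
  omega

/-- Termwise integration in the half plane of absolute convergence. -/
theorem mellin_chiTheta_of_half_lt {d : ℕ} [NeZero (8 * d)] (hd : 0 < d) {s : ℂ}
    (hs : 1 / 2 < s.re) :
    mellin (chiTheta d) s = ((Real.pi / (8 * d) : ℝ) : ℂ) ^ (-s) * Complex.Gamma s *
      DirichletCharacter.LFunction (chi8 d) (2 * s) := by
  have hd0 : (0 : ℝ) < d := by exact_mod_cast hd
  have hs2 : 1 < (2 * s).re := by simp; linarith
  have hc : 0 < Real.pi / (8 * d) := by have := Real.pi_pos; positivity
  have hpow : ∀ n : ℕ, (Real.pi * n ^ 2 / (8 * d)) ^ s.re =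
      (Real.pi / (8 * d)) ^ s.re * (n : ℝ) ^ (2 * s.re) := by
    intro n
    rw [show Real.pi * n ^ 2 / (8 * d) = Real.pi / (8 * d) * (n : ℝ) ^ 2 by ring,
      Real.mul_rpow hc.le (by positivity), ← Real.rpow_natCast, ← Real.rpow_mul (by positivity)]
    norm_cast
  have h := hasSum_mellin (a := fun n : ℕ => (chiZ d n : ℂ))
    (p := fun n : ℕ => Real.pi * n ^ 2 / (8 * d)) (F := chiTheta d) (s := s) ?_ (by linarith) ?_ ?_
  · rw [DirichletCharacter.LFunction_eq_LSeries _ hs2, ← h.tsum_eq, LSeries, ← tsum_mul_left]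
    refine tsum_congr fun n => ?_
    rcases Nat.eq_zero_or_pos n with rfl | hn
    · simp [chiZ_zero]
    · have hn0 : n ≠ 0 := hn.ne'
      rw [LSeries.term_of_ne_zero hn0, chi8_natCast]
      have hnr : (0 : ℝ) < n := by exact_mod_cast hn
      have e : ((Real.pi * n ^ 2 / (8 * d) : ℝ) : ℂ) ^ s =
          ((Real.pi / (8 * d) : ℝ) : ℂ) ^ s * (n : ℂ) ^ (2 * s) := by
        rw [show Real.pi * n ^ 2 / (8 * d) = Real.pi / (8 * d) * ((n : ℝ) ^ 2) by ring,
          Complex.ofReal_mul, Complex.mul_cpow_ofReal_nonneg hc.le (by positivity)]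
        congr 1
        have := Complex.natCast_cpow_natCast_mul n 2 s
        push_cast at this ⊢
        rw [this]
      rw [e, Complex.cpow_neg]
      have e1 : ((Real.pi / (8 * d) : ℝ) : ℂ) ^ s ≠ 0 := by
        rw [Complex.cpow_ne_zero_iff]
        left
        exact_mod_cast hc.ne'
      field_simp
  · intro n
    rcases Nat.eq_zero_or_pos n with rfl | hn
    · left; simp [chiZ_zero]
    · right
      have := Real.pi_pos
      positivity
  · intro t ht
    exact hasSum_chiTheta hd ht
  · simp only [hpow]
    have h1 : Summable fun n : ℕ => 1 / (n : ℝ) ^ (2 * s.re) :=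
      Real.summable_one_div_nat_rpow.2 (by linarith)
    refine Summable.of_nonneg_of_le (fun n => by positivity) (fun n => ?_)
      (h1.mul_left (1 / (Real.pi / (8 * d)) ^ s.re))
    rw [one_div_mul_one_div]
    exact div_le_div_of_nonneg_right (norm_chiZ_le_one d n) (by positivity)

/-- Both sides are holomorphic for `0 < s.re`, so the identity extends from the half plane of
absolute convergence. -/
theorem mellin_chiTheta {d : ℕ} [NeZero (8 * d)] (hd : Odd d) (hsq : Squarefree d) {s : ℂ}
    (hs : 0 < s.re) :
    mellin (chiTheta d) s = ((Real.pi / (8 * d) : ℝ) : ℂ) ^ (-s) * Complex.Gamma s *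
      DirichletCharacter.LFunction (chi8 d) (2 * s) := by
  have hd0 : (0 : ℝ) < d := by exact_mod_cast hd.pos
  have hc : 0 < Real.pi / (8 * d) := by have := Real.pi_pos; positivity
  have hP : IsStrongFEPair (chiFEPair hd hsq) := ⟨rfl, rfl⟩
  have hU : IsOpen {s : ℂ | 0 < s.re} := isOpen_lt continuous_const Complex.continuous_re
  have hL : DifferentiableOn ℂ (mellin (chiTheta d)) {s : ℂ | 0 < s.re} := by
    have := hP.differentiable_Λ
    rw [hP.Λ_eq] at this
    exact this.differentiableOn
  have hR : DifferentiableOn ℂ (fun s : ℂ => ((Real.pi / (8 * d) : ℝ) : ℂ) ^ (-s) *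
      Complex.Gamma s * DirichletCharacter.LFunction (chi8 d) (2 * s)) {s : ℂ | 0 < s.re} := by
    intro s hs
    have hs' : 0 < s.re := hs
    refine DifferentiableAt.differentiableWithinAt ?_
    refine DifferentiableAt.mul (DifferentiableAt.mul ?_ ?_) ?_
    · refine DifferentiableAt.const_cpow (by fun_prop) ?_
      left
      exact_mod_cast hc.ne'
    · refine Complex.differentiableAt_Gamma _ fun m h => ?_
      rw [h] at hs'
      simp at hs'
      linarith [(Nat.cast_nonneg m : (0 : ℝ) ≤ m)]
    · exact ((DirichletCharacter.differentiable_LFunction (chi8_ne_one hd hsq)) _).comp s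
        (by fun_prop)
  have hpre : IsPreconnected {s : ℂ | 0 < s.re} := (convex_halfSpace_re_gt 0).isPreconnected
  have := (hL.analyticOnNhd hU).eqOn_of_preconnected_of_eventuallyEq (hR.analyticOnNhd hU) hpre
    (z₀ := 1) (by simp) ?_
  · exact this hs
  · have : {s : ℂ | 1 / 2 < s.re} ∈ nhds (1 : ℂ) :=
      (isOpen_lt continuous_const Complex.continuous_re).mem_nhds (by norm_num)
    filter_upwards [this] with z hz
    exact mellin_chiTheta_of_half_lt hd.pos hz

/-- At `s = 1/4`, the centre of symmetry of the functional equation of the theta series, the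
integral over `(0, 1)` equals the one over `(1, ∞)`. -/
theorem mellin_chiTheta_quarter {d : ℕ} (hd : Odd d) (hsq : Squarefree d) :
    mellin (chiTheta d) (1 / 4) =
      2 * ∫ t in Set.Ioi (1 : ℝ), ((t ^ ((1 / 4 : ℝ) - 1) : ℝ) : ℂ) * chiTheta d t := by
  have hP : IsStrongFEPair (chiFEPair hd hsq) := ⟨rfl, rfl⟩
  have hconv : MellinConvergent (chiTheta d) (1 / 4) := (hP.hasMellin (1 / 4)).1
  -- `chiTheta d t` is `g t + t ^ (-1/2) * g t⁻¹`, where `g` is its restriction to `t > 1`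
  set g : ℝ → ℂ := (Set.Ioi 1).indicator (chiTheta d) with hg
  have hgconv : MellinConvergent g (1 / 4) := by
    have := hconv.indicator (measurableSet_Ioi (a := (1 : ℝ)))
    refine this.congr_fun (fun t _ => ?_) measurableSet_Ioi
    rw [hg]
    by_cases h : t ∈ Set.Ioi (1 : ℝ)
    · simp [Set.indicator_of_mem h]
    · simp [Set.indicator_of_notMem h]
  have hinv : MellinConvergent (fun t => g t⁻¹) (1 / 4 + (-(1 / 2))) := by
    have h := (MellinConvergent.comp_rpow (f := g) (s := 1 / 4 + (-(1 / 2)))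
      (by norm_num : (-1 : ℝ) ≠ 0)).2 (by convert hgconv using 1; push_cast; norm_num)
    simpa only [Real.rpow_neg_one] using h
  have hinv2 : MellinConvergent (fun t : ℝ => (t : ℂ) ^ (-(1 / 2) : ℂ) • g t⁻¹) (1 / 4) :=
    MellinConvergent.cpow_smul.2 hinv
  have h1 : mellin (chiTheta d) (1 / 4) =
      mellin (fun t : ℝ => g t + (t : ℂ) ^ (-(1 / 2) : ℂ) • g t⁻¹) (1 / 4) := by
    refine MeasureTheory.setIntegral_congr_ae measurableSet_Ioi ?_
    have : ∀ᵐ t : ℝ, t ≠ 1 := by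
      simp [MeasureTheory.ae_iff, MeasureTheory.measure_singleton]
    filter_upwards [this] with t ht1 ht0
    have ht0' : (0 : ℝ) < t := ht0
    congr 1
    rcases lt_or_gt_of_ne ht1 with h | h
    · have ha : t ∉ Set.Ioi (1 : ℝ) := fun h' => absurd h' (not_lt.2 h.le)
      have hb : t⁻¹ ∈ Set.Ioi (1 : ℝ) := (one_lt_inv₀ ht0').2 h
      rw [hg, Set.indicator_of_notMem ha, Set.indicator_of_mem hb, zero_add,
        chiTheta_eq hd hsq ht0', one_div, one_div, smul_eq_mul, Complex.cpow_neg,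
        Real.sqrt_eq_rpow]
      push_cast
      rw [Complex.ofReal_cpow ht0'.le]
      push_cast
      norm_num
    · have ha : t ∈ Set.Ioi (1 : ℝ) := h
      have hb : t⁻¹ ∉ Set.Ioi (1 : ℝ) := not_lt.2 (inv_le_one_of_one_le₀ h.le)
      rw [hg, Set.indicator_of_mem ha, Set.indicator_of_notMem hb, smul_zero, add_zero]
  have h2 : mellin g (1 / 4) =
      ∫ t in Set.Ioi (1 : ℝ), ((t ^ ((1 / 4 : ℝ) - 1) : ℝ) : ℂ) * chiTheta d t := by
    rw [mellin, ← MeasureTheory.integral_indicator measurableSet_Ioi,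
      ← MeasureTheory.integral_indicator measurableSet_Ioi]
    congr 1
    ext t
    by_cases h : t ∈ Set.Ioi (1 : ℝ)
    · have h0' : (0 : ℝ) < t := lt_trans zero_lt_one (Set.mem_Ioi.1 h)
      have h0 : t ∈ Set.Ioi (0 : ℝ) := h0'
      rw [Set.indicator_of_mem h0, Set.indicator_of_mem h, hg, Set.indicator_of_mem h,
        Complex.ofReal_cpow h0'.le, smul_eq_mul]
      push_cast
      rfl
    · rw [Set.indicator_of_notMem h]
      by_cases h0 : t ∈ Set.Ioi (0 : ℝ)
      · rw [Set.indicator_of_mem h0, hg, Set.indicator_of_notMem h, smul_zero]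
      · rw [Set.indicator_of_notMem h0]
  rw [h1, (hasMellin_add hgconv hinv2).2, mellin_cpow_smul, mellin_comp_inv,
    show -(1 / 4 + -(1 / 2) : ℂ) = 1 / 4 by norm_num, h2]
  ring

/-- The substitution `u = p * t` turns the integral of one term of the theta series into the
weight. -/
theorem integral_Ioi_one_exp {p x : ℝ} (hp : 0 < p) (hpx : p = Real.pi * x ^ 2) :
    ∫ t in Set.Ioi (1 : ℝ), t ^ ((1 / 4 : ℝ) - 1) * Real.exp (-p * t) =
      p ^ (-(1 / 4) : ℝ) * (Real.Gamma (1 / 4) * gammaWeight x) := by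
  have h := MeasureTheory.integral_comp_mul_left_Ioi
    (fun u : ℝ => Real.exp (-u) * u ^ ((1 / 4 : ℝ) - 1)) 1 hp
  rw [mul_one] at h
  have h1 : ∫ t in Set.Ioi (1 : ℝ), Real.exp (-(p * t)) * (p * t) ^ ((1 / 4 : ℝ) - 1) =
      p ^ ((1 / 4 : ℝ) - 1) * ∫ t in Set.Ioi (1 : ℝ), t ^ ((1 / 4 : ℝ) - 1) * Real.exp (-p * t) := by
    rw [← MeasureTheory.integral_const_mul]
    refine MeasureTheory.setIntegral_congr_fun measurableSet_Ioi fun t ht => ?_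
    have ht0 : (0 : ℝ) < t := lt_trans zero_lt_one ht
    rw [Real.mul_rpow hp.le ht0.le, neg_mul]
    ring
  rw [h1] at h
  have h2 : Real.Gamma (1 / 4) * gammaWeight x =
      ∫ u in Set.Ioi p, Real.exp (-u) * u ^ ((1 / 4 : ℝ) - 1) := by
    rw [gammaWeight, hpx]
    field_simp [gamma_quarter_pos.ne']
  have h3 : p ^ (-(1 / 4) : ℝ) * p ^ ((1 / 4 : ℝ) - 1) = p⁻¹ := by
    rw [← Real.rpow_add hp, ← Real.rpow_neg_one]; norm_num
  have h4 : p ^ ((1 / 4 : ℝ) - 1) ≠ 0 := (Real.rpow_pos_of_pos hp _).ne'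
  rw [h2]
  apply mul_left_cancel₀ h4
  rw [h, ← h3, smul_eq_mul]
  ring

theorem integrableOn_Ioi_one_exp {p : ℝ} (hp : 0 < p) :
    MeasureTheory.IntegrableOn (fun t : ℝ => t ^ ((1 / 4 : ℝ) - 1) * Real.exp (-p * t))
      (Set.Ioi 1) := by
  have := integrableOn_rpow_mul_exp_neg_mul_rpow (p := 1) (s := (1 / 4 : ℝ) - 1) (b := p)
    (by norm_num) one_pos hp
  simp only [Real.rpow_one] at this
  exact this.mono_set (Set.Ioi_subset_Ioi zero_le_one)

theorem summable_gammaWeight {Y : ℝ} (hY : 0 < Y) :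
    Summable fun n : ℕ => (n : ℝ) ^ (-(1 / 2) : ℝ) * gammaWeight (n / Y) := by
  obtain ⟨C, hC, h⟩ := exists_rpow_mul_gammaWeight_le (1 / 2) 1 (by norm_num) one_pos
  refine Summable.of_nonneg_of_le (fun n => mul_nonneg (by positivity) (gammaWeight_nonneg _))
    (fun n => ?_) ((Real.summable_nat_rpow.2 (by norm_num : (-(1 + 1) : ℝ) < -1)).mul_left
      (C * Y ^ (1 - 1 / 2 + 1 : ℝ)))
  rcases Nat.eq_zero_or_pos n with rfl | hn
  · simp
  · exact h Y hY n hn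

/-- Approximate functional equation for the central value `L(1/2, χ_{8d})`. -/
theorem centralValue_eq {d : ℕ} (hd : Odd d) (hsq : Squarefree d) :
    centralValue d = ((2 * ∑' n : ℕ, (chiZ d n : ℝ) *
      ((n : ℝ) ^ (-(1 / 2) : ℝ) * gammaWeight (n / Real.sqrt (8 * d))) : ℝ) : ℂ) := by
  have hd0 : (0 : ℝ) < d := by exact_mod_cast hd.pos
  have hne : d ≠ 0 := hd.pos.ne'
  have : NeZero (8 * d) := ⟨by positivity⟩
  rw [centralValue, dif_neg hne]
  have hc : 0 < Real.pi / (8 * d) := by have := Real.pi_pos; positivity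
  have hM := mellin_chiTheta hd hsq (s := 1 / 4) (by norm_num)
  have hq : 0 < Real.sqrt (8 * d) := by positivity
  have hp : ∀ n : ℕ, Real.pi * n ^ 2 / (8 * d) = Real.pi * (n / Real.sqrt (8 * d)) ^ 2 := by
    intro n
    rw [div_pow, Real.sq_sqrt (by positivity)]; ring
  -- integrate the theta series term by term
  set c : ℝ := (Real.pi / (8 * d)) ^ (-(1 / 4) : ℝ) * Real.Gamma (1 / 4) with hcdef
  have hint0 : ∀ n : ℕ, 0 < n → ∫ t in Set.Ioi (1 : ℝ), t ^ ((1 / 4 : ℝ) - 1) *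
      Real.exp (-(Real.pi * n ^ 2 / (8 * d)) * t) =
      c * ((n : ℝ) ^ (-(1 / 2) : ℝ) * gammaWeight (n / Real.sqrt (8 * d))) := by
    intro n hn
    have hn' : (0 : ℝ) < n := by exact_mod_cast hn
    have hpn : 0 < Real.pi * n ^ 2 / (8 * d) := by have := Real.pi_pos; positivity
    rw [integral_Ioi_one_exp hpn (hp n), hcdef,
      show Real.pi * n ^ 2 / (8 * d) = Real.pi / (8 * d) * (n : ℝ) ^ 2 by ring,
      Real.mul_rpow hc.le (by positivity), ← Real.rpow_natCast, ← Real.rpow_mul hn'.le]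
    norm_num
    ring
  have hint' : ∀ n : ℕ, ∫ t in Set.Ioi (1 : ℝ), (((chiZ d n : ℝ) * (t ^ ((1 / 4 : ℝ) - 1) *
      Real.exp (-(Real.pi * n ^ 2 / (8 * d)) * t)) : ℝ) : ℂ) =
      (((chiZ d n : ℝ) * (c * ((n : ℝ) ^ (-(1 / 2) : ℝ) *
        gammaWeight (n / Real.sqrt (8 * d)))) : ℝ) : ℂ) := by
    intro n
    rcases Nat.eq_zero_or_pos n with rfl | hn
    · simp [chiZ_zero]
    · rw [integral_complex_ofReal, MeasureTheory.integral_const_mul, hint0 n hn]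
  have hint : ∀ n : ℕ, ∫ t in Set.Ioi (1 : ℝ), ‖(((chiZ d n : ℝ) * (t ^ ((1 / 4 : ℝ) - 1) *
      Real.exp (-(Real.pi * n ^ 2 / (8 * d)) * t)) : ℝ) : ℂ)‖ =
      |(chiZ d n : ℝ)| * (c * ((n : ℝ) ^ (-(1 / 2) : ℝ) * gammaWeight (n / Real.sqrt (8 * d)))) := by
    intro n
    rcases Nat.eq_zero_or_pos n with rfl | hn
    · simp [chiZ_zero]
    · rw [← hint0 n hn, ← MeasureTheory.integral_const_mul]
      refine MeasureTheory.setIntegral_congr_fun measurableSet_Ioi fun t ht => ?_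
      have ht0 : (0 : ℝ) < t := lt_trans zero_lt_one ht
      rw [Complex.norm_real, Real.norm_eq_abs, abs_mul,
        abs_of_pos (a := t ^ ((1 / 4 : ℝ) - 1) * _) (by positivity)]
  have hsum := MeasureTheory.hasSum_integral_of_summable_integral_norm
    (μ := MeasureTheory.volume.restrict (Set.Ioi (1 : ℝ)))
    (F := fun (n : ℕ) (t : ℝ) => (((chiZ d n : ℝ) * (t ^ ((1 / 4 : ℝ) - 1) *
      Real.exp (-(Real.pi * n ^ 2 / (8 * d)) * t)) : ℝ) : ℂ)) ?_ ?_
  · have hI : ∫ t in Set.Ioi (1 : ℝ), ((t ^ ((1 / 4 : ℝ) - 1) : ℝ) : ℂ) * chiTheta d t =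
        ∫ t in Set.Ioi (1 : ℝ), ∑' n : ℕ, (((chiZ d n : ℝ) * (t ^ ((1 / 4 : ℝ) - 1) *
          Real.exp (-(Real.pi * n ^ 2 / (8 * d)) * t)) : ℝ) : ℂ) := by
      refine MeasureTheory.setIntegral_congr_fun measurableSet_Ioi fun t _ => ?_
      rw [chiTheta, ← tsum_mul_left]
      refine tsum_congr fun n => ?_
      push_cast
      ring
    rw [mellin_chiTheta_quarter hd hsq, hI, ← hsum.tsum_eq] at hM
    simp only [hint'] at hM
    rw [← Complex.ofReal_tsum] at hM
    have e1 : ∑' n : ℕ, (chiZ d n : ℝ) * (c * ((n : ℝ) ^ (-(1 / 2) : ℝ) *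
        gammaWeight (n / Real.sqrt (8 * d)))) = c * ∑' n : ℕ, (chiZ d n : ℝ) *
        ((n : ℝ) ^ (-(1 / 2) : ℝ) * gammaWeight (n / Real.sqrt (8 * d))) := by
      rw [← tsum_mul_left]
      exact tsum_congr fun n => by ring
    have e2 : ((Real.pi / (8 * d) : ℝ) : ℂ) ^ (-(1 / 4) : ℂ) * Complex.Gamma (1 / 4) = (c : ℂ) := by
      rw [hcdef]
      push_cast
      rw [Complex.ofReal_cpow hc.le, ← Complex.Gamma_ofReal]
      push_cast
      rfl
    have hc0 : (c : ℂ) ≠ 0 := by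
      have : 0 < c := by have := gamma_quarter_pos; positivity
      exact_mod_cast this.ne'
    rw [e1, e2, show (2 : ℂ) * (1 / 4) = 1 / 2 by norm_num] at hM
    apply mul_left_cancel₀ hc0
    rw [← hM]
    push_cast
    ring
  · intro n
    rcases Nat.eq_zero_or_pos n with rfl | hn
    · simp [chiZ_zero]
    · have hpn : 0 < Real.pi * n ^ 2 / (8 * d) := by have := Real.pi_pos; positivity
      exact ((integrableOn_Ioi_one_exp hpn).const_mul _).ofReal
  · simp only [hint]
    refine Summable.of_nonneg_of_le (fun n => ?_) (fun n => ?_)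
      ((summable_gammaWeight hq).mul_left c)
    · have := gammaWeight_nonneg (n / Real.sqrt (8 * d))
      have := gamma_quarter_pos
      positivity
    · refine mul_le_of_le_one_left ?_ (by exact_mod_cast abs_chiZ_le_one d n)
      have := gammaWeight_nonneg (n / Real.sqrt (8 * d))
      have := gamma_quarter_pos
      positivity

/-! ### Sums of Jacobi symbols over intervals -/

/-- Jordan's inequality for the chord `2 sin(πa/N)`. -/
theorem norm_one_sub_eN_ge {N a : ℕ} (ha : 0 < a) (haN : a < N) :
    4 * (min (a : ℝ) (N - a)) / N ≤ ‖eN N a - 1‖ := by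
  have hN : (0 : ℝ) < N := by exact_mod_cast ha.trans haN
  have ha' : (0 : ℝ) < a := by exact_mod_cast ha
  have haN' : (a : ℝ) < N := by exact_mod_cast haN
  have h1 : eN N a = Complex.exp (Complex.I * ((2 * Real.pi * (a / N) : ℝ) : ℂ)) := by
    rw [eN]; congr 1; push_cast; ring
  rw [h1, Complex.norm_exp_I_mul_ofReal_sub_one, Real.norm_eq_abs, abs_mul, abs_two,
    show 2 * Real.pi * (a / N) / 2 = Real.pi * (a / N) by ring]
  have hπ := Real.pi_pos
  have hx : (a : ℝ) / N < 1 := (div_lt_one hN).2 haN'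
  have hx0 : 0 < (a : ℝ) / N := by positivity
  rcases le_total ((a : ℝ) / N) (1 / 2) with h | h
  · have := Real.mul_le_sin (x := Real.pi * (a / N)) (by positivity) (by nlinarith)
    have h2 : 2 / Real.pi * (Real.pi * (a / N)) = 2 * (a / N) := by field_simp
    rw [h2] at this
    have h3 : 4 * (min (a : ℝ) (N - a)) / N ≤ 4 * (a / N) := by
      rw [mul_div_assoc]
      gcongr
      exact min_le_left _ _
    have := le_abs_self (Real.sin (Real.pi * (a / N)))
    linarith
  · have := Real.mul_le_sin (x := Real.pi - Real.pi * (a / N)) (by nlinarith) (by nlinarith)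
    have h2 : 2 / Real.pi * (Real.pi - Real.pi * (a / N)) = 2 * (1 - a / N) := by field_simp
    rw [h2, Real.sin_pi_sub] at this
    have h3 : 4 * (min (a : ℝ) (N - a)) / N ≤ 4 * (1 - a / N) := by
      have : 1 - (a : ℝ) / N = (N - a) / N := by field_simp
      rw [this, mul_div_assoc]
      gcongr
      exact min_le_right _ _
    have := le_abs_self (Real.sin (Real.pi * (a / N)))
    linarith

/-- A geometric sum of additive characters; the bound is written so as to be summed over `a`. -/
theorem norm_sum_eN_le {N a : ℕ} (ha : 0 < a) (haN : a < N) (B : ℕ) :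
    ‖∑ b ∈ Finset.range B, eN N ((b : ℤ) * a)‖ ≤ N / 2 * (1 / a + 1 / (N - a : ℕ)) := by
  have hN : (0 : ℝ) < N := by exact_mod_cast ha.trans haN
  have ha' : (0 : ℝ) < a := by exact_mod_cast ha
  have haN' : (0 : ℝ) < (N - a : ℕ) := by exact_mod_cast Nat.sub_pos_of_lt haN
  have hcast : ((N - a : ℕ) : ℝ) = N - a := by rw [Nat.cast_sub haN.le]
  have h1 := norm_one_sub_eN_ge ha haN
  have hmin : 0 < min (a : ℝ) (N - a) := lt_min ha' (hcast ▸ haN')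
  have hpos : 0 < ‖eN N a - 1‖ := lt_of_lt_of_le (by positivity) h1
  have hne : eN N a ≠ 1 := by
    intro h; rw [h] at hpos; simp at hpos
  have h2 : ∀ b : ℕ, eN N ((b : ℤ) * a) = (eN N a) ^ b := by
    intro b
    induction b with
    | zero => simp [eN]
    | succ b ih => rw [pow_succ, ← ih, ← eN_add]; congr 1; push_cast; ring
  simp only [h2]
  rw [geom_sum_eq hne, norm_div, div_le_iff₀ hpos]
  have h3 : ‖eN N a ^ B - 1‖ ≤ 2 := by
    refine (norm_sub_le _ _).trans ?_
    rw [norm_pow, norm_eN]; norm_num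
  refine h3.trans ?_
  have h4 : 2 ≤ N / 2 * (1 / min (a : ℝ) (N - a)) * (4 * (min (a : ℝ) (N - a)) / N) := by
    field_simp; norm_num
  have h5 : 1 / min (a : ℝ) (N - a) ≤ 1 / a + 1 / (N - a : ℕ) := by
    rw [hcast]
    rcases min_choice (a : ℝ) (N - a) with h | h <;> rw [h]
    · have : 0 < 1 / ((N : ℝ) - a) := by rw [← hcast]; positivity
      linarith
    · have : 0 < 1 / (a : ℝ) := by positivity
      linarith
  refine h4.trans ?_
  gcongr

/-- The Pólya–Vinogradov inequality for the primitive Jacobi symbols. -/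
theorem abs_sum_jacobi_le_of_squarefree {q : ℕ} (hq : Odd q) (hsq : Squarefree q) (hq1 : q ≠ 1)
    (B : ℕ) : |((∑ b ∈ Finset.range B, J(b | q) : ℤ) : ℝ)| ≤ Real.sqrt q * (1 + Real.log q) := by
  have hq0 : (0 : ℝ) < q := by exact_mod_cast hq.pos
  have hsq0 : 0 < Real.sqrt q := Real.sqrt_pos.2 hq0
  -- expand the symbol into additive characters by the Gauss sum, and interchange the sums
  have hG : ((∑ b ∈ Finset.range B, J(b | q) : ℤ) : ℂ) * quadGauss q 1 =
      ∑ a ∈ Finset.range q, ((J(a | q) : ℤ) : ℂ) * ∑ b ∈ Finset.range B, eN q ((b : ℤ) * a) := by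
    push_cast
    rw [Finset.sum_mul]
    simp only [Finset.mul_sum]
    rw [Finset.sum_comm]
    refine Finset.sum_congr rfl fun b _ => ?_
    rw [← (finiteFT_jacobi hq hsq).1, finiteFT]
  have h1 : ‖((∑ b ∈ Finset.range B, J(b | q) : ℤ) : ℂ) * quadGauss q 1‖ ≤
      ∑ a ∈ (Finset.range q).erase 0, q / 2 * (1 / (a : ℝ) + 1 / (q - a : ℕ)) := by
    rw [hG]
    have h0 : (0 : ℕ) ∈ Finset.range q := Finset.mem_range.2 hq.pos
    have hz : ((J((0 : ℕ) | q) : ℤ) : ℂ) = 0 := by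
      have := jacobiSym.zero_left (b := q) (by have := hq.pos; omega)
      simp [this]
    rw [← Finset.add_sum_erase _ _ h0, hz, zero_mul, zero_add]
    refine norm_sum_le_of_le _ fun a ha => ?_
    obtain ⟨ha0, ha1⟩ := Finset.mem_erase.1 ha
    rw [norm_mul]
    refine (mul_le_of_le_one_left (norm_nonneg _) ?_).trans
      (norm_sum_eN_le (Nat.pos_of_ne_zero ha0) (Finset.mem_range.1 ha1) B)
    rcases jacobiSym.trichotomy a q with h | h | h <;> simp [h]
  -- `a ↦ q - a` interchanges the two halves, leaving a harmonic sum
  have h2 : ∑ a ∈ (Finset.range q).erase 0, (q : ℝ) / 2 * (1 / (a : ℝ) + 1 / (q - a : ℕ)) ≤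
      q * (1 + Real.log q) := by
    have e1 : (Finset.range q).erase 0 = Finset.Ico 1 q := by
      ext a; simp [Finset.mem_erase, Nat.one_le_iff_ne_zero]
    have e2 : ∑ a ∈ Finset.Ico 1 q, (1 : ℝ) / (q - a : ℕ) = ∑ a ∈ Finset.Ico 1 q, (1 : ℝ) / a := by
      refine Finset.sum_nbij' (fun a => q - a) (fun a => q - a) ?_ ?_ ?_ ?_ ?_
      all_goals intro a ha
      all_goals obtain ⟨h1, h2⟩ := Finset.mem_Ico.1 ha
      · exact Finset.mem_Ico.2 ⟨by omega, by omega⟩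
      · exact Finset.mem_Ico.2 ⟨by omega, by omega⟩
      · omega
      · omega
      · rfl
    rw [e1, ← Finset.mul_sum, Finset.sum_add_distrib, e2, ← two_mul]
    have h3 : ∑ a ∈ Finset.Ico 1 q, (1 : ℝ) / a ≤ 1 + Real.log q := by
      have := harmonic_le_one_add_log q
      refine le_trans ?_ this
      rw [harmonic_eq_sum_Icc]
      push_cast
      simp only [one_div]
      exact Finset.sum_le_sum_of_subset_of_nonneg
        (fun a ha => Finset.mem_Icc.2 ⟨(Finset.mem_Ico.1 ha).1, (Finset.mem_Ico.1 ha).2.le⟩)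
        (fun a _ _ => by positivity)
    nlinarith
  have h3 := h1.trans h2
  rw [norm_mul, norm_quadGauss_one hq, Complex.norm_intCast] at h3
  have h4 : (q : ℝ) * (1 + Real.log q) = Real.sqrt q * (1 + Real.log q) * Real.sqrt q := by
    rw [mul_right_comm, Real.mul_self_sqrt hq0.le]
  rw [h4] at h3
  exact le_of_mul_le_mul_right h3 hsq0

theorem dvd_of_sq_dvd_mul_sq {a b s : ℕ} (hs : Squarefree s) (h : a ^ 2 ∣ b ^ 2 * s) (hb : 0 < b) :
    a ∣ b := by
  obtain ⟨g, hg, a', b', hco, rfl, rfl⟩ : ∃ g : ℕ, 0 < g ∧ ∃ a' b' : ℕ, a'.Coprime b' ∧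
      a = a' * g ∧ b = b' * g :=
    ⟨a.gcd b, Nat.gcd_pos_of_pos_right _ hb, Nat.exists_coprime a b⟩
  have h1 : a' ^ 2 ∣ b' ^ 2 * s := by
    refine Nat.dvd_of_mul_dvd_mul_left (k := g ^ 2) (by positivity) ?_
    convert h using 1 <;> ring
  have h2 : a' ^ 2 ∣ s := (Nat.Coprime.pow 2 2 hco).dvd_of_dvd_mul_left h1
  have h3 : IsUnit a' := hs a' (by rwa [← sq])
  rw [Nat.isUnit_iff] at h3
  rw [h3]
  exact Nat.mul_dvd_mul_right (one_dvd _) g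

/-- The square-free indicator as a Möbius sum over the square divisors. -/
theorem sum_moebius_sq_dvd {d K : ℕ} (hd : 0 < d) (hK : d < K) :
    ∑ a ∈ (Finset.range K).filter (fun a => a ^ 2 ∣ d), ArithmeticFunction.moebius a =
      if Squarefree d then 1 else 0 := by
  obtain ⟨s, b, hs0, hb0, rfl, hs⟩ := Nat.sq_mul_squarefree_of_pos hd
  have h1 : (Finset.range K).filter (fun a => a ^ 2 ∣ b ^ 2 * s) = b.divisors := by
    ext a
    rw [Finset.mem_filter, Finset.mem_range, Nat.mem_divisors]
    constructor
    · rintro ⟨-, h⟩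
      exact ⟨dvd_of_sq_dvd_mul_sq hs h hb0, hb0.ne'⟩
    · rintro ⟨h, -⟩
      refine ⟨lt_of_le_of_lt ?_ hK, (pow_dvd_pow_of_dvd h 2).mul_right s⟩
      have : a ≤ b := Nat.le_of_dvd hb0 h
      nlinarith
  rw [h1, ← ArithmeticFunction.coe_mul_zeta_apply, ArithmeticFunction.moebius_mul_coe_zeta,
    ArithmeticFunction.one_apply]
  congr 1
  rw [eq_iff_iff]
  constructor
  · rintro rfl; simpa using hs
  · intro h
    have := h b ⟨s, by ring⟩
    exact Nat.isUnit_iff.1 this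

theorem filter_dvd_range {e : ℕ} (he : 0 < e) (B : ℕ) :
    (Finset.range B).filter (fun b => e ∣ b) =
      (Finset.range ((B + e - 1) / e)).image (fun c => e * c) := by
  ext b
  simp only [Finset.mem_filter, Finset.mem_range, Finset.mem_image]
  have key : ∀ c, c < (B + e - 1) / e ↔ e * c < B := by
    intro c
    rw [← Nat.succ_le_iff, Nat.le_div_iff_mul_le he, Nat.succ_mul, mul_comm c e]
    omega
  constructor
  · rintro ⟨h, c, rfl⟩
    exact ⟨c, (key c).2 h, rfl⟩
  · rintro ⟨c, h, rfl⟩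
    exact ⟨(key c).1 h, dvd_mul_right e c⟩

theorem sum_filter_dvd_range {e : ℕ} (he : 0 < e) (B : ℕ) {M : Type*} [AddCommMonoid M]
    (F : ℕ → M) : ∑ b ∈ (Finset.range B).filter (fun b => e ∣ b), F b =
      ∑ c ∈ Finset.range ((B + e - 1) / e), F (e * c) := by
  rw [filter_dvd_range he, Finset.sum_image]
  intro a _ b _ h
  exact Nat.eq_of_mul_eq_mul_left he h

/-- The Pólya–Vinogradov inequality for Jacobi symbols of odd non-square denominator. -/
theorem abs_sum_jacobi_le {q : ℕ} (hq : Odd q) (hns : ¬ IsSquare q) (B : ℕ) :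
    |((∑ b ∈ Finset.range B, J(b | q) : ℤ) : ℝ)| ≤ Real.sqrt q * (1 + Real.log q) := by
  -- write `q = r² s` with `s` square-free; the symbol modulo `q` is the primitive one modulo `s`,
  -- restricted to arguments coprime to `r`
  obtain ⟨s, r, hs0, hr0, rfl, hs⟩ := Nat.sq_mul_squarefree_of_pos hq.pos
  have hs1 : s ≠ 1 := by
    rintro rfl; exact hns ⟨r, by ring⟩
  have hrodd : Odd r := by
    have := (Nat.odd_mul.1 hq).1
    exact (Nat.odd_pow_iff two_ne_zero).1 this
  have hsodd := (Nat.odd_mul.1 hq).2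
  -- detect coprimality to `r` by a Möbius sum over the divisors of `r`
  have hJ : ∀ b : ℕ, J(b | r ^ 2 * s) = ∑ e ∈ r.divisors,
      if e ∣ b then ArithmeticFunction.moebius e * J(b | s) else 0 := by
    intro b
    have : NeZero r := ⟨hr0.ne'⟩
    have : NeZero s := ⟨hs0.ne'⟩
    rw [jacobiSym.mul_right' _ (by positivity) hs0.ne', jacobiSym.pow_right, ← Finset.sum_filter,
      ← Finset.sum_mul]
    congr 1
    have h1 : r.divisors.filter (fun e => e ∣ b) = (b.gcd r).divisors := by
      ext e
      simp only [Finset.mem_filter, Nat.mem_divisors, Nat.dvd_gcd_iff]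
      have : b.gcd r ≠ 0 := (Nat.gcd_pos_of_pos_right _ hr0).ne'
      have := hr0.ne'
      tauto
    rw [h1, ← ArithmeticFunction.coe_mul_zeta_apply, ArithmeticFunction.moebius_mul_coe_zeta,
      ArithmeticFunction.one_apply]
    split_ifs with h
    · exact jacobiSym.sq_one (by rwa [Int.gcd_natCast_natCast])
    · rw [jacobiSym.eq_zero_iff_not_coprime.2 (by rwa [Int.gcd_natCast_natCast])]
      norm_num
  have hsum : ∑ b ∈ Finset.range B, J(b | r ^ 2 * s) = ∑ e ∈ r.divisors,
      ArithmeticFunction.moebius e * J(e | s) *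
        ∑ c ∈ Finset.range ((B + e - 1) / e), J(c | s) := by
    simp only [hJ]
    rw [Finset.sum_comm]
    refine Finset.sum_congr rfl fun e he => ?_
    rw [← Finset.sum_filter, sum_filter_dvd_range (Nat.pos_of_mem_divisors he), Finset.mul_sum]
    refine Finset.sum_congr rfl fun c _ => ?_
    push_cast
    rw [jacobiSym.mul_left]
    ring
  rw [hsum]
  push_cast
  have hL : 0 ≤ Real.sqrt s * (1 + Real.log s) := by
    have : 0 ≤ Real.log s := Real.log_natCast_nonneg s
    positivity
  have hterm : ∀ e ∈ r.divisors, |((ArithmeticFunction.moebius e : ℤ) : ℝ) * ((J(e | s) : ℤ) : ℝ) *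
      ∑ c ∈ Finset.range ((B + e - 1) / e), ((J(c | s) : ℤ) : ℝ)| ≤
      Real.sqrt s * (1 + Real.log s) := by
    intro e _
    have h1 := abs_sum_jacobi_le_of_squarefree hsodd hs hs1 ((B + e - 1) / e)
    push_cast at h1
    rw [abs_mul, abs_mul]
    have h2 : |((ArithmeticFunction.moebius e : ℤ) : ℝ)| ≤ 1 := by
      exact_mod_cast ArithmeticFunction.abs_moebius_le_one
    have h3 : |((J(e | s) : ℤ) : ℝ)| ≤ 1 := by
      rcases jacobiSym.trichotomy e s with h | h | h <;> simp [h]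
    calc _ ≤ 1 * 1 * (Real.sqrt s * (1 + Real.log s)) := by gcongr
      _ = _ := by ring
  refine (Finset.abs_sum_le_sum_abs _ _).trans ((Finset.sum_le_sum hterm).trans ?_)
  rw [Finset.sum_const, nsmul_eq_mul]
  -- each of the at most `r` divisors contributes `√s (1 + log s)`, and `r √s = √q`
  have hcard : (r.divisors.card : ℝ) ≤ r := by exact_mod_cast Nat.card_divisors_le_self r
  have hs0' : (0 : ℝ) < s := by exact_mod_cast hs0
  have hr0' : (1 : ℝ) ≤ r := by exact_mod_cast hr0
  have hlog : Real.log s ≤ Real.log ((r : ℝ) ^ 2 * s) := by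
    apply Real.log_le_log hs0'
    exact le_mul_of_one_le_left hs0'.le (one_le_pow₀ hr0')
  have hsqrt : Real.sqrt ((r : ℝ) ^ 2 * s) = r * Real.sqrt s := by
    rw [Real.sqrt_mul (by positivity), Real.sqrt_sq (by positivity)]
  have hls : 0 ≤ Real.log s := Real.log_natCast_nonneg s
  rw [hsqrt, mul_assoc]
  gcongr

/-- The even arguments form a sum of the same kind, multiplied by `(2 / q)`. -/
theorem abs_sum_odd_jacobi_le {q : ℕ} (hq : Odd q) (hns : ¬ IsSquare q) (B : ℕ) :
    |((∑ b ∈ (Finset.range B).filter Odd, J(b | q) : ℤ) : ℝ)| ≤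
      2 * (Real.sqrt q * (1 + Real.log q)) := by
  have h1 := Finset.sum_filter_add_sum_filter_not (Finset.range B) (fun b => 2 ∣ b)
    (fun b : ℕ => J(b | q))
  have h2 : (Finset.range B).filter (fun b => ¬ 2 ∣ b) = (Finset.range B).filter Odd := by
    refine Finset.filter_congr fun b _ => ?_
    rw [← even_iff_two_dvd, Nat.not_even_iff_odd]
  rw [h2, sum_filter_dvd_range two_pos] at h1
  have h3 : ∑ c ∈ Finset.range ((B + 2 - 1) / 2), J((2 * c : ℕ) | q) =
      J(2 | q) * ∑ c ∈ Finset.range ((B + 2 - 1) / 2), J(c | q) := by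
    rw [Finset.mul_sum]
    refine Finset.sum_congr rfl fun c _ => ?_
    push_cast
    rw [jacobiSym.mul_left]
  rw [h3] at h1
  have h4 := abs_sum_jacobi_le hq hns B
  have h5 := abs_sum_jacobi_le hq hns ((B + 2 - 1) / 2)
  have h6 : ∑ b ∈ (Finset.range B).filter Odd, J(b | q) = ∑ b ∈ Finset.range B, J(b | q) -
      J(2 | q) * ∑ c ∈ Finset.range ((B + 2 - 1) / 2), J(c | q) := by linarith
  rw [h6]
  push_cast at h4 h5 ⊢
  refine (abs_sub _ _).trans ?_
  rw [abs_mul, two_mul]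
  refine add_le_add h4 ?_
  refine (mul_le_of_le_one_left (abs_nonneg _) ?_).trans h5
  rcases jacobiSym.trichotomy 2 q with h | h | h <;> simp [h]

/-- The sum over odd square-free `d` is obtained by sieving by squares; for each square divisor
the better of the trivial bound and the Pólya–Vinogradov bound is used, in the form of a weighted
geometric mean. -/
theorem abs_sum_oddSquarefree_jacobi_le {q : ℕ} (hq : Odd q) (hns : ¬ IsSquare q) {y : ℝ}
    (hy : 0 ≤ y) : |((∑ d ∈ oddSquarefree y, J(d | q) : ℤ) : ℝ)| ≤
      (∑' a : ℕ, (a : ℝ) ^ (-(9 / 8) : ℝ)) * (y ^ (9 / 16 : ℝ) *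
        (2 * (Real.sqrt q * (1 + Real.log q))) ^ (7 / 16 : ℝ)) := by
  classical
  set Y := ⌊y⌋₊ with hY
  have hYy : (Y : ℝ) ≤ y := Nat.floor_le hy
  set Q : ℝ := 2 * (Real.sqrt q * (1 + Real.log q)) with hQ
  have hQ0 : 0 ≤ Q := by
    have : 0 ≤ Real.log q := Real.log_natCast_nonneg q
    positivity
  set S : ℕ → Finset ℕ := fun a => ((Finset.Ioc 0 Y).filter Odd).filter (fun d => a ^ 2 ∣ d) with hS
  -- Möbius sum over the square divisors `a ^ 2` of `d`
  have h1 : ∑ d ∈ oddSquarefree y, J(d | q) = ∑ a ∈ Finset.range (Y + 1),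
      ArithmeticFunction.moebius a * ∑ d ∈ S a, J(d | q) := by
    have e1 : oddSquarefree y = ((Finset.Ioc 0 Y).filter Odd).filter Squarefree := by
      rw [oddSquarefree, Finset.filter_filter]
    rw [e1, Finset.sum_filter]
    simp only [hS, Finset.mul_sum]
    have e2 : ∀ a ∈ Finset.range (Y + 1), ∑ d ∈ ((Finset.Ioc 0 Y).filter Odd).filter
        (fun d => a ^ 2 ∣ d), ArithmeticFunction.moebius a * J(d | q) =
        ∑ d ∈ (Finset.Ioc 0 Y).filter Odd,
          if a ^ 2 ∣ d then ArithmeticFunction.moebius a * J(d | q) else 0 :=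
      fun a _ => Finset.sum_filter _ _
    rw [Finset.sum_congr rfl e2, Finset.sum_comm]
    refine Finset.sum_congr rfl fun d hd => ?_
    have hd' := Finset.mem_Ioc.1 (Finset.mem_filter.1 hd).1
    rw [← Finset.sum_filter, ← Finset.sum_mul, sum_moebius_sq_dvd hd'.1 (by omega)]
    split_ifs <;> simp
  -- an even `a` contributes nothing, since `d` is odd
  have h2 : ∀ a ∈ Finset.range (Y + 1), |((ArithmeticFunction.moebius a *
      ∑ d ∈ S a, J(d | q) : ℤ) : ℝ)| ≤ (a : ℝ) ^ (-(9 / 8) : ℝ) * (y ^ (9 / 16 : ℝ) *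
        Q ^ (7 / 16 : ℝ)) := by
    intro a _
    rcases Nat.eq_zero_or_pos a with rfl | ha
    · simp
    by_cases hao : Odd a
    · have himg : S a = ((Finset.range (Y / a ^ 2 + 1)).filter Odd).image (fun b => a ^ 2 * b) := by
        ext d
        simp only [hS, Finset.mem_filter, Finset.mem_Ioc, Finset.mem_image, Finset.mem_range]
        constructor
        · rintro ⟨⟨⟨h1, h2⟩, h3⟩, b, rfl⟩
          refine ⟨b, ⟨?_, (Nat.odd_mul.1 h3).2⟩, rfl⟩
          rw [Nat.lt_succ_iff, Nat.le_div_iff_mul_le (by positivity)]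
          linarith
        · rintro ⟨b, ⟨h1, h2⟩, rfl⟩
          rw [Nat.lt_succ_iff, Nat.le_div_iff_mul_le (by positivity)] at h1
          have := h2.pos
          exact ⟨⟨⟨by positivity, by linarith⟩, (hao.pow).mul h2⟩, dvd_mul_right _ _⟩
      have hsum : ∑ d ∈ S a, J(d | q) = J(a | q) ^ 2 *
          ∑ b ∈ (Finset.range (Y / a ^ 2 + 1)).filter Odd, J(b | q) := by
        rw [himg, Finset.sum_image (fun x _ y _ h =>
          Nat.eq_of_mul_eq_mul_left (by positivity : 0 < a ^ 2) h), Finset.mul_sum]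
        refine Finset.sum_congr rfl fun b _ => ?_
        push_cast
        rw [jacobiSym.mul_left, jacobiSym.pow_left]
      have hb1 : |((ArithmeticFunction.moebius a * ∑ d ∈ S a, J(d | q) : ℤ) : ℝ)| ≤
          |((∑ b ∈ (Finset.range (Y / a ^ 2 + 1)).filter Odd, J(b | q) : ℤ) : ℝ)| := by
        rw [hsum]
        have h2 : |ArithmeticFunction.moebius a| ≤ 1 := ArithmeticFunction.abs_moebius_le_one
        have h3 : |J(a | q) ^ 2| ≤ 1 := by
          rcases jacobiSym.trichotomy a q with h | h | h <;> simp [h]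
        have h4 : |ArithmeticFunction.moebius a * (J(a | q) ^ 2 *
            ∑ b ∈ (Finset.range (Y / a ^ 2 + 1)).filter Odd, J(b | q))| ≤
            |∑ b ∈ (Finset.range (Y / a ^ 2 + 1)).filter Odd, J(b | q)| := by
          rw [abs_mul, abs_mul]
          calc _ ≤ 1 * (1 * |∑ b ∈ (Finset.range (Y / a ^ 2 + 1)).filter Odd, J(b | q)|) := by
                gcongr
            _ = _ := by ring
        exact_mod_cast h4
      have hb2 := abs_sum_odd_jacobi_le hq hns (Y / a ^ 2 + 1)
      have hb3 : |((∑ b ∈ (Finset.range (Y / a ^ 2 + 1)).filter Odd, J(b | q) : ℤ) : ℝ)| ≤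
          y / a ^ 2 := by
        push_cast
        have hterm : ∀ b ∈ (Finset.range (Y / a ^ 2 + 1)).filter Odd, |((J(b | q) : ℤ) : ℝ)| ≤ 1 := by
          intro b _
          rcases jacobiSym.trichotomy b q with h | h | h <;> simp [h]
        refine (Finset.abs_sum_le_sum_abs _ _).trans ((Finset.sum_le_sum hterm).trans ?_)
        have hcard : ((Finset.range (Y / a ^ 2 + 1)).filter Odd).card ≤ Y / a ^ 2 := by
          have : (Finset.range (Y / a ^ 2 + 1)).filter Odd ⊆ Finset.Ioc 0 (Y / a ^ 2) := by
            intro b hb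
            obtain ⟨h1, h2⟩ := Finset.mem_filter.1 hb
            have := h2.pos
            exact Finset.mem_Ioc.2 ⟨this, by have := Finset.mem_range.1 h1; omega⟩
          simpa using Finset.card_le_card this
        rw [Finset.sum_const, nsmul_eq_mul, mul_one]
        calc (((Finset.range (Y / a ^ 2 + 1)).filter Odd).card : ℝ) ≤ ((Y / a ^ 2 : ℕ) : ℝ) := by
              exact_mod_cast hcard
          _ ≤ (Y : ℝ) / ((a ^ 2 : ℕ) : ℝ) := Nat.cast_div_le
          _ ≤ y / a ^ 2 := by push_cast; gcongr
      set x := |((∑ b ∈ (Finset.range (Y / a ^ 2 + 1)).filter Odd, J(b | q) : ℤ) : ℝ)| with hx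
      have hx0 : 0 ≤ x := abs_nonneg _
      -- the trivial bound `y / a²` is used for the first factor and the Pólya–Vinogradov bound for
      -- the second; as `2 * (9 / 16) > 1` the sum over `a` converges
      have hxx : x = x ^ (9 / 16 : ℝ) * x ^ (7 / 16 : ℝ) := by
        rw [← Real.rpow_add_of_nonneg hx0 (by norm_num) (by norm_num)]; norm_num
      have ha0 : (0 : ℝ) < a := by exact_mod_cast ha
      calc _ ≤ x := hb1
        _ = x ^ (9 / 16 : ℝ) * x ^ (7 / 16 : ℝ) := hxx
        _ ≤ (y / a ^ 2) ^ (9 / 16 : ℝ) * Q ^ (7 / 16 : ℝ) := by gcongr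
        _ = _ := by
          rw [Real.div_rpow hy (by positivity), ← Real.rpow_natCast, ← Real.rpow_mul ha0.le,
            Real.rpow_neg ha0.le]
          norm_num
          ring
    · have : S a = ∅ := by
        rw [Finset.eq_empty_iff_forall_notMem]
        intro d hd
        obtain ⟨h1, h2⟩ := Finset.mem_filter.1 hd
        have h3 := (Finset.mem_filter.1 h1).2
        obtain ⟨c, rfl⟩ := h2
        exact hao ((Nat.odd_pow_iff two_ne_zero).1 (Nat.odd_mul.1 h3).1)
      rw [this]
      simp
      positivity
  rw [h1, Int.cast_sum]
  refine (Finset.abs_sum_le_sum_abs _ _).trans ((Finset.sum_le_sum h2).trans ?_)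
  rw [← Finset.sum_mul]
  have hsumm : Summable fun a : ℕ => (a : ℝ) ^ (-(9 / 8) : ℝ) :=
    Real.summable_nat_rpow.2 (by norm_num)
  have := hsumm.sum_le_tsum (Finset.range (Y + 1)) (fun a _ => by positivity)
  gcongr

/-! ### Weighted character sums over the discriminants -/

/-- Abel summation against a monotone weight. -/
theorem abs_sum_range_mul_sub_le {c w : ℕ → ℝ} {B : ℝ} (hB : ∀ M, |∑ i ∈ Finset.range M, c i| ≤ B)
    (hw : Monotone w) (N : ℕ) :
    |∑ i ∈ Finset.range N, c i * w i - (∑ i ∈ Finset.range N, c i) * w N| ≤ B * (w N - w 0) := by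
  induction N with
  | zero => simp
  | succ N ih =>
    have h1 : ∑ i ∈ Finset.range (N + 1), c i * w i -
        (∑ i ∈ Finset.range (N + 1), c i) * w (N + 1) =
        (∑ i ∈ Finset.range N, c i * w i - (∑ i ∈ Finset.range N, c i) * w N) +
          (∑ i ∈ Finset.range (N + 1), c i) * (w N - w (N + 1)) := by
      simp only [Finset.sum_range_succ]
      ring
    have h2 : |(∑ i ∈ Finset.range (N + 1), c i) * (w N - w (N + 1))| ≤ B * (w (N + 1) - w N) := by
      rw [abs_mul, abs_sub_comm, abs_of_nonneg (sub_nonneg.2 (hw (Nat.le_succ N)))]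
      exact mul_le_mul_of_nonneg_right (hB _) (sub_nonneg.2 (hw (Nat.le_succ N)))
    rw [h1]
    refine (abs_add_le _ _).trans ((add_le_add ih h2).trans (le_of_eq ?_))
    ring

/-- Partial summation against a nonnegative nondecreasing weight, for sums over `1 ≤ i ≤ N`. -/
theorem abs_sum_Ioc_mul_le {c w : ℕ → ℝ} {B : ℝ} {N : ℕ} (hN : 0 < N)
    (hB : ∀ M ≤ N, |∑ i ∈ Finset.Ioc 0 M, c i| ≤ B)
    (hw0 : ∀ i, 0 < i → 0 ≤ w i) (hw : ∀ i j, 0 < i → i ≤ j → w i ≤ w j) :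
    |∑ i ∈ Finset.Ioc 0 N, c i * w i| ≤ 2 * B * w N := by
  have key : ∀ (f : ℕ → ℝ) (M : ℕ), ∑ i ∈ Finset.Ioc 0 M, f i =
      ∑ i ∈ Finset.range M, f (i + 1) := by
    intro f M
    rw [Finset.range_eq_Ico, Finset.sum_Ico_add' f 0 M 1]
    rfl
  have hB0 : 0 ≤ B := (abs_nonneg _).trans (hB 0 (Nat.zero_le _))
  -- shift to `range N` and extend the weight by the constant `w N`, so that it is monotone on `ℕ`
  set c' : ℕ → ℝ := fun i => if i < N then c (i + 1) else 0 with hc'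
  set w' : ℕ → ℝ := fun i => if i < N then w (i + 1) else w N with hw'
  have e1 : ∀ M, M ≤ N → ∑ i ∈ Finset.range M, c' i = ∑ i ∈ Finset.Ioc 0 M, c i := by
    intro M hM
    rw [key]
    refine Finset.sum_congr rfl fun i hi => ?_
    have := Finset.mem_range.1 hi
    simp [hc', show i < N by omega]
  have hB' : ∀ M, |∑ i ∈ Finset.range M, c' i| ≤ B := by
    intro M
    rcases le_total M N with h | h
    · rw [e1 M h]; exact hB M h
    · have : ∑ i ∈ Finset.range M, c' i = ∑ i ∈ Finset.range N, c' i := by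
        symm
        refine Finset.sum_subset (Finset.range_mono h) fun i _ hi => ?_
        simp only [Finset.mem_range] at hi
        simp [hc', hi]
      rw [this, e1 N le_rfl]; exact hB N le_rfl
  have hm : Monotone w' := by
    intro i j hij
    simp only [hw']
    split_ifs with h1 h2 h2
    · exact hw _ _ (by omega) (by omega)
    · exact hw _ _ (by omega) (by omega)
    · omega
    · exact le_rfl
  have h := abs_sum_range_mul_sub_le hB' hm N
  have e2 : ∑ i ∈ Finset.range N, c' i * w' i = ∑ i ∈ Finset.Ioc 0 N, c i * w i := by
    rw [key]
    refine Finset.sum_congr rfl fun i hi => ?_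
    have := Finset.mem_range.1 hi
    simp [hc', hw', this]
  have e3 : w' N = w N := by simp [hw']
  have e4 : 0 ≤ w' 0 := by simp only [hw']; split_ifs; exacts [hw0 _ (by omega)]
  rw [e2, e3, e1 N le_rfl] at h
  have h5 : |(∑ i ∈ Finset.Ioc 0 N, c i) * w N| ≤ B * w N := by
    rw [abs_mul, abs_of_nonneg (hw0 N hN)]
    exact mul_le_mul_of_nonneg_right (hB N le_rfl) (hw0 N hN)
  have h6 : B * (w N - w' 0) ≤ B * w N := by gcongr; linarith
  have h7 := abs_sub_abs_le_abs_sub (∑ i ∈ Finset.Ioc 0 N, c i * w i)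
    ((∑ i ∈ Finset.Ioc 0 N, c i) * w N)
  linarith

theorem chiZ_mul (d m n : ℕ) : chiZ d (m * n) = chiZ d m * chiZ d n := by
  unfold chiZ
  by_cases hm : Odd m
  · by_cases hn : Odd n
    · have : NeZero m := ⟨hm.pos.ne'⟩
      have : NeZero n := ⟨hn.pos.ne'⟩
      simp [hm, hn, hm.mul hn, jacobiSym.mul_right]
    · have : ¬ Odd (m * n) := by rw [Nat.odd_mul]; tauto
      simp [this, hn]
  · have : ¬ Odd (m * n) := by rw [Nat.odd_mul]; tauto
    simp [this, hm]

theorem chiZ_of_odd (d : ℕ) {n : ℕ} (hn : Odd n) : chiZ d n = J(8 | n) * J(d | n) := by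
  simp [chiZ, hn, jacobiSym.mul_left]

theorem abs_jacobiSym_le_one (a : ℤ) (n : ℕ) : |((J(a | n) : ℤ) : ℝ)| ≤ 1 := by
  rcases jacobiSym.trichotomy a n with h | h | h <;> simp [h]

theorem gammaWeight_div_sqrt_mono {n : ℕ} {i j : ℕ} (hi : 0 < i) (hij : i ≤ j) :
    gammaWeight (n / Real.sqrt (8 * i)) ≤ gammaWeight (n / Real.sqrt (8 * j)) := by
  have h1 : (0 : ℝ) < i := by exact_mod_cast hi
  have h2 : (i : ℝ) ≤ j := by exact_mod_cast hij
  refine gammaWeight_antitoneOn ?_ ?_ ?_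
  · exact Set.mem_Ici.2 (by positivity)
  · exact Set.mem_Ici.2 (by positivity)
  · gcongr

/-- The Pólya–Vinogradov bound as a power of `q`. -/
theorem exists_sqrt_mul_one_add_log_le {ε : ℝ} (hε : 0 < ε) : ∃ C : ℝ, 0 < C ∧ ∀ q : ℕ, 0 < q →
    Real.sqrt q * (1 + Real.log q) ≤ C * (q : ℝ) ^ (1 / 2 + ε) := by
  refine ⟨1 + 1 / ε, by positivity, fun q hq => ?_⟩
  have hq1 : (1 : ℝ) ≤ q := by exact_mod_cast hq
  have h1 : Real.log q ≤ (q : ℝ) ^ ε / ε := Real.log_le_rpow_div (by positivity) hε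
  have h2 : 1 ≤ (q : ℝ) ^ ε := Real.one_le_rpow hq1 hε.le
  rw [Real.rpow_add (by positivity), ← Real.sqrt_eq_rpow]
  have : 1 + Real.log q ≤ (1 + 1 / ε) * (q : ℝ) ^ ε := by
    have : (1 + 1 / ε) * (q : ℝ) ^ ε = (q : ℝ) ^ ε + (q : ℝ) ^ ε / ε := by ring
    linarith
  calc _ ≤ Real.sqrt q * ((1 + 1 / ε) * (q : ℝ) ^ ε) := by gcongr
    _ = _ := by ring

/-- Cancellation over all `d ≤ N`, with a nondecreasing weight, away from squares. -/
theorem exists_abs_sum_chiZ_mul_le {ε : ℝ} (hε : 0 < ε) : ∃ C : ℝ, 0 < C ∧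
    ∀ (q N : ℕ), ¬ IsSquare q → 0 < N → ∀ w : ℕ → ℝ, (∀ i, 0 < i → 0 ≤ w i) →
      (∀ i j, 0 < i → i ≤ j → w i ≤ w j) →
      |∑ d ∈ Finset.Ioc 0 N, (chiZ d q : ℝ) * w d| ≤ C * (q : ℝ) ^ (1 / 2 + ε) * w N := by
  obtain ⟨C, hC, h⟩ := exists_sqrt_mul_one_add_log_le hε
  refine ⟨2 * C, by positivity, fun q N hns hN w hw0 hw => ?_⟩
  by_cases hq : Odd q
  swap
  · simp only [chiZ, if_neg hq]
    simp only [Int.cast_zero, zero_mul, Finset.sum_const_zero, abs_zero]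
    have := hw0 N hN
    positivity
  have hq1 : q ≠ 1 := by rintro rfl; exact hns ⟨1, rfl⟩
  have := abs_sum_Ioc_mul_le (c := fun d => (chiZ d q : ℝ)) (w := w) (B := C * (q : ℝ) ^ (1 / 2 + ε))
    hN ?_ hw0 hw
  · linarith
  intro M _
  simp only [chiZ_of_odd _ hq]
  push_cast
  rw [← Finset.mul_sum, abs_mul]
  refine (mul_le_of_le_one_left (abs_nonneg _) (abs_jacobiSym_le_one _ _)).trans ?_
  have e : ∑ i ∈ Finset.Ioc 0 M, ((J((i : ℕ) | q) : ℤ) : ℝ) =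
      ((∑ i ∈ Finset.range (M + 1), J((i : ℕ) | q) : ℤ) : ℝ) := by
    rw [Finset.range_eq_Ico, Finset.sum_eq_sum_Ico_succ_bot (Nat.succ_pos M)]
    simp only [Nat.cast_zero, jacobiSym.zero_left (show 1 < q by have := hq.pos; omega), zero_add]
    push_cast
    rfl
  rw [e]
  exact (abs_sum_jacobi_le hq hns _).trans (h q hq.pos)

/-- Cancellation over odd square-free `d ≤ D`, with a nondecreasing weight, away from squares. -/
theorem exists_abs_sum_oddSquarefree_chiZ_mul_le : ∃ C : ℝ, 0 < C ∧
    ∀ (q : ℕ) (D : ℝ), ¬ IsSquare q → 1 ≤ D → ∀ w : ℕ → ℝ, (∀ i, 0 < i → 0 ≤ w i) →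
      (∀ i j, 0 < i → i ≤ j → w i ≤ w j) →
      |∑ d ∈ oddSquarefree D, (chiZ d q : ℝ) * w d| ≤
        C * D ^ (9 / 16 : ℝ) * (q : ℝ) ^ (1 / 4 : ℝ) * w ⌊D⌋₊ := by
  classical
  -- `1 / 14` is chosen so that `(1 / 2 + 1 / 14) * (7 / 16) = 1 / 4`
  obtain ⟨C, hC, h⟩ := exists_sqrt_mul_one_add_log_le (show (0 : ℝ) < 1 / 14 by norm_num)
  set A := ∑' a : ℕ, (a : ℝ) ^ (-(9 / 8) : ℝ) with hA
  have hA0 : 0 ≤ A := tsum_nonneg fun a => by positivity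
  refine ⟨2 * ((A + 1) * (2 * C) ^ (7 / 16 : ℝ)), by positivity, fun q D hns hD w hw0 hw => ?_⟩
  have hN : 0 < ⌊D⌋₊ := Nat.floor_pos.2 hD
  by_cases hq : Odd q
  swap
  · simp only [chiZ, if_neg hq]
    simp only [Int.cast_zero, zero_mul, Finset.sum_const_zero, abs_zero]
    have := hw0 _ hN
    positivity
  have e0 : ∀ (M : ℕ) (f : ℕ → ℝ), ∑ d ∈ oddSquarefree M, f d =
      ∑ d ∈ Finset.Ioc 0 M, if Odd d ∧ Squarefree d then f d else 0 := by
    intro M f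
    rw [oddSquarefree, Nat.floor_natCast, Finset.sum_filter]
  have e1 : oddSquarefree D = oddSquarefree (⌊D⌋₊ : ℝ) := by
    rw [oddSquarefree, oddSquarefree, Nat.floor_natCast]
  have := abs_sum_Ioc_mul_le (c := fun d => if Odd d ∧ Squarefree d then (chiZ d q : ℝ) else 0)
    (w := w) (B := (A + 1) * (2 * C) ^ (7 / 16 : ℝ) * D ^ (9 / 16 : ℝ) * (q : ℝ) ^ (1 / 4 : ℝ))
    hN ?_ hw0 hw
  · rw [e1, e0]
    simp only [ite_mul, zero_mul] at this
    linarith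
  intro M hM
  have hMD : (M : ℝ) ≤ D := (Nat.cast_le.2 hM).trans (Nat.floor_le (by linarith))
  rw [← e0]
  simp only [chiZ_of_odd _ hq]
  push_cast
  rw [← Finset.mul_sum, abs_mul]
  refine (mul_le_of_le_one_left (abs_nonneg _) (abs_jacobiSym_le_one _ _)).trans ?_
  have := abs_sum_oddSquarefree_jacobi_le hq hns (Nat.cast_nonneg M)
  push_cast at this
  refine this.trans ?_
  have hl : 0 ≤ Real.log q := Real.log_natCast_nonneg q
  calc _ ≤ (A + 1) * (D ^ (9 / 16 : ℝ) *
        (2 * (C * (q : ℝ) ^ (1 / 2 + 1 / 14 : ℝ))) ^ (7 / 16 : ℝ)) := by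
        have h1 := h q hq.pos
        have h2 : A ≤ A + 1 := by linarith
        have h3 : (M : ℝ) ^ (9 / 16 : ℝ) ≤ D ^ (9 / 16 : ℝ) := by gcongr
        have h4 : (2 * (Real.sqrt q * (1 + Real.log q))) ^ (7 / 16 : ℝ) ≤
            (2 * (C * (q : ℝ) ^ (1 / 2 + 1 / 14 : ℝ))) ^ (7 / 16 : ℝ) :=
          Real.rpow_le_rpow (by positivity) (by linarith) (by norm_num)
        exact mul_le_mul h2 (mul_le_mul h3 h4 (by positivity) (by positivity)) (by positivity)
          (by positivity)
    _ = _ := by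
        rw [← mul_assoc 2 C, Real.mul_rpow (by positivity) (by positivity), ← Real.rpow_mul
          (by positivity)]
        norm_num
        ring

/-- A positive proportion of the integers up to `D` is odd and square-free. -/
theorem card_oddSquarefree_ge (D : ℝ) : (⌊D⌋₊ : ℝ) / 4 ≤ (oddSquarefree D).card := by
  classical
  set N := ⌊D⌋₊ with hN
  -- an odd `d` that is not square-free is divisible by the square of an odd number
  -- `2 (k + 1) + 1 ≥ 3`
  have hsub : (Finset.Ioc 0 N).filter Odd ⊆ oddSquarefree D ∪
      (Finset.range N).biUnion (fun k => (Finset.Ioc 0 N).filter (fun d => (2 * (k + 1) + 1) ^ 2 ∣ d)) := by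
    intro d hd
    obtain ⟨h1, h2⟩ := Finset.mem_filter.1 hd
    rw [Finset.mem_union]
    by_cases h : Squarefree d
    · left
      simp only [oddSquarefree, Finset.mem_filter]
      exact ⟨h1, h2, h⟩
    right
    rw [Nat.squarefree_iff_prime_squarefree] at h
    push Not at h
    obtain ⟨p, hp, hpd⟩ := h
    have hpo : Odd p := by
      obtain ⟨c, rfl⟩ := hpd
      rw [Nat.odd_mul, Nat.odd_mul] at h2
      exact h2.1.1
    obtain ⟨k, rfl⟩ := hpo
    have hk : k ≠ 0 := by rintro rfl; exact hp.ne_one rfl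
    obtain ⟨k, rfl⟩ := Nat.exists_eq_succ_of_ne_zero hk
    have hd' := Finset.mem_Ioc.1 h1
    have := Nat.le_of_dvd hd'.1 hpd
    simp only [Finset.mem_biUnion, Finset.mem_range, Finset.mem_filter]
    refine ⟨k, ?_, h1, by rw [sq]; exact hpd⟩
    simp only [Nat.succ_eq_add_one] at this
    nlinarith
  have h1 := (Finset.card_le_card hsub).trans ((Finset.card_union_le _ _).trans
    (Nat.add_le_add_left Finset.card_biUnion_le _))
  have h2 : (N : ℝ) / 2 ≤ ((Finset.Ioc 0 N).filter Odd).card := by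
    have : ∀ M : ℕ, M ≤ 2 * ((Finset.Ioc 0 M).filter Odd).card ∧
        (Odd M → M + 1 ≤ 2 * ((Finset.Ioc 0 M).filter Odd).card) := by
      intro M
      induction M with
      | zero => simp
      | succ M ih =>
        have e : Finset.Ioc 0 (M + 1) = insert (M + 1) (Finset.Ioc 0 M) := by
          ext x; simp only [Finset.mem_Ioc, Finset.mem_insert]; omega
        rw [e, Finset.filter_insert]
        split_ifs with ho
        · rw [Finset.card_insert_of_notMem (by simp)]
          constructor
          · omega
          · intro; omega
        · have hM : Odd M := by
            rw [Nat.not_odd_iff_even] at ho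
            by_contra hcon
            rw [Nat.not_odd_iff_even] at hcon
            exact (Nat.not_odd_iff_even.2 ho) hcon.add_one
          have := ih.2 hM
          exact ⟨by omega, fun h => absurd h ho⟩
    have := (this N).1
    have h3 : (N : ℝ) ≤ 2 * ((Finset.Ioc 0 N).filter Odd).card := by exact_mod_cast this
    linarith
  -- `1 / (2 (k + 1) + 1)²` is at most `1 / (4 (k + 1) (k + 2))`, and these sum to `1 / 4` by
  -- telescoping; half of the integers being odd, a quarter of them remains
  have h3 : ∀ M : ℕ, ((∑ k ∈ Finset.range M,
      ((Finset.Ioc 0 N).filter (fun d => (2 * (k + 1) + 1) ^ 2 ∣ d)).card : ℕ) : ℝ) ≤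
      N / 4 * (1 - 1 / (M + 1)) := by
    intro M
    induction M with
    | zero => simp
    | succ M ih =>
      rw [Finset.sum_range_succ]
      push_cast at ih ⊢
      have h4 : (((Finset.Ioc 0 N).filter (fun d => (2 * (M + 1) + 1) ^ 2 ∣ d)).card : ℝ) ≤
          N / ((2 * (M + 1) + 1) ^ 2 : ℝ) := by
        rw [Nat.Ioc_filter_dvd_card_eq_div]
        refine Nat.cast_div_le.trans (le_of_eq ?_)
        push_cast
        ring
      have h5 : (N : ℝ) / ((2 * (M + 1) + 1) ^ 2 : ℝ) ≤ N / 4 * (1 / ((M + 1) * (M + 1 + 1))) := by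
        rw [div_mul_div_comm, mul_one]
        gcongr
        nlinarith
      have h6 : (1 : ℝ) / ((M + 1) * (M + 1 + 1)) = 1 / (M + 1) - 1 / (M + 1 + 1) := by
        field_simp
        ring
      rw [h6] at h5
      nlinarith
  have h7 := h3 N
  have h8 : (N : ℝ) / 4 * (1 - 1 / (N + 1)) ≤ N / 4 := by
    apply mul_le_of_le_one_right (by positivity)
    have : (0 : ℝ) ≤ 1 / (N + 1) := by positivity
    linarith
  have h9 : (((Finset.Ioc 0 N).filter Odd).card : ℝ) ≤ (oddSquarefree D).card +
      ((∑ k ∈ Finset.range N,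
      ((Finset.Ioc 0 N).filter (fun d => (2 * (k + 1) + 1) ^ 2 ∣ d)).card : ℕ) : ℝ) := by
    exact_mod_cast h1
  linarith

/-! ### The first and second moments of the approximating sums -/

/-- Half of the approximate functional equation: the smoothed sum whose double is the central
value. -/
noncomputable def smoothSum (d : ℕ) : ℝ :=
  ∑' n : ℕ, (chiZ d n : ℝ) * ((n : ℝ) ^ (-(1 / 2) : ℝ) * gammaWeight (n / Real.sqrt (8 * d)))

/-- The condition `b ≠ 0` makes the term at `n = 0` vanish. -/
theorem exists_tsum_rpow_mul_gammaWeight_le {b ε : ℝ} (hb0 : b ≠ 0) (hb : b ≤ 1) (hε : 0 < ε) :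
    ∃ C : ℝ, 0 < C ∧ ∀ Y : ℝ, 0 < Y →
      (Summable fun n : ℕ => (n : ℝ) ^ (-b) * gammaWeight (n / Y)) ∧
      ∑' n : ℕ, (n : ℝ) ^ (-b) * gammaWeight (n / Y) ≤ C * Y ^ (1 - b + ε) := by
  obtain ⟨C, hC, h⟩ := exists_rpow_mul_gammaWeight_le b ε hb hε
  have hs : Summable fun n : ℕ => (n : ℝ) ^ (-(1 + ε)) := Real.summable_nat_rpow.2 (by linarith)
  set A := ∑' n : ℕ, (n : ℝ) ^ (-(1 + ε)) with hA
  have hA0 : 0 ≤ A := tsum_nonneg fun n => by positivity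
  refine ⟨C * (A + 1), by positivity, fun Y hY => ?_⟩
  have hle : ∀ n : ℕ, (n : ℝ) ^ (-b) * gammaWeight (n / Y) ≤
      C * Y ^ (1 - b + ε) * (n : ℝ) ^ (-(1 + ε)) := by
    intro n
    rcases Nat.eq_zero_or_pos n with rfl | hn
    · rw [Nat.cast_zero, Real.zero_rpow (neg_ne_zero.2 hb0), zero_mul]
      positivity
    · exact h Y hY n (by exact_mod_cast hn)
  have hnn : ∀ n : ℕ, 0 ≤ (n : ℝ) ^ (-b) * gammaWeight (n / Y) := fun n =>
    mul_nonneg (by positivity) (gammaWeight_nonneg _)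
  have hs2 := Summable.of_nonneg_of_le hnn hle (hs.mul_left _)
  refine ⟨hs2, (hs2.tsum_le_tsum hle (hs.mul_left _)).trans ?_⟩
  rw [tsum_mul_left]
  have : C * Y ^ (1 - b + ε) * A ≤ C * Y ^ (1 - b + ε) * (A + 1) := by gcongr; linarith
  linarith

theorem exists_eq_mul_sq_of_isSquare_mul {m n : ℕ} (hm : m ≠ 0)
    (h : IsSquare (m * n)) : ∃ g a b : ℕ, m = g * a ^ 2 ∧ n = g * b ^ 2 := by
  have hg : 0 < m.gcd n := Nat.gcd_pos_of_pos_left _ (Nat.pos_of_ne_zero hm)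
  obtain ⟨m', n', hco, hm', hn'⟩ := Nat.exists_coprime m n
  obtain ⟨k, hk⟩ := h
  set g := m.gcd n
  have h1 : g ^ 2 ∣ k ^ 2 := ⟨m' * n', by rw [sq k, ← hk, hm', hn']; ring⟩
  obtain ⟨k', rfl⟩ := (Nat.pow_dvd_pow_iff two_ne_zero).1 h1
  have h2 : m' * n' = k' ^ 2 := by
    have : g ^ 2 * (m' * n') = g ^ 2 * k' ^ 2 := by
      calc _ = m * n := by rw [hm', hn']; ring
        _ = _ := by rw [hk]; ring
    exact Nat.eq_of_mul_eq_mul_left (by positivity) this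
  obtain ⟨a, ha⟩ := exists_associated_pow_of_mul_eq_pow
    (Nat.isUnit_iff.2 hco) h2
  obtain ⟨b, hb⟩ := exists_associated_pow_of_mul_eq_pow
    (Nat.isUnit_iff.2 hco.symm)
    ((mul_comm _ _).trans h2)
  rw [associated_iff_eq] at ha hb
  exact ⟨g, a, b, by rw [ha]; rw [mul_comm]; exact hm', by rw [hb]; rw [mul_comm]; exact hn'⟩

open scoped Classical in
/-- Since `m * n` is a square exactly when `m = g a²` and `n = g b²` for some `g`, `a`, `b`, the sum
is dominated by the triple sum of `(g a b) ^ (-(1 + 2ε))`. -/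
theorem summable_isSquare_mul {ε : ℝ} (hε : 0 < ε) : Summable fun p : ℕ × ℕ =>
    if IsSquare (p.1 * p.2) ∧ p.1 ≠ 0 ∧ p.2 ≠ 0 then ((p.1 : ℝ) * p.2) ^ (-(1 / 2 + ε)) else 0 := by
  set T : Set (ℕ × ℕ) := {p | IsSquare (p.1 * p.2) ∧ p.1 ≠ 0 ∧ p.2 ≠ 0} with hT
  have hs : Summable fun n : ℕ => (n : ℝ) ^ (-(1 + 2 * ε)) :=
    Real.summable_nat_rpow.2 (by linarith)
  have hs2 := hs.mul_of_nonneg hs (fun n => by positivity) (fun n => by positivity)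
  have hs3 := hs.mul_of_nonneg hs2 (fun n => by positivity)
    (fun n => by simp only [Pi.zero_apply]; positivity)
  have hex : ∀ p : T, ∃ t : ℕ × ℕ × ℕ, p.1.1 = t.1 * t.2.1 ^ 2 ∧ p.1.2 = t.1 * t.2.2 ^ 2 := by
    rintro ⟨p, hp⟩
    obtain ⟨g, a, b, h1, h2⟩ := exists_eq_mul_sq_of_isSquare_mul hp.2.1 hp.1
    exact ⟨(g, a, b), h1, h2⟩
  choose s hs_1 hs_2 using hex
  have hinj : Function.Injective s := by
    intro p q hpq
    ext
    · rw [hs_1, hs_1, hpq]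
    · rw [hs_2, hs_2, hpq]
  have h4 := hs3.comp_injective hinj
  have h5 : Summable fun p : T => ((p.1.1 : ℝ) * p.1.2) ^ (-(1 / 2 + ε)) := by
    refine h4.congr fun p => ?_
    simp only [Function.comp]
    rw [hs_1 p, hs_2 p]
    push_cast
    rw [← Real.mul_rpow (by positivity) (by positivity), ← Real.mul_rpow (by positivity)
      (by positivity)]
    rw [show -(1 + 2 * ε) = (2 : ℝ) * (-(1 / 2 + ε)) by ring, Real.rpow_mul (by positivity)]
    congr 1
    norm_cast
    ring
  have h6 := (summable_subtype_iff_indicator (f := fun p : ℕ × ℕ =>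
    ((p.1 : ℝ) * p.2) ^ (-(1 / 2 + ε))) (s := T)).1 h5
  refine h6.congr fun p => ?_
  simp only [Set.indicator_apply, hT, Set.mem_ofPred_eq]

theorem summable_smoothSum {d : ℕ} (hd : 0 < d) : Summable fun n : ℕ =>
    ‖(chiZ d n : ℝ) * ((n : ℝ) ^ (-(1 / 2) : ℝ) * gammaWeight (n / Real.sqrt (8 * d)))‖ := by
  have hY : 0 < Real.sqrt (8 * d) := by positivity
  refine Summable.of_nonneg_of_le (fun _ => norm_nonneg _) (fun n => ?_) (summable_gammaWeight hY)
  rw [norm_mul, Real.norm_eq_abs, Real.norm_of_nonneg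
    (mul_nonneg (by positivity) (gammaWeight_nonneg _))]
  exact mul_le_of_le_one_left (mul_nonneg (by positivity) (gammaWeight_nonneg _))
    (by exact_mod_cast abs_chiZ_le_one d n)

/-- The second moment over all discriminants, of size `N` up to an arbitrarily small power. -/
theorem exists_sum_sq_smoothSum_le {ε : ℝ} (hε : 0 < ε) : ∃ C : ℝ, 0 < C ∧ ∀ N : ℕ, 0 < N →
    ∑ d ∈ Finset.Ioc 0 N, smoothSum d ^ 2 ≤ C * (N : ℝ) ^ (1 + 2 * ε) := by
  classical
  obtain ⟨C₁, hC₁, h₁⟩ := exists_abs_sum_chiZ_mul_le hε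
  obtain ⟨C₂, hC₂, h₂⟩ := exists_tsum_rpow_mul_gammaWeight_le (b := -ε) (ε := ε)
    (by linarith) (by linarith) hε
  obtain ⟨C₃, hC₃, h₃⟩ := exists_gammaWeight_le_rpow ε hε
  have hF := summable_isSquare_mul hε
  set F : ℕ × ℕ → ℝ := fun p =>
    if IsSquare (p.1 * p.2) ∧ p.1 ≠ 0 ∧ p.2 ≠ 0 then ((p.1 : ℝ) * p.2) ^ (-(1 / 2 + ε)) else 0
    with hFdef
  have hF0 : ∀ p, 0 ≤ F p := fun p => by
    simp only [hFdef]; split_ifs <;> positivity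
  set A := ∑' p, F p with hA
  have hA0 : 0 ≤ A := tsum_nonneg hF0
  refine ⟨C₁ * C₂ ^ 2 * 8 ^ (1 + 2 * ε) + C₃ ^ 2 * 8 ^ ε * A, by positivity, fun N hN => ?_⟩
  have hN' : (0 : ℝ) < N := by exact_mod_cast hN
  set Y := Real.sqrt (8 * N) with hYdef
  have hY : 0 < Y := by positivity
  set a : ℕ → ℕ → ℝ := fun d n =>
    (chiZ d n : ℝ) * ((n : ℝ) ^ (-(1 / 2) : ℝ) * gammaWeight (n / Real.sqrt (8 * d))) with ha
  have hsum : ∀ d ∈ Finset.Ioc 0 N, Summable fun p : ℕ × ℕ => a d p.1 * a d p.2 := by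
    intro d hd
    exact summable_mul_of_summable_norm (summable_smoothSum (Finset.mem_Ioc.1 hd).1)
      (summable_smoothSum (Finset.mem_Ioc.1 hd).1)
  have e1 : ∑ d ∈ Finset.Ioc 0 N, smoothSum d ^ 2 =
      ∑' p : ℕ × ℕ, ∑ d ∈ Finset.Ioc 0 N, a d p.1 * a d p.2 := by
    rw [Summable.tsum_finsetSum hsum]
    refine Finset.sum_congr rfl fun d hd => ?_
    rw [sq, smoothSum, tsum_mul_tsum_of_summable_norm (summable_smoothSum (Finset.mem_Ioc.1 hd).1)
      (summable_smoothSum (Finset.mem_Ioc.1 hd).1)]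
  obtain ⟨hs, hsle⟩ := h₂ Y hY
  rw [neg_neg] at hs hsle
  set u : ℕ → ℝ := fun n => (n : ℝ) ^ ε * gammaWeight (n / Y) with hu
  have hu0 : ∀ n, 0 ≤ u n := fun n => mul_nonneg (by positivity) (gammaWeight_nonneg _)
  have huu : Summable fun p : ℕ × ℕ => u p.1 * u p.2 := hs.mul_of_nonneg hs hu0 hu0
  -- if `m * n` is a square, estimate the sum over `d` trivially; otherwise the character sum over
  -- `d` shows cancellation
  have hbound : ∀ p : ℕ × ℕ, ∑ d ∈ Finset.Ioc 0 N, a d p.1 * a d p.2 ≤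
      C₁ * (u p.1 * u p.2) + N * (C₃ ^ 2 * Y ^ (2 * ε)) * F p := by
    rintro ⟨m, n⟩
    have hR0 : 0 ≤ C₁ * (u m * u n) := mul_nonneg hC₁.le (mul_nonneg (hu0 m) (hu0 n))
    have hR1 : 0 ≤ N * (C₃ ^ 2 * Y ^ (2 * ε)) * F (m, n) := mul_nonneg (by positivity) (hF0 _)
    rcases Nat.eq_zero_or_pos m with rfl | hm
    · simp only [ha, chiZ_zero, Int.cast_zero, zero_mul, Finset.sum_const_zero]
      exact add_nonneg hR0 hR1
    rcases Nat.eq_zero_or_pos n with rfl | hn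
    · simp only [ha, chiZ_zero, Int.cast_zero, zero_mul, mul_zero, Finset.sum_const_zero]
      exact add_nonneg hR0 hR1
    have hm' : (0 : ℝ) < m := by exact_mod_cast hm
    have hn' : (0 : ℝ) < n := by exact_mod_cast hn
    set w : ℕ → ℝ := fun d => gammaWeight (m / Real.sqrt (8 * d)) *
      gammaWeight (n / Real.sqrt (8 * d)) with hw
    have hw0 : ∀ i, 0 < i → 0 ≤ w i := fun i _ =>
      mul_nonneg (gammaWeight_nonneg _) (gammaWeight_nonneg _)
    have hwm : ∀ i j, 0 < i → i ≤ j → w i ≤ w j := fun i j hi hij =>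
      mul_le_mul (gammaWeight_div_sqrt_mono hi hij) (gammaWeight_div_sqrt_mono hi hij)
        (gammaWeight_nonneg _) (gammaWeight_nonneg _)
    have e2 : ∑ d ∈ Finset.Ioc 0 N, a d m * a d n =
        ((m : ℝ) * n) ^ (-(1 / 2) : ℝ) * ∑ d ∈ Finset.Ioc 0 N, (chiZ d (m * n) : ℝ) * w d := by
      rw [Finset.mul_sum]
      refine Finset.sum_congr rfl fun d _ => ?_
      simp only [ha, hw]
      rw [chiZ_mul, Real.mul_rpow hm'.le hn'.le]
      push_cast
      ring
    change ∑ d ∈ Finset.Ioc 0 N, a d m * a d n ≤ _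
    rw [e2]
    have hwN : w N = gammaWeight (m / Y) * gammaWeight (n / Y) := rfl
    by_cases hsq : IsSquare (m * n)
    · refine le_trans ?_ (le_add_of_nonneg_left hR0)
      have hFe : F (m, n) = ((m : ℝ) * n) ^ (-(1 / 2 + ε)) := by
        simp only [hFdef]
        rw [if_pos ⟨hsq, hm.ne', hn.ne'⟩]
      have h7 : ∑ d ∈ Finset.Ioc 0 N, (chiZ d (m * n) : ℝ) * w d ≤ N * w N := by
        calc _ ≤ ∑ d ∈ Finset.Ioc 0 N, w N := by
              refine Finset.sum_le_sum fun d hd => ?_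
              have hd' := Finset.mem_Ioc.1 hd
              refine le_trans ?_ (hwm d N hd'.1 hd'.2)
              refine mul_le_of_le_one_left (hw0 d hd'.1) ?_
              exact (le_abs_self _).trans (by exact_mod_cast abs_chiZ_le_one d (m * n))
          _ = _ := by simp
      have h8 : w N ≤ C₃ ^ 2 * Y ^ (2 * ε) * ((m : ℝ) * n) ^ (-ε) := by
        rw [hwN]
        have h9 : ∀ k : ℝ, 0 < k → gammaWeight (k / Y) ≤ C₃ * (Y ^ ε * k ^ (-ε)) := by
          intro k hk
          refine (h₃ (k / Y) (by positivity)).trans (le_of_eq ?_)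
          rw [Real.div_rpow hk.le hY.le, Real.rpow_neg hY.le, div_inv_eq_mul]
          ring
        calc _ ≤ (C₃ * (Y ^ ε * (m : ℝ) ^ (-ε))) * (C₃ * (Y ^ ε * (n : ℝ) ^ (-ε))) :=
              mul_le_mul (h9 m hm') (h9 n hn') (gammaWeight_nonneg _) (by positivity)
          _ = _ := by
              rw [Real.mul_rpow hm'.le hn'.le, two_mul ε, Real.rpow_add hY]
              ring
      rw [hFe]
      calc _ ≤ ((m : ℝ) * n) ^ (-(1 / 2) : ℝ) * (N * (C₃ ^ 2 * Y ^ (2 * ε) *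
            ((m : ℝ) * n) ^ (-ε))) := by
            gcongr
            exact h7.trans (by gcongr)
        _ = _ := by
            rw [neg_add, Real.rpow_add (by positivity)]
            ring
    · refine le_trans ?_ (le_add_of_nonneg_right hR1)
      have h7 := (le_abs_self _).trans (h₁ (m * n) N hsq hN w hw0 hwm)
      calc _ ≤ ((m : ℝ) * n) ^ (-(1 / 2) : ℝ) * (C₁ * ((m * n : ℕ) : ℝ) ^ (1 / 2 + ε) * w N) := by
            gcongr
        _ = _ := by
            push_cast
            rw [hwN, Real.rpow_add (by positivity), Real.rpow_neg (by positivity)]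
            simp only [hu]
            have : ((m : ℝ) * n) ^ (1 / 2 : ℝ) ≠ 0 := by positivity
            rw [Real.mul_rpow (z := ε) hm'.le hn'.le]
            field_simp
  have hsumL : Summable fun p : ℕ × ℕ => ∑ d ∈ Finset.Ioc 0 N, a d p.1 * a d p.2 :=
    summable_sum hsum
  have hsumR : Summable fun p : ℕ × ℕ =>
      C₁ * (u p.1 * u p.2) + N * (C₃ ^ 2 * Y ^ (2 * ε)) * F p :=
    (huu.mul_left _).add (hF.mul_left _)
  rw [e1]
  refine (hsumL.tsum_le_tsum hbound hsumR).trans ?_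
  rw [(huu.mul_left C₁).tsum_add (hF.mul_left _), tsum_mul_left, tsum_mul_left]
  rw [← hs.tsum_mul_tsum hs huu]
  have hYpow : ∀ t : ℝ, Y ^ (2 * t) = 8 ^ t * (N : ℝ) ^ t := by
    intro t
    rw [hYdef, Real.sqrt_eq_rpow, ← Real.rpow_mul (by positivity), ← Real.mul_rpow (by positivity)
      (by positivity)]
    congr 1
    ring
  have hU : (∑' n, u n) * (∑' n, u n) ≤ C₂ ^ 2 * (8 ^ (1 + 2 * ε) * (N : ℝ) ^ (1 + 2 * ε)) := by
    rw [← hYpow]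
    have h0 : 0 ≤ ∑' n, u n := tsum_nonneg hu0
    calc _ ≤ (C₂ * Y ^ (1 - -ε + ε)) * (C₂ * Y ^ (1 - -ε + ε)) :=
          mul_le_mul hsle hsle h0 (by positivity)
      _ = _ := by
          have : Y ^ (2 * (1 + 2 * ε)) = Y ^ (1 - -ε + ε) * Y ^ (1 - -ε + ε) := by
            rw [← Real.rpow_add hY]
            ring_nf
          rw [this]
          ring
  have hN1 : (1 : ℝ) ≤ N := by exact_mod_cast hN
  have hNp : (N : ℝ) * (N : ℝ) ^ ε ≤ (N : ℝ) ^ (1 + 2 * ε) := by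
    rw [← Real.rpow_one_add' hN'.le (by linarith)]
    exact Real.rpow_le_rpow_of_exponent_le hN1 (by linarith)
  rw [hYpow]
  calc _ ≤ C₁ * (C₂ ^ 2 * (8 ^ (1 + 2 * ε) * (N : ℝ) ^ (1 + 2 * ε))) +
        C₃ ^ 2 * 8 ^ ε * A * (N * (N : ℝ) ^ ε) := by
        refine add_le_add (by gcongr) (le_of_eq ?_)
        ring
    _ ≤ C₁ * (C₂ ^ 2 * (8 ^ (1 + 2 * ε) * (N : ℝ) ^ (1 + 2 * ε))) +
        C₃ ^ 2 * 8 ^ ε * A * (N : ℝ) ^ (1 + 2 * ε) := by gcongr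
    _ = _ := by ring

/-- The first absolute moment, by Cauchy–Schwarz from the second moment. -/
theorem exists_sum_abs_smoothSum_le {ε : ℝ} (hε : 0 < ε) : ∃ C : ℝ, 0 < C ∧ ∀ D : ℝ, 1 ≤ D →
    ∑ d ∈ oddSquarefree D, |smoothSum d| ≤ C * D ^ (1 + ε) := by
  classical
  obtain ⟨C, hC, h⟩ := exists_sum_sq_smoothSum_le hε
  refine ⟨Real.sqrt C, by positivity, fun D hD => ?_⟩
  have hN : 0 < ⌊D⌋₊ := Nat.floor_pos.2 hD
  have hND : (⌊D⌋₊ : ℝ) ≤ D := Nat.floor_le (by linarith)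
  have h1 : ∑ d ∈ oddSquarefree D, |smoothSum d| ≤ ∑ d ∈ Finset.Ioc 0 ⌊D⌋₊, |smoothSum d| :=
    Finset.sum_le_sum_of_subset_of_nonneg (Finset.filter_subset _ _) fun _ _ _ => abs_nonneg _
  have h2 := sq_sum_le_card_mul_sum_sq (s := Finset.Ioc 0 ⌊D⌋₊) (f := fun d => |smoothSum d|)
  simp only [sq_abs, Nat.card_Ioc, tsub_zero] at h2
  refine h1.trans (le_of_sq_le_sq ?_ (by positivity))
  calc _ ≤ (⌊D⌋₊ : ℝ) * (C * (⌊D⌋₊ : ℝ) ^ (1 + 2 * ε)) :=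
        h2.trans (mul_le_mul_of_nonneg_left (h _ hN) (by positivity))
    _ ≤ D * (C * D ^ (1 + 2 * ε)) := by gcongr
    _ = _ := by
        have hD0 : 0 < D := by linarith
        rw [mul_pow, Real.sq_sqrt hC.le, ← Real.rpow_natCast (D ^ (1 + ε)), ← Real.rpow_mul hD0.le]
        rw [mul_left_comm, ← Real.rpow_one_add' hD0.le (by linarith)]
        push_cast
        ring_nf

open scoped Classical in
/-- The terms of the twisted first moment for which `n * l` is not a square are negligible. -/
theorem exists_abs_offDiagonal_le : ∃ C : ℝ, 0 < C ∧ ∀ (l : ℕ) (D : ℝ), 1 ≤ D →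
    |∑ d ∈ oddSquarefree D, ∑' n : ℕ, if IsSquare (n * l) then 0 else (chiZ d (n * l) : ℝ) *
      ((n : ℝ) ^ (-(1 / 2) : ℝ) * gammaWeight (n / Real.sqrt (8 * d)))| ≤
      C * D ^ (61 / 64 : ℝ) * (l : ℝ) ^ (1 / 4 : ℝ) := by
  obtain ⟨C₁, hC₁, h₁⟩ := exists_abs_sum_oddSquarefree_chiZ_mul_le
  -- `n ^ (-1/2)` and the factor `n ^ (1/4)` of the character sum combine to `n ^ (-1/4)`
  obtain ⟨C₂, hC₂, h₂⟩ := exists_tsum_rpow_mul_gammaWeight_le (b := 1 / 4) (ε := 1 / 32)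
    (by norm_num) (by norm_num) (by norm_num)
  refine ⟨C₁ * C₂ * 8 ^ (25 / 64 : ℝ), by positivity, fun l D hD => ?_⟩
  have hD0 : 0 < D := by linarith
  have hN : 0 < ⌊D⌋₊ := Nat.floor_pos.2 hD
  set Y := Real.sqrt (8 * ⌊D⌋₊) with hYdef
  have hY : 0 < Y := by positivity
  obtain ⟨hs, hsle⟩ := h₂ Y hY
  have hsum : ∀ d ∈ oddSquarefree D, Summable fun n : ℕ => if IsSquare (n * l) then 0 else
      (chiZ d (n * l) : ℝ) *
      ((n : ℝ) ^ (-(1 / 2) : ℝ) * gammaWeight (n / Real.sqrt (8 * d))) := by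
    intro d hd
    have hd0 := (Finset.mem_Ioc.1 (Finset.mem_filter.1 hd).1).1
    refine Summable.of_norm_bounded (summable_gammaWeight (show 0 < Real.sqrt (8 * d) by positivity))
      fun n => ?_
    have h0 : 0 ≤ (n : ℝ) ^ (-(1 / 2) : ℝ) * gammaWeight (n / Real.sqrt (8 * d)) :=
      mul_nonneg (by positivity) (gammaWeight_nonneg _)
    split_ifs
    · rw [norm_zero]; exact h0
    · rw [norm_mul, Real.norm_eq_abs, Real.norm_of_nonneg h0]
      exact mul_le_of_le_one_left h0 (by exact_mod_cast abs_chiZ_le_one d (n * l))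
  rw [← Summable.tsum_finsetSum hsum]
  have hb : ∀ n : ℕ, ‖∑ d ∈ oddSquarefree D, (if IsSquare (n * l) then 0 else
      (chiZ d (n * l) : ℝ) *
      ((n : ℝ) ^ (-(1 / 2) : ℝ) * gammaWeight (n / Real.sqrt (8 * d))))‖ ≤
      C₁ * D ^ (9 / 16 : ℝ) * (l : ℝ) ^ (1 / 4 : ℝ) *
        ((n : ℝ) ^ (-(1 / 4) : ℝ) * gammaWeight (n / Y)) := by
    intro n
    have hR : 0 ≤ C₁ * D ^ (9 / 16 : ℝ) * (l : ℝ) ^ (1 / 4 : ℝ) *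
        ((n : ℝ) ^ (-(1 / 4) : ℝ) * gammaWeight (n / Y)) :=
      mul_nonneg (by positivity) (mul_nonneg (by positivity) (gammaWeight_nonneg _))
    by_cases hsq : IsSquare (n * l)
    · simpa only [if_pos hsq, Finset.sum_const_zero, norm_zero] using hR
    have hn : n ≠ 0 := by rintro rfl; exact hsq ⟨0, by simp⟩
    have hn0 : (0 : ℝ) < n := by positivity
    simp only [if_neg hsq]
    have e : ∑ d ∈ oddSquarefree D, (chiZ d (n * l) : ℝ) *
        ((n : ℝ) ^ (-(1 / 2) : ℝ) * gammaWeight (n / Real.sqrt (8 * d))) =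
        (n : ℝ) ^ (-(1 / 2) : ℝ) * ∑ d ∈ oddSquarefree D, (chiZ d (n * l) : ℝ) *
          gammaWeight (n / Real.sqrt (8 * d)) := by
      rw [Finset.mul_sum]
      exact Finset.sum_congr rfl fun d _ => by ring
    rw [e, norm_mul, Real.norm_of_nonneg (by positivity), Real.norm_eq_abs]
    have h7 := h₁ (n * l) D hsq hD (fun d => gammaWeight (n / Real.sqrt (8 * d)))
      (fun _ _ => gammaWeight_nonneg _) (fun i j hi hij => gammaWeight_div_sqrt_mono hi hij)
    refine (mul_le_mul_of_nonneg_left h7 (by positivity)).trans (le_of_eq ?_)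
    push_cast
    rw [Real.mul_rpow hn0.le (by positivity),
      show (-(1 / 4) : ℝ) = -(1 / 2) + 1 / 4 by norm_num, Real.rpow_add hn0]
    ring
  refine (tsum_of_norm_bounded (hs.hasSum.mul_left _) hb).trans ?_
  -- altogether the exponent of `D` is `9 / 16 + 25 / 64 = 61 / 64`
  have hY2 : Y ^ (1 - 1 / 4 + 1 / 32 : ℝ) ≤ 8 ^ (25 / 64 : ℝ) * D ^ (25 / 64 : ℝ) := by
    rw [hYdef, Real.sqrt_eq_rpow, ← Real.rpow_mul (by positivity), ← Real.mul_rpow (by positivity)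
      (by positivity)]
    norm_num
    have : (⌊D⌋₊ : ℝ) ≤ D := Nat.floor_le (by linarith)
    gcongr
  calc _ ≤ C₁ * D ^ (9 / 16 : ℝ) * (l : ℝ) ^ (1 / 4 : ℝ) *
        (C₂ * (8 ^ (25 / 64 : ℝ) * D ^ (25 / 64 : ℝ))) := by
        gcongr
        exact hsle.trans (by gcongr)
    _ = _ := by
        rw [show (61 / 64 : ℝ) = 9 / 16 + 25 / 64 by norm_num, Real.rpow_add hD0]
        ring

/-! ### Multiplicative functions given by local data -/

/-- The multiplicative function whose value at a prime power `p ^ j` is `g p j`; it vanishes at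
`0`. The values `g p 0` should be `1`. -/
noncomputable def multFun {R : Type*} [CommMonoidWithZero R] (g : ℕ → ℕ → R) (n : ℕ) : R :=
  if n = 0 then 0 else n.factorization.prod g

section multFun

variable {R : Type*} [CommMonoidWithZero R] (g : ℕ → ℕ → R)

theorem multFun_zero : multFun g 0 = 0 := by simp [multFun]

theorem multFun_one : multFun g 1 = 1 := by simp [multFun]

theorem multFun_prime_pow (hg : ∀ p, g p 0 = 1) {p : ℕ} (hp : p.Prime) (j : ℕ) :
    multFun g (p ^ j) = g p j := by
  rw [multFun, if_neg (pow_ne_zero _ hp.ne_zero), hp.factorization_pow,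
    Finsupp.prod_single_index (hg p)]

theorem multFun_mul_of_coprime {m n : ℕ} (h : m.Coprime n) :
    multFun g (m * n) = multFun g m * multFun g n := by
  by_cases hm : m = 0
  · simp [multFun, hm]
  by_cases hn : n = 0
  · simp [multFun, hn]
  rw [multFun, multFun, multFun, if_neg hm, if_neg hn, if_neg (mul_ne_zero hm hn),
    Nat.factorization_mul_of_coprime h,
    Finsupp.prod_add_index_of_disjoint h.disjoint_primeFactors]

end multFun

/-- The Euler product of a multiplicative function supported on smooth numbers. -/
theorem summable_and_hasSum_euler {f : ℕ → ℝ} (h0 : f 0 = 0) (h1 : f 1 = 1)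
    (hmul : ∀ {m n : ℕ}, m.Coprime n → f (m * n) = f m * f n) {N : ℕ}
    (hN : ∀ p, p.Prime → N < p → ∀ j, 0 < j → f (p ^ j) = 0)
    (hsum : ∀ {p : ℕ}, p.Prime → Summable fun j => ‖f (p ^ j)‖) :
    (Summable fun n => ‖f n‖) ∧
      HasSum f (∏ p ∈ (N + 1).primesBelow, ∑' j, f (p ^ j)) := by
  have hsupp : Function.support f ⊆ (N + 1).smoothNumbers := by
    intro n hn
    by_contra hcon
    have hn0 : n ≠ 0 := by rintro rfl; exact hn h0
    rw [Nat.mem_smoothNumbers_iff_forall_le] at hcon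
    push Not at hcon
    obtain ⟨p, hpn, hp, hdvd, hlt⟩ := hcon hn0
    apply hn
    rw [← Nat.ordProj_mul_ordCompl_eq_self n p, hmul (Nat.Coprime.pow_left _
      (Nat.coprime_ordCompl hp hn0)), hN p hp (by omega) _
      (hp.factorization_pos_of_dvd hn0 hdvd), zero_mul]
  have h := EulerProduct.summable_and_hasSum_smoothNumbers_prod_primesBelow_tsum h1 hmul hsum (N + 1)
  constructor
  · have := (summable_subtype_iff_indicator (f := fun n => ‖f n‖)
      (s := (N + 1).smoothNumbers)).1 h.1
    refine this.congr fun n => ?_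
    by_cases hn : n ∈ (N + 1).smoothNumbers
    · rw [Set.indicator_of_mem hn]
    · rw [Set.indicator_of_notMem hn, Function.notMem_support.1 (fun h => hn (hsupp h)), norm_zero]
  · exact (hasSum_subtype_iff_of_support_subset hsupp).1 h.2

/-! ### The coefficients of the truncated Euler factors -/

/-- The coefficients of the power series `exp (-∑_{k=1}^K z^k / k)`, by the recursion coming from
its logarithmic derivative `-(1 + z + ⋯ + z^{K-1})`. -/
noncomputable def eulerCoeff (K : ℕ) : ℕ → ℝ
  | 0 => 1
  | j + 1 => -(∑ i : Fin (j + 1), if (i : ℕ) < K then eulerCoeff K (j - i) else 0) / (j + 1)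

theorem eulerCoeff_zero (K : ℕ) : eulerCoeff K 0 = 1 := by rw [eulerCoeff]

theorem eulerCoeff_succ (K j : ℕ) : (j + 1) * eulerCoeff K (j + 1) =
    -∑ i ∈ Finset.range (j + 1), if i < K then eulerCoeff K (j - i) else 0 := by
  rw [eulerCoeff, Fin.sum_univ_eq_sum_range (fun i => if i < K then eulerCoeff K (j - i) else 0)]
  field_simp

/-- By induction, as `a_{j+1}` is a sum of at most `j + 1` of the earlier coefficients, divided by
`-(j + 1)`. -/
theorem abs_eulerCoeff_le_one (K j : ℕ) : |eulerCoeff K j| ≤ 1 := by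
  induction j using Nat.strong_induction_on with
  | _ j ih =>
    rcases j with _ | j
    · simp [eulerCoeff_zero]
    · have h := congrArg abs (eulerCoeff_succ K j)
      rw [abs_mul, abs_neg, abs_of_nonneg (by positivity : (0 : ℝ) ≤ j + 1)] at h
      have h2 : |∑ i ∈ Finset.range (j + 1), if i < K then eulerCoeff K (j - i) else 0| ≤
          ∑ i ∈ Finset.range (j + 1), (1 : ℝ) := by
        refine (Finset.abs_sum_le_sum_abs _ _).trans (Finset.sum_le_sum fun i _ => ?_)
        split_ifs
        · exact ih _ (by omega)
        · simp
      rw [Finset.sum_const, Finset.card_range, nsmul_eq_mul, mul_one] at h2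
      push_cast at h2
      rw [← h] at h2
      exact le_of_mul_le_mul_left (by linarith) (by positivity : (0 : ℝ) < j + 1)

theorem eulerCoeff_zero_left {j : ℕ} (hj : 0 < j) : eulerCoeff 0 j = 0 := by
  obtain ⟨j, rfl⟩ := Nat.exists_eq_succ_of_ne_zero hj.ne'
  have := eulerCoeff_succ 0 j
  simp only [Nat.not_lt_zero, if_false, Finset.sum_const_zero, neg_zero] at this
  exact (mul_eq_zero.1 this).resolve_left (by positivity)

theorem eulerCoeff_one {K : ℕ} (hK : 0 < K) : eulerCoeff K 1 = -1 := by
  have := eulerCoeff_succ K 0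
  rw [zero_add, Finset.sum_range_one, if_pos hK, Nat.sub_zero, eulerCoeff_zero] at this
  simpa using this

theorem eulerCoeff_one_two : eulerCoeff 1 2 = 1 / 2 := by
  have := eulerCoeff_succ 1 1
  simp [eulerCoeff_one] at this
  linarith

/-- Up to degree `K` the series agrees with `1 - z`. -/
theorem eulerCoeff_eq_zero {K j : ℕ} (hj : 2 ≤ j) (hjK : j ≤ K) : eulerCoeff K j = 0 := by
  induction j using Nat.strong_induction_on with
  | _ j ih =>
    obtain ⟨j, rfl⟩ : ∃ i, j = i + 2 := ⟨j - 2, by omega⟩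
    have h := eulerCoeff_succ K (j + 1)
    have h2 : ∑ i ∈ Finset.range (j + 1 + 1), (if i < K then eulerCoeff K (j + 1 - i) else 0) =
        ∑ i ∈ Finset.range (j + 1 + 1), eulerCoeff K i := by
      rw [← Finset.sum_range_reflect (fun i => eulerCoeff K i) (j + 1 + 1)]
      refine Finset.sum_congr rfl fun i hi => ?_
      have := Finset.mem_range.1 hi
      rw [if_pos (by omega)]
      congr 1
    have h3 : ∑ i ∈ Finset.range (j + 1 + 1), eulerCoeff K i = 0 := by
      rw [Finset.sum_range_succ', Finset.sum_range_succ']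
      rw [Finset.sum_eq_zero fun i hi => ?_]
      · rw [eulerCoeff_zero, zero_add, eulerCoeff_one (by omega)]; ring
      · have := Finset.mem_range.1 hi
        exact ih _ (by omega) (by omega) (by omega)
    rw [h2, h3, neg_zero] at h
    exact (mul_eq_zero.1 h).resolve_left (by positivity)

theorem summable_norm_eulerCoeff_mul_pow (K : ℕ) {z : ℝ} (hz : |z| < 1) :
    Summable fun j => ‖eulerCoeff K j * z ^ j‖ := by
  refine Summable.of_nonneg_of_le (fun _ => norm_nonneg _) (fun j => ?_)
    (summable_geometric_of_lt_one (abs_nonneg z) hz)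
  rw [norm_mul, norm_pow, Real.norm_eq_abs, Real.norm_eq_abs]
  exact mul_le_of_le_one_left (by positivity) (abs_eulerCoeff_le_one K j)

/-- The power series with these coefficients is the exponential. -/
theorem tsum_eulerCoeff_mul_pow (K : ℕ) {z : ℝ} (hz : |z| < 1) :
    ∑' j, eulerCoeff K j * z ^ j = Real.exp (-∑ k ∈ Finset.range K, z ^ (k + 1) / (k + 1)) := by
  set f : ℝ → ℝ := fun x => ∑' j, eulerCoeff K j * x ^ j with hf
  obtain ⟨r, hzr, hr1⟩ := exists_between hz
  have hr0 : 0 ≤ r := (abs_nonneg z).trans hzr.le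
  -- the recursion says that the logarithmic derivative of `f` is `-∑_{k < K} x ^ k`
  have hder : ∀ x ∈ Metric.ball (0 : ℝ) r, HasDerivAt f (-(∑ k ∈ Finset.range K, x ^ k) * f x) x := by
    intro x hx
    have hx1 : |x| < 1 := by
      have : |x| < r := by simpa using hx
      linarith
    have h1 := hasDerivAt_tsum_of_isPreconnected (𝕜 := ℝ) (u := fun j : ℕ => (j : ℝ) * r ^ (j - 1))
      (g := fun j x => eulerCoeff K j * x ^ j)
      (g' := fun j x => eulerCoeff K j * (j * x ^ (j - 1))) (t := Metric.ball 0 r) (y₀ := x) (y := x)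
      ?_ Metric.isOpen_ball (convex_ball 0 r).isPreconnected ?_ ?_ hx
      (summable_norm_eulerCoeff_mul_pow K hx1).of_norm hx
    · refine h1.congr_deriv ?_
      have hsum : Summable fun j : ℕ => eulerCoeff K j * (j * x ^ (j - 1)) := by
        refine Summable.of_norm_bounded (g := fun j : ℕ => (j : ℝ) * |x| ^ (j - 1)) ?_ fun j => ?_
        · have := summable_pow_mul_geometric_of_norm_lt_one 1
            (show ‖|x|‖ < 1 by rwa [Real.norm_eq_abs, abs_abs]) (R := ℝ)
          rw [← summable_nat_add_iff 1] at this ⊢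
          by_cases hx0 : x = 0
          · refine summable_of_ne_finset_zero (s := {0}) fun j hj => ?_
            have : j ≠ 0 := by simpa using hj
            simp [hx0, this]
          · refine (this.mul_left |x|⁻¹).congr fun j => ?_
            have : |x| ≠ 0 := abs_ne_zero.2 hx0
            simp only [Nat.add_sub_cancel, pow_succ]
            field_simp
        · rw [norm_mul, norm_mul, norm_pow, Real.norm_natCast]
          exact mul_le_of_le_one_left (by positivity) (abs_eulerCoeff_le_one K j)
      rw [hsum.tsum_eq_zero_add]
      simp only [Nat.cast_zero, zero_mul, mul_zero, zero_add, Nat.add_sub_cancel]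
      set c : ℕ → ℝ := fun i => if i < K then x ^ i else 0 with hc
      have hcs : Summable fun i => ‖c i‖ := by
        refine summable_of_ne_finset_zero (s := Finset.range K) fun i hi => ?_
        simp only [Finset.mem_range] at hi
        simp [hc, hi]
      have hct : ∑' i, c i = ∑ k ∈ Finset.range K, x ^ k := by
        rw [tsum_eq_sum (s := Finset.range K) fun i hi => by
          simp only [Finset.mem_range] at hi; simp [hc, hi]]
        exact Finset.sum_congr rfl fun i hi => by simp [hc, Finset.mem_range.1 hi]
      rw [← hct, neg_mul, hf]
      simp only
      rw [tsum_mul_tsum_eq_tsum_sum_range_of_summable_norm hcs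
        (summable_norm_eulerCoeff_mul_pow K hx1), ← tsum_neg]
      refine tsum_congr fun j => ?_
      have h3 := eulerCoeff_succ K j
      push_cast
      have : eulerCoeff K (j + 1) * (((j : ℝ) + 1) * x ^ j) =
          ((j + 1) * eulerCoeff K (j + 1)) * x ^ j := by ring
      rw [this, h3, neg_mul, Finset.sum_mul]
      congr 1
      refine Finset.sum_congr rfl fun i hi => ?_
      have hij : i ≤ j := Nat.lt_succ_iff.1 (Finset.mem_range.1 hi)
      simp only [hc]
      split_ifs
      · rw [mul_left_comm, ← pow_add, Nat.add_sub_cancel' hij]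
      · simp
    · have := summable_pow_mul_geometric_of_norm_lt_one 1
        (show ‖r‖ < 1 by rwa [Real.norm_of_nonneg hr0]) (R := ℝ)
      rw [← summable_nat_add_iff 1] at this ⊢
      have hrpos : 0 < r := by
        have : |x| < r := by simpa using hx
        exact (abs_nonneg x).trans_lt this
      refine (this.mul_left r⁻¹).congr fun j => ?_
      simp only [Nat.add_sub_cancel, pow_succ]
      field_simp
    · intro j y _
      exact (hasDerivAt_pow j y).const_mul _
    · intro j y hy
      have hy' : |y| ≤ r := by
        have : |y| < r := by simpa using hy
        exact this.le
      rw [norm_mul, norm_mul, norm_pow, Real.norm_natCast, Real.norm_eq_abs, Real.norm_eq_abs]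
      exact (mul_le_of_le_one_left (by positivity) (abs_eulerCoeff_le_one K j)).trans (by gcongr)
  set P : ℝ → ℝ := fun x => ∑ k ∈ Finset.range K, x ^ (k + 1) / (k + 1) with hP
  have hPd : ∀ x, HasDerivAt P (∑ k ∈ Finset.range K, x ^ k) x := by
    intro x
    refine HasDerivAt.fun_sum fun k _ => ?_
    have := (hasDerivAt_pow (k + 1) x).div_const ((k : ℝ) + 1)
    refine this.congr_deriv ?_
    push_cast
    have : (k : ℝ) + 1 ≠ 0 := by positivity
    field_simp
  -- hence `f * exp P` has derivative zero
  have hconst : ∀ x ∈ Metric.ball (0 : ℝ) r, HasDerivAt (fun x => f x * Real.exp (P x)) 0 x := by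
    intro x hx
    refine ((hder x hx).mul (hPd x).exp).congr_deriv ?_
    ring
  have hzb : z ∈ Metric.ball (0 : ℝ) r := by simpa using hzr
  have h0b : (0 : ℝ) ∈ Metric.ball (0 : ℝ) r := by
    simpa using (abs_nonneg z).trans_lt hzr
  have hE : f z * Real.exp (P z) = f 0 * Real.exp (P 0) :=
    (convex_ball (0 : ℝ) r).is_const_of_fderivWithin_eq_zero (𝕜 := ℝ)
      (fun x hx => (hconst x hx).differentiableAt.differentiableWithinAt)
      (fun x hx => by
        have := (hconst x hx).hasFDerivAt.hasFDerivWithinAt (s := Metric.ball (0 : ℝ) r)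
        rw [this.fderivWithin (Metric.isOpen_ball.uniqueDiffWithinAt hx)]
        ext; simp) hzb h0b
  have hf0 : f 0 = 1 := by
    simp only [hf]
    rw [tsum_eq_single 0 fun j hj => by simp [hj]]
    simp [eulerCoeff_zero]
  have hP0 : P 0 = 0 := by simp [hP]
  rw [hf0, hP0, Real.exp_zero, mul_one] at hE
  rw [Real.exp_neg]
  exact eq_inv_of_mul_eq_one_left hE

/-! ### Expansion of the inverse of the truncated Euler product -/

/-- The prime powers up to `N`, arranged by primes. -/
theorem sum_isPrimePow {M : Type*} [AddCommMonoid M] (f : ℕ → M) (N : ℕ) :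
    ∑ n ∈ (Finset.Ioc 0 N).filter IsPrimePow, f n =
      ∑ p ∈ (N + 1).primesBelow, ∑ k ∈ Finset.range (Nat.log p N), f (p ^ (k + 1)) := by
  rw [Finset.sum_sigma']
  symm
  refine Finset.sum_nbij (fun x => x.1 ^ (x.2 + 1)) ?_ ?_ ?_ fun _ _ => rfl
  · rintro ⟨p, k⟩ h
    simp only [Finset.mem_sigma, Nat.mem_primesBelow, Finset.mem_range] at h
    obtain ⟨⟨hpN, hp⟩, hk⟩ := h
    simp only [Finset.mem_filter, Finset.mem_Ioc]
    refine ⟨⟨pow_pos hp.pos _, ?_⟩, hp.isPrimePow.pow (Nat.succ_ne_zero k)⟩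
    exact Nat.pow_le_of_le_log (by have := hp.pos; omega) hk
  · rintro ⟨p, k⟩ h ⟨q, m⟩ h' heq
    simp only [Finset.mem_coe, Finset.mem_sigma, Nat.mem_primesBelow, Finset.mem_range] at h h'
    obtain ⟨h1, h2⟩ := h.1.2.pow_inj h'.1.2 heq
    subst h1 h2
    rfl
  · rintro n hn
    simp only [Finset.mem_coe, Finset.mem_filter, Finset.mem_Ioc] at hn
    obtain ⟨⟨hn0, hnN⟩, hpp⟩ := hn
    obtain ⟨p, k, hp, hk, rfl⟩ := (isPrimePow_nat_iff n).1 hpp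
    obtain ⟨k, rfl⟩ := Nat.exists_eq_succ_of_ne_zero hk.ne'
    refine ⟨⟨p, k⟩, ?_, rfl⟩
    simp only [Finset.mem_coe, Finset.mem_sigma, Nat.mem_primesBelow, Finset.mem_range]
    refine ⟨⟨?_, hp⟩, Nat.le_log_of_pow_le hp.one_lt hnN⟩
    exact Nat.lt_succ_of_le ((Nat.le_self_pow (Nat.succ_ne_zero k) p).trans hnN)

/-- The multiplicative coefficients of the Dirichlet series of `P_X⁻¹`, with `N = ⌊X⌋`. -/
noncomputable def eulerInvCoeff (N : ℕ) : ℕ → ℝ :=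
  multFun fun p j => eulerCoeff (Nat.log p N) j

theorem eulerInvCoeff_prime_pow (N : ℕ) {p : ℕ} (hp : p.Prime) (j : ℕ) :
    eulerInvCoeff N (p ^ j) = eulerCoeff (Nat.log p N) j :=
  multFun_prime_pow _ (fun _ => eulerCoeff_zero _) hp j

theorem eulerInvCoeff_prime_pow_eq_zero {N p : ℕ} (hp : p.Prime) (hN : N < p) {j : ℕ}
    (hj : 0 < j) : eulerInvCoeff N (p ^ j) = 0 := by
  rw [eulerInvCoeff_prime_pow N hp, Nat.log_of_lt hN, eulerCoeff_zero_left hj]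

theorem abs_chiZ_mul_rpow_lt_one (d : ℕ) {p : ℕ} (hp : p.Prime) :
    |(chiZ d p : ℝ) * (p : ℝ) ^ (-(1 / 2) : ℝ)| < 1 := by
  have h1 : (p : ℝ) ^ (-(1 / 2) : ℝ) < 1 :=
    Real.rpow_lt_one_of_one_lt_of_neg (by exact_mod_cast hp.one_lt) (by norm_num)
  have h2 : |(chiZ d p : ℝ)| ≤ 1 := by exact_mod_cast abs_chiZ_le_one d p
  rw [abs_mul, abs_of_nonneg (by positivity : (0 : ℝ) ≤ (p : ℝ) ^ (-(1 / 2) : ℝ))]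
  exact (mul_le_of_le_one_left (by positivity) h2).trans_lt h1

theorem chiZ_pow (d n j : ℕ) : chiZ d (n ^ j) = chiZ d n ^ j := by
  induction j with
  | zero => simp [chiZ]
  | succ j ih => rw [pow_succ, chiZ_mul, ih, pow_succ]

/-- The von Mangoldt function in the exponent contributes `∑_{k ≤ K} z ^ k / k` with
`z = χ_{8d}(p) p ^ (-1/2)` for every prime `p`, where `K` is maximal with `p ^ K ≤ X`. -/
theorem eulerPart_inv_eq (X : ℝ) (d : ℕ) : (eulerPart X d)⁻¹ =
    ((∏ p ∈ (⌊X⌋₊ + 1).primesBelow,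
      ∑' j, eulerCoeff (Nat.log p ⌊X⌋₊) j * ((chiZ d p : ℝ) * (p : ℝ) ^ (-(1 / 2) : ℝ)) ^ j : ℝ) : ℂ) := by
  set N := ⌊X⌋₊ with hN
  have h1 : ∑ n ∈ Finset.Icc 2 N, ((ArithmeticFunction.vonMangoldt n /
      (Real.sqrt n * Real.log n) : ℝ) : ℂ) * chi8 d (n : ZMod (8 * d)) =
      ((∑ p ∈ (N + 1).primesBelow, ∑ k ∈ Finset.range (Nat.log p N),
        ((chiZ d p : ℝ) * (p : ℝ) ^ (-(1 / 2) : ℝ)) ^ (k + 1) / (k + 1) : ℝ) : ℂ) := by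
    have h2 : ∑ n ∈ Finset.Icc 2 N, ((ArithmeticFunction.vonMangoldt n /
        (Real.sqrt n * Real.log n) : ℝ) : ℂ) * chi8 d (n : ZMod (8 * d)) =
        ((∑ n ∈ (Finset.Ioc 0 N).filter IsPrimePow, ArithmeticFunction.vonMangoldt n /
        (Real.sqrt n * Real.log n) * (chiZ d n : ℝ) : ℝ) : ℂ) := by
      push_cast
      simp only [chi8_natCast]
      symm
      refine Finset.sum_subset_zero_on_sdiff ?_ ?_ fun _ _ => rfl
      · intro n hn
        simp only [Finset.mem_filter, Finset.mem_Ioc] at hn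
        exact Finset.mem_Icc.2 ⟨hn.2.one_lt, hn.1.2⟩
      · intro n hn
        have h3 : ¬ IsPrimePow n := by
          intro hp
          have := Finset.mem_sdiff.1 hn
          refine this.2 (Finset.mem_filter.2 ⟨Finset.mem_Ioc.2 ⟨hp.pos, ?_⟩, hp⟩)
          exact (Finset.mem_Icc.1 this.1).2
        rw [ArithmeticFunction.vonMangoldt_eq_zero_iff.2 h3]
        simp
    rw [h2, sum_isPrimePow]
    congr 1
    refine Finset.sum_congr rfl fun p hp => Finset.sum_congr rfl fun k _ => ?_
    have hp' := (Nat.mem_primesBelow.1 hp).2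
    have hp0 : (0 : ℝ) < p := by exact_mod_cast hp'.pos
    have hlog : 0 < Real.log p := Real.log_pos (by exact_mod_cast hp'.one_lt)
    rw [ArithmeticFunction.vonMangoldt_apply_pow (Nat.succ_ne_zero k),
      ArithmeticFunction.vonMangoldt_apply_prime hp', chiZ_pow]
    push_cast
    rw [Real.log_pow, mul_pow, Real.sqrt_eq_rpow, ← Real.rpow_natCast (p : ℝ) (k + 1),
      ← Real.rpow_natCast ((p : ℝ) ^ (-(1 / 2) : ℝ)), ← Real.rpow_mul hp0.le, ← Real.rpow_mul hp0.le]
    push_cast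
    rw [show (-(1 / 2) : ℝ) * (k + 1) = -(((k : ℝ) + 1) * (1 / 2)) by ring, Real.rpow_neg hp0.le]
    have : (k : ℝ) + 1 ≠ 0 := by positivity
    field_simp
  rw [eulerPart, ← hN, h1, ← Complex.exp_neg, ← Complex.ofReal_neg, ← Complex.ofReal_exp,
    ← Finset.sum_neg_distrib, Real.exp_sum]
  congr 1
  refine Finset.prod_congr rfl fun p hp => ?_
  rw [tsum_eulerCoeff_mul_pow _ (abs_chiZ_mul_rpow_lt_one d (Nat.mem_primesBelow.1 hp).2)]

/-- The Dirichlet series of `P_X⁻¹`. -/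
theorem summable_and_eulerPart_inv_eq_tsum (X : ℝ) (d : ℕ) :
    (Summable fun l => ‖eulerInvCoeff ⌊X⌋₊ l * ((chiZ d l : ℝ) * (l : ℝ) ^ (-(1 / 2) : ℝ))‖) ∧
    (eulerPart X d)⁻¹ = ((∑' l, eulerInvCoeff ⌊X⌋₊ l *
      ((chiZ d l : ℝ) * (l : ℝ) ^ (-(1 / 2) : ℝ)) : ℝ) : ℂ) := by
  set N := ⌊X⌋₊ with hN
  have hpow : ∀ {p : ℕ}, p.Prime → ∀ j : ℕ, eulerInvCoeff N (p ^ j) *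
      ((chiZ d (p ^ j) : ℝ) * ((p ^ j : ℕ) : ℝ) ^ (-(1 / 2) : ℝ)) =
      eulerCoeff (Nat.log p N) j * ((chiZ d p : ℝ) * (p : ℝ) ^ (-(1 / 2) : ℝ)) ^ j := by
    intro p hp j
    rw [eulerInvCoeff_prime_pow N hp, chiZ_pow, mul_pow]
    push_cast
    rw [← Real.rpow_natCast (p : ℝ), ← Real.rpow_natCast ((p : ℝ) ^ (-(1 / 2) : ℝ)),
      ← Real.rpow_mul (by positivity), ← Real.rpow_mul (by positivity), mul_comm (j : ℝ)]
  have h := summable_and_hasSum_euler (N := N) (f := fun l => eulerInvCoeff N l *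
    ((chiZ d l : ℝ) * (l : ℝ) ^ (-(1 / 2) : ℝ))) (by simp [chiZ_zero])
    (by simp [eulerInvCoeff, multFun_one, chiZ]) ?_ ?_ ?_
  · refine ⟨h.1, ?_⟩
    rw [h.2.tsum_eq, eulerPart_inv_eq, ← hN]
    congr 1
    refine Finset.prod_congr rfl fun p hp => ?_
    exact tsum_congr fun j => (hpow (Nat.mem_primesBelow.1 hp).2 j).symm
  · intro m n hmn
    rw [eulerInvCoeff, multFun_mul_of_coprime _ hmn, chiZ_mul]
    push_cast
    rw [Real.mul_rpow (by positivity) (by positivity)]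
    ring
  · intro p hp hlt j hj
    rw [eulerInvCoeff_prime_pow_eq_zero hp hlt hj, zero_mul]
  · intro p hp
    simp only [hpow hp]
    exact summable_norm_eulerCoeff_mul_pow _ (abs_chiZ_mul_rpow_lt_one d hp)

/-! ### Mertens' theorems -/

/-- Mertens' first theorem for the von Mangoldt function, from `log N! = ∑ Λ(n) ⌊N / n⌋`, Stirling's
bound and Chebyshev's bound for `ψ`. -/
theorem exists_abs_sum_vonMangoldt_div_sub_log_le : ∃ C : ℝ, ∀ N : ℕ, 0 < N →
    |∑ n ∈ Finset.Ioc 0 N, ArithmeticFunction.vonMangoldt n / n - Real.log N| ≤ C := by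
  refine ⟨Real.log 4 + 5, fun N hN => ?_⟩
  have hN0 : (0 : ℝ) < N := by exact_mod_cast hN
  have h1 : Real.log (N.factorial) =
      ∑ n ∈ Finset.Ioc 0 N, ArithmeticFunction.vonMangoldt n * ((N / n : ℕ) : ℝ) := by
    rw [← ArithmeticFunction.sum_Ioc_mul_zeta_eq_sum, ArithmeticFunction.vonMangoldt_mul_zeta]
    clear hN hN0
    induction N with
    | zero => simp
    | succ N ih =>
      rw [Nat.factorial_succ, Nat.cast_mul, Real.log_mul (by positivity) (by positivity), ih,
        Finset.sum_Ioc_succ_top (Nat.zero_le N), add_comm]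
      simp
  have h2 : Real.log N.factorial ≤ N * Real.log N := by
    rw [← Real.log_pow]
    exact Real.log_le_log (by positivity) (by exact_mod_cast Nat.factorial_le_pow N)
  have h3 := Stirling.le_log_factorial_stirling hN.ne'
  have h3' : 0 ≤ Real.log N / 2 + Real.log (2 * Real.pi) / 2 := by
    have := Real.log_natCast_nonneg N
    have : 0 ≤ Real.log (2 * Real.pi) := Real.log_nonneg (by linarith [Real.pi_gt_three])
    positivity
  have h4 : ∑ n ∈ Finset.Ioc 0 N, ArithmeticFunction.vonMangoldt n * ((N / n : ℕ) : ℝ) ≤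
      N * ∑ n ∈ Finset.Ioc 0 N, ArithmeticFunction.vonMangoldt n / n := by
    rw [Finset.mul_sum]
    refine Finset.sum_le_sum fun n _ => ?_
    have := (Nat.cast_div_le : ((N / n : ℕ) : ℝ) ≤ N / n)
    calc _ ≤ ArithmeticFunction.vonMangoldt n * ((N : ℝ) / n) :=
          mul_le_mul_of_nonneg_left this ArithmeticFunction.vonMangoldt_nonneg
      _ = _ := by ring
  have h5 : N * ∑ n ∈ Finset.Ioc 0 N, ArithmeticFunction.vonMangoldt n / n ≤
      ∑ n ∈ Finset.Ioc 0 N, ArithmeticFunction.vonMangoldt n * ((N / n : ℕ) : ℝ) +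
        ∑ n ∈ Finset.Ioc 0 N, ArithmeticFunction.vonMangoldt n := by
    rw [Finset.mul_sum, ← Finset.sum_add_distrib]
    refine Finset.sum_le_sum fun n hn => ?_
    have hn0 := (Finset.mem_Ioc.1 hn).1
    have hn' : (0 : ℝ) < n := by exact_mod_cast hn0
    have h6 : (N : ℝ) / n ≤ ((N / n : ℕ) : ℝ) + 1 := by
      rw [← Nat.floor_div_eq_div (K := ℝ) N n]
      exact (Nat.lt_floor_add_one _).le
    calc _ = ArithmeticFunction.vonMangoldt n * ((N : ℝ) / n) := by ring
      _ ≤ ArithmeticFunction.vonMangoldt n * (((N / n : ℕ) : ℝ) + 1) :=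
          mul_le_mul_of_nonneg_left h6 ArithmeticFunction.vonMangoldt_nonneg
      _ = _ := by ring
  have h6 := Chebyshev.psi_le_const_mul_self hN0.le
  rw [Chebyshev.psi, Nat.floor_natCast] at h6
  rw [← h1] at h4 h5
  have hl4 : 0 < Real.log 4 := Real.log_pos (by norm_num)
  set S := ∑ n ∈ Finset.Ioc 0 N, ArithmeticFunction.vonMangoldt n / n
  rw [abs_le]
  constructor
  · have : (N : ℝ) * (Real.log N - 1) ≤ N * S := by linarith
    have := le_of_mul_le_mul_left this hN0
    linarith
  · have : (N : ℝ) * S ≤ N * (Real.log N + (Real.log 4 + 4)) := by linarith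
    have := le_of_mul_le_mul_left this hN0
    linarith

theorem summable_log_div_sq : Summable fun n : ℕ => Real.log n * (2 / (n : ℝ) ^ 2) := by
  have hs : Summable fun n : ℕ => 4 * (n : ℝ) ^ (-(3 / 2) : ℝ) :=
    (Real.summable_nat_rpow.2 (by norm_num)).mul_left 4
  refine Summable.of_nonneg_of_le (fun n => ?_) (fun n => ?_) hs
  · exact mul_nonneg (Real.log_natCast_nonneg n) (by positivity)
  · rcases Nat.eq_zero_or_pos n with rfl | hn
    · simp
    have hn' : (0 : ℝ) < n := by exact_mod_cast hn
    have h := Real.log_le_rpow_div hn'.le (show (0 : ℝ) < 1 / 2 by norm_num)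
    calc _ ≤ (n : ℝ) ^ (1 / 2 : ℝ) / (1 / 2) * (2 / (n : ℝ) ^ 2) := by gcongr
      _ = 4 * ((n : ℝ) ^ (1 / 2 : ℝ) * (n : ℝ) ^ (-2 : ℝ)) := by
          rw [Real.rpow_neg hn'.le, ← Real.rpow_natCast (n : ℝ) 2]
          push_cast
          ring
      _ = _ := by rw [← Real.rpow_add hn']; norm_num

/-- Mertens' first theorem for primes; the higher prime powers form a convergent series. -/
theorem exists_abs_sum_log_div_prime_sub_log_le : ∃ C : ℝ, ∀ N : ℕ, 0 < N →
    |∑ p ∈ (N + 1).primesBelow, Real.log p / p - Real.log N| ≤ C := by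
  obtain ⟨C, hC⟩ := exists_abs_sum_vonMangoldt_div_sub_log_le
  refine ⟨C + ∑' n : ℕ, Real.log n * (2 / (n : ℝ) ^ 2), fun N hN => ?_⟩
  have h1 : ∑ n ∈ Finset.Ioc 0 N, ArithmeticFunction.vonMangoldt n / n =
      ∑ p ∈ (N + 1).primesBelow, ∑ k ∈ Finset.range (Nat.log p N), Real.log p / (p : ℝ) ^ (k + 1) := by
    have e : ∑ n ∈ Finset.Ioc 0 N, ArithmeticFunction.vonMangoldt n / n =
        ∑ n ∈ (Finset.Ioc 0 N).filter IsPrimePow, ArithmeticFunction.vonMangoldt n / n := by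
      symm
      refine Finset.sum_filter_of_ne fun n _ hn => ?_
      by_contra hcon
      rw [ArithmeticFunction.vonMangoldt_eq_zero_iff.2 hcon, zero_div] at hn
      exact hn rfl
    rw [e, sum_isPrimePow]
    refine Finset.sum_congr rfl fun p hp => Finset.sum_congr rfl fun k _ => ?_
    rw [ArithmeticFunction.vonMangoldt_apply_pow (Nat.succ_ne_zero k),
      ArithmeticFunction.vonMangoldt_apply_prime (Nat.mem_primesBelow.1 hp).2]
    push_cast
    rfl
  have h2 : ∀ p ∈ (N + 1).primesBelow, 0 ≤ ∑ k ∈ Finset.range (Nat.log p N),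
      Real.log p / (p : ℝ) ^ (k + 1) - Real.log p / p ∧ ∑ k ∈ Finset.range (Nat.log p N),
      Real.log p / (p : ℝ) ^ (k + 1) - Real.log p / p ≤ Real.log p * (2 / (p : ℝ) ^ 2) := by
    intro p hp
    obtain ⟨hpN, hp'⟩ := Nat.mem_primesBelow.1 hp
    have hp2 : (2 : ℝ) ≤ p := by exact_mod_cast hp'.two_le
    have hlog : 0 ≤ Real.log p := Real.log_natCast_nonneg p
    obtain ⟨K, hK⟩ : ∃ K, Nat.log p N = K + 1 :=
      Nat.exists_eq_succ_of_ne_zero (Nat.log_pos hp'.one_lt (by omega)).ne'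
    rw [hK, Finset.sum_range_succ']
    simp only [zero_add, pow_one, add_sub_cancel_right]
    constructor
    · positivity
    have h3 : ∑ k ∈ Finset.range K, Real.log p / (p : ℝ) ^ (k + 1 + 1) =
        Real.log p / (p : ℝ) ^ 2 * ∑ k ∈ Finset.range K, ((p : ℝ)⁻¹) ^ k := by
      rw [Finset.mul_sum]
      refine Finset.sum_congr rfl fun k _ => ?_
      rw [inv_pow, pow_succ, pow_succ, sq]
      field_simp
    have hpi : (p : ℝ)⁻¹ ≤ 2⁻¹ := inv_anti₀ (by norm_num) hp2
    have h4 : ∑ k ∈ Finset.range K, ((p : ℝ)⁻¹) ^ k ≤ 2 := by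
      calc _ ≤ ∑ k ∈ Finset.range K, ((2 : ℝ)⁻¹) ^ k :=
            Finset.sum_le_sum fun k _ => pow_le_pow_left₀ (by positivity) hpi k
        _ ≤ ∑' k : ℕ, ((2 : ℝ)⁻¹) ^ k := (summable_geometric_of_lt_one (by norm_num)
            (by norm_num)).sum_le_tsum _ fun k _ => by positivity
        _ = 2 := by rw [tsum_geometric_of_lt_one (by norm_num) (by norm_num)]; norm_num
    rw [h3]
    calc _ ≤ Real.log p / (p : ℝ) ^ 2 * 2 := by gcongr
      _ = _ := by ring
  have h3 : |∑ n ∈ Finset.Ioc 0 N, ArithmeticFunction.vonMangoldt n / n -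
      ∑ p ∈ (N + 1).primesBelow, Real.log p / p| ≤ ∑' n : ℕ, Real.log n * (2 / (n : ℝ) ^ 2) := by
    rw [h1, ← Finset.sum_sub_distrib, abs_of_nonneg (Finset.sum_nonneg fun p hp => (h2 p hp).1)]
    refine (Finset.sum_le_sum fun p hp => (h2 p hp).2).trans ?_
    exact summable_log_div_sq.sum_le_tsum _ fun n _ =>
      mul_nonneg (Real.log_natCast_nonneg n) (by positivity)
  have h4 := hC N hN
  rw [abs_sub_comm] at h3
  calc _ ≤ _ := abs_sub_le _ (∑ n ∈ Finset.Ioc 0 N, ArithmeticFunction.vonMangoldt n / n) _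
    _ ≤ _ := by linarith

/-- The increments of `log log`, estimated by its derivative `1 / (x log x)`. -/
theorem loglog_succ_sub_bounds {x : ℝ} (hx : 1 < x) :
    1 / ((x + 1) * Real.log (x + 1)) ≤ Real.log (Real.log (x + 1)) - Real.log (Real.log x) ∧
    Real.log (Real.log (x + 1)) - Real.log (Real.log x) ≤ 1 / (x * Real.log x) := by
  have hlx : 0 < Real.log x := Real.log_pos hx
  have hlx1 : 0 < Real.log (x + 1) := Real.log_pos (by linarith)
  have h1 : 1 / (x + 1) ≤ Real.log (x + 1) - Real.log x := by
    rw [← Real.log_div (by positivity) (by positivity)]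
    have := Real.one_sub_inv_le_log_of_pos (show 0 < (x + 1) / x by positivity)
    have e : 1 - ((x + 1) / x)⁻¹ = 1 / (x + 1) := by field_simp; ring
    linarith
  have h2 : Real.log (x + 1) - Real.log x ≤ 1 / x := by
    rw [← Real.log_div (by positivity) (by positivity)]
    have := Real.log_le_sub_one_of_pos (show 0 < (x + 1) / x by positivity)
    have e : (x + 1) / x - 1 = 1 / x := by field_simp; ring
    linarith
  constructor
  · rw [← Real.log_div hlx1.ne' hlx.ne']
    have := Real.one_sub_inv_le_log_of_pos (show 0 < Real.log (x + 1) / Real.log x by positivity)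
    have e : 1 - (Real.log (x + 1) / Real.log x)⁻¹ =
        (Real.log (x + 1) - Real.log x) / Real.log (x + 1) := by field_simp
    calc _ = 1 / (x + 1) / Real.log (x + 1) := by rw [div_div]
      _ ≤ (Real.log (x + 1) - Real.log x) / Real.log (x + 1) := by gcongr
      _ ≤ _ := by linarith
  · rw [← Real.log_div hlx1.ne' hlx.ne']
    have := Real.log_le_sub_one_of_pos (show 0 < Real.log (x + 1) / Real.log x by positivity)
    have e : Real.log (x + 1) / Real.log x - 1 =
        (Real.log (x + 1) - Real.log x) / Real.log x := by field_simp
    calc _ ≤ (Real.log (x + 1) - Real.log x) / Real.log x := by linarith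
      _ ≤ 1 / x / Real.log x := by gcongr
      _ = _ := by rw [div_div]

theorem abs_harmonic_sub_log_le (N : ℕ) (hN : 0 < N) :
    |∑ n ∈ Finset.Ioc 0 N, (1 : ℝ) / n - Real.log N| ≤ 1 := by
  have h1 := log_add_one_le_harmonic N
  have h2 := harmonic_le_one_add_log N
  have e : ((harmonic N : ℚ) : ℝ) = ∑ n ∈ Finset.Ioc 0 N, (1 : ℝ) / n := by
    rw [harmonic_eq_sum_Icc]
    push_cast
    refine Finset.sum_congr rfl fun n _ => by rw [one_div]
  rw [e] at h1 h2
  have h3 : Real.log N ≤ Real.log (N + 1 : ℕ) := Real.log_le_log (by exact_mod_cast hN) (by simp)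
  rw [abs_le]
  constructor <;> linarith

/-- Mertens' second theorem, with an unspecified constant. -/
theorem exists_tendsto_sum_inv_prime : ∃ c : ℝ, Tendsto (fun n : ℕ =>
    ∑ p ∈ n.primesBelow, (1 : ℝ) / p - Real.log (Real.log n)) atTop (nhds c) := by
  obtain ⟨C, hC⟩ := exists_abs_sum_log_div_prime_sub_log_le
  set z : ℕ → ℝ := fun i => ((if (i + 2).Prime then Real.log (i + 2 : ℕ) else 0) - 1) / (i + 2 : ℕ)
    with hz
  set f : ℕ → ℝ := fun i => 1 / Real.log (i + 2 : ℕ) with hf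
  have hpb : ∀ (g : ℕ → ℝ) (n : ℕ), ∑ i ∈ Finset.range n, (if (i + 2).Prime then g (i + 2) else 0) =
      ∑ p ∈ (n + 2).primesBelow, g p := by
    intro g n
    rw [Nat.primesBelow, Finset.sum_filter, Finset.sum_range_succ', Finset.sum_range_succ']
    simp [Nat.not_prime_zero, Nat.not_prime_one]
  -- `1 / p` is `log p / p` times `1 / log p`. Comparing `log p / p` with `1 / n` gives bounded
  -- partial sums by Mertens' first theorem, so Dirichlet's test applies.
  have hzb : ∀ n, ‖∑ i ∈ Finset.range n, z i‖ ≤ C + 2 := by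
    intro n
    have h1 : ∑ i ∈ Finset.range n, z i = ∑ p ∈ (n + 1 + 1).primesBelow, Real.log p / p -
        (∑ m ∈ Finset.Ioc 0 (n + 1), (1 : ℝ) / m - 1) := by
      rw [← hpb (fun p => Real.log p / p)]
      have : ∑ m ∈ Finset.Ioc 0 (n + 1), (1 : ℝ) / m - 1 =
          ∑ i ∈ Finset.range n, (1 : ℝ) / (i + 2 : ℕ) := by
        have : ∑ m ∈ Finset.Ioc 0 (n + 1), (1 : ℝ) / m =
            ∑ i ∈ Finset.range (n + 1), (1 : ℝ) / (i + 1 : ℕ) := by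
          rw [Finset.range_eq_Ico, Finset.sum_Ico_add' (fun i : ℕ => (1 : ℝ) / i) 0 (n + 1) 1]
          rfl
        rw [this, Finset.sum_range_succ']
        simp [add_assoc, one_add_one_eq_two]
      rw [this, ← Finset.sum_sub_distrib]
      refine Finset.sum_congr rfl fun i _ => ?_
      simp only [hz]
      split_ifs <;> ring
    have h2 := hC (n + 1) (Nat.succ_pos n)
    have h3 := abs_harmonic_sub_log_le (n + 1) (Nat.succ_pos n)
    rw [h1, Real.norm_eq_abs]
    rw [abs_le] at h2 h3 ⊢
    constructor <;> linarith [h2.1, h2.2, h3.1, h3.2]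
  have hfa : Antitone f := by
    intro i j hij
    have : 0 < Real.log ((i + 2 : ℕ) : ℝ) := Real.log_pos (by exact_mod_cast (by omega : 1 < i + 2))
    simp only [hf]
    gcongr
  have hf0 : Tendsto f atTop (nhds 0) := by
    have h1 : Tendsto (fun n : ℕ => Real.log (n : ℝ)) atTop atTop :=
      Real.tendsto_log_atTop.comp tendsto_natCast_atTop_atTop
    have h2 := (tendsto_inv_atTop_zero.comp h1)
    have h3 := h2.comp (tendsto_add_atTop_nat 2)
    refine h3.congr fun n => ?_
    simp [hf]
  obtain ⟨c₁, hc₁⟩ := cauchySeq_tendsto_of_complete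
    (hfa.cauchySeq_series_mul_of_tendsto_zero_of_bounded hf0 hzb)
  set b : ℕ → ℝ := fun i => 1 / ((i + 2 : ℕ) * Real.log (i + 2 : ℕ)) with hb
  set g : ℕ → ℝ := fun i => Real.log (Real.log (i + 2 : ℕ)) with hg
  -- the comparison sum of `1 / (n log n)` follows `log log n`, by telescoping
  have hbg : ∀ i, b (i + 1) ≤ g (i + 1) - g i ∧ g (i + 1) - g i ≤ b i := by
    intro i
    have := loglog_succ_sub_bounds (x := (i + 2 : ℕ)) (by exact_mod_cast (by omega : 1 < i + 2))
    simp only [hb, hg]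
    have e : ((i + 1 + 2 : ℕ) : ℝ) = ((i + 2 : ℕ) : ℝ) + 1 := by push_cast; ring
    rw [e]
    exact this
  have hb0 : ∀ i, 0 ≤ b i := fun i => by
    simp only [hb]
    have := Real.log_natCast_nonneg (i + 2)
    positivity
  have hsumm : Summable fun i => b i - (g (i + 1) - g i) := by
    refine summable_of_sum_range_le (c := b 0) (fun i => sub_nonneg.2 (hbg i).2) fun n => ?_
    calc _ ≤ ∑ i ∈ Finset.range n, (b i - b (i + 1)) :=
          Finset.sum_le_sum fun i _ => by linarith [(hbg i).1]
      _ = b 0 - b n := Finset.sum_range_sub' _ _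
      _ ≤ b 0 := by linarith [hb0 n]
  have h5 := hc₁.add hsumm.hasSum.tendsto_sum_nat
  refine ⟨c₁ + ∑' i, (b i - (g (i + 1) - g i)) - g 0, ?_⟩
  rw [← tendsto_add_atTop_iff_nat 2]
  refine (h5.sub_const (g 0)).congr fun n => ?_
  rw [Finset.sum_sub_distrib (fun i => b i), Finset.sum_range_sub, ← hpb (fun p => 1 / (p : ℝ))]
  have : ∑ i ∈ Finset.range n, f i • z i + ∑ i ∈ Finset.range n, b i =
      ∑ i ∈ Finset.range n, if (i + 2).Prime then 1 / ((i + 2 : ℕ) : ℝ) else 0 := by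
    rw [← Finset.sum_add_distrib]
    refine Finset.sum_congr rfl fun i _ => ?_
    have hl : 0 < Real.log ((i + 2 : ℕ) : ℝ) := Real.log_pos (by exact_mod_cast (by omega : 1 < i + 2))
    have hi : (0 : ℝ) < (i + 2 : ℕ) := by positivity
    simp only [hf, hz, hb, smul_eq_mul]
    split_ifs <;> field_simp <;> ring
  rw [← this]
  simp only [hg]
  ring

theorem integrableOn_log_mul_exp_neg :
    MeasureTheory.IntegrableOn (fun u : ℝ => |Real.log u| * Real.exp (-u)) (Set.Ioi 0) := by
  have h1 := Real.GammaIntegral_convergent (s := 2) (by norm_num)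
  have h2 := Real.GammaIntegral_convergent (s := 1 / 2) (by norm_num)
  refine MeasureTheory.Integrable.mono' (h1.add (h2.const_mul 2)) ?_ ?_
  · exact (Real.measurable_log.norm.mul (Real.measurable_exp.comp measurable_neg)).aestronglyMeasurable
  · refine (MeasureTheory.ae_restrict_iff' measurableSet_Ioi).2 (Eventually.of_forall fun u hu => ?_)
    have hu' : (0 : ℝ) < u := hu
    rw [norm_mul, norm_abs_eq_norm, Real.norm_eq_abs, Real.norm_of_nonneg (Real.exp_nonneg _)]
    have h3 : |Real.log u| ≤ u ^ (2 - 1 : ℝ) + 2 * u ^ (1 / 2 - 1 : ℝ) := by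
      have h4 : Real.log u ≤ u := Real.log_le_self hu'.le
      have h5 : -Real.log u ≤ 2 * u ^ (1 / 2 - 1 : ℝ) := by
        have := Real.log_le_rpow_div (inv_nonneg.2 hu'.le) (show (0 : ℝ) < 1 / 2 by norm_num)
        rw [Real.log_inv, Real.inv_rpow hu'.le, ← Real.rpow_neg hu'.le] at this
        norm_num at this ⊢
        linarith
      have h6 : u ^ (2 - 1 : ℝ) = u := by norm_num
      have h7 : 0 < u ^ (1 / 2 - 1 : ℝ) := by positivity
      rw [h6, abs_le]
      constructor <;> linarith
    calc _ ≤ (u ^ (2 - 1 : ℝ) + 2 * u ^ (1 / 2 - 1 : ℝ)) * Real.exp (-u) := by gcongr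
      _ = _ := by simp only [Pi.add_apply]; ring

/-- Euler's constant as a logarithmic integral, from the derivative of `Γ` at `1`. -/
theorem integral_log_mul_exp_neg :
    ∫ u in Set.Ioi (0 : ℝ), Real.log u * Real.exp (-u) = -Real.eulerMascheroniConstant := by
  have h1 := Complex.hasDerivAt_GammaIntegral (s := 1) (by simp)
  have h2 : HasDerivAt Complex.GammaIntegral (-(Real.eulerMascheroniConstant : ℂ)) 1 := by
    refine Complex.hasDerivAt_Gamma_one.congr_of_eventuallyEq ?_
    have : {s : ℂ | 0 < s.re} ∈ nhds (1 : ℂ) :=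
      (isOpen_lt continuous_const Complex.continuous_re).mem_nhds (by simp)
    filter_upwards [this] with s hs using (Complex.Gamma_eq_integral hs).symm
  have h3 := h1.unique h2
  have h4 : ∫ t in Set.Ioi (0 : ℝ), (t : ℂ) ^ ((1 : ℂ) - 1) * (Real.log t * Real.exp (-t)) =
      ((∫ t in Set.Ioi (0 : ℝ), Real.log t * Real.exp (-t) : ℝ) : ℂ) := by
    rw [← integral_complex_ofReal]
    refine MeasureTheory.setIntegral_congr_fun measurableSet_Ioi fun t _ => ?_
    simp
  rw [h4] at h3
  exact_mod_cast h3

theorem loglog_ceil_exp_bounds {v : ℝ} (hv : 0 < v) :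
    0 ≤ Real.log (Real.log ⌈Real.exp v⌉₊) - Real.log v ∧
      Real.log (Real.log ⌈Real.exp v⌉₊) - Real.log v ≤ 1 / v := by
  have h1 : Real.exp v ≤ ⌈Real.exp v⌉₊ := Nat.le_ceil _
  have h2 : (⌈Real.exp v⌉₊ : ℝ) ≤ Real.exp v + 1 := (Nat.ceil_lt_add_one (Real.exp_nonneg _)).le
  have h3 : v ≤ Real.log ⌈Real.exp v⌉₊ := by
    rw [← Real.log_exp v]
    exact Real.log_le_log (Real.exp_pos _) (by rwa [Real.log_exp])
  have h4 : Real.log ⌈Real.exp v⌉₊ ≤ v + 1 := by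
    rw [← Real.log_exp (v + 1)]
    refine Real.log_le_log (lt_of_lt_of_le (Real.exp_pos _) h1) (h2.trans ?_)
    rw [Real.exp_add]
    have h5 : 1 ≤ Real.exp v := Real.one_le_exp hv.le
    have h6 : (2 : ℝ) ≤ Real.exp 1 := by have := Real.add_one_le_exp (1 : ℝ); linarith
    nlinarith
  constructor
  · exact sub_nonneg.2 (Real.log_le_log hv h3)
  · have h7 : Real.log (Real.log ⌈Real.exp v⌉₊) ≤ Real.log (v + 1) :=
      Real.log_le_log (hv.trans_le h3) h4
    have h8 : Real.log (v + 1) - Real.log v ≤ 1 / v := by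
      rw [← Real.log_div (by positivity) (by positivity)]
      have := Real.log_le_sub_one_of_pos (show 0 < (v + 1) / v by positivity)
      have e : (v + 1) / v - 1 = 1 / v := by field_simp; ring
      linarith
    linarith

/-- The sum `∑ 1 / p` over the primes `p < n`. -/
noncomputable def primeRecipSum (n : ℕ) : ℝ := ∑ p ∈ n.primesBelow, (1 : ℝ) / p

theorem primeRecipSum_nonneg (n : ℕ) : 0 ≤ primeRecipSum n :=
  Finset.sum_nonneg fun _ _ => by positivity

theorem primeRecipSum_mono : Monotone primeRecipSum := by
  intro m n hmn
  refine Finset.sum_le_sum_of_subset_of_nonneg ?_ fun _ _ _ => by positivity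
  intro p hp
  rw [Nat.mem_primesBelow] at hp ⊢
  exact ⟨hp.1.trans_le hmn, hp.2⟩

/-- An Abelian theorem: the behaviour of the partial sums of `1 / p` determines that of the
Dirichlet series `∑ p^{-1-ε}` as `ε → 0`, which is the Laplace transform of the partial sums. -/
theorem tendsto_integral_primeRecipSum {c : ℝ} (hc : Tendsto (fun n : ℕ =>
    primeRecipSum n - Real.log (Real.log n)) atTop (nhds c)) :
    Tendsto (fun ε : ℝ => (∫ u in Set.Ioi (0 : ℝ),
      primeRecipSum ⌈Real.exp (u / ε)⌉₊ * Real.exp (-u)) + Real.log ε)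
      (nhdsWithin 0 (Set.Ioi 0)) (nhds (c - Real.eulerMascheroniConstant)) := by
  -- `E v` is the error of the asymptotic formula at `e ^ v`; it tends to `0`
  set E : ℝ → ℝ := fun v => primeRecipSum ⌈Real.exp v⌉₊ - Real.log v - c with hE
  have hlim : Tendsto E atTop (nhds 0) := by
    have h1 : Tendsto (fun v : ℝ => ⌈Real.exp v⌉₊) atTop atTop :=
      tendsto_nat_ceil_atTop.comp Real.tendsto_exp_atTop
    have h2 : Tendsto (fun v : ℝ => Real.log (Real.log ⌈Real.exp v⌉₊) - Real.log v) atTop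
        (nhds 0) := by
      refine squeeze_zero' ?_ ?_ (tendsto_const_nhds.div_atTop tendsto_id : Tendsto
        (fun v : ℝ => (1 : ℝ) / v) atTop (nhds 0))
      · filter_upwards [eventually_gt_atTop 0] with v hv using (loglog_ceil_exp_bounds hv).1
      · filter_upwards [eventually_gt_atTop 0] with v hv using (loglog_ceil_exp_bounds hv).2
    have h3 := ((hc.comp h1).add h2).sub_const c
    rw [add_zero, sub_self] at h3
    refine h3.congr fun v => ?_
    simp only [hE, Function.comp]
    ring
  obtain ⟨B, hB⟩ : ∃ B, ∀ n : ℕ, |primeRecipSum n - Real.log (Real.log n)| ≤ B := by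
    obtain ⟨B, hB⟩ := (Metric.isBounded_range_of_tendsto _ hc).exists_norm_le
    exact ⟨B, fun n => hB _ ⟨n, rfl⟩⟩
  set C := B + 1 + primeRecipSum 3 + |c| with hC
  have hB0 : 0 ≤ B := (abs_nonneg _).trans (hB 0)
  have hP3 := primeRecipSum_nonneg 3
  -- bounds for `E` away from `0` and near `0`, for dominated convergence
  have hE1 : ∀ v, 1 ≤ v → |E v| ≤ C := by
    intro v hv
    have h1 := loglog_ceil_exp_bounds (by linarith : 0 < v)
    have h2 := hB ⌈Real.exp v⌉₊
    have h3 : 1 / v ≤ 1 := by rw [div_le_one (by linarith)]; exact hv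
    have h4 := abs_le.1 h2
    have h5 := abs_le.1 (le_refl |c|)
    simp only [hE, hC]
    rw [abs_le]
    constructor <;> linarith [h1.1, h1.2]
  have hE2 : ∀ v, v < 1 → |E v| ≤ C + |Real.log v| := by
    intro v hv
    have h1 : ⌈Real.exp v⌉₊ ≤ 3 := by
      rw [Nat.ceil_le]
      have h5 : Real.exp v ≤ Real.exp 1 := Real.exp_le_exp.2 hv.le
      have h6 := Real.exp_one_lt_d9
      push_cast
      linarith
    have h2 := primeRecipSum_mono h1
    have h3 := primeRecipSum_nonneg ⌈Real.exp v⌉₊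
    have h4 := abs_le.1 (le_refl |c|)
    have h5 := abs_le.1 (le_refl |Real.log v|)
    simp only [hE, hC]
    rw [abs_le]
    constructor <;> linarith
  have hmeas : Measurable E := by
    refine (Measurable.sub ?_ Real.measurable_log).sub_const c
    exact (measurable_from_top (f := primeRecipSum)).comp
      (Nat.measurable_ceil.comp Real.measurable_exp)
  have hexp : MeasureTheory.IntegrableOn (fun u : ℝ => Real.exp (-u)) (Set.Ioi 0) :=
    integrableOn_exp_neg_Ioi 0
  have hdom : MeasureTheory.IntegrableOn (fun u : ℝ => (C + |Real.log u|) * Real.exp (-u))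
      (Set.Ioi 0) := by
    have : MeasureTheory.IntegrableOn (fun u : ℝ => C * Real.exp (-u) + |Real.log u| * Real.exp (-u))
      (Set.Ioi 0) := (hexp.const_mul C).add integrableOn_log_mul_exp_neg
    refine this.congr_fun (fun u _ => ?_) measurableSet_Ioi
    ring
  have hEb : ∀ ε : ℝ, 0 < ε → ε ≤ 1 → ∀ u : ℝ, 0 < u →
      ‖E (u / ε) * Real.exp (-u)‖ ≤ (C + |Real.log u|) * Real.exp (-u) := by
    intro ε hε hε1 u hu
    rw [norm_mul, Real.norm_of_nonneg (Real.exp_nonneg _), Real.norm_eq_abs]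
    refine mul_le_mul_of_nonneg_right ?_ (Real.exp_nonneg _)
    rcases le_or_gt 1 (u / ε) with h | h
    · exact (hE1 _ h).trans (le_add_of_nonneg_right (abs_nonneg _))
    · refine (hE2 _ h).trans (add_le_add_right ?_ C)
      have h1 : Real.log u ≤ Real.log (u / ε) :=
        Real.log_le_log hu (le_div_self hu.le hε hε1)
      have h2 : Real.log (u / ε) ≤ 0 := Real.log_nonpos (by positivity) h.le
      rw [abs_of_nonpos h2, abs_of_nonpos (h1.trans h2)]
      linarith
  have hDCT : Tendsto (fun ε : ℝ => ∫ u in Set.Ioi (0 : ℝ), E (u / ε) * Real.exp (-u))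
      (nhdsWithin 0 (Set.Ioi 0)) (nhds (∫ u in Set.Ioi (0 : ℝ), (0 : ℝ))) := by
    refine MeasureTheory.tendsto_integral_filter_of_dominated_convergence
      (fun u => (C + |Real.log u|) * Real.exp (-u)) ?_ ?_ hdom ?_
    · refine Eventually.of_forall fun ε => ?_
      exact ((hmeas.comp (measurable_id.div_const ε)).mul
        (Real.measurable_exp.comp measurable_neg)).aestronglyMeasurable
    · filter_upwards [Ioc_mem_nhdsGT one_pos] with ε hε
      exact (MeasureTheory.ae_restrict_iff' measurableSet_Ioi).2
        (Eventually.of_forall fun u hu => hEb ε hε.1 hε.2 u hu)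
    · refine (MeasureTheory.ae_restrict_iff' measurableSet_Ioi).2 (Eventually.of_forall fun u hu => ?_)
      have h1 : Tendsto (fun ε : ℝ => u / ε) (nhdsWithin 0 (Set.Ioi 0)) atTop := by
        simp only [div_eq_mul_inv]
        exact tendsto_inv_nhdsGT_zero.const_mul_atTop hu
      have := (hlim.comp h1).mul_const (Real.exp (-u))
      rwa [zero_mul] at this
  rw [MeasureTheory.integral_zero] at hDCT
  -- the main terms `log (u / ε) + c` integrate to `-γ - log ε + c`
  have h6 := hDCT.add_const (c - Real.eulerMascheroniConstant)
  rw [zero_add] at h6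
  refine h6.congr' ?_
  filter_upwards [Ioc_mem_nhdsGT one_pos] with ε hε
  have hi1 : MeasureTheory.IntegrableOn (fun u : ℝ => E (u / ε) * Real.exp (-u)) (Set.Ioi 0) := by
    refine MeasureTheory.Integrable.mono' hdom ?_ ?_
    · exact ((hmeas.comp (measurable_id.div_const ε)).mul
        (Real.measurable_exp.comp measurable_neg)).aestronglyMeasurable
    · exact (MeasureTheory.ae_restrict_iff' measurableSet_Ioi).2
        (Eventually.of_forall fun u hu => hEb ε hε.1 hε.2 u hu)
  have hi2 : MeasureTheory.IntegrableOn (fun u : ℝ => Real.log u * Real.exp (-u)) (Set.Ioi 0) := by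
    refine MeasureTheory.Integrable.mono' integrableOn_log_mul_exp_neg
      (Real.measurable_log.mul (Real.measurable_exp.comp measurable_neg)).aestronglyMeasurable
      (Eventually.of_forall fun u => ?_)
    rw [norm_mul, Real.norm_of_nonneg (Real.exp_nonneg _), Real.norm_eq_abs]
  have e : ∫ u in Set.Ioi (0 : ℝ), primeRecipSum ⌈Real.exp (u / ε)⌉₊ * Real.exp (-u) =
      ∫ u in Set.Ioi (0 : ℝ), (E (u / ε) * Real.exp (-u) + Real.log u * Real.exp (-u) +
        (c - Real.log ε) * Real.exp (-u)) := by
    refine MeasureTheory.setIntegral_congr_fun measurableSet_Ioi fun u hu => ?_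
    simp only [hE]
    rw [Real.log_div (ne_of_gt hu) hε.1.ne']
    ring
  have hi12 : MeasureTheory.IntegrableOn (fun u : ℝ => E (u / ε) * Real.exp (-u) +
      Real.log u * Real.exp (-u)) (Set.Ioi 0) := hi1.add hi2
  rw [e, MeasureTheory.integral_add hi12 (hexp.const_mul _),
    MeasureTheory.integral_add hi1 hi2, MeasureTheory.integral_const_mul, integral_exp_neg_Ioi,
    integral_log_mul_exp_neg]
  simp
  ring

/-- For each prime, `p ^ (-(1 + ε))` is `1 / p` times the integral of `e ^ (-u)` over `u > ε log p`;
now sum over the primes. -/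
theorem tsum_prime_rpow_eq_integral {ε : ℝ} (hε : 0 < ε) :
    ∑' n : ℕ, (if n.Prime then (n : ℝ) ^ (-(1 + ε)) else 0) =
      ∫ u in Set.Ioi (0 : ℝ), primeRecipSum ⌈Real.exp (u / ε)⌉₊ * Real.exp (-u) := by
  -- the contribution of `n` to the integrand on the right
  set F : ℕ → ℝ → ℝ := fun n => if n.Prime then
    Set.indicator (Set.Ioi (ε * Real.log n)) (fun u => 1 / (n : ℝ) * Real.exp (-u)) else 0 with hF
  have hint : ∀ n, MeasureTheory.IntegrableOn (F n) (Set.Ioi 0) := by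
    intro n
    simp only [hF]
    split_ifs
    · exact ((integrableOn_exp_neg_Ioi 0).const_mul _).indicator measurableSet_Ioi
    · exact MeasureTheory.integrableOn_zero
  have hval : ∀ n, ∫ u in Set.Ioi (0 : ℝ), F n u =
      if n.Prime then (n : ℝ) ^ (-(1 + ε)) else 0 := by
    intro n
    simp only [hF]
    split_ifs with h
    · have hn : (0 : ℝ) < n := by exact_mod_cast h.pos
      have hl : 0 ≤ ε * Real.log n := mul_nonneg hε.le (Real.log_natCast_nonneg n)
      rw [MeasureTheory.setIntegral_indicator measurableSet_Ioi, Set.Ioi_inter_Ioi, max_eq_right hl,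
        MeasureTheory.integral_const_mul, integral_exp_neg_Ioi, neg_add, Real.rpow_add hn,
        Real.rpow_neg_one, Real.rpow_def_of_pos hn, one_div]
      congr 2
      ring
    · simp
  have hnn : ∀ n u, 0 ≤ F n u := by
    intro n u
    simp only [hF]
    split_ifs
    · exact Set.indicator_nonneg (fun u _ => by positivity) u
    · simp
  have hs : Summable fun n : ℕ => if n.Prime then (n : ℝ) ^ (-(1 + ε)) else 0 := by
    refine Summable.of_nonneg_of_le (fun n => ?_) (fun n => ?_)
      (Real.summable_nat_rpow.2 (show -(1 + ε) < -1 by linarith))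
    · split_ifs <;> positivity
    · split_ifs
      · exact le_rfl
      · positivity
  have h := MeasureTheory.hasSum_integral_of_summable_integral_norm
    (μ := MeasureTheory.volume.restrict (Set.Ioi (0 : ℝ))) hint (by
      refine hs.congr fun n => ?_
      rw [← hval n]
      simp only [Real.norm_of_nonneg (hnn n _)])
  rw [← tsum_congr hval, h.tsum_eq]
  refine MeasureTheory.setIntegral_congr_fun measurableSet_Ioi fun u hu => ?_
  rw [tsum_eq_sum (s := (⌈Real.exp (u / ε)⌉₊).primesBelow), primeRecipSum, Finset.sum_mul]
  · refine Finset.sum_congr rfl fun p hp => ?_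
    obtain ⟨h1, h2⟩ := Nat.mem_primesBelow.1 hp
    have hp0 : (0 : ℝ) < p := by exact_mod_cast h2.pos
    simp only [hF, if_pos h2]
    rw [Set.indicator_of_mem]
    rw [Nat.lt_ceil, ← Real.log_lt_iff_lt_exp hp0, lt_div_iff₀ hε] at h1
    rw [Set.mem_Ioi]
    linarith
  · intro p hp
    simp only [hF]
    split_ifs with h2
    · have hp0 : (0 : ℝ) < p := by exact_mod_cast h2.pos
      rw [Set.indicator_of_notMem]
      intro hmem
      apply hp
      rw [Nat.mem_primesBelow, Nat.lt_ceil, ← Real.log_lt_iff_lt_exp hp0, lt_div_iff₀ hε]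
      rw [Set.mem_Ioi] at hmem
      exact ⟨by linarith, h2⟩
    · rfl

theorem abs_neg_log_one_sub_sub_le {x : ℝ} (hx0 : 0 ≤ x) (hx : x ≤ 1 / 2) :
    |-Real.log (1 - x) - x| ≤ 2 * x ^ 2 := by
  have h := Real.abs_log_sub_add_sum_range_le (x := x) (by rw [abs_of_nonneg hx0]; linarith) 1
  simp only [Finset.sum_range_one, zero_add, pow_one, Nat.cast_zero, div_one, abs_of_nonneg hx0] at h
  rw [← abs_neg, show -(-Real.log (1 - x) - x) = x + Real.log (1 - x) by ring]
  refine h.trans ?_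
  rw [div_le_iff₀ (by linarith)]
  norm_num
  nlinarith [sq_nonneg x]

/-- The sum is the logarithm of `ζ(1 + ε)` by the Euler product, and `ζ` has a simple pole of
residue `1` at `1`. -/
theorem tendsto_tsum_neg_log_add_log : Tendsto (fun ε : ℝ =>
    ∑' n : ℕ, (if n.Prime then -Real.log (1 - (n : ℝ) ^ (-(1 + ε))) else 0) + Real.log ε)
    (nhdsWithin 0 (Set.Ioi 0)) (nhds 0) := by
  set L : ℝ → ℝ := fun ε => ∑' n : ℕ, (if n.Prime then -Real.log (1 - (n : ℝ) ^ (-(1 + ε))) else 0)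
    with hL
  have h1 : ∀ ε : ℝ, 0 < ε → ((Real.exp (L ε) : ℝ) : ℂ) = riemannZeta (1 + ε : ℝ) := by
    intro ε hε
    rw [← riemannZeta_eulerProduct_exp_log (s := ((1 + ε : ℝ) : ℂ)) (by simp [hε])]
    rw [Complex.ofReal_exp]
    congr 1
    simp only [hL]
    rw [Complex.ofReal_tsum]
    have : ∑' p : Nat.Primes, -Complex.log (1 - (p : ℂ) ^ (-((1 + ε : ℝ) : ℂ))) =
        ∑' n : ℕ, Set.indicator {n : ℕ | n.Prime}
          (fun n => -Complex.log (1 - (n : ℂ) ^ (-((1 + ε : ℝ) : ℂ)))) n :=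
      tsum_subtype {n : ℕ | n.Prime} (fun n => -Complex.log (1 - (n : ℂ) ^ (-((1 + ε : ℝ) : ℂ))))
    rw [this]
    refine tsum_congr fun n => ?_
    by_cases h : n.Prime
    · rw [Set.indicator_of_mem (show n ∈ {n : ℕ | n.Prime} from h), if_pos h]
      have hlt : (n : ℝ) ^ (-(1 + ε)) < 1 :=
        Real.rpow_lt_one_of_one_lt_of_neg (by exact_mod_cast h.one_lt) (by linarith)
      rw [Complex.ofReal_neg, Complex.ofReal_log (by linarith)]
      push_cast
      rw [Complex.ofReal_cpow (by positivity)]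
      push_cast
      rfl
    · rw [Set.indicator_of_notMem (show n ∉ {n : ℕ | n.Prime} from h), if_neg h]
      simp
  have h2 : Tendsto (fun ε : ℝ => ((ε * Real.exp (L ε) : ℝ) : ℂ)) (nhdsWithin 0 (Set.Ioi 0))
      (nhds 1) := by
    have h3 : Tendsto (fun ε : ℝ => ((1 + ε : ℝ) : ℂ)) (nhdsWithin 0 (Set.Ioi 0))
        (nhdsWithin 1 {1}ᶜ) := by
      refine tendsto_nhdsWithin_iff.2 ⟨?_, ?_⟩
      · have : Continuous fun ε : ℝ => ((1 + ε : ℝ) : ℂ) := by fun_prop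
        have := this.tendsto 0
        simp only [add_zero, Complex.ofReal_one] at this
        exact this.mono_left nhdsWithin_le_nhds
      · filter_upwards [self_mem_nhdsWithin] with ε hε
        have : (0 : ℝ) < ε := hε
        simp only [Set.mem_compl_iff, Set.mem_singleton_iff]
        norm_cast
        linarith
    refine (riemannZeta_residue_one.comp h3).congr' ?_
    filter_upwards [self_mem_nhdsWithin] with ε hε
    simp only [Function.comp]
    rw [← h1 ε hε]
    push_cast
    ring
  have h4 : Tendsto (fun ε : ℝ => ε * Real.exp (L ε)) (nhdsWithin 0 (Set.Ioi 0)) (nhds 1) := by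
    have := (Complex.continuous_re.tendsto 1).comp h2
    simpa only [Function.comp_def, Complex.ofReal_re, Complex.one_re] using this
  have h5 := h4.log one_ne_zero
  rw [Real.log_one] at h5
  refine h5.congr' ?_
  filter_upwards [self_mem_nhdsWithin] with ε hε
  rw [Real.log_mul (ne_of_gt hε) (Real.exp_ne_zero _), Real.log_exp, add_comm]

theorem summable_prime_log_term_bound : Summable fun n : ℕ => 2 * ((n : ℝ) ^ (-1 : ℝ)) ^ 2 := by
  refine Summable.mul_left 2 ((Real.summable_nat_rpow.2 (by norm_num : (-2 : ℝ) < -1)).congr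
    fun n => ?_)
  rw [← Real.rpow_natCast, ← Real.rpow_mul (by positivity)]
  norm_num

theorem prime_rpow_le {n : ℕ} (hn : n.Prime) {ε : ℝ} (hε : 0 ≤ ε) :
    (n : ℝ) ^ (-(1 + ε)) ≤ (n : ℝ) ^ (-1 : ℝ) ∧ (n : ℝ) ^ (-(1 + ε)) ≤ 1 / 2 := by
  have h2 : (2 : ℝ) ≤ n := by exact_mod_cast hn.two_le
  have h1 : (n : ℝ) ^ (-(1 + ε)) ≤ (n : ℝ) ^ (-1 : ℝ) :=
    Real.rpow_le_rpow_of_exponent_le (by linarith) (by linarith)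
  refine ⟨h1, h1.trans ?_⟩
  rw [Real.rpow_neg_one, one_div]
  exact inv_anti₀ (by norm_num) h2

/-- Mertens' third theorem, in logarithmic form. -/
theorem tendsto_sum_neg_log_one_sub_inv : Tendsto (fun n : ℕ =>
    ∑ p ∈ n.primesBelow, -Real.log (1 - 1 / (p : ℝ)) - Real.log (Real.log n)) atTop
      (nhds Real.eulerMascheroniConstant) := by
  obtain ⟨c, hc⟩ := exists_tendsto_sum_inv_prime
  have hF := tendsto_integral_primeRecipSum hc
  -- the contribution of the higher prime powers, which converges uniformly in `ε ≥ 0`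
  set t : ℝ → ℕ → ℝ := fun ε n => if n.Prime then
    -Real.log (1 - (n : ℝ) ^ (-(1 + ε))) - (n : ℝ) ^ (-(1 + ε)) else 0 with ht
  have htb : ∀ ε : ℝ, 0 ≤ ε → ∀ n, ‖t ε n‖ ≤ 2 * ((n : ℝ) ^ (-1 : ℝ)) ^ 2 := by
    intro ε hε n
    simp only [ht]
    split_ifs with h
    · obtain ⟨h1, h2⟩ := prime_rpow_le h hε
      refine (abs_neg_log_one_sub_sub_le (by positivity) h2).trans ?_
      gcongr
    · rw [norm_zero]; positivity
  have hts : ∀ ε : ℝ, 0 ≤ ε → Summable (t ε) := fun ε hε =>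
    Summable.of_norm_bounded summable_prime_log_term_bound (htb ε hε)
  have hH : Tendsto (fun ε : ℝ => ∑' n, t ε n) (nhdsWithin 0 (Set.Ioi 0)) (nhds (∑' n, t 0 n)) := by
    refine tendsto_tsum_of_dominated_convergence summable_prime_log_term_bound ?_ ?_
    · intro n
      simp only [ht]
      split_ifs with h
      · have hn : (0 : ℝ) < n := by exact_mod_cast h.pos
        have h1 : Tendsto (fun ε : ℝ => (n : ℝ) ^ (-(1 + ε))) (nhdsWithin 0 (Set.Ioi 0))
            (nhds ((n : ℝ) ^ (-(1 + 0) : ℝ))) := by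
          have : Continuous fun ε : ℝ => (n : ℝ) ^ (-(1 + ε)) :=
            Continuous.rpow continuous_const (by fun_prop) fun _ => Or.inl hn.ne'
          exact (this.tendsto 0).mono_left nhdsWithin_le_nhds
        have h2 := (prime_rpow_le h le_rfl).2
        exact ((tendsto_const_nhds.sub h1).log (sub_ne_zero.2
          (lt_of_le_of_lt h2 (by norm_num)).ne')).neg.sub h1
      · exact tendsto_const_nhds
    · filter_upwards [self_mem_nhdsWithin] with ε hε n
      exact htb ε (le_of_lt hε) n
  have hcomb : Tendsto (fun ε : ℝ => (∫ u in Set.Ioi (0 : ℝ),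
      primeRecipSum ⌈Real.exp (u / ε)⌉₊ * Real.exp (-u)) + Real.log ε)
      (nhdsWithin 0 (Set.Ioi 0)) (nhds (0 - ∑' n, t 0 n)) := by
    refine (tendsto_tsum_neg_log_add_log.sub hH).congr' ?_
    filter_upwards [self_mem_nhdsWithin] with ε hε
    have hε' : (0 : ℝ) < ε := hε
    rw [← tsum_prime_rpow_eq_integral hε']
    have hs : Summable fun n : ℕ => if n.Prime then (n : ℝ) ^ (-(1 + ε)) else 0 := by
      refine Summable.of_nonneg_of_le (fun n => ?_) (fun n => ?_)
        (Real.summable_nat_rpow.2 (show -(1 + ε) < -1 by linarith))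
      · split_ifs <;> positivity
      · split_ifs
        · exact le_rfl
        · positivity
    have e : ∑' n : ℕ, (if n.Prime then -Real.log (1 - (n : ℝ) ^ (-(1 + ε))) else 0) =
        ∑' n, t ε n + ∑' n : ℕ, (if n.Prime then (n : ℝ) ^ (-(1 + ε)) else 0) := by
      rw [← (hts ε hε'.le).tsum_add hs]
      refine tsum_congr fun n => ?_
      simp only [ht]
      split_ifs <;> ring
    rw [e]
    ring
  -- the two evaluations of the limit determine the constant `c`
  have hceq : c - Real.eulerMascheroniConstant = 0 - ∑' n, t 0 n := tendsto_nhds_unique hF hcomb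
  have hpart := (hts 0 le_rfl).hasSum.tendsto_sum_nat
  have hfin := hc.add hpart
  have : c + ∑' n, t 0 n = Real.eulerMascheroniConstant := by linarith
  rw [this] at hfin
  refine hfin.congr fun n => ?_
  simp only [ht]
  rw [← Finset.sum_filter, ← Nat.primesBelow, sub_add_eq_add_sub, ← Finset.sum_add_distrib]
  congr 1
  refine Finset.sum_congr rfl fun p _ => ?_
  rw [add_zero, Real.rpow_neg_one, one_div]
  ring

/-- Mertens' third theorem. -/
theorem tendsto_prod_one_sub_inv_mul_log : Tendsto (fun x : ℝ =>
    (∏ p ∈ (⌊x⌋₊ + 1).primesBelow, (1 - 1 / (p : ℝ))) * Real.log x) atTop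
      (nhds (Real.exp (-Real.eulerMascheroniConstant))) := by
  have h1 : Tendsto (fun x : ℝ => ⌊x⌋₊ + 1) atTop atTop :=
    (tendsto_add_atTop_nat 1).comp tendsto_nat_floor_atTop
  have h2 := (Real.continuous_exp.tendsto _).comp (tendsto_sum_neg_log_one_sub_inv.comp h1).neg
  have h3 : Tendsto (fun x : ℝ => Real.log x / Real.log (⌊x⌋₊ + 1 : ℕ)) atTop (nhds 1) := by
    have h4 : Tendsto (fun x : ℝ => 1 - 1 / Real.log (⌊x⌋₊ + 1 : ℕ)) atTop (nhds 1) := by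
      have : Tendsto (fun x : ℝ => Real.log (⌊x⌋₊ + 1 : ℕ)) atTop atTop :=
        Real.tendsto_log_atTop.comp (tendsto_natCast_atTop_atTop.comp h1)
      have := (tendsto_const_nhds.div_atTop this : Tendsto
        (fun x : ℝ => (1 : ℝ) / Real.log (⌊x⌋₊ + 1 : ℕ)) atTop (nhds 0))
      simpa using this.const_sub 1
    refine tendsto_of_tendsto_of_tendsto_of_le_of_le' h4 tendsto_const_nhds ?_ ?_
    · filter_upwards [eventually_gt_atTop 1] with x hx
      have hx1 : x ≤ (⌊x⌋₊ + 1 : ℕ) := by push_cast; exact (Nat.lt_floor_add_one x).le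
      have hfl : ((⌊x⌋₊ + 1 : ℕ) : ℝ) ≤ x + 1 := by
        push_cast; linarith [Nat.floor_le (show 0 ≤ x by linarith)]
      have hl : 0 < Real.log (⌊x⌋₊ + 1 : ℕ) := Real.log_pos (by linarith)
      rw [one_sub_div hl.ne', div_le_div_iff_of_pos_right hl]
      have h5 : Real.log (⌊x⌋₊ + 1 : ℕ) ≤ Real.log (Real.exp 1 * x) := by
        refine Real.log_le_log (by linarith) (hfl.trans ?_)
        have := Real.add_one_le_exp (1 : ℝ)
        nlinarith
      rw [Real.log_mul (Real.exp_ne_zero _) (by linarith), Real.log_exp] at h5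
      linarith
    · filter_upwards [eventually_gt_atTop 1] with x hx
      have hx1 : x ≤ (⌊x⌋₊ + 1 : ℕ) := by push_cast; exact (Nat.lt_floor_add_one x).le
      have hl : 0 < Real.log (⌊x⌋₊ + 1 : ℕ) := Real.log_pos (by linarith)
      rw [div_le_one hl]
      exact Real.log_le_log (by linarith) hx1
  have h5 := h2.mul h3
  rw [mul_one] at h5
  refine h5.congr' ?_
  filter_upwards [eventually_gt_atTop 1] with x hx
  have hx1 : x ≤ (⌊x⌋₊ + 1 : ℕ) := by push_cast; exact (Nat.lt_floor_add_one x).le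
  have hl : 0 < Real.log (⌊x⌋₊ + 1 : ℕ) := Real.log_pos (by linarith)
  simp only [Function.comp]
  rw [neg_sub, Real.exp_sub, Real.exp_log hl, Real.exp_sum]
  have : ∏ p ∈ (⌊x⌋₊ + 1).primesBelow, (1 - 1 / (p : ℝ)) =
      (∏ p ∈ (⌊x⌋₊ + 1).primesBelow, Real.exp (-Real.log (1 - 1 / (p : ℝ))))⁻¹ := by
    rw [← Finset.prod_inv_distrib]
    refine Finset.prod_congr rfl fun p hp => ?_
    have hp2 : (2 : ℝ) ≤ p := by exact_mod_cast (Nat.mem_primesBelow.1 hp).2.two_le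
    have : 1 / (p : ℝ) ≤ 1 / 2 := one_div_le_one_div_of_le (by norm_num) hp2
    rw [Real.exp_neg, inv_inv, Real.exp_log (by linarith)]
  rw [this]
  field_simp

/-! ### The least root of a square multiple, and sums over smooth numbers -/

/-- `rootMul l` is the least `r ≥ 1` such that `l` divides `r ^ 2`, namely `∏ p ^ ⌈j / 2⌉` over
the exact prime powers `p ^ j` dividing `l`. -/
noncomputable def rootMul : ℕ → ℕ := multFun fun p j => p ^ ((j + 1) / 2)

/-- The product of the primes dividing `l` to an odd power. -/
noncomputable def oddKernel : ℕ → ℕ := multFun fun p j => p ^ (j % 2)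

theorem mul_oddKernel (l : ℕ) : l * oddKernel l = rootMul l ^ 2 := by
  rcases eq_or_ne l 0 with rfl | hl
  · simp [rootMul, multFun]
  rw [oddKernel, rootMul, multFun, multFun, if_neg hl, if_neg hl]
  nth_rewrite 1 [← Nat.prod_factorization_pow_eq_self hl]
  simp only [Finsupp.prod]
  rw [← Finset.prod_mul_distrib, ← Finset.prod_pow]
  refine Finset.prod_congr rfl fun p _ => ?_
  rw [← pow_add, ← pow_mul]
  congr 1
  omega

theorem oddKernel_dvd_prod {l : ℕ} (hl : l ≠ 0) : oddKernel l ∣ ∏ p ∈ l.primeFactors, p := by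
  rw [oddKernel, multFun, if_neg hl]
  refine Finset.prod_dvd_prod_of_dvd _ _ fun p _ => ?_
  rcases Nat.mod_two_eq_zero_or_one (l.factorization p) with h | h <;> simp [h]

theorem squarefree_oddKernel {l : ℕ} (hl : l ≠ 0) : Squarefree (oddKernel l) := by
  refine Squarefree.squarefree_of_dvd (oddKernel_dvd_prod hl) ?_
  refine Finset.squarefree_prod_of_pairwise_isCoprime (fun p hp q hq hpq => ?_) fun p hp => ?_
  · exact Nat.isCoprime_iff_coprime.1 ((Nat.isCoprime_iff_coprime.2 ((Nat.coprime_primes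
      (Nat.prime_of_mem_primeFactors hp) (Nat.prime_of_mem_primeFactors hq)).2 hpq))) |>
      Nat.coprime_iff_isRelPrime.1
  · exact (Nat.prime_of_mem_primeFactors hp).prime.squarefree

theorem oddKernel_pos {l : ℕ} (hl : l ≠ 0) : 0 < oddKernel l :=
  Nat.pos_of_ne_zero (squarefree_oddKernel hl).ne_zero

/-- The integers `n` for which `n * l` is a square are the square multiples of `oddKernel l`. -/
theorem isSquare_mul_iff {l : ℕ} (hl : l ≠ 0) (n : ℕ) :
    IsSquare (n * l) ↔ ∃ m, n = oddKernel l * m ^ 2 := by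
  constructor
  · rintro ⟨k, hk⟩
    have h1 : n * oddKernel l * l ^ 2 = (k * rootMul l) ^ 2 := by
      calc _ = (n * l) * (l * oddKernel l) := by ring
        _ = _ := by rw [hk, mul_oddKernel]; ring
    have h2 : l ∣ k * rootMul l :=
      (Nat.pow_dvd_pow_iff two_ne_zero).1 ⟨n * oddKernel l, by rw [← h1]; ring⟩
    obtain ⟨t, ht⟩ := h2
    have h3 : n * oddKernel l = t ^ 2 := by
      rw [ht, mul_pow] at h1
      exact Nat.eq_of_mul_eq_mul_left (show 0 < l ^ 2 by positivity) (by rw [← h1]; ring)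
    have h4 : oddKernel l ∣ t :=
      ((squarefree_oddKernel hl).dvd_pow_iff_dvd two_ne_zero).1 ⟨n, by rw [← h3]; ring⟩
    obtain ⟨m, rfl⟩ := h4
    refine ⟨m, Nat.eq_of_mul_eq_mul_left (oddKernel_pos hl) ?_⟩
    rw [mul_comm _ n, h3]
    ring
  · rintro ⟨m, rfl⟩
    exact ⟨rootMul l * m, by
      calc _ = (l * oddKernel l) * m ^ 2 := by ring
        _ = _ := by rw [mul_oddKernel]; ring⟩

theorem sqrt_le_rootMul {l : ℕ} (hl : l ≠ 0) : Real.sqrt l ≤ rootMul l := by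
  rw [Real.sqrt_le_left (by positivity)]
  have : l ≤ rootMul l ^ 2 := by
    rw [← mul_oddKernel]; exact Nat.le_mul_of_pos_right l (oddKernel_pos hl)
  exact_mod_cast this

theorem rootMul_prime_pow {p : ℕ} (hp : p.Prime) (j : ℕ) : rootMul (p ^ j) = p ^ ((j + 1) / 2) :=
  multFun_prime_pow _ (fun _ => by simp) hp j

theorem rootMul_mul_of_coprime {m n : ℕ} (h : m.Coprime n) :
    rootMul (m * n) = rootMul m * rootMul n := multFun_mul_of_coprime _ h

/-- An integer and `rootMul` of it have the same prime factors. -/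
theorem coprime_mul_iff_coprime_rootMul {l n : ℕ} : (rootMul l).Coprime n ↔ l.Coprime n := by
  rcases eq_or_ne l 0 with rfl | hl
  · simp [rootMul, multFun]
  constructor
  · intro h
    have : (rootMul l ^ 2).Coprime n := Nat.Coprime.pow_left 2 h
    rw [← mul_oddKernel] at this
    exact Nat.Coprime.coprime_mul_right this
  · intro h
    have h1 : ∀ p, p.Prime → p ∣ rootMul l → p ∣ l := by
      intro p hp hd
      rw [rootMul, multFun, if_neg hl, Finsupp.prod, hp.prime.dvd_finsetProd_iff] at hd
      obtain ⟨q, hq, hpq⟩ := hd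
      have hq' := Nat.prime_of_mem_primeFactors hq
      have : p = q := (Nat.prime_dvd_prime_iff_eq hp hq').1 (hp.dvd_of_dvd_pow hpq)
      rw [this]
      exact Nat.dvd_of_mem_primeFactors hq
    exact Nat.coprime_of_dvd fun p hp hd => fun hn =>
      Nat.not_coprime_of_dvd_of_dvd hp.one_lt (h1 p hp hd) hn h

/-- `2 ^ s`, with `s` the number of primes dividing `l` to an odd power. -/
noncomputable def twoPowOdd : ℕ → ℝ := multFun fun _ j => 2 ^ (j % 2)

/-- If `s` primes divide `l` to an odd power, then `log (oddKernel l) ≤ s log N`, while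
`1 + s ≤ 2 ^ s`. -/
theorem one_add_log_oddKernel_le {N l : ℕ} (hl : l ≠ 0)
    (hlN : ∀ p, p.Prime → p ∣ l → p ≤ N) :
    1 + Real.log (oddKernel l) ≤ (1 + Real.log N) * twoPowOdd l := by
  have hlogN : 0 ≤ Real.log N := Real.log_natCast_nonneg N
  set s := ∑ p ∈ l.factorization.support, l.factorization p % 2 with hs
  have h1 : oddKernel l ≤ N ^ s := by
    rw [oddKernel, multFun, if_neg hl, Finsupp.prod, hs, ← Finset.prod_pow_eq_pow_sum]
    refine Finset.prod_le_prod' fun p hp => ?_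
    exact Nat.pow_le_pow_left (hlN p (Nat.prime_of_mem_primeFactors hp)
      (Nat.dvd_of_mem_primeFactors hp)) _
  have h2 : Real.log (oddKernel l) ≤ s * Real.log N := by
    rw [← Real.log_pow]
    exact Real.log_le_log (by exact_mod_cast oddKernel_pos hl) (by exact_mod_cast h1)
  have h3 : twoPowOdd l = 2 ^ s := by
    rw [twoPowOdd, multFun, if_neg hl, Finsupp.prod, hs, ← Finset.prod_pow_eq_pow_sum]
  have h4 : (1 : ℝ) + s ≤ 2 ^ s := by
    have := one_add_mul_le_pow (show (-2 : ℝ) ≤ 1 by norm_num) s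
    norm_num at this
    linarith
  have hs0 : (0 : ℝ) ≤ s := Nat.cast_nonneg s
  rw [h3]
  calc _ ≤ (1 + Real.log N) * (1 + s) := by nlinarith
    _ ≤ _ := by gcongr

theorem eulerInvCoeff_eq_zero {N l p : ℕ} (hp : p.Prime) (hd : p ∣ l) (hN : N < p) :
    eulerInvCoeff N l = 0 := by
  rcases eq_or_ne l 0 with rfl | hl
  · exact multFun_zero _
  rw [eulerInvCoeff, ← Nat.ordProj_mul_ordCompl_eq_self l p,
    multFun_mul_of_coprime _ (Nat.Coprime.pow_left _ (Nat.coprime_ordCompl hp hl))]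
  have := eulerInvCoeff_prime_pow_eq_zero hp hN (hp.factorization_pos_of_dvd hl hd)
  rw [eulerInvCoeff] at this
  rw [this, zero_mul]

theorem abs_eulerInvCoeff_le_one (N l : ℕ) : |eulerInvCoeff N l| ≤ 1 := by
  rcases eq_or_ne l 0 with rfl | hl
  · simp [eulerInvCoeff, multFun]
  rw [eulerInvCoeff, multFun, if_neg hl, Finsupp.prod, Finset.abs_prod]
  exact Finset.prod_le_one (fun _ _ => abs_nonneg _) fun _ _ => abs_eulerCoeff_le_one _ _

theorem eulerInvCoeff_mul_of_coprime (N : ℕ) {m n : ℕ} (h : m.Coprime n) :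
    eulerInvCoeff N (m * n) = eulerInvCoeff N m * eulerInvCoeff N n := multFun_mul_of_coprime _ h

theorem eulerInvCoeff_one (N : ℕ) : eulerInvCoeff N 1 = 1 := multFun_one _

theorem eulerInvCoeff_zero (N : ℕ) : eulerInvCoeff N 0 = 0 := multFun_zero _

/-- An upper bound for Euler products of nonnegative multiplicative functions supported on smooth
numbers, whose local factors are at most `1 + y p`. -/
theorem summable_and_tsum_le_exp {f : ℕ → ℝ} (hf : ∀ n, 0 ≤ f n) (h0 : f 0 = 0) (h1 : f 1 = 1)
    (hmul : ∀ {m n : ℕ}, m.Coprime n → f (m * n) = f m * f n) {N : ℕ}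
    (hN : ∀ p, p.Prime → N < p → ∀ j, 0 < j → f (p ^ j) = 0) (y : ℕ → ℝ)
    (hy : ∀ p, p.Prime → Summable (fun j => f (p ^ j)) ∧ ∑' j, f (p ^ j) ≤ 1 + y p) :
    Summable f ∧ ∑' n, f n ≤ Real.exp (∑ p ∈ (N + 1).primesBelow, y p) := by
  have h := summable_and_hasSum_euler h0 h1 hmul hN fun {p} hp => (hy p hp).1.norm
  refine ⟨h.1.of_norm, ?_⟩
  rw [h.2.tsum_eq, Real.exp_sum]
  refine Finset.prod_le_prod (fun p _ => tsum_nonneg fun _ => hf _) fun p hp => ?_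
  refine (hy p (Nat.mem_primesBelow.1 hp).2).2.trans ?_
  rw [add_comm]
  exact Real.add_one_le_exp _

/-- A geometric majorant of `2 ^ (-⌊i / 2⌋)` with sum `8`. -/
theorem half_pow_div_two_le (i : ℕ) : (1 / 2 : ℝ) ^ (i / 2) ≤ 2 * (3 / 4 : ℝ) ^ i := by
  obtain ⟨k, rfl | rfl⟩ := Nat.even_or_odd' i
  · rw [Nat.mul_div_cancel_left _ two_pos, pow_mul]
    have : (1 / 2 : ℝ) ^ k ≤ ((3 / 4 : ℝ) ^ 2) ^ k := by gcongr; norm_num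
    have : 0 ≤ ((3 / 4 : ℝ) ^ 2) ^ k := by positivity
    linarith
  · rw [show (2 * k + 1) / 2 = k by omega, pow_succ, pow_mul]
    have : (1 / 2 : ℝ) ^ k ≤ ((3 / 4 : ℝ) ^ 2) ^ k := by gcongr; norm_num
    have : 0 ≤ ((3 / 4 : ℝ) ^ 2) ^ k := by positivity
    linarith

theorem summable_half_pow_div_two : Summable fun i : ℕ => (1 / 2 : ℝ) ^ (i / 2) :=
  Summable.of_nonneg_of_le (fun i => by positivity) half_pow_div_two_le
    ((summable_geometric_of_lt_one (by norm_num) (by norm_num : (3 / 4 : ℝ) < 1)).mul_left 2)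

theorem tsum_half_pow_div_two_le : ∑' i : ℕ, (1 / 2 : ℝ) ^ (i / 2) ≤ 8 := by
  have hs := (summable_geometric_of_lt_one (by norm_num) (by norm_num : (3 / 4 : ℝ) < 1)).mul_left 2
  refine (summable_half_pow_div_two.tsum_le_tsum half_pow_div_two_le hs).trans ?_
  rw [tsum_mul_left, tsum_geometric_of_lt_one (by norm_num) (by norm_num)]
  norm_num

/-- Tails of `∑ p ^ {-⌈j / 2⌉}` are governed by their first term. -/
theorem summable_and_tsum_inv_pow_le {p : ℕ} (hp : p.Prime) (J : ℕ) :
    (Summable fun i => 1 / (p : ℝ) ^ ((J + i + 1) / 2)) ∧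
      ∑' i, 1 / (p : ℝ) ^ ((J + i + 1) / 2) ≤ 8 / (p : ℝ) ^ ((J + 1) / 2) := by
  have hp2 : (2 : ℝ) ≤ p := by exact_mod_cast hp.two_le
  have hle : ∀ i, 1 / (p : ℝ) ^ ((J + i + 1) / 2) ≤
      1 / (p : ℝ) ^ ((J + 1) / 2) * (1 / 2 : ℝ) ^ (i / 2) := by
    intro i
    have h1 : (p : ℝ) ^ ((J + 1) / 2) * 2 ^ (i / 2) ≤ (p : ℝ) ^ ((J + i + 1) / 2) := by
      calc _ ≤ (p : ℝ) ^ ((J + 1) / 2) * (p : ℝ) ^ (i / 2) := by gcongr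
        _ = (p : ℝ) ^ ((J + 1) / 2 + i / 2) := (pow_add _ _ _).symm
        _ ≤ _ := pow_le_pow_right₀ (by linarith) (by omega)
    rw [one_div_pow, one_div_mul_one_div]
    exact one_div_le_one_div_of_le (by positivity) h1
  have hs := summable_half_pow_div_two.mul_left (1 / (p : ℝ) ^ ((J + 1) / 2))
  have hs2 := Summable.of_nonneg_of_le (fun i => by positivity) hle hs
  refine ⟨hs2, (hs2.tsum_le_tsum hle hs).trans ?_⟩
  rw [tsum_mul_left]
  calc _ ≤ 1 / (p : ℝ) ^ ((J + 1) / 2) * 8 := by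
        gcongr; exact tsum_half_pow_div_two_le
    _ = _ := by ring

theorem exists_sum_inv_prime_le : ∃ C : ℝ, ∀ N : ℕ, 3 ≤ N →
    ∑ p ∈ (N + 1).primesBelow, 1 / (p : ℝ) ≤ Real.log (Real.log N) + C := by
  obtain ⟨c, hc⟩ := exists_tendsto_sum_inv_prime
  obtain ⟨B, hB⟩ := (Metric.isBounded_range_of_tendsto _ hc).exists_norm_le
  refine ⟨B + 1, fun N hN => ?_⟩
  have h1 := hB _ ⟨N + 1, rfl⟩
  have h2 := (abs_le.1 h1).2
  have hN3 : (3 : ℝ) ≤ N := by exact_mod_cast hN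
  have h3 := (loglog_succ_sub_bounds (x := N) (by linarith)).2
  have hlog : 1 ≤ Real.log N := by
    rw [Real.le_log_iff_exp_le (by linarith)]
    have := Real.exp_one_lt_d9
    linarith
  have h4 : 1 / ((N : ℝ) * Real.log N) ≤ 1 := by
    rw [div_le_one (by positivity)]
    nlinarith
  push_cast at h2
  linarith

/-- Sums over smooth numbers weighted by `1 / rootMul` are at most a power of the logarithm. -/
theorem exists_tsum_twoPowOdd_div_rootMul_le : ∃ C : ℝ, 0 < C ∧ ∀ N : ℕ, 3 ≤ N →
    (Summable fun l => |eulerInvCoeff N l| * twoPowOdd l / rootMul l) ∧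
    ∑' l, |eulerInvCoeff N l| * twoPowOdd l / rootMul l ≤ C * Real.log N ^ 16 := by
  obtain ⟨C, hC⟩ := exists_sum_inv_prime_le
  refine ⟨Real.exp (16 * C), Real.exp_pos _, fun N hN => ?_⟩
  have hN3 : (3 : ℝ) ≤ N := by exact_mod_cast hN
  have hlog : 0 < Real.log N := Real.log_pos (by linarith)
  have hpow : ∀ {p : ℕ}, p.Prime → ∀ j, |eulerInvCoeff N (p ^ j)| * twoPowOdd (p ^ j) /
      rootMul (p ^ j) = |eulerCoeff (Nat.log p N) j| * 2 ^ (j % 2) / (p : ℝ) ^ ((j + 1) / 2) := by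
    intro p hp j
    rw [eulerInvCoeff_prime_pow N hp, rootMul_prime_pow hp, twoPowOdd,
      multFun_prime_pow _ (fun _ => by simp) hp]
    push_cast
    rfl
  have hT0 : ∀ l, 0 ≤ twoPowOdd l := by
    intro l
    rw [twoPowOdd, multFun]
    split_ifs
    · exact le_rfl
    · exact Finset.prod_nonneg fun _ _ => by positivity
  have h := summable_and_tsum_le_exp (N := N)
    (f := fun l => |eulerInvCoeff N l| * twoPowOdd l / rootMul l)
    (fun l => div_nonneg (mul_nonneg (abs_nonneg _) (hT0 l)) (Nat.cast_nonneg _))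
    (by simp [eulerInvCoeff_zero])
    (by simp [eulerInvCoeff_one, twoPowOdd, rootMul, multFun_one]) ?_ ?_
    (fun p => 16 * (1 / (p : ℝ))) ?_
  · refine ⟨h.1, h.2.trans ?_⟩
    rw [← Finset.mul_sum]
    calc _ ≤ Real.exp (16 * (Real.log (Real.log N) + C)) := by
          gcongr
          exact hC N hN
      _ = _ := by
          rw [mul_add, Real.exp_add, mul_comm (16 : ℝ) (Real.log _), Real.exp_mul,
            Real.exp_log hlog, mul_comm]
          norm_cast
  · intro m n hmn
    rw [eulerInvCoeff_mul_of_coprime N hmn, rootMul_mul_of_coprime hmn, twoPowOdd,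
      multFun_mul_of_coprime _ hmn, abs_mul]
    push_cast
    ring
  · intro p hp hlt j hj
    simp [eulerInvCoeff_prime_pow_eq_zero hp hlt hj]
  · intro p hp
    simp only [hpow hp]
    have ht := summable_and_tsum_inv_pow_le hp 1
    -- the terms with `j ≥ 1` are at most `2 / p ^ ⌈j / 2⌉`, whose sum is at most `2 * 8 / p`; this
    -- is the source of the exponent `16`
    have hle : ∀ j, |eulerCoeff (Nat.log p N) (j + 1)| * 2 ^ ((j + 1) % 2) /
        (p : ℝ) ^ ((j + 1 + 1) / 2) ≤ 2 * (1 / (p : ℝ) ^ ((1 + j + 1) / 2)) := by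
      intro j
      have h1 := abs_eulerCoeff_le_one (Nat.log p N) (j + 1)
      have h2 : (2 : ℝ) ^ ((j + 1) % 2) ≤ 2 := by
        have : (j + 1) % 2 < 2 := Nat.mod_lt _ two_pos
        interval_cases (j + 1) % 2 <;> norm_num
      rw [show 1 + j + 1 = j + 1 + 1 by ring, mul_one_div]
      gcongr
      calc _ ≤ 1 * (2 : ℝ) := mul_le_mul h1 h2 (by positivity) zero_le_one
        _ = 2 := one_mul 2
    have hs : Summable fun j => |eulerCoeff (Nat.log p N) (j + 1)| * 2 ^ ((j + 1) % 2) /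
        (p : ℝ) ^ ((j + 1 + 1) / 2) :=
      Summable.of_nonneg_of_le (fun j => by positivity) hle (ht.1.mul_left 2)
    have hs' : Summable fun j => |eulerCoeff (Nat.log p N) j| * 2 ^ (j % 2) /
        (p : ℝ) ^ ((j + 1) / 2) := (summable_nat_add_iff 1).1 hs
    refine ⟨hs', ?_⟩
    rw [hs'.tsum_eq_zero_add]
    have h3 := hs.tsum_le_tsum hle (ht.1.mul_left 2)
    rw [tsum_mul_left] at h3
    have h4 := ht.2
    simp only [show (1 + 1) / 2 = 1 from rfl, pow_one] at h4
    simp only [eulerCoeff_zero, abs_one, Nat.zero_mod, pow_zero, mul_one, zero_add]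
    have e : (8 : ℝ) / p = 8 * (1 / p) := by ring
    simp only [show (0 + 1) / 2 = 0 from rfl, pow_zero, div_one]
    linarith

/-- Rankin's bound for the terms `l > Z` of the Dirichlet series of `P_X⁻¹`. -/
theorem tsum_eulerInvCoeff_rpow_le {η : ℝ} (hη : 0 < η) (hη4 : η ≤ 1 / 4) (N : ℕ) :
    (Summable fun l => |eulerInvCoeff N l| * (l : ℝ) ^ (-(1 / 2 - η))) ∧
    ∑' l, |eulerInvCoeff N l| * (l : ℝ) ^ (-(1 / 2 - η)) ≤
      Real.exp (100 * (N : ℝ) ^ (1 / 2 + η)) := by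
  have hpow : ∀ {p : ℕ}, p.Prime → ∀ j, |eulerInvCoeff N (p ^ j)| *
      ((p ^ j : ℕ) : ℝ) ^ (-(1 / 2 - η)) =
      |eulerCoeff (Nat.log p N) j| * ((p : ℝ) ^ (-(1 / 2 - η))) ^ j := by
    intro p hp j
    rw [eulerInvCoeff_prime_pow N hp]
    push_cast
    rw [← Real.rpow_natCast (p : ℝ), ← Real.rpow_natCast ((p : ℝ) ^ (-(1 / 2 - η))),
      ← Real.rpow_mul (by positivity), ← Real.rpow_mul (by positivity), mul_comm (j : ℝ)]
  have h := summable_and_tsum_le_exp (N := N)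
    (f := fun l => |eulerInvCoeff N l| * (l : ℝ) ^ (-(1 / 2 - η)))
    (fun l => by positivity) (by simp [eulerInvCoeff_zero]) (by simp [eulerInvCoeff_one]) ?_ ?_
    (fun p => 10 * (p : ℝ) ^ (-(1 / 2 - η))) ?_
  · refine ⟨h.1, h.2.trans (Real.exp_le_exp.2 ?_)⟩
    -- the sum over primes is at most the sum over all integers up to `N`
    have h1 : ∀ M : ℕ, ∑ n ∈ Finset.range M, ((n + 1 : ℕ) : ℝ) ^ (-(1 / 2 - η)) ≤
        8 * (M : ℝ) ^ (1 / 2 + η) := by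
      intro M
      induction M with
      | zero => simp; positivity
      | succ M ih =>
        rw [Finset.sum_range_succ]
        have hM : (0 : ℝ) < (M + 1 : ℕ) := by positivity
        have hM0 : (0 : ℝ) ≤ M := Nat.cast_nonneg M
        have e : ((M + 1 : ℕ) : ℝ) ^ (-(1 / 2 - η)) =
            ((M + 1 : ℕ) : ℝ) ^ (1 / 2 + η) * ((M + 1 : ℕ) : ℝ)⁻¹ := by
          rw [← Real.rpow_neg_one, ← Real.rpow_add hM]
          ring_nf
        have hb : (M : ℝ) ^ (1 / 2 + η) ≤ ((M + 1 : ℕ) : ℝ) ^ (1 / 2 + η) *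
            (1 - 1 / 2 * ((M + 1 : ℕ) : ℝ)⁻¹) := by
          have e2 : (M : ℝ) = ((M + 1 : ℕ) : ℝ) * (1 + -((M + 1 : ℕ) : ℝ)⁻¹) := by
            push_cast; field_simp; ring
          have hinv : ((M + 1 : ℕ) : ℝ)⁻¹ ≤ 1 := inv_le_one_of_one_le₀ (by push_cast; linarith)
          have hinv0 : 0 < ((M + 1 : ℕ) : ℝ)⁻¹ := by positivity
          conv_lhs => rw [e2]
          rw [Real.mul_rpow hM.le (by linarith)]
          refine mul_le_mul_of_nonneg_left ?_ (by positivity)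
          have := rpow_one_add_le_one_add_mul_self (s := -((M + 1 : ℕ) : ℝ)⁻¹)
            (by linarith) (p := 1 / 2 + η) (by linarith) (by linarith)
          nlinarith
        have hpos : 0 ≤ ((M + 1 : ℕ) : ℝ) ^ (1 / 2 + η) * ((M + 1 : ℕ) : ℝ)⁻¹ := by positivity
        rw [e]
        nlinarith
    rw [← Finset.mul_sum]
    have h2 : ∑ p ∈ (N + 1).primesBelow, (p : ℝ) ^ (-(1 / 2 - η)) ≤
        ∑ n ∈ Finset.range N, ((n + 1 : ℕ) : ℝ) ^ (-(1 / 2 - η)) := by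
      have e : ∑ n ∈ Finset.range N, ((n + 1 : ℕ) : ℝ) ^ (-(1 / 2 - η)) =
          ∑ n ∈ Finset.Ioc 0 N, (n : ℝ) ^ (-(1 / 2 - η)) := by
        rw [Finset.range_eq_Ico, Finset.sum_Ico_add' (fun i : ℕ => (i : ℝ) ^ (-(1 / 2 - η))) 0 N 1]
        rfl
      rw [e]
      refine Finset.sum_le_sum_of_subset_of_nonneg (fun p hp => ?_) fun _ _ _ => by positivity
      obtain ⟨h3, h4⟩ := Nat.mem_primesBelow.1 hp
      exact Finset.mem_Ioc.2 ⟨h4.pos, by omega⟩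
    have h3 := h1 N
    have h4 : 0 ≤ (N : ℝ) ^ (1 / 2 + η) := by positivity
    linarith
  · intro m n hmn
    rw [eulerInvCoeff_mul_of_coprime N hmn, abs_mul]
    push_cast
    rw [Real.mul_rpow (by positivity) (by positivity)]
    ring
  · intro p hp hlt j hj
    simp [eulerInvCoeff_prime_pow_eq_zero hp hlt hj]
  · intro p hp
    simp only [hpow hp]
    have hp2 : (2 : ℝ) ≤ p := by exact_mod_cast hp.two_le
    set x := (p : ℝ) ^ (-(1 / 2 - η)) with hx
    have hx0 : 0 < x := by positivity
    -- `2 ^ (-1/4) ≤ 9 / 10`, so that the local factor is at most `1 / (1 - x) ≤ 1 + 10 x`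
    have hx1 : x ≤ 9 / 10 := by
      have h1 : x ≤ (2 : ℝ) ^ (-(1 / 4) : ℝ) := by
        calc x ≤ (p : ℝ) ^ (-(1 / 4) : ℝ) :=
              Real.rpow_le_rpow_of_exponent_le (by linarith) (by linarith)
          _ ≤ _ := Real.rpow_le_rpow_of_nonpos (by norm_num) hp2 (by norm_num)
      refine h1.trans ?_
      rw [Real.rpow_neg (by norm_num), inv_le_comm₀ (by positivity) (by norm_num)]
      calc (9 / 10 : ℝ)⁻¹ = (((9 / 10 : ℝ)⁻¹) ^ 4) ^ ((4 : ℕ) : ℝ)⁻¹ :=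
            (Real.pow_rpow_inv_natCast (by norm_num) (by norm_num)).symm
        _ ≤ (2 : ℝ) ^ ((4 : ℕ) : ℝ)⁻¹ :=
            Real.rpow_le_rpow (by norm_num) (by norm_num) (by norm_num)
        _ = _ := by norm_num
    have hs : Summable fun j => |eulerCoeff (Nat.log p N) j| * x ^ j :=
      (summable_norm_eulerCoeff_mul_pow _ (show |x| < 1 by rw [abs_of_pos hx0]; linarith)).congr
        fun j => by rw [norm_mul, norm_pow, Real.norm_eq_abs, Real.norm_of_nonneg hx0.le]
    refine ⟨hs, ?_⟩
    calc _ ≤ ∑' j, x ^ j := hs.tsum_le_tsum (fun j => mul_le_of_le_one_left (by positivity)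
          (abs_eulerCoeff_le_one _ _)) (summable_geometric_of_lt_one hx0.le (by linarith))
      _ = (1 - x)⁻¹ := tsum_geometric_of_lt_one hx0.le (by linarith)
      _ ≤ _ := by
          rw [inv_le_iff_one_le_mul₀ (by linarith)]
          nlinarith

/-! ### Local factors of the diagonal -/

/-- The local factor `∑ a_j p ^ {-⌈j / 2⌉}` at `p` of the diagonal contribution. -/
noncomputable def diagFactor (N p : ℕ) : ℝ :=
  ∑' j, eulerCoeff (Nat.log p N) j * (1 / (p : ℝ) ^ ((j + 1) / 2))

/-- The model for `diagFactor`: `1 - 1 / p` for `p ≤ √N` and its square root for larger `p`. -/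
noncomputable def modelFactor (N p : ℕ) : ℝ :=
  if p ^ 2 ≤ N then 1 - 1 / (p : ℝ) else Real.sqrt (1 - 1 / p)

theorem one_div_prime_le_half {p : ℕ} (hp : p.Prime) : 1 / (p : ℝ) ≤ 1 / 2 :=
  one_div_le_one_div_of_le (by norm_num) (by exact_mod_cast hp.two_le)

theorem half_le_modelFactor (N : ℕ) {p : ℕ} (hp : p.Prime) : 1 / 2 ≤ modelFactor N p := by
  have h := one_div_prime_le_half hp
  have h0 : 0 ≤ 1 / (p : ℝ) := by positivity
  rw [modelFactor]
  split_ifs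
  · linarith
  · refine Real.le_sqrt_of_sq_le ?_
    nlinarith

theorem summable_diagFactor (N : ℕ) {p : ℕ} (hp : p.Prime) :
    Summable fun j => ‖eulerCoeff (Nat.log p N) j * (1 / (p : ℝ) ^ ((j + 1) / 2))‖ := by
  have h := (summable_and_tsum_inv_pow_le hp 0).1
  simp only [zero_add] at h
  refine Summable.of_nonneg_of_le (fun _ => norm_nonneg _) (fun j => ?_) h
  rw [norm_mul, Real.norm_of_nonneg (by positivity : (0 : ℝ) ≤ 1 / (p : ℝ) ^ ((j + 1) / 2))]
  exact mul_le_of_le_one_left (by positivity) (abs_eulerCoeff_le_one _ _)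

/-- The local factor is determined by its first terms, since the coefficients are bounded. -/
theorem abs_diagFactor_sub_sum_le (N : ℕ) {p : ℕ} (hp : p.Prime) (J : ℕ) :
    |diagFactor N p - ∑ j ∈ Finset.range J,
      eulerCoeff (Nat.log p N) j * (1 / (p : ℝ) ^ ((j + 1) / 2))| ≤ 8 / (p : ℝ) ^ ((J + 1) / 2) := by
  have hs := (summable_diagFactor N hp).of_norm
  have h := hs.sum_add_tsum_nat_add J
  rw [diagFactor, ← h, add_sub_cancel_left]
  have ht := summable_and_tsum_inv_pow_le hp J
  have hb : ∀ i, ‖eulerCoeff (Nat.log p N) (i + J) * (1 / (p : ℝ) ^ ((i + J + 1) / 2))‖ ≤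
      1 / (p : ℝ) ^ ((J + i + 1) / 2) := by
    intro i
    rw [norm_mul, Real.norm_of_nonneg (by positivity : (0 : ℝ) ≤ 1 / (p : ℝ) ^ ((i + J + 1) / 2)),
      add_comm i J]
    exact mul_le_of_le_one_left (by positivity) (abs_eulerCoeff_le_one _ _)
  exact (tsum_of_norm_bounded ht.1.hasSum hb).trans ht.2

theorem abs_sqrt_one_sub_sub_le {x : ℝ} (hx0 : 0 ≤ x) (hx1 : x ≤ 1 / 2) :
    |Real.sqrt (1 - x) - (1 - x / 2)| ≤ x ^ 2 := by
  have h1 : Real.sqrt (1 - x) ≤ 1 - x / 2 := by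
    rw [Real.sqrt_le_left (by linarith)]
    nlinarith
  have h2 : 1 - x / 2 - x ^ 2 ≤ Real.sqrt (1 - x) := by
    refine Real.le_sqrt_of_sq_le ?_
    have : 0 ≤ x ^ 2 := sq_nonneg x
    nlinarith [mul_nonneg this hx0, mul_nonneg this (sub_nonneg.2 hx1),
      mul_nonneg (mul_nonneg this hx0) (sub_nonneg.2 hx1)]
  rw [abs_le]
  constructor <;> linarith [sq_nonneg x]

/-- The local factor agrees with its model up to a relative error that is summable over primes,
with a gain of a power of `N`. -/
theorem abs_diagFactor_div_sub_one_le {N p : ℕ} (hp : p.Prime) (hpN : p ≤ N) :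
    |diagFactor N p / modelFactor N p - 1| ≤
      18 * (N : ℝ) ^ (-(1 / 8) : ℝ) * (p : ℝ) ^ (-(3 / 2) : ℝ) := by
  have hp2 : (2 : ℝ) ≤ p := by exact_mod_cast hp.two_le
  have hp0 : (0 : ℝ) < p := by linarith
  have hg := half_le_modelFactor N hp
  have hN0 : (0 : ℝ) < N := by exact_mod_cast hp.pos.trans_le hpN
  set K := Nat.log p N with hK
  have hK1 : 0 < K := Nat.log_pos hp.one_lt hpN
  have hNp : (N : ℝ) ≤ (p : ℝ) ^ (K + 1) := by
    exact_mod_cast (Nat.lt_pow_succ_log_self hp.one_lt N).le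
  have hmain : |diagFactor N p - modelFactor N p| ≤ 9 / (p : ℝ) ^ (max 2 ((K + 2) / 2)) := by
    -- if `p² ≤ N`, the series is `1 - 1 / p` up to terms of degree `> K`; otherwise `K = 1` and the
    -- terms of degree at most `2` are `1 - 1 / p + 1 / (2p)`
    by_cases h2 : p ^ 2 ≤ N
    · have hK2 : 2 ≤ K := Nat.le_log_of_pow_le hp.one_lt h2
      have h := abs_diagFactor_sub_sum_le N hp (K + 1)
      have e : ∑ j ∈ Finset.range (K + 1), eulerCoeff K j * (1 / (p : ℝ) ^ ((j + 1) / 2)) =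
          modelFactor N p := by
        obtain ⟨k, hk⟩ : ∃ k, K + 1 = k + 2 := ⟨K - 1, by omega⟩
        rw [hk, Finset.sum_range_succ', Finset.sum_range_succ', Finset.sum_eq_zero]
        · rw [eulerCoeff_zero, zero_add, eulerCoeff_one hK1, modelFactor, if_pos h2]
          simp only [show (1 + 1) / 2 = 1 from rfl, show (0 + 1) / 2 = 0 from rfl]
          ring
        · intro i hi
          have := Finset.mem_range.1 hi
          rw [eulerCoeff_eq_zero (by omega) (by omega), zero_mul]
      rw [e] at h
      refine h.trans ?_
      rw [max_eq_right (by omega)]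
      gcongr
      linarith
    · have hK1' : K = 1 := by
        have : ¬ 2 ≤ K := fun h => h2 (Nat.pow_le_of_le_log (by have := hp.pos; omega) h)
        omega
      have h := abs_diagFactor_sub_sum_le N hp 3
      rw [← hK, hK1'] at h
      simp only [Finset.sum_range_succ, Finset.sum_range_zero, eulerCoeff_zero,
        eulerCoeff_one one_pos, eulerCoeff_one_two, show (1 + 1) / 2 = 1 from rfl,
        show (0 + 1) / 2 = 0 from rfl, pow_zero, pow_one,
        show (3 + 1) / 2 = 2 from rfl] at h
      have h3 := abs_sqrt_one_sub_sub_le (show 0 ≤ 1 / (p : ℝ) by positivity)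
        (one_div_prime_le_half hp)
      rw [modelFactor, if_neg h2, hK1']
      norm_num at h h3 ⊢
      have e : (9 : ℝ) / (p : ℝ) ^ 2 = 8 / (p : ℝ) ^ 2 + ((p : ℝ) ^ 2)⁻¹ := by ring
      rw [e, abs_le]
      rw [abs_le] at h h3
      constructor <;> linarith [h.1, h.2, h3.1, h3.2]
  -- since `N ≤ p ^ (K + 1)`, this only requires `12 + (K + 1) ≤ 8 * max 2 ((K + 2) / 2)`
  have hexp : 1 / (p : ℝ) ^ (max 2 ((K + 2) / 2)) ≤
      (N : ℝ) ^ (-(1 / 8) : ℝ) * (p : ℝ) ^ (-(3 / 2) : ℝ) := by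
    have h1 : ((p : ℝ) ^ (K + 1)) ^ (-(1 / 8) : ℝ) ≤ (N : ℝ) ^ (-(1 / 8) : ℝ) :=
      Real.rpow_le_rpow_of_nonpos hN0 hNp (by norm_num)
    have h2 : 1 / (p : ℝ) ^ (max 2 ((K + 2) / 2)) ≤
        ((p : ℝ) ^ (K + 1)) ^ (-(1 / 8) : ℝ) * (p : ℝ) ^ (-(3 / 2) : ℝ) := by
      rw [← Real.rpow_natCast (p : ℝ) (K + 1), ← Real.rpow_mul hp0.le, ← Real.rpow_add hp0, one_div,
        ← Real.rpow_natCast (p : ℝ), ← Real.rpow_neg hp0.le]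
      refine Real.rpow_le_rpow_of_exponent_le (by linarith) ?_
      have h3 : (12 + (K + 1) : ℕ) ≤ 8 * max 2 ((K + 2) / 2) := by
        rcases le_total 2 ((K + 2) / 2) with h | h
        · rw [max_eq_right h]; omega
        · rw [max_eq_left h]; omega
      have h4 : (12 + (K + 1) : ℝ) ≤ 8 * (max 2 ((K + 2) / 2) : ℕ) := by exact_mod_cast h3
      push_cast at h4 ⊢
      linarith
    exact h2.trans (by gcongr)
  have hg0 : 0 < modelFactor N p := by linarith
  rw [div_sub_one hg0.ne', abs_div, abs_of_pos hg0, div_le_iff₀ hg0]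
  have h0 : 0 ≤ (N : ℝ) ^ (-(1 / 8) : ℝ) * (p : ℝ) ^ (-(3 / 2) : ℝ) := by positivity
  calc _ ≤ 9 * (1 / (p : ℝ) ^ (max 2 ((K + 2) / 2))) := by rw [mul_one_div]; exact hmain
    _ ≤ 9 * ((N : ℝ) ^ (-(1 / 8) : ℝ) * (p : ℝ) ^ (-(3 / 2) : ℝ)) := by gcongr
    _ ≤ _ := by nlinarith

/-- The factor by which a prime `p` dividing `d` changes the model. -/
theorem abs_one_sub_inv_div_sub_one_le {N p : ℕ} (hp : p.Prime) (hN : 0 < N) :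
    |(1 - 1 / (p : ℝ)) / (if p ≤ N then modelFactor N p else 1) - 1| ≤
      (N : ℝ) ^ (-(1 / 8) : ℝ) * (p : ℝ) ^ (-(3 / 4) : ℝ) := by
  have hp2 : (2 : ℝ) ≤ p := by exact_mod_cast hp.two_le
  have hp0 : (0 : ℝ) < p := by linarith
  have hN0 : (0 : ℝ) < N := by exact_mod_cast hN
  have hx := one_div_prime_le_half hp
  have hx0 : 0 < 1 / (p : ℝ) := by positivity
  -- the quotient is exactly `1` when `p² ≤ N`; otherwise it is `1 + O(1 / p)`, and a part of
  -- `1 / p` is traded for a power of `N`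
  by_cases h2 : p ^ 2 ≤ N
  · have hpN : p ≤ N := (Nat.le_self_pow two_ne_zero p).trans h2
    rw [if_pos hpN, modelFactor, if_pos h2, div_self (by linarith), sub_self, abs_zero]
    positivity
  have hle : 1 / (p : ℝ) ≤ (N : ℝ) ^ (-(1 / 8) : ℝ) * (p : ℝ) ^ (-(3 / 4) : ℝ) := by
    have h3 : (N : ℝ) ≤ (p : ℝ) ^ 2 := by exact_mod_cast (not_le.1 h2).le
    have h4 : ((p : ℝ) ^ 2) ^ (-(1 / 8) : ℝ) ≤ (N : ℝ) ^ (-(1 / 8) : ℝ) :=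
      Real.rpow_le_rpow_of_nonpos hN0 h3 (by norm_num)
    have h5 : 1 / (p : ℝ) = ((p : ℝ) ^ 2) ^ (-(1 / 8) : ℝ) * (p : ℝ) ^ (-(3 / 4) : ℝ) := by
      rw [← Real.rpow_natCast (p : ℝ) 2, ← Real.rpow_mul hp0.le, ← Real.rpow_add hp0]
      norm_num [Real.rpow_neg_one]
    rw [h5]
    gcongr
  refine le_trans ?_ hle
  split_ifs with hpN
  · rw [modelFactor, if_neg h2, Real.div_sqrt]
    have h6 : 1 - 1 / (p : ℝ) ≤ Real.sqrt (1 - 1 / p) := by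
      refine Real.le_sqrt_of_sq_le ?_
      nlinarith
    have h7 : Real.sqrt (1 - 1 / (p : ℝ)) ≤ 1 := by
      rw [Real.sqrt_le_left zero_le_one]
      linarith
    rw [abs_le]
    constructor <;> linarith
  · rw [div_one, abs_le]
    constructor <;> linarith

/-- The Dirichlet series over `l` coprime to `M` of the diagonal. -/
theorem hasSum_eulerInvCoeff_div_rootMul (N M : ℕ) :
    (Summable fun l => ‖(if l.Coprime M then eulerInvCoeff N l / rootMul l else 0 : ℝ)‖) ∧
    HasSum (fun l => (if l.Coprime M then eulerInvCoeff N l / rootMul l else 0 : ℝ))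
      (∏ p ∈ (N + 1).primesBelow, if p ∣ M then 1 else diagFactor N p) := by
  have hpow : ∀ {p : ℕ}, p.Prime → ∀ j,
      (if (p ^ j).Coprime M then eulerInvCoeff N (p ^ j) / rootMul (p ^ j) else 0 : ℝ) =
      if p ∣ M then (if j = 0 then 1 else 0) else
        eulerCoeff (Nat.log p N) j * (1 / (p : ℝ) ^ ((j + 1) / 2)) := by
    intro p hp j
    rcases Nat.eq_zero_or_pos j with rfl | hj
    · simp [eulerInvCoeff_one, rootMul, multFun_one, eulerCoeff_zero]
    · have hiff : (p ^ j).Coprime M ↔ ¬ p ∣ M := by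
        rw [Nat.coprime_pow_left_iff hj, hp.coprime_iff_not_dvd]
      simp only [hiff]
      rw [eulerInvCoeff_prime_pow N hp, rootMul_prime_pow hp, if_neg hj.ne']
      split_ifs <;> simp_all [div_eq_mul_inv]
  have h := summable_and_hasSum_euler (N := N)
    (f := fun l => (if l.Coprime M then eulerInvCoeff N l / rootMul l else 0 : ℝ))
    (by simp [eulerInvCoeff_zero]) (by simp [eulerInvCoeff_one, rootMul, multFun_one]) ?_ ?_ ?_
  · refine ⟨h.1, ?_⟩
    convert h.2 using 1
    refine Finset.prod_congr rfl fun p hp => ?_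
    rw [tsum_congr (hpow (Nat.mem_primesBelow.1 hp).2)]
    split_ifs
    · rw [tsum_eq_single 0 fun j hj => if_neg hj, if_pos rfl]
    · rfl
  · intro m n hmn
    simp only [Nat.coprime_mul_iff_left]
    by_cases h1 : m.Coprime M
    · by_cases h2 : n.Coprime M
      · rw [if_pos ⟨h1, h2⟩, if_pos h1, if_pos h2]
        rw [eulerInvCoeff_mul_of_coprime N hmn, rootMul_mul_of_coprime hmn]
        push_cast
        rw [mul_div_mul_comm]
      · simp [h2]
    · simp [h1]
  · intro p hp hlt j hj
    rw [eulerInvCoeff_prime_pow_eq_zero hp hlt hj]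
    simp
  · intro p hp
    simp only [hpow hp]
    split_ifs
    · exact summable_of_ne_finset_zero (s := {0}) fun j hj => by
        rw [if_neg (by simpa using hj), norm_zero]
    · exact summable_diagFactor N hp

/-! ### The diagonal -/

/-- The smoothed harmonic sum `∑ W(m² / U) / m`. -/
noncomputable def harmonicWeight (U : ℝ) : ℝ :=
  ∑' m : ℕ, 1 / (m : ℝ) * gammaWeight ((m : ℝ) ^ 2 / U)

theorem summable_harmonicWeight {U : ℝ} (hU : 0 < U) :
    Summable fun m : ℕ => 1 / (m : ℝ) * gammaWeight ((m : ℝ) ^ 2 / U) := by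
  obtain ⟨C, hC, h⟩ := exists_gammaWeight_le_rpow (1 / 2) (by norm_num)
  refine Summable.of_nonneg_of_le (fun m => mul_nonneg (by positivity) (gammaWeight_nonneg _))
    (fun m => ?_) ((Real.summable_one_div_nat_pow.2 (by norm_num : 1 < 2)).mul_left
      (C * Real.sqrt U))
  rcases Nat.eq_zero_or_pos m with rfl | hm
  · simp
  have hm' : (0 : ℝ) < m := by exact_mod_cast hm
  have h1 := h ((m : ℝ) ^ 2 / U) (by positivity)
  rw [Real.rpow_neg (by positivity), ← Real.sqrt_eq_rpow, Real.sqrt_div (by positivity),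
    Real.sqrt_sq hm'.le, inv_div] at h1
  calc _ ≤ 1 / (m : ℝ) * (C * (Real.sqrt U / m)) := by gcongr
    _ = _ := by field_simp

/-- The weight restricts the harmonic sum to `m ≤ √U` up to a bounded error; for `U < 1` only the
bounded tail remains, hence the truncation of the logarithm. -/
theorem exists_abs_harmonicWeight_sub_le : ∃ C : ℝ, 0 < C ∧ ∀ U : ℝ, 0 < U →
    |harmonicWeight U - 1 / 2 * max (Real.log U) 0| ≤ C := by
  obtain ⟨C₁, hC₁, h₁⟩ := exists_gammaWeight_le_rpow (1 / 2) (by norm_num)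
  obtain ⟨C₂, hC₂, h₂⟩ := exists_one_sub_gammaWeight_le
  set A := ∑' n : ℕ, 1 / (n : ℝ) ^ 2 with hA
  have hA0 : 0 ≤ A := tsum_nonneg fun n => by positivity
  have hsA : Summable fun n : ℕ => 1 / (n : ℝ) ^ 2 :=
    Real.summable_one_div_nat_pow.2 (by norm_num : 1 < 2)
  refine ⟨C₁ * A + (C₂ + 2 * C₁ + 2), by positivity, fun U hU => ?_⟩
  have hs := summable_harmonicWeight hU
  have hW : ∀ m : ℕ, 1 / (m : ℝ) * gammaWeight ((m : ℝ) ^ 2 / U) ≤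
      C₁ * Real.sqrt U * (1 / (m : ℝ) ^ 2) := by
    intro m
    rcases Nat.eq_zero_or_pos m with rfl | hm
    · simp
    have hm' : (0 : ℝ) < m := by exact_mod_cast hm
    have h1 := h₁ ((m : ℝ) ^ 2 / U) (by positivity)
    rw [Real.rpow_neg (by positivity), ← Real.sqrt_eq_rpow, Real.sqrt_div (by positivity),
      Real.sqrt_sq hm'.le, inv_div] at h1
    calc _ ≤ 1 / (m : ℝ) * (C₁ * (Real.sqrt U / m)) := by gcongr
      _ = _ := by field_simp
  rcases lt_or_ge U 1 with hU1 | hU1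
  · rw [max_eq_right (Real.log_nonpos hU.le hU1.le), mul_zero, sub_zero, harmonicWeight, abs_of_nonneg
      (tsum_nonneg fun m => mul_nonneg (by positivity) (gammaWeight_nonneg _))]
    refine (hs.tsum_le_tsum hW (hsA.mul_left _)).trans ?_
    rw [tsum_mul_left]
    have hsq : Real.sqrt U ≤ 1 := by
      rw [Real.sqrt_le_left zero_le_one]; linarith
    calc C₁ * Real.sqrt U * A ≤ C₁ * 1 * A := by gcongr
      _ ≤ _ := by linarith
  · rw [max_eq_left (Real.log_nonneg hU1)]
    set R := Real.sqrt U with hR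
    have hR1 : 1 ≤ R := Real.one_le_sqrt.2 hU1
    have hlogR : 1 / 2 * Real.log U = Real.log R := by rw [hR, Real.log_sqrt hU.le]; ring
    rw [hlogR]
    set M := ⌊R⌋₊ with hM
    have hM1 : 1 ≤ M := Nat.le_floor (by exact_mod_cast hR1)
    have hMR : (M : ℝ) ≤ R := Nat.floor_le (by linarith)
    have hRM : R < M + 1 := Nat.lt_floor_add_one R
    have hM1' : (1 : ℝ) ≤ M := by exact_mod_cast hM1
    -- split at `√U`: below, the weight is nearly `1`; above, it decays like `√U / m`
    have hsplit := hs.sum_add_tsum_nat_add (M + 1)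
    have htail : 0 ≤ ∑' i : ℕ, 1 / ((i + (M + 1) : ℕ) : ℝ) *
        gammaWeight (((i + (M + 1) : ℕ) : ℝ) ^ 2 / U) ∧ ∑' i : ℕ, 1 / ((i + (M + 1) : ℕ) : ℝ) *
        gammaWeight (((i + (M + 1) : ℕ) : ℝ) ^ 2 / U) ≤ 2 * C₁ := by
      refine ⟨tsum_nonneg fun m => mul_nonneg (by positivity) (gammaWeight_nonneg _), ?_⟩
      refine Real.tsum_le_of_sum_range_le
        (fun m => mul_nonneg (by positivity) (gammaWeight_nonneg _)) fun n => ?_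
      refine (Finset.sum_le_sum fun i _ => hW (i + (M + 1))).trans ?_
      rw [← Finset.mul_sum]
      have e : ∑ i ∈ Finset.range n, 1 / ((i + (M + 1) : ℕ) : ℝ) ^ 2 =
          ∑ i ∈ Finset.Ioo M (n + (M + 1)), ((i : ℝ) ^ 2)⁻¹ := by
        have : Finset.Ioo M (n + (M + 1)) = Finset.Ico (0 + (M + 1)) (n + (M + 1)) := by
          ext x; simp only [Finset.mem_Ioo, Finset.mem_Ico]; omega
        rw [this, Finset.range_eq_Ico, ← Finset.sum_Ico_add' (fun i : ℕ => ((i : ℝ) ^ 2)⁻¹)]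
        refine Finset.sum_congr rfl fun i _ => by rw [one_div]
      rw [e]
      calc _ ≤ C₁ * R * (2 / (M + 1)) := by
            gcongr
            exact sum_Ioo_inv_sq_le M _
        _ = 2 * C₁ * (R / (M + 1)) := by ring
        _ ≤ 2 * C₁ * 1 := by
            gcongr
            rw [div_le_one (by positivity)]
            exact hRM.le
        _ = _ := mul_one _
    have hhead : |∑ m ∈ Finset.range (M + 1), 1 / (m : ℝ) * gammaWeight ((m : ℝ) ^ 2 / U) -
        ∑ m ∈ Finset.range (M + 1), 1 / (m : ℝ)| ≤ C₂ := by
      rw [Finset.sum_range_succ', Finset.sum_range_succ']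
      simp only [Nat.cast_zero, div_zero, zero_mul, add_zero]
      rw [← Finset.sum_sub_distrib]
      have hb : ∀ m ∈ Finset.range M, |1 / ((m + 1 : ℕ) : ℝ) *
          gammaWeight (((m + 1 : ℕ) : ℝ) ^ 2 / U) - 1 / ((m + 1 : ℕ) : ℝ)| ≤ C₂ / R := by
        intro m _
        have hm : (0 : ℝ) < (m + 1 : ℕ) := by positivity
        have hx : 0 ≤ ((m + 1 : ℕ) : ℝ) ^ 2 / U := by positivity
        have h4 := h₂ _ hx
        have h5 := gammaWeight_le_one hx
        rw [Real.sqrt_div (by positivity), Real.sqrt_sq hm.le, ← hR] at h4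
        rw [abs_sub_comm, ← mul_one_sub, abs_of_nonneg (mul_nonneg (by positivity) (by linarith))]
        calc _ ≤ 1 / ((m + 1 : ℕ) : ℝ) * (C₂ * (((m + 1 : ℕ) : ℝ) / R)) := by gcongr
          _ = _ := by field_simp
      refine (Finset.abs_sum_le_sum_abs _ _).trans ((Finset.sum_le_sum hb).trans ?_)
      rw [Finset.sum_const, Finset.card_range, nsmul_eq_mul, mul_div_assoc', div_le_iff₀ (by linarith)]
      nlinarith
    have hharm : |∑ m ∈ Finset.range (M + 1), 1 / (m : ℝ) - Real.log R| ≤ 2 := by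
      have e : ∑ m ∈ Finset.range (M + 1), 1 / (m : ℝ) = ∑ m ∈ Finset.Ioc 0 M, 1 / (m : ℝ) := by
        rw [Finset.range_eq_Ico, Finset.sum_eq_sum_Ico_succ_bot (Nat.succ_pos M)]
        simp only [Nat.cast_zero, div_zero, zero_add]
        rfl
      have h3 := abs_harmonic_sub_log_le M hM1
      have h4 : Real.log M ≤ Real.log R := Real.log_le_log (by linarith) hMR
      have h5 : Real.log R ≤ Real.log M + 1 := by
        have h6 : Real.log R ≤ Real.log (Real.exp 1 * M) := by
          refine Real.log_le_log (by linarith) ?_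
          have := Real.add_one_le_exp (1 : ℝ)
          nlinarith
        rw [Real.log_mul (Real.exp_ne_zero _) (by linarith), Real.log_exp] at h6
        linarith
      rw [e]
      rw [abs_le] at h3 ⊢
      constructor <;> linarith [h3.1, h3.2]
    rw [harmonicWeight, ← hsplit]
    have : 0 ≤ C₁ * A := by positivity
    rw [abs_le] at hhead hharm ⊢
    constructor <;> linarith [htail.1, htail.2, hhead.1, hhead.2, hharm.1, hharm.2]

theorem indicator_coprime_eq_sum (M m : ℕ) (hM : M ≠ 0) :
    (if m.Coprime M then 1 else 0 : ℝ) =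
      ∑ e ∈ M.divisors, if e ∣ m then (ArithmeticFunction.moebius e : ℝ) else 0 := by
  rw [← Finset.sum_filter]
  have h1 : M.divisors.filter (fun e => e ∣ m) = (m.gcd M).divisors := by
    ext e
    simp only [Finset.mem_filter, Nat.mem_divisors, Nat.dvd_gcd_iff]
    have : m.gcd M ≠ 0 := (Nat.gcd_pos_of_pos_right _ (Nat.pos_of_ne_zero hM)).ne'
    tauto
  have h2 := ArithmeticFunction.coe_mul_zeta_apply (f := ArithmeticFunction.moebius) (x := m.gcd M)
  rw [ArithmeticFunction.moebius_mul_coe_zeta, ArithmeticFunction.one_apply] at h2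
  rw [h1, ← Int.cast_sum, ← h2]
  by_cases h : m.gcd M = 1
  · rw [if_pos h, if_pos h]; norm_num
  · rw [if_neg h, if_neg h]; norm_num

theorem prod_one_sub_inv_eq_sum {M : ℕ} (hM : Squarefree M) :
    ∏ p ∈ M.primeFactors, (1 - 1 / (p : ℝ)) =
      ∑ e ∈ M.divisors, (ArithmeticFunction.moebius e : ℝ) * (1 / (e : ℝ)) := by
  have h := ArithmeticFunction.IsMultiplicative.prodPrimeFactors_one_sub_of_squarefree
    (⟨fun n => 1 / (n : ℝ), by simp⟩ : ArithmeticFunction ℝ) ⟨by simp, fun {m n} _ => by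
      simp [mul_comm]⟩ hM
  exact h

/-- The coprimality condition is removed by a Möbius sum over the divisors of `M`. -/
theorem tsum_coprime_harmonicWeight {M : ℕ} (hM : M ≠ 0) {q : ℕ} (hq : 0 < q) {Y : ℝ} (hY : 0 < Y) :
    ∑' m : ℕ, (if m.Coprime M then 1 / (m : ℝ) * gammaWeight (q * (m : ℝ) ^ 2 / Y) else 0) =
      ∑ e ∈ M.divisors, (ArithmeticFunction.moebius e : ℝ) * (1 / (e : ℝ)) *
        harmonicWeight (Y / (q * (e : ℝ) ^ 2)) := by
  have hq' : (0 : ℝ) < q := by exact_mod_cast hq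
  set t : ℕ → ℝ := fun m => 1 / (m : ℝ) * gammaWeight (q * (m : ℝ) ^ 2 / Y) with ht
  have hts : Summable t := by
    refine (summable_harmonicWeight (show 0 < Y / q by positivity)).congr fun m => ?_
    rw [show (m : ℝ) ^ 2 / (Y / q) = q * (m : ℝ) ^ 2 / Y by field_simp]
  have h1 : ∀ m : ℕ, (if m.Coprime M then t m else 0) =
      ∑ e ∈ M.divisors, (ArithmeticFunction.moebius e : ℝ) * (if e ∣ m then t m else 0) := by
    intro m
    have := congrArg (· * t m) (indicator_coprime_eq_sum M m hM)
    simp only [ite_mul, one_mul, zero_mul, Finset.sum_mul] at this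
    rw [this]
    refine Finset.sum_congr rfl fun e _ => ?_
    split_ifs <;> simp
  have hse : ∀ e, Summable fun m : ℕ => if e ∣ m then t m else 0 := by
    intro e
    refine Summable.of_norm_bounded hts.norm fun m => ?_
    split_ifs
    · exact le_rfl
    · rw [norm_zero]; exact norm_nonneg _
  change ∑' m : ℕ, (if m.Coprime M then t m else 0) = _
  rw [tsum_congr h1, Summable.tsum_finsetSum fun e _ => (hse e).mul_left _]
  refine Finset.sum_congr rfl fun e he => ?_
  have he0 : 0 < e := Nat.pos_of_mem_divisors he
  have he0' : (0 : ℝ) < e := by exact_mod_cast he0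
  rw [tsum_mul_left, mul_assoc]
  congr 1
  have hinj : Function.Injective fun k : ℕ => e * k := fun a b h => Nat.eq_of_mul_eq_mul_left he0 h
  rw [harmonicWeight, ← tsum_mul_left, ← hinj.tsum_eq]
  · refine tsum_congr fun k => ?_
    rw [if_pos (Dvd.intro k rfl)]
    simp only [ht]
    push_cast
    rw [show (q : ℝ) * ((e : ℝ) * k) ^ 2 / Y = (k : ℝ) ^ 2 / (Y / (q * (e : ℝ) ^ 2)) by field_simp,
      ← one_div_mul_one_div, mul_assoc]
  · intro m hm
    rw [Function.mem_support] at hm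
    by_cases hd : e ∣ m
    · obtain ⟨k, rfl⟩ := hd
      exact ⟨k, rfl⟩
    · exact absurd (if_neg hd) hm

/-- The harmonic sum over `m` coprime to a square-free modulus. -/
theorem exists_abs_tsum_coprime_sub_le : ∃ C : ℝ, 0 < C ∧ ∀ M : ℕ, Squarefree M →
    ∀ q : ℕ, 0 < q → ∀ Y : ℝ, 1 ≤ Y →
    |∑' m : ℕ, (if m.Coprime M then 1 / (m : ℝ) * gammaWeight (q * (m : ℝ) ^ 2 / Y) else 0) -
      (∏ p ∈ M.primeFactors, (1 - 1 / (p : ℝ))) * (1 / 2 * Real.log Y)| ≤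
      C * (1 + Real.log q) * ∑ e ∈ M.divisors, (1 + Real.log e) / e := by
  obtain ⟨C, hC, h⟩ := exists_abs_harmonicWeight_sub_le
  refine ⟨C + 1, by positivity, fun M hM q hq Y hY => ?_⟩
  have hY0 : 0 < Y := by linarith
  have hq' : (1 : ℝ) ≤ q := by exact_mod_cast hq
  have hlq : 0 ≤ Real.log q := Real.log_natCast_nonneg q
  rw [tsum_coprime_harmonicWeight hM.ne_zero hq hY0, prod_one_sub_inv_eq_sum hM, Finset.sum_mul,
    ← Finset.sum_sub_distrib, Finset.mul_sum]
  refine (Finset.abs_sum_le_sum_abs _ _).trans (Finset.sum_le_sum fun e he => ?_)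
  have he0 : 0 < e := Nat.pos_of_mem_divisors he
  have he1 : (1 : ℝ) ≤ e := by exact_mod_cast he0
  have hle : 0 ≤ Real.log e := Real.log_natCast_nonneg e
  rw [← mul_sub, abs_mul, abs_mul]
  have h1 : |(ArithmeticFunction.moebius e : ℝ)| ≤ 1 := by
    exact_mod_cast ArithmeticFunction.abs_moebius_le_one
  have h2 := h (Y / (q * (e : ℝ) ^ 2)) (by positivity)
  -- the argument `Y / (q e²)` may be smaller than `1`, but then `log Y` is itself bounded by
  -- `log q + 2 log e`
  have h3 : |1 / 2 * max (Real.log (Y / (q * (e : ℝ) ^ 2))) 0 - 1 / 2 * Real.log Y| ≤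
      1 / 2 * Real.log q + Real.log e := by
    rw [Real.log_div (by positivity) (by positivity), Real.log_mul (by positivity) (by positivity),
      Real.log_pow]
    have hlY := Real.log_nonneg hY
    push_cast
    rw [abs_le]
    rcases le_total (Real.log Y - (Real.log q + 2 * Real.log e)) 0 with h | h
    · rw [max_eq_right h]
      constructor <;> linarith
    · rw [max_eq_left h]
      constructor <;> linarith
  have h4 := abs_add_le (harmonicWeight (Y / (q * (e : ℝ) ^ 2)) -
    1 / 2 * max (Real.log (Y / (q * (e : ℝ) ^ 2))) 0)
    (1 / 2 * max (Real.log (Y / (q * (e : ℝ) ^ 2))) 0 - 1 / 2 * Real.log Y)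
  rw [sub_add_sub_cancel] at h4
  have h5 : |harmonicWeight (Y / (q * (e : ℝ) ^ 2)) - 1 / 2 * Real.log Y| ≤
      (C + 1) * (1 + Real.log q) * (1 + Real.log e) := by
    have : 0 ≤ Real.log q * Real.log e := mul_nonneg hlq hle
    have h6 : 0 ≤ C * (Real.log q + Real.log e + Real.log q * Real.log e) := by positivity
    nlinarith
  calc _ ≤ 1 * (1 / (e : ℝ)) * ((C + 1) * (1 + Real.log q) * (1 + Real.log e)) := by
        rw [abs_of_nonneg (by positivity : 0 ≤ 1 / (e : ℝ))]
        gcongr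
    _ = _ := by ring

theorem chiZ_sq (d k : ℕ) : chiZ d k ^ 2 = if k.Coprime (2 * d) then 1 else 0 := by
  by_cases hk : Odd k
  · have : NeZero k := ⟨hk.pos.ne'⟩
    have h1 : k.Coprime (2 * d) ↔ Int.gcd ((8 * d : ℕ) : ℤ) k = 1 := by
      rw [Int.gcd_natCast_natCast, ← Nat.coprime_iff_gcd_eq_one, Nat.coprime_comm,
        Nat.coprime_mul_iff_left, Nat.coprime_mul_iff_left]
      have : Nat.Coprime 8 k := by
        rw [show 8 = 2 ^ 3 from rfl]
        exact (hk.coprime_two_left).pow_left 3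
      have h2 : Nat.Coprime 2 k := hk.coprime_two_left
      tauto
    rw [chiZ, if_pos hk]
    split_ifs with h
    · exact jacobiSym.sq_one (h1.1 h)
    · rw [jacobiSym.eq_zero_iff_not_coprime.2 fun hc => h (h1.2 hc)]
      norm_num
  · have : ¬ k.Coprime (2 * d) := by
      intro h
      exact hk (Nat.Coprime.coprime_mul_right_right h).odd_of_right
    rw [chiZ, if_neg hk, if_neg this]
    norm_num

open scoped Classical in
/-- The diagonal terms `n * l = □`, in terms of `n = oddKernel l * m²`. -/
theorem diagonal_eq (d : ℕ) {l : ℕ} (hl : l ≠ 0) (Y : ℝ) :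
    (l : ℝ) ^ (-(1 / 2) : ℝ) * ∑' n : ℕ, (if IsSquare (n * l) then (chiZ d (n * l) : ℝ) *
      ((n : ℝ) ^ (-(1 / 2) : ℝ) * gammaWeight (n / Y)) else 0) =
    if l.Coprime (2 * d) then 1 / (rootMul l : ℝ) * ∑' m : ℕ, (if m.Coprime (2 * d) then
      1 / (m : ℝ) * gammaWeight (oddKernel l * (m : ℝ) ^ 2 / Y) else 0) else 0 := by
  have hinj : Function.Injective fun m : ℕ => oddKernel l * m ^ 2 := fun a b h =>
    Nat.pow_left_injective two_ne_zero (Nat.eq_of_mul_eq_mul_left (oddKernel_pos hl) h)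
  rw [← hinj.tsum_eq, ← tsum_mul_left]
  · have hterm : ∀ m : ℕ, (l : ℝ) ^ (-(1 / 2) : ℝ) * (if IsSquare (oddKernel l * m ^ 2 * l) then
        (chiZ d (oddKernel l * m ^ 2 * l) : ℝ) * (((oddKernel l * m ^ 2 : ℕ) : ℝ) ^ (-(1 / 2) : ℝ) *
          gammaWeight (((oddKernel l * m ^ 2 : ℕ) : ℝ) / Y)) else 0) =
        if l.Coprime (2 * d) then 1 / (rootMul l : ℝ) * (if m.Coprime (2 * d) then
          1 / (m : ℝ) * gammaWeight (oddKernel l * (m : ℝ) ^ 2 / Y) else 0) else 0 := by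
      intro m
      have e : oddKernel l * m ^ 2 * l = (rootMul l * m) ^ 2 := by
        calc _ = (l * oddKernel l) * m ^ 2 := by ring
          _ = _ := by rw [mul_oddKernel]; ring
      have e2 : (l : ℝ) ^ (-(1 / 2) : ℝ) * ((oddKernel l * m ^ 2 : ℕ) : ℝ) ^ (-(1 / 2) : ℝ) =
          1 / (rootMul l : ℝ) * (1 / (m : ℝ)) := by
        rw [← Real.mul_rpow (by positivity) (by positivity)]
        have : (l : ℝ) * ((oddKernel l * m ^ 2 : ℕ) : ℝ) = ((rootMul l : ℝ) * m) ^ (2 : ℝ) := by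
          rw [Real.rpow_two]
          exact_mod_cast (by rw [← e]; ring : l * (oddKernel l * m ^ 2) = (rootMul l * m) ^ 2)
        rw [this, ← Real.rpow_mul (by positivity)]
        norm_num [Real.rpow_neg_one]
        ring
      rw [if_pos ((isSquare_mul_iff hl _).2 ⟨m, rfl⟩), e, chiZ_pow, chiZ_sq d _]
      have hiff : (rootMul l * m).Coprime (2 * d) ↔ l.Coprime (2 * d) ∧ m.Coprime (2 * d) := by
        rw [Nat.coprime_mul_iff_left, coprime_mul_iff_coprime_rootMul]
      have e3 : ((oddKernel l * m ^ 2 : ℕ) : ℝ) = oddKernel l * (m : ℝ) ^ 2 := by push_cast; ring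
      by_cases h1 : l.Coprime (2 * d)
      · by_cases h2 : m.Coprime (2 * d)
        · rw [if_pos (hiff.2 ⟨h1, h2⟩), if_pos h1, if_pos h2, Int.cast_one, one_mul, ← mul_assoc, e2,
            e3, mul_assoc]
        · rw [if_neg fun h => h2 (hiff.1 h).2, if_pos h1, if_neg h2]
          simp
      · rw [if_neg fun h => h1 (hiff.1 h).1, if_neg h1]
        simp
    rw [tsum_congr hterm]
    split_ifs
    · rw [tsum_mul_left]
    · exact tsum_zero
  · intro n hn
    rw [Function.mem_support] at hn
    by_cases hs : IsSquare (n * l)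
    · obtain ⟨m, hm⟩ := (isSquare_mul_iff hl n).1 hs
      exact ⟨m, hm.symm⟩
    · exact absurd (if_neg hs) hn

/-! ### The twisted first moment -/

/-- The value of `P_X⁻¹` at a discriminant, as a real Dirichlet series. -/
noncomputable def eulerInv (N d : ℕ) : ℝ :=
  ∑' l, eulerInvCoeff N l * ((chiZ d l : ℝ) * (l : ℝ) ^ (-(1 / 2) : ℝ))

/-- The error committed by cutting a Dirichlet series with coefficients dominated by those of
`P_X⁻¹` at `Z`. -/
theorem abs_tsum_sub_sum_le {η : ℝ} (hη : 0 < η) (hη4 : η ≤ 1 / 4) (N : ℕ) {Z : ℝ} (hZ : 0 < Z)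
    {f : ℕ → ℝ} (hf : ∀ l, |f l| ≤ |eulerInvCoeff N l| * (l : ℝ) ^ (-(1 / 2) : ℝ))
    (hfs : Summable f) :
    |∑' l, f l - ∑ l ∈ Finset.range (⌊Z⌋₊ + 1), f l| ≤
      Z ^ (-η) * Real.exp (100 * (N : ℝ) ^ (1 / 2 + η)) := by
  obtain ⟨hs, hle⟩ := tsum_eulerInvCoeff_rpow_le hη hη4 N
  rw [← hfs.sum_add_tsum_nat_add (⌊Z⌋₊ + 1), add_sub_cancel_left]
  set g : ℕ → ℝ := fun l => |eulerInvCoeff N l| * (l : ℝ) ^ (-(1 / 2 - η)) with hg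
  have hg0 : ∀ l, 0 ≤ g l := fun l => by positivity
  have hb : ∀ i, ‖f (i + (⌊Z⌋₊ + 1))‖ ≤ Z ^ (-η) * g (i + (⌊Z⌋₊ + 1)) := by
    intro i
    set l := i + (⌊Z⌋₊ + 1) with hl
    have hlZ : Z ≤ l := by
      have h1 := (Nat.lt_floor_add_one Z).le
      have h2 : ((⌊Z⌋₊ + 1 : ℕ) : ℝ) ≤ l := by exact_mod_cast Nat.le_add_left _ _
      push_cast at h2
      linarith
    have hl0 : (0 : ℝ) < l := hZ.trans_le hlZ
    refine (hf l).trans ?_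
    have h3 : (l : ℝ) ^ (-(1 / 2) : ℝ) = (l : ℝ) ^ (-η) * (l : ℝ) ^ (-(1 / 2 - η)) := by
      rw [← Real.rpow_add hl0]
      congr 1
      ring
    have h4 : (l : ℝ) ^ (-η) ≤ Z ^ (-η) := Real.rpow_le_rpow_of_nonpos hZ hlZ (by linarith)
    rw [h3, hg]
    calc _ ≤ |eulerInvCoeff N l| * (Z ^ (-η) * (l : ℝ) ^ (-(1 / 2 - η))) := by gcongr
      _ = _ := by ring
  have hs2 : Summable fun i => g (i + (⌊Z⌋₊ + 1)) := (summable_nat_add_iff _).2 hs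
  refine (tsum_of_norm_bounded (hs2.hasSum.mul_left _) hb).trans ?_
  have h5 : ∑' i, g (i + (⌊Z⌋₊ + 1)) ≤ ∑' l, g l := by
    rw [← hs.sum_add_tsum_nat_add (⌊Z⌋₊ + 1)]
    exact le_add_of_nonneg_left (Finset.sum_nonneg fun l _ => hg0 l)
  gcongr
  exact h5.trans hle

/-- Summing over the divisors of `2 * d`, on average over `d`. -/
theorem sum_sum_divisors_le {φ : ℕ → ℝ} (hφ : ∀ e, 0 ≤ φ e) (hs : Summable fun e : ℕ => φ e / e)
    {D : ℝ} (hD : 0 ≤ D) :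
    ∑ d ∈ oddSquarefree D, ∑ e ∈ (2 * d).divisors, φ e ≤ 2 * D * ∑' e : ℕ, φ e / e := by
  classical
  set M := ⌊D⌋₊ with hM
  have h1 : ∑ d ∈ oddSquarefree D, ∑ e ∈ (2 * d).divisors, φ e ≤
      ∑ k ∈ Finset.Ioc 0 (2 * M), ∑ e ∈ k.divisors, φ e := by
    have hinj : Set.InjOn (fun d : ℕ => 2 * d) (oddSquarefree D) := fun a _ b _ h =>
      Nat.eq_of_mul_eq_mul_left two_pos h
    rw [← Finset.sum_image (f := fun k => ∑ e ∈ k.divisors, φ e) hinj]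
    refine Finset.sum_le_sum_of_subset_of_nonneg (fun k hk => ?_) fun _ _ _ =>
      Finset.sum_nonneg fun e _ => hφ e
    obtain ⟨d, hd, rfl⟩ := Finset.mem_image.1 hk
    have := Finset.mem_Ioc.1 (Finset.mem_filter.1 hd).1
    simp only [Finset.mem_Ioc]
    omega
  have h2 : ∀ k ∈ Finset.Ioc 0 (2 * M), ∑ e ∈ k.divisors, φ e =
      ∑ e ∈ Finset.Ioc 0 (2 * M), if e ∣ k then φ e else 0 := by
    intro k hk
    have hk' := Finset.mem_Ioc.1 hk
    rw [← Finset.sum_filter]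
    refine Finset.sum_congr ?_ fun _ _ => rfl
    ext e
    simp only [Nat.mem_divisors, Finset.mem_filter, Finset.mem_Ioc]
    constructor
    · rintro ⟨h, _⟩
      exact ⟨⟨Nat.pos_of_dvd_of_pos h hk'.1, (Nat.le_of_dvd hk'.1 h).trans hk'.2⟩, h⟩
    · rintro ⟨_, h⟩
      exact ⟨h, by omega⟩
  refine h1.trans ?_
  rw [Finset.sum_congr rfl h2, Finset.sum_comm]
  have h3 : ∀ e ∈ Finset.Ioc 0 (2 * M), ∑ k ∈ Finset.Ioc 0 (2 * M), (if e ∣ k then φ e else 0) ≤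
      2 * D * (φ e / e) := by
    intro e _
    rw [← Finset.sum_filter, Finset.sum_const, Nat.Ioc_filter_dvd_card_eq_div, nsmul_eq_mul]
    have h4 : ((2 * M / e : ℕ) : ℝ) ≤ 2 * D / e := by
      refine Nat.cast_div_le.trans ?_
      have : (M : ℝ) ≤ D := Nat.floor_le hD
      push_cast
      gcongr
    calc _ ≤ 2 * D / e * φ e := mul_le_mul_of_nonneg_right h4 (hφ e)
      _ = _ := by ring
  refine (Finset.sum_le_sum h3).trans ?_
  rw [← Finset.mul_sum]
  gcongr
  exact hs.sum_le_tsum _ fun e _ => div_nonneg (hφ e) (Nat.cast_nonneg e)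

theorem summable_one_add_log_div_sq : Summable fun e : ℕ => (1 + Real.log e) / e / e := by
  have h1 : Summable fun e : ℕ => 1 / (e : ℝ) ^ 2 := Real.summable_one_div_nat_pow.2 (by norm_num)
  refine (h1.add (summable_log_div_sq.mul_left (1 / 2))).congr fun e => ?_
  rw [div_div, ← sq]
  ring

/-- The local density `∏_{p ∣ 2d} (1 - 1 / p)` of the diagonal. -/
noncomputable def coprimeDensity (d : ℕ) : ℝ := ∏ p ∈ (2 * d).primeFactors, (1 - 1 / (p : ℝ))

/-- The Euler product of the diagonal over primes not dividing `2 d`. -/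
noncomputable def diagProduct (N d : ℕ) : ℝ :=
  ∏ p ∈ (N + 1).primesBelow, if p ∣ 2 * d then 1 else diagFactor N p

theorem coprimeDensity_nonneg (d : ℕ) : 0 ≤ coprimeDensity d :=
  Finset.prod_nonneg fun p hp => by
    have := one_div_prime_le_half (Nat.prime_of_mem_primeFactors hp)
    linarith

theorem coprimeDensity_le_one (d : ℕ) : coprimeDensity d ≤ 1 :=
  Finset.prod_le_one (fun p hp => by
    have := one_div_prime_le_half (Nat.prime_of_mem_primeFactors hp)
    linarith) fun p _ => by
    have : 0 ≤ 1 / (p : ℝ) := by positivity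
    linarith

theorem squarefree_two_mul {D : ℝ} {d : ℕ} (hd : d ∈ oddSquarefree D) : Squarefree (2 * d) := by
  obtain ⟨_, ho, hsq⟩ := Finset.mem_filter.1 hd
  exact (Nat.squarefree_mul ho.coprime_two_left).2 ⟨Nat.prime_two.prime.squarefree, hsq⟩

theorem pos_and_le_of_mem_oddSquarefree {D : ℝ} (hD : 0 ≤ D) {d : ℕ} (hd : d ∈ oddSquarefree D) :
    (1 : ℝ) ≤ d ∧ (d : ℝ) ≤ D := by
  have := Finset.mem_Ioc.1 (Finset.mem_filter.1 hd).1
  exact ⟨by exact_mod_cast this.1, (Nat.cast_le.2 this.2).trans (Nat.floor_le hD)⟩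

/-- The diagonal contribution of one discriminant. -/
theorem exists_abs_sum_diagonal_le : ∃ C : ℝ, 0 < C ∧ ∀ (N : ℕ) (D : ℝ) (d : ℕ), 3 ≤ N → 0 ≤ D →
    d ∈ oddSquarefree D → ∀ L : ℕ,
    |∑ l ∈ Finset.range L, eulerInvCoeff N l * (if l.Coprime (2 * d) then
        1 / (rootMul l : ℝ) * ∑' m : ℕ, (if m.Coprime (2 * d) then 1 / (m : ℝ) *
          gammaWeight (oddKernel l * (m : ℝ) ^ 2 / Real.sqrt (8 * d)) else 0) else 0) -
      coprimeDensity d * (1 / 4 * Real.log (8 * d)) * ∑ l ∈ Finset.range L,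
        (if l.Coprime (2 * d) then eulerInvCoeff N l / rootMul l else 0 : ℝ)| ≤
      C * Real.log N ^ 17 * ∑ e ∈ (2 * d).divisors, (1 + Real.log e) / e := by
  obtain ⟨C₁, hC₁, h₁⟩ := exists_abs_tsum_coprime_sub_le
  obtain ⟨C₂, hC₂, h₂⟩ := exists_tsum_twoPowOdd_div_rootMul_le
  refine ⟨2 * C₁ * C₂, by positivity, fun N D d hN hD hd L => ?_⟩
  have hd1 := (pos_and_le_of_mem_oddSquarefree hD hd).1
  have hN3 : (3 : ℝ) ≤ N := by exact_mod_cast hN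
  have hlogN : 1 ≤ Real.log N := by
    rw [Real.le_log_iff_exp_le (by linarith)]
    have := Real.exp_one_lt_d9
    linarith
  obtain ⟨hs, hsle⟩ := h₂ N hN
  set E := ∑ e ∈ (2 * d).divisors, (1 + Real.log e) / e with hE
  have hE0 : 0 ≤ E := Finset.sum_nonneg fun e _ => by
    have := Real.log_natCast_nonneg e
    positivity
  have hY : 1 ≤ Real.sqrt (8 * d) := Real.one_le_sqrt.2 (by linarith)
  have hlogY : 1 / 2 * Real.log (Real.sqrt (8 * d)) = 1 / 4 * Real.log (8 * d) := by
    rw [Real.log_sqrt (by positivity)]; ring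
  rw [Finset.mul_sum, ← Finset.sum_sub_distrib]
  have hT0 : ∀ l, 0 ≤ twoPowOdd l := by
    intro l
    rw [twoPowOdd, multFun]
    split_ifs
    · exact le_rfl
    · exact Finset.prod_nonneg fun _ _ => by positivity
  -- the error for a single `l` involves `1 + log (oddKernel l)`, which is at most
  -- `(1 + log N) * twoPowOdd l`
  have hterm : ∀ l ∈ Finset.range L, |eulerInvCoeff N l * (if l.Coprime (2 * d) then
        1 / (rootMul l : ℝ) * ∑' m : ℕ, (if m.Coprime (2 * d) then 1 / (m : ℝ) *
          gammaWeight (oddKernel l * (m : ℝ) ^ 2 / Real.sqrt (8 * d)) else 0) else 0) -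
      coprimeDensity d * (1 / 4 * Real.log (8 * d)) *
        (if l.Coprime (2 * d) then eulerInvCoeff N l / rootMul l else 0 : ℝ)| ≤
      C₁ * E * (1 + Real.log N) * (|eulerInvCoeff N l| * twoPowOdd l / rootMul l) := by
    intro l _
    have hR : 0 ≤ C₁ * E * (1 + Real.log N) * (|eulerInvCoeff N l| * twoPowOdd l / rootMul l) := by
      have := hT0 l
      positivity
    by_cases h0 : eulerInvCoeff N l = 0
    · rw [h0]; simp
    have hl : l ≠ 0 := by rintro rfl; exact h0 (eulerInvCoeff_zero N)
    by_cases hco : l.Coprime (2 * d)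
    · rw [if_pos hco, if_pos hco]
      have h3 := h₁ (2 * d) (squarefree_two_mul hd) (oddKernel l) (oddKernel_pos hl) _ hY
      rw [hlogY] at h3
      have h4 : 1 + Real.log (oddKernel l) ≤ (1 + Real.log N) * twoPowOdd l :=
        one_add_log_oddKernel_le hl fun p hp hpl => by
          by_contra hcon
          exact h0 (eulerInvCoeff_eq_zero hp hpl (not_le.1 hcon))
      set S := ∑' m : ℕ, (if m.Coprime (2 * d) then 1 / (m : ℝ) *
          gammaWeight (oddKernel l * (m : ℝ) ^ 2 / Real.sqrt (8 * d)) else 0)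
      have e : eulerInvCoeff N l * (1 / (rootMul l : ℝ) * S) -
          coprimeDensity d * (1 / 4 * Real.log (8 * d)) * (eulerInvCoeff N l / rootMul l) =
          eulerInvCoeff N l / rootMul l * (S - coprimeDensity d * (1 / 4 * Real.log (8 * d))) := by
        ring
      rw [e, abs_mul, abs_div, Nat.abs_cast]
      calc _ ≤ |eulerInvCoeff N l| / rootMul l * (C₁ * ((1 + Real.log N) * twoPowOdd l) * E) := by
            gcongr
            exact h3.trans (by gcongr)
        _ = _ := by ring
    · rw [if_neg hco, if_neg hco]
      simpa using hR
  refine (Finset.abs_sum_le_sum_abs _ _).trans ((Finset.sum_le_sum hterm).trans ?_)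
  rw [← Finset.mul_sum]
  have h5 : ∑ l ∈ Finset.range L, |eulerInvCoeff N l| * twoPowOdd l / rootMul l ≤
      C₂ * Real.log N ^ 16 :=
    (hs.sum_le_tsum _ fun l _ => div_nonneg (mul_nonneg (abs_nonneg _) (hT0 l))
      (Nat.cast_nonneg _)).trans hsle
  have h6 : 1 + Real.log N ≤ 2 * Real.log N := by linarith
  calc _ ≤ C₁ * E * (1 + Real.log N) * (C₂ * Real.log N ^ 16) :=
        mul_le_mul_of_nonneg_left h5 (by positivity)
    _ ≤ C₁ * E * (2 * Real.log N) * (C₂ * Real.log N ^ 16) :=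
        mul_le_mul_of_nonneg_right (mul_le_mul_of_nonneg_left h6 (by positivity)) (by positivity)
    _ = _ := by ring

theorem exists_log_le_rpow {ε : ℝ} (hε : 0 < ε) : ∃ C : ℝ, 0 < C ∧ ∀ D : ℝ, 1 ≤ D →
    Real.log (8 * D) ≤ C * D ^ ε := by
  refine ⟨8 ^ ε / ε, by positivity, fun D hD => ?_⟩
  refine (Real.log_le_rpow_div (by positivity) hε).trans (le_of_eq ?_)
  rw [Real.mul_rpow (by norm_num) (by linarith)]
  ring

open scoped Classical in
/-- The product with `χ_{8d}(l)`, split according to whether `n * l` is a square. -/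
theorem smoothSum_mul_chiZ {d : ℕ} (hd : 0 < d) (l : ℕ) : smoothSum d * (chiZ d l : ℝ) =
    (∑' n : ℕ, if IsSquare (n * l) then (chiZ d (n * l) : ℝ) *
      ((n : ℝ) ^ (-(1 / 2) : ℝ) * gammaWeight (n / Real.sqrt (8 * d))) else 0) +
    ∑' n : ℕ, if IsSquare (n * l) then 0 else (chiZ d (n * l) : ℝ) *
      ((n : ℝ) ^ (-(1 / 2) : ℝ) * gammaWeight (n / Real.sqrt (8 * d))) := by
  have hs : Summable fun n : ℕ => (chiZ d (n * l) : ℝ) *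
      ((n : ℝ) ^ (-(1 / 2) : ℝ) * gammaWeight (n / Real.sqrt (8 * d))) := by
    refine ((summable_smoothSum hd).of_norm.mul_right (chiZ d l : ℝ)).congr fun n => ?_
    rw [chiZ_mul]
    push_cast
    ring
  rw [← Summable.tsum_add]
  · rw [smoothSum, ← tsum_mul_right]
    refine tsum_congr fun n => ?_
    rw [chiZ_mul]
    push_cast
    split_ifs <;> ring
  · refine Summable.of_norm_bounded hs.norm fun n => ?_
    split_ifs
    · exact le_rfl
    · rw [norm_zero]; exact norm_nonneg _
  · refine Summable.of_norm_bounded hs.norm fun n => ?_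
    split_ifs
    · rw [norm_zero]; exact norm_nonneg _
    · exact le_rfl

/-- The twisted first moment is its diagonal, up to admissible errors. -/
theorem exists_abs_moment_sub_le {η : ℝ} (hη : 0 < η) (hη4 : η ≤ 1 / 4) : ∃ C : ℝ, 0 < C ∧
    ∀ (N : ℕ) (D : ℝ), 3 ≤ N → 1 ≤ D →
    |∑ d ∈ oddSquarefree D, 2 * smoothSum d * eulerInv N d -
      1 / 2 * ∑ d ∈ oddSquarefree D, Real.log (8 * d) * (coprimeDensity d * diagProduct N d)| ≤
      C * (D ^ (1 - η / 128) * Real.exp (100 * (N : ℝ) ^ (1 / 2 + η)) + D ^ (31 / 32 : ℝ) +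
        D * Real.log N ^ 17) := by
  classical
  obtain ⟨C₁, hC₁, h₁⟩ := exists_sum_abs_smoothSum_le (show 0 < η / 128 by positivity)
  obtain ⟨C₂, hC₂, h₂⟩ := exists_abs_offDiagonal_le
  obtain ⟨C₃, hC₃, h₃⟩ := exists_abs_sum_diagonal_le
  obtain ⟨C₄, hC₄, h₄⟩ := exists_log_le_rpow (show 0 < η / 128 by positivity)
  set A := ∑' e : ℕ, (1 + Real.log e) / e / e with hA
  have hA0 : 0 ≤ A := tsum_nonneg fun e => by
    have := Real.log_natCast_nonneg e
    positivity
  refine ⟨2 * C₁ + C₄ + 4 * C₂ + 4 * C₃ * A, by positivity, fun N D hN hD => ?_⟩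
  have hD0 : 0 < D := by linarith
  have hN0 : (0 : ℝ) < N := by exact_mod_cast (by omega : 0 < N)
  have hlogN : 0 ≤ Real.log N := Real.log_natCast_nonneg N
  -- any small power of `D` will do for `Z`; the exponent has to be less than `3 / 64` on account of
  -- the off-diagonal bound `D ^ (61 / 64)` for each `l ≤ Z`
  set Z := D ^ (1 / 64 : ℝ) with hZdef
  have hZ1 : 1 ≤ Z := Real.one_le_rpow hD (by norm_num)
  have hZ0 : 0 < Z := by linarith
  set L := ⌊Z⌋₊ + 1 with hL
  set V := Real.exp (100 * (N : ℝ) ^ (1 / 2 + η)) with hV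
  set T := Z ^ (-η) * V with hT
  have hT0 : 0 < T := by positivity
  have hTD : T * D ^ (1 + η / 128) = D ^ (1 - η / 128) * V := by
    have e : D ^ (1 - η / 128) = D ^ (1 / 64 * -η) * D ^ (1 + η / 128) := by
      rw [← Real.rpow_add hD0]
      ring_nf
    rw [hT, hZdef, ← Real.rpow_mul hD0.le, e]
    ring
  set c : ℕ → ℝ := fun l => eulerInvCoeff N l * (l : ℝ) ^ (-(1 / 2) : ℝ) with hc
  -- cutting the Dirichlet series at `Z`
  have hcut : ∀ d, |eulerInv N d - ∑ l ∈ Finset.range L, c l * (chiZ d l : ℝ)| ≤ T := by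
    intro d
    have h := abs_tsum_sub_sum_le hη hη4 N hZ0 (f := fun l => eulerInvCoeff N l *
      ((chiZ d l : ℝ) * (l : ℝ) ^ (-(1 / 2) : ℝ))) (fun l => ?_) ?_
    · have e : ∑ l ∈ Finset.range L, c l * (chiZ d l : ℝ) = ∑ l ∈ Finset.range L,
          eulerInvCoeff N l * ((chiZ d l : ℝ) * (l : ℝ) ^ (-(1 / 2) : ℝ)) :=
        Finset.sum_congr rfl fun l _ => by simp only [hc]; ring
      rw [e]
      exact h
    · rw [abs_mul, abs_mul, abs_of_nonneg (by positivity : (0 : ℝ) ≤ (l : ℝ) ^ (-(1 / 2) : ℝ))]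
      have : |(chiZ d l : ℝ)| ≤ 1 := by exact_mod_cast abs_chiZ_le_one d l
      refine mul_le_mul_of_nonneg_left ?_ (abs_nonneg _)
      exact mul_le_of_le_one_left (by positivity) this
    · have := (summable_and_eulerPart_inv_eq_tsum N d).1.of_norm
      rwa [Nat.floor_natCast] at this
  have hE1 : |∑ d ∈ oddSquarefree D, 2 * smoothSum d * eulerInv N d -
      ∑ d ∈ oddSquarefree D, 2 * smoothSum d * ∑ l ∈ Finset.range L, c l * (chiZ d l : ℝ)| ≤
      2 * C₁ * (D ^ (1 - η / 128) * V) := by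
    rw [← Finset.sum_sub_distrib]
    have h : ∀ d ∈ oddSquarefree D, |2 * smoothSum d * eulerInv N d -
        2 * smoothSum d * ∑ l ∈ Finset.range L, c l * (chiZ d l : ℝ)| ≤ 2 * T * |smoothSum d| := by
      intro d _
      rw [← mul_sub, abs_mul, abs_mul, abs_two]
      calc _ ≤ 2 * |smoothSum d| * T := by
            gcongr
            exact hcut d
        _ = _ := by ring
    refine (Finset.abs_sum_le_sum_abs _ _).trans ((Finset.sum_le_sum h).trans ?_)
    rw [← Finset.mul_sum, ← hTD]
    calc _ ≤ 2 * T * (C₁ * D ^ (1 + η / 128)) := by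
          gcongr
          exact h₁ D hD
      _ = _ := by ring
  -- separating diagonal and off-diagonal terms
  set diag : ℕ → ℕ → ℝ := fun d l => ∑' n : ℕ, if IsSquare (n * l) then (chiZ d (n * l) : ℝ) *
      ((n : ℝ) ^ (-(1 / 2) : ℝ) * gammaWeight (n / Real.sqrt (8 * d))) else 0 with hdiag
  set off : ℕ → ℕ → ℝ := fun d l => ∑' n : ℕ, if IsSquare (n * l) then 0 else
      (chiZ d (n * l) : ℝ) *
      ((n : ℝ) ^ (-(1 / 2) : ℝ) * gammaWeight (n / Real.sqrt (8 * d))) with hoff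
  have hsplit : ∑ d ∈ oddSquarefree D, 2 * smoothSum d * ∑ l ∈ Finset.range L, c l * (chiZ d l : ℝ) =
      2 * ∑ d ∈ oddSquarefree D, ∑ l ∈ Finset.range L, c l * diag d l +
      2 * ∑ l ∈ Finset.range L, c l * ∑ d ∈ oddSquarefree D, off d l := by
    have e1 : ∑ l ∈ Finset.range L, c l * ∑ d ∈ oddSquarefree D, off d l =
        ∑ d ∈ oddSquarefree D, ∑ l ∈ Finset.range L, c l * off d l := by
      simp only [Finset.mul_sum]
      exact Finset.sum_comm
    rw [e1, ← mul_add, ← Finset.sum_add_distrib, Finset.mul_sum]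
    refine Finset.sum_congr rfl fun d hd => ?_
    rw [← Finset.sum_add_distrib, mul_assoc, Finset.mul_sum]
    congr 1
    refine Finset.sum_congr rfl fun l _ => ?_
    have hd0 := (Finset.mem_Ioc.1 (Finset.mem_filter.1 hd).1).1
    rw [mul_left_comm, smoothSum_mul_chiZ hd0 l, mul_add]
  have hE2 : |2 * ∑ l ∈ Finset.range L, c l * ∑ d ∈ oddSquarefree D, off d l| ≤
      4 * C₂ * D ^ (31 / 32 : ℝ) := by
    have h : ∀ l ∈ Finset.range L, |c l * ∑ d ∈ oddSquarefree D, off d l| ≤ C₂ * D ^ (61 / 64 : ℝ) := by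
      intro l _
      rcases Nat.eq_zero_or_pos l with rfl | hl
      · simp [hc, eulerInvCoeff_zero]
        positivity
      have hl1 : (1 : ℝ) ≤ l := by exact_mod_cast hl
      rw [abs_mul]
      have h5 : |c l| ≤ (l : ℝ) ^ (-(1 / 2) : ℝ) := by
        rw [hc]
        simp only
        rw [abs_mul, abs_of_nonneg (by positivity : (0 : ℝ) ≤ (l : ℝ) ^ (-(1 / 2) : ℝ))]
        exact mul_le_of_le_one_left (by positivity) (abs_eulerInvCoeff_le_one N l)
      have h6 : (l : ℝ) ^ (-(1 / 2) : ℝ) * (l : ℝ) ^ (1 / 4 : ℝ) ≤ 1 := by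
        rw [← Real.rpow_add (by linarith)]
        exact Real.rpow_le_one_of_one_le_of_nonpos hl1 (by norm_num)
      calc _ ≤ (l : ℝ) ^ (-(1 / 2) : ℝ) * (C₂ * D ^ (61 / 64 : ℝ) * (l : ℝ) ^ (1 / 4 : ℝ)) :=
            mul_le_mul h5 (h₂ l D hD) (abs_nonneg _) (by positivity)
        _ = C₂ * D ^ (61 / 64 : ℝ) * ((l : ℝ) ^ (-(1 / 2) : ℝ) * (l : ℝ) ^ (1 / 4 : ℝ)) := by ring
        _ ≤ _ := mul_le_of_le_one_right (by positivity) h6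
    rw [abs_mul, abs_two]
    have h7 := (Finset.abs_sum_le_sum_abs _ _).trans (Finset.sum_le_sum h)
    rw [Finset.sum_const, Finset.card_range, nsmul_eq_mul] at h7
    have h8 : (L : ℝ) ≤ 2 * Z := by
      rw [hL]
      push_cast
      have := Nat.floor_le hZ0.le
      linarith
    have h9 : Z * D ^ (61 / 64 : ℝ) = D ^ (31 / 32 : ℝ) := by
      rw [hZdef, ← Real.rpow_add hD0]
      norm_num
    calc _ ≤ 2 * ((L : ℝ) * (C₂ * D ^ (61 / 64 : ℝ))) := by gcongr
      _ ≤ 2 * (2 * Z * (C₂ * D ^ (61 / 64 : ℝ))) := by gcongr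
      _ = 4 * C₂ * (Z * D ^ (61 / 64 : ℝ)) := by ring
      _ = _ := by rw [h9]
  -- evaluating the diagonal
  set B : ℕ → ℝ := fun d => ∑ l ∈ Finset.range L,
    (if l.Coprime (2 * d) then eulerInvCoeff N l / rootMul l else 0 : ℝ) with hB
  have hE3 : |∑ d ∈ oddSquarefree D, ∑ l ∈ Finset.range L, c l * diag d l -
      ∑ d ∈ oddSquarefree D, coprimeDensity d * (1 / 4 * Real.log (8 * d)) * B d| ≤
      2 * C₃ * A * (D * Real.log N ^ 17) := by
    rw [← Finset.sum_sub_distrib]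
    have h : ∀ d ∈ oddSquarefree D, |∑ l ∈ Finset.range L, c l * diag d l -
        coprimeDensity d * (1 / 4 * Real.log (8 * d)) * B d| ≤
        C₃ * Real.log N ^ 17 * ∑ e ∈ (2 * d).divisors, (1 + Real.log e) / e := by
      intro d hd
      have e : ∑ l ∈ Finset.range L, c l * diag d l = ∑ l ∈ Finset.range L, eulerInvCoeff N l *
          (if l.Coprime (2 * d) then 1 / (rootMul l : ℝ) * ∑' m : ℕ, (if m.Coprime (2 * d) then
          1 / (m : ℝ) * gammaWeight (oddKernel l * (m : ℝ) ^ 2 / Real.sqrt (8 * d)) else 0)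
          else 0) := by
        refine Finset.sum_congr rfl fun l _ => ?_
        rcases eq_or_ne l 0 with rfl | hl
        · simp [hc, eulerInvCoeff_zero]
        · rw [← diagonal_eq d hl, hc, hdiag]
          ring
      rw [e]
      exact h₃ N D d hN hD0.le hd L
    refine (Finset.abs_sum_le_sum_abs _ _).trans ((Finset.sum_le_sum h).trans ?_)
    rw [← Finset.mul_sum]
    have h5 := sum_sum_divisors_le (φ := fun e => (1 + Real.log e) / e) (fun e => by
      have := Real.log_natCast_nonneg e
      positivity) summable_one_add_log_div_sq hD0.le
    calc _ ≤ C₃ * Real.log N ^ 17 * (2 * D * A) := by gcongr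
      _ = _ := by ring
  -- completing the sum over `l`, again by Rankin's bound, to obtain the Euler product
  have hE4 : |∑ d ∈ oddSquarefree D, coprimeDensity d * (1 / 4 * Real.log (8 * d)) * B d -
      1 / 4 * ∑ d ∈ oddSquarefree D, Real.log (8 * d) * (coprimeDensity d * diagProduct N d)| ≤
      1 / 4 * C₄ * (D ^ (1 - η / 128) * V) := by
    rw [Finset.mul_sum, ← Finset.sum_sub_distrib]
    have h : ∀ d ∈ oddSquarefree D, |coprimeDensity d * (1 / 4 * Real.log (8 * d)) * B d -
        1 / 4 * (Real.log (8 * d) * (coprimeDensity d * diagProduct N d))| ≤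
        1 / 4 * C₄ * (D ^ (η / 128) * T) := by
      intro d hd
      obtain ⟨hd1, hdD⟩ := pos_and_le_of_mem_oddSquarefree hD0.le hd
      have hprod := hasSum_eulerInvCoeff_div_rootMul N (2 * d)
      have htail := abs_tsum_sub_sum_le hη hη4 N hZ0
        (f := fun l => (if l.Coprime (2 * d) then eulerInvCoeff N l / rootMul l else 0 : ℝ))
        (fun l => by
          split_ifs
          · rcases eq_or_ne l 0 with rfl | hl
            · simp [eulerInvCoeff_zero]
            rw [abs_div, Nat.abs_cast, div_eq_mul_inv]
            have h6 := sqrt_le_rootMul hl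
            have h7 : (0 : ℝ) < Real.sqrt l := Real.sqrt_pos.2 (by positivity)
            rw [Real.rpow_neg (by positivity), ← Real.sqrt_eq_rpow]
            gcongr
          · rw [abs_zero]; positivity) hprod.1.of_norm
      rw [hprod.2.tsum_eq] at htail
      have hlog8 : 0 ≤ Real.log (8 * d) := Real.log_nonneg (by linarith)
      have hlog8' : Real.log (8 * d) ≤ C₄ * D ^ (η / 128) :=
        (Real.log_le_log (by positivity) (by linarith)).trans (h₄ D hD)
      have e : coprimeDensity d * (1 / 4 * Real.log (8 * d)) * B d -
          1 / 4 * (Real.log (8 * d) * (coprimeDensity d * diagProduct N d)) =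
          1 / 4 * (coprimeDensity d * Real.log (8 * d)) * (B d - diagProduct N d) := by ring
      rw [e, abs_mul, abs_of_nonneg (mul_nonneg (by norm_num)
        (mul_nonneg (coprimeDensity_nonneg d) hlog8)), abs_sub_comm]
      have h8 : coprimeDensity d * Real.log (8 * d) ≤ C₄ * D ^ (η / 128) :=
        (mul_le_of_le_one_left hlog8 (coprimeDensity_le_one d)).trans hlog8'
      calc _ ≤ 1 / 4 * (C₄ * D ^ (η / 128)) * T := by
            gcongr
            exact htail
        _ = _ := by ring
    refine (Finset.abs_sum_le_sum_abs _ _).trans ((Finset.sum_le_sum h).trans ?_)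
    rw [Finset.sum_const, nsmul_eq_mul]
    have hcard : ((oddSquarefree D).card : ℝ) ≤ D := by
      have h5 : (oddSquarefree D).card ≤ ⌊D⌋₊ := by
        refine (Finset.card_filter_le _ _).trans ?_
        rw [Nat.card_Ioc, tsub_zero]
      exact (Nat.cast_le.2 h5).trans (Nat.floor_le hD0.le)
    rw [← hTD, Real.rpow_add hD0, Real.rpow_one]
    calc _ ≤ D * (1 / 4 * C₄ * (D ^ (η / 128) * T)) := by gcongr
      _ = _ := by ring
  rw [hsplit] at hE1
  set M1 := ∑ d ∈ oddSquarefree D, 2 * smoothSum d * eulerInv N d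
  set M2 := ∑ d ∈ oddSquarefree D, ∑ l ∈ Finset.range L, c l * diag d l
  set M3 := ∑ d ∈ oddSquarefree D, coprimeDensity d * (1 / 4 * Real.log (8 * d)) * B d
  set M4 := ∑ d ∈ oddSquarefree D, Real.log (8 * d) * (coprimeDensity d * diagProduct N d)
  set O := ∑ l ∈ Finset.range L, c l * ∑ d ∈ oddSquarefree D, off d l
  have hP1 : 0 ≤ D ^ (1 - η / 128) * V := by positivity
  have hP2 : 0 ≤ D ^ (31 / 32 : ℝ) := by positivity
  have hP3 : 0 ≤ D * Real.log N ^ 17 := by positivity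
  have hfin : |M1 - 1 / 2 * M4| ≤ 2 * C₁ * (D ^ (1 - η / 128) * V) + 4 * C₂ * D ^ (31 / 32 : ℝ) +
      2 * (2 * C₃ * A * (D * Real.log N ^ 17)) + 2 * (1 / 4 * C₄ * (D ^ (1 - η / 128) * V)) := by
    rw [abs_le] at hE1 hE2 hE3 hE4 ⊢
    constructor <;> linarith [hE1.1, hE1.2, hE2.1, hE2.2, hE3.1, hE3.2, hE4.1, hE4.2]
  refine hfin.trans ?_
  have q1 : 0 ≤ C₁ * D ^ (31 / 32 : ℝ) := by positivity
  have q2 : 0 ≤ C₁ * (D * Real.log N ^ 17) := by positivity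
  have q3 : 0 ≤ C₂ * (D ^ (1 - η / 128) * V) := by positivity
  have q4 : 0 ≤ C₂ * (D * Real.log N ^ 17) := by positivity
  have q5 : 0 ≤ C₃ * A * (D ^ (1 - η / 128) * V) := by positivity
  have q6 : 0 ≤ C₃ * A * D ^ (31 / 32 : ℝ) := by positivity
  have q7 : 0 ≤ C₄ * D ^ (31 / 32 : ℝ) := by positivity
  have q8 : 0 ≤ C₄ * (D * Real.log N ^ 17) := by positivity
  have q9 : 0 ≤ C₄ * (D ^ (1 - η / 128) * V) := by positivity
  nlinarith

/-! ### The average of the main term -/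

/-- The product of the model factors over the primes up to `N`. -/
noncomputable def modelProduct (N : ℕ) : ℝ := ∏ p ∈ (N + 1).primesBelow, modelFactor N p

theorem modelFactor_le_one (N : ℕ) {p : ℕ} (hp : p.Prime) : modelFactor N p ≤ 1 := by
  have h := one_div_prime_le_half hp
  have h0 : 0 ≤ 1 / (p : ℝ) := by positivity
  rw [modelFactor]
  split_ifs
  · linarith
  · exact Real.sqrt_le_one.2 (by linarith)

theorem modelProduct_pos (N : ℕ) : 0 < modelProduct N :=
  Finset.prod_pos fun p hp => by
    have := half_le_modelFactor N (Nat.prime_of_mem_primesBelow hp)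
    linarith

theorem modelProduct_le_one (N : ℕ) : modelProduct N ≤ 1 :=
  Finset.prod_le_one (fun p hp => by
    have := half_le_modelFactor N (Nat.prime_of_mem_primesBelow hp)
    linarith) fun p hp => modelFactor_le_one N (Nat.prime_of_mem_primesBelow hp)

/-- For `κ ≤ 1` a product of factors within `κ x_i` of `1` still gains a factor `κ`. -/
theorem abs_prod_sub_one_le {ι : Type*} (s : Finset ι) {u x : ι → ℝ} {κ : ℝ}
    (hκ1 : κ ≤ 1) (hx : ∀ i ∈ s, 0 ≤ x i) (hu : ∀ i ∈ s, |u i - 1| ≤ κ * x i) :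
    |∏ i ∈ s, u i - 1| ≤ κ * (∏ i ∈ s, (1 + x i) - 1) := by
  classical
  induction s using Finset.induction_on with
  | empty => simp
  | insert a s ha ih =>
    have ih := ih (fun i hi => hx i (Finset.mem_insert_of_mem hi))
      fun i hi => hu i (Finset.mem_insert_of_mem hi)
    have hxa := hx a (Finset.mem_insert_self a s)
    have hua := hu a (Finset.mem_insert_self a s)
    rw [Finset.prod_insert ha, Finset.prod_insert ha]
    set P := ∏ i ∈ s, (1 + x i)
    set U := ∏ i ∈ s, u i
    have hua' : |u a| ≤ 1 + x a := by
      have h1 := abs_add_le (u a - 1) 1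
      rw [sub_add_cancel, abs_one] at h1
      nlinarith
    have e : u a * U - 1 = u a * (U - 1) + (u a - 1) := by ring
    rw [e]
    calc _ ≤ |u a| * |U - 1| + |u a - 1| := by
          rw [← abs_mul]
          exact abs_add_le _ _
      _ ≤ (1 + x a) * (κ * (P - 1)) + κ * x a :=
          add_le_add (mul_le_mul hua' ih (abs_nonneg _) (by linarith)) hua
      _ = _ := by ring

/-- Comparison with the model product, prime by prime; the second product corrects the primes
dividing `2d`, which do not occur in `diagProduct`. -/
theorem coprimeDensity_mul_diagProduct (N : ℕ) {d : ℕ} (hd : d ≠ 0) :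
    coprimeDensity d * diagProduct N d = modelProduct N *
      ((∏ p ∈ (N + 1).primesBelow, if p ∣ 2 * d then 1 else diagFactor N p / modelFactor N p) *
        ∏ p ∈ (2 * d).primeFactors, (1 - 1 / (p : ℝ)) / (if p ≤ N then modelFactor N p else 1)) := by
  have h1 : ∏ p ∈ (2 * d).primeFactors, (if p ≤ N then modelFactor N p else 1) =
      ∏ p ∈ (N + 1).primesBelow, if p ∣ 2 * d then modelFactor N p else 1 := by
    rw [← Finset.prod_filter, ← Finset.prod_filter]
    refine Finset.prod_congr ?_ fun _ _ => rfl
    ext p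
    simp only [Finset.mem_filter, Nat.mem_primeFactors, Nat.mem_primesBelow, Nat.lt_succ_iff]
    have : 2 * d ≠ 0 := by omega
    tauto
  have h2 : diagProduct N d * ∏ p ∈ (N + 1).primesBelow, (if p ∣ 2 * d then modelFactor N p else 1) =
      modelProduct N *
        ∏ p ∈ (N + 1).primesBelow, if p ∣ 2 * d then 1 else diagFactor N p / modelFactor N p := by
    rw [diagProduct, modelProduct, ← Finset.prod_mul_distrib, ← Finset.prod_mul_distrib]
    refine Finset.prod_congr rfl fun p hp => ?_
    have := half_le_modelFactor N (Nat.prime_of_mem_primesBelow hp)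
    have h0 : modelFactor N p ≠ 0 := by linarith
    split_ifs
    · ring
    · field_simp
  have h3 : ∏ p ∈ (2 * d).primeFactors, (if p ≤ N then modelFactor N p else 1) ≠ 0 :=
    Finset.prod_ne_zero_iff.2 fun p hp => by
      have := half_le_modelFactor N (Nat.prime_of_mem_primeFactors hp)
      split_ifs
      · linarith
      · exact one_ne_zero
  rw [Finset.prod_div_distrib, ← coprimeDensity, ← mul_assoc, ← h2, ← h1]
  field_simp

theorem summable_rpow_neg_three_div_two : Summable fun n : ℕ => (n : ℝ) ^ (-(3 / 2) : ℝ) :=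
  Real.summable_nat_rpow.2 (by norm_num)

theorem prod_one_add_rpow_eq_sum {M : ℕ} (hM : Squarefree M) :
    ∏ p ∈ M.primeFactors, (1 + (p : ℝ) ^ (-(3 / 4) : ℝ)) =
      ∑ e ∈ M.divisors, (e : ℝ) ^ (-(3 / 4) : ℝ) :=
  ArithmeticFunction.IsMultiplicative.prodPrimeFactors_one_add_of_squarefree
    (f := (⟨fun n => (n : ℝ) ^ (-(3 / 4) : ℝ), by simp⟩ : ArithmeticFunction ℝ))
    ⟨by simp, fun {m n} _ => by
      simp [Real.mul_rpow (Nat.cast_nonneg m) (Nat.cast_nonneg n)]⟩ hM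

/-- The Euler product attached to `d` is close to the model product, with an error that is small
on average over `d`. -/
theorem exists_abs_coprimeDensity_mul_diagProduct_sub_le : ∃ C : ℝ, 0 < C ∧
    ∀ (N : ℕ) (d : ℕ), 0 < N → Squarefree (2 * d) →
    |coprimeDensity d * diagProduct N d - modelProduct N| ≤
      C * modelProduct N * (N : ℝ) ^ (-(1 / 8) : ℝ) *
        ∑ e ∈ (2 * d).divisors, (e : ℝ) ^ (-(3 / 4) : ℝ) := by
  set A := Real.exp (∑' n : ℕ, 18 * (n : ℝ) ^ (-(3 / 2) : ℝ)) with hA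
  refine ⟨A, Real.exp_pos _, fun N d hN hsq => ?_⟩
  have hd : d ≠ 0 := by rintro rfl; exact not_squarefree_zero hsq
  have hN1 : (1 : ℝ) ≤ N := by exact_mod_cast hN
  rw [coprimeDensity_mul_diagProduct N hd]
  set κ := (N : ℝ) ^ (-(1 / 8) : ℝ) with hκ
  have hκ0 : 0 ≤ κ := by positivity
  have hκ1 : κ ≤ 1 := Real.rpow_le_one_of_one_le_of_nonpos hN1 (by norm_num)
  -- `U` and `V` are the two products of `coprimeDensity_mul_diagProduct`; both are within `O(κ S)`
  -- of `1`, where `S` is the divisor sum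
  set U := ∏ p ∈ (N + 1).primesBelow,
    if p ∣ 2 * d then 1 else diagFactor N p / modelFactor N p with hU
  set V := ∏ p ∈ (2 * d).primeFactors,
    (1 - 1 / (p : ℝ)) / (if p ≤ N then modelFactor N p else 1) with hV
  set S := ∑ e ∈ (2 * d).divisors, (e : ℝ) ^ (-(3 / 4) : ℝ) with hS
  set P := ∏ p ∈ (N + 1).primesBelow, (1 + 18 * (p : ℝ) ^ (-(3 / 2) : ℝ)) with hP
  have hUle : |U - 1| ≤ κ * (P - 1) := by
    refine abs_prod_sub_one_le _ hκ1 (fun p _ => by positivity) fun p hp => ?_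
    split_ifs
    · rw [sub_self, abs_zero]; positivity
    · refine (abs_diagFactor_div_sub_one_le (Nat.prime_of_mem_primesBelow hp)
        (Nat.lt_succ_iff.1 (Nat.mem_primesBelow.1 hp).1)).trans (le_of_eq ?_)
      ring
  have hVle : |V - 1| ≤ κ * (S - 1) := by
    rw [hS, ← prod_one_add_rpow_eq_sum hsq]
    exact abs_prod_sub_one_le _ hκ1 (fun p _ => by positivity) fun p hp =>
      abs_one_sub_inv_div_sub_one_le (Nat.prime_of_mem_primeFactors hp) hN
  have hPA : P ≤ A := by
    rw [hA]
    calc P ≤ ∏ p ∈ (N + 1).primesBelow, Real.exp (18 * (p : ℝ) ^ (-(3 / 2) : ℝ)) :=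
          Finset.prod_le_prod (fun p _ => by positivity) fun p _ => by
            rw [add_comm]
            exact Real.add_one_le_exp _
      _ = Real.exp (∑ p ∈ (N + 1).primesBelow, 18 * (p : ℝ) ^ (-(3 / 2) : ℝ)) :=
          (Real.exp_sum _ _).symm
      _ ≤ _ := Real.exp_le_exp.2 ((summable_rpow_neg_three_div_two.mul_left 18).sum_le_tsum _
          fun n _ => by positivity)
  have hS0 : 0 ≤ S := Finset.sum_nonneg fun e _ => by positivity
  have hV' : |V| ≤ S := by
    have h1 := abs_add_le (V - 1) 1
    rw [sub_add_cancel, abs_one] at h1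
    have h2 : 0 ≤ S - 1 := by
      rw [hS, ← prod_one_add_rpow_eq_sum hsq]
      have : (1 : ℝ) ≤ ∏ p ∈ (2 * d).primeFactors, (1 + (p : ℝ) ^ (-(3 / 4) : ℝ)) :=
        Finset.one_le_prod fun p _ => by
          have : (0 : ℝ) ≤ (p : ℝ) ^ (-(3 / 4) : ℝ) := by positivity
          linarith
      linarith
    nlinarith
  have hG := modelProduct_pos N
  rw [← mul_sub_one, abs_mul, abs_of_pos hG]
  have e : U * V - 1 = (U - 1) * V + (V - 1) := by ring
  have h1 : |U * V - 1| ≤ κ * (P - 1) * S + κ * (S - 1) := by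
    rw [e]
    refine (abs_add_le _ _).trans (add_le_add ?_ hVle)
    rw [abs_mul]
    exact mul_le_mul hUle hV' (abs_nonneg _) ((abs_nonneg _).trans hUle)
  have h2 : |U * V - 1| ≤ A * κ * S := by
    have h3 : κ * S * P ≤ κ * S * A := mul_le_mul_of_nonneg_left hPA (by positivity)
    nlinarith
  calc _ ≤ modelProduct N * (A * κ * S) := by gcongr
    _ = _ := by ring

/-- The logarithms of the discriminants up to `D` are close to `log D` on average, by Stirling's
formula for the sum over all `d ≤ D`. -/
theorem sum_log_sub_log_le {D : ℝ} (hD : 1 ≤ D) :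
    ∑ d ∈ oddSquarefree D, (Real.log D - Real.log d) ≤ 2 * D := by
  classical
  have hD0 : 0 < D := by linarith
  have hM1 : 1 ≤ ⌊D⌋₊ := Nat.le_floor (by exact_mod_cast hD)
  set M := ⌊D⌋₊ with hM
  have hM0 : (1 : ℝ) ≤ M := by exact_mod_cast hM1
  have hMD : (M : ℝ) ≤ D := Nat.floor_le hD0.le
  have hDM : D < M + 1 := Nat.lt_floor_add_one D
  have hsub : oddSquarefree D ⊆ Finset.Ioc 0 M := Finset.filter_subset _ _
  have h1 : ∑ d ∈ oddSquarefree D, (Real.log D - Real.log d) ≤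
      ∑ d ∈ Finset.Ioc 0 M, (Real.log D - Real.log d) :=
    Finset.sum_le_sum_of_subset_of_nonneg hsub fun d hd _ => by
      have hd' := Finset.mem_Ioc.1 hd
      have h2 : (d : ℝ) ≤ M := by exact_mod_cast hd'.2
      exact sub_nonneg.2 (Real.log_le_log (by exact_mod_cast hd'.1) (h2.trans hMD))
  have h2 : ∑ d ∈ Finset.Ioc 0 M, Real.log (d : ℝ) = Real.log (M.factorial) := by
    have h3 : Finset.Ioc 0 M = Finset.Ico 1 (M + 1) := by
      ext d
      simp only [Finset.mem_Ioc, Finset.mem_Ico]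
      omega
    rw [← Finset.prod_Ico_id_eq_factorial, Nat.cast_prod, h3, Real.log_prod]
    intro i hi
    have := (Finset.mem_Ico.1 hi).1
    positivity
  have h3 := Stirling.le_log_factorial_stirling (n := M) (by omega)
  have h4 : 0 ≤ Real.log (2 * Real.pi) := Real.log_nonneg (by linarith [Real.pi_gt_three])
  have h5 : 0 ≤ Real.log M := Real.log_nonneg hM0
  have h6 : Real.log D - Real.log M ≤ D / M - 1 := by
    rw [← Real.log_div (by positivity) (by positivity)]
    exact Real.log_le_sub_one_of_pos (by positivity)
  have h7 : M * (Real.log D - Real.log M) ≤ D - M := by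
    calc _ ≤ M * (D / M - 1) := by gcongr
      _ = _ := by field_simp
  refine h1.trans ?_
  rw [Finset.sum_sub_distrib, h2, Finset.sum_const, Nat.card_Ioc, nsmul_eq_mul, Nat.sub_zero]
  linarith

/-- The main term, averaged over the discriminants. -/
theorem exists_abs_sum_main_sub_le : ∃ C : ℝ, 0 < C ∧ ∀ (N : ℕ) (D : ℝ), 0 < N → 1 ≤ D →
    |∑ d ∈ oddSquarefree D, Real.log (8 * d) * (coprimeDensity d * diagProduct N d) -
      modelProduct N * ((oddSquarefree D).card * Real.log D)| ≤
      C * (modelProduct N * (D + D * ((N : ℝ) ^ (-(1 / 8) : ℝ) * Real.log (8 * D)))) := by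
  obtain ⟨C, hC, h⟩ := exists_abs_coprimeDensity_mul_diagProduct_sub_le
  set A := ∑' e : ℕ, (e : ℝ) ^ (-(3 / 4) : ℝ) / e with hA
  have hA0 : 0 ≤ A := tsum_nonneg fun e => by positivity
  have hAs : Summable fun e : ℕ => (e : ℝ) ^ (-(3 / 4) : ℝ) / e := by
    refine (Real.summable_nat_rpow.2 (show (-(7 / 4) : ℝ) < -1 by norm_num)).congr fun e => ?_
    rcases Nat.eq_zero_or_pos e with rfl | he
    · rw [Nat.cast_zero, Real.zero_rpow (by norm_num), div_zero]
    · have he0 : (0 : ℝ) < e := by exact_mod_cast he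
      rw [← Real.rpow_sub_one he0.ne']
      norm_num
  refine ⟨2 * C * A + 10, by positivity, fun N D hN hD => ?_⟩
  have hD0 : 0 < D := by linarith
  have hG := modelProduct_pos N
  set G := modelProduct N
  set κ := (N : ℝ) ^ (-(1 / 8) : ℝ) with hκ
  have hκ0 : 0 ≤ κ := by positivity
  have hlog8D : 0 ≤ Real.log (8 * D) := Real.log_nonneg (by linarith)
  have hlog : ∀ d ∈ oddSquarefree D, 0 ≤ Real.log (8 * d) ∧ Real.log (8 * d) ≤ Real.log (8 * D) := by
    intro d hd
    obtain ⟨h1, h2⟩ := pos_and_le_of_mem_oddSquarefree hD0.le hd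
    exact ⟨Real.log_nonneg (by linarith), Real.log_le_log (by linarith) (by linarith)⟩
  -- replace the Euler product attached to `d` by the model product
  have hE1 : |∑ d ∈ oddSquarefree D, Real.log (8 * d) * (coprimeDensity d * diagProduct N d) -
      G * ∑ d ∈ oddSquarefree D, Real.log (8 * d)| ≤
      2 * C * A * (G * (D * (κ * Real.log (8 * D)))) := by
    rw [Finset.mul_sum, ← Finset.sum_sub_distrib]
    have h1 : ∀ d ∈ oddSquarefree D, |Real.log (8 * d) * (coprimeDensity d * diagProduct N d) -
        G * Real.log (8 * d)| ≤ Real.log (8 * D) * (C * G * κ) *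
          ∑ e ∈ (2 * d).divisors, (e : ℝ) ^ (-(3 / 4) : ℝ) := by
      intro d hd
      obtain ⟨h2, h3⟩ := hlog d hd
      rw [mul_comm G, ← mul_sub, abs_mul, abs_of_nonneg h2, mul_assoc]
      exact mul_le_mul h3 (h N d hN (squarefree_two_mul hd)) (abs_nonneg _) hlog8D
    refine (Finset.abs_sum_le_sum_abs _ _).trans ((Finset.sum_le_sum h1).trans ?_)
    rw [← Finset.mul_sum]
    calc _ ≤ Real.log (8 * D) * (C * G * κ) * (2 * D * A) := by
          gcongr
          exact sum_sum_divisors_le (fun e => by positivity) hAs hD0.le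
      _ = _ := by ring
  have hcard : ((oddSquarefree D).card : ℝ) ≤ D := by
    have h1 : (oddSquarefree D).card ≤ ⌊D⌋₊ := by
      refine (Finset.card_filter_le _ _).trans ?_
      rw [Nat.card_Ioc, Nat.sub_zero]
    exact (Nat.cast_le.2 h1).trans (Nat.floor_le hD0.le)
  -- replace `log (8 d)` by `log D`
  have hE2 : |∑ d ∈ oddSquarefree D, Real.log (8 * d) - (oddSquarefree D).card * Real.log D| ≤
      10 * D := by
    have e : ∑ d ∈ oddSquarefree D, Real.log (8 * d) - (oddSquarefree D).card * Real.log D =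
        (oddSquarefree D).card * Real.log 8 -
          ∑ d ∈ oddSquarefree D, (Real.log D - Real.log d) := by
      have h1 : ∑ d ∈ oddSquarefree D, Real.log (8 * d) =
          ∑ d ∈ oddSquarefree D, (Real.log 8 + Real.log d) :=
        Finset.sum_congr rfl fun d hd => by
          have := (pos_and_le_of_mem_oddSquarefree hD0.le hd).1
          exact Real.log_mul (by norm_num) (by linarith)
      rw [h1, Finset.sum_add_distrib, Finset.sum_sub_distrib, Finset.sum_const, Finset.sum_const,
        nsmul_eq_mul, nsmul_eq_mul]
      ring
    have h8 : 0 ≤ Real.log 8 := Real.log_nonneg (by norm_num)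
    have h8' : Real.log 8 ≤ 7 := by
      have := Real.log_le_sub_one_of_pos (show (0 : ℝ) < 8 by norm_num)
      linarith
    have h1 := sum_log_sub_log_le hD
    have h2 : 0 ≤ ∑ d ∈ oddSquarefree D, (Real.log D - Real.log d) :=
      Finset.sum_nonneg fun d hd => by
        obtain ⟨h1, h2⟩ := pos_and_le_of_mem_oddSquarefree hD0.le hd
        exact sub_nonneg.2 (Real.log_le_log (by linarith) h2)
    have h3 : ((oddSquarefree D).card : ℝ) * Real.log 8 ≤ D * 7 :=
      mul_le_mul hcard h8' h8 hD0.le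
    have h4 : 0 ≤ ((oddSquarefree D).card : ℝ) * Real.log 8 := by positivity
    rw [e, abs_le]
    constructor <;> linarith
  have hE3 : |G * ∑ d ∈ oddSquarefree D, Real.log (8 * d) -
      G * ((oddSquarefree D).card * Real.log D)| ≤ 10 * (G * D) := by
    rw [← mul_sub, abs_mul, abs_of_pos hG]
    calc _ ≤ G * (10 * D) := by gcongr
      _ = _ := by ring
  refine (abs_sub_le _ (G * ∑ d ∈ oddSquarefree D, Real.log (8 * d)) _).trans
    ((add_le_add hE1 hE3).trans ?_)
  have hx : 0 ≤ G * (D * (κ * Real.log (8 * D))) := by positivity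
  have hy : 0 ≤ G * D := by positivity
  have hCA : 0 ≤ C * A := by positivity
  nlinarith [mul_nonneg hCA hy]

/-- Primes up to `√X` contribute `(1 - 1/p)²` to the square, and the others `1 - 1/p`. -/
theorem modelProduct_sq (X : ℝ) (hX : 0 ≤ X) : modelProduct ⌊X⌋₊ ^ 2 =
    (∏ p ∈ (⌊X⌋₊ + 1).primesBelow, (1 - 1 / (p : ℝ))) *
      ∏ p ∈ (⌊Real.sqrt X⌋₊ + 1).primesBelow, (1 - 1 / (p : ℝ)) := by
  have hiff : ∀ p : ℕ, p ^ 2 ≤ ⌊X⌋₊ ↔ p ≤ ⌊Real.sqrt X⌋₊ := by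
    intro p
    rw [Nat.le_floor_iff hX, Nat.le_floor_iff (Real.sqrt_nonneg X), Nat.cast_pow,
      Real.le_sqrt (Nat.cast_nonneg p) hX]
  have h1 : ∏ p ∈ (⌊Real.sqrt X⌋₊ + 1).primesBelow, (1 - 1 / (p : ℝ)) =
      ∏ p ∈ (⌊X⌋₊ + 1).primesBelow, if p ^ 2 ≤ ⌊X⌋₊ then 1 - 1 / (p : ℝ) else 1 := by
    rw [← Finset.prod_filter]
    refine Finset.prod_congr ?_ fun _ _ => rfl
    ext p
    simp only [Finset.mem_filter, Nat.mem_primesBelow, Nat.lt_succ_iff, hiff]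
    constructor
    · rintro ⟨h, hp⟩
      exact ⟨⟨(Nat.le_self_pow two_ne_zero p).trans ((hiff p).2 h), hp⟩, h⟩
    · rintro ⟨⟨_, hp⟩, h⟩
      exact ⟨h, hp⟩
  rw [h1, modelProduct, ← Finset.prod_pow, ← Finset.prod_mul_distrib]
  refine Finset.prod_congr rfl fun p hp => ?_
  have := one_div_prime_le_half (Nat.prime_of_mem_primesBelow hp)
  rw [modelFactor]
  split_ifs
  · ring
  · rw [Real.sq_sqrt (by linarith), mul_one]

/-- The asymptotics of the model product. The primes above `√X` contribute only the square root of
their Mertens factor, which is the source of the constant `√2`. -/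
theorem tendsto_modelProduct_mul_log : Tendsto (fun X : ℝ => modelProduct ⌊X⌋₊ * Real.log X) atTop
    (nhds (Real.sqrt 2 * Real.exp (-Real.eulerMascheroniConstant))) := by
  have h1 := tendsto_prod_one_sub_inv_mul_log
  have h2 := h1.comp Real.tendsto_sqrt_atTop
  have h3 := ((h1.mul h2).const_mul 2).sqrt
  have e : Real.sqrt (2 * (Real.exp (-Real.eulerMascheroniConstant) *
      Real.exp (-Real.eulerMascheroniConstant))) =
      Real.sqrt 2 * Real.exp (-Real.eulerMascheroniConstant) := by
    rw [Real.sqrt_mul (by norm_num), Real.sqrt_mul_self (Real.exp_pos _).le]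
  rw [e] at h3
  refine h3.congr' ?_
  filter_upwards [eventually_ge_atTop 1] with X hX
  have hlog : 0 ≤ Real.log X := Real.log_nonneg hX
  rw [← Real.sqrt_sq (mul_nonneg (modelProduct_pos ⌊X⌋₊).le hlog), mul_pow,
    modelProduct_sq X (by linarith)]
  congr 1
  simp only [Function.comp_apply]
  rw [Real.log_sqrt (by linarith)]
  ring

/-! ### The asymptotic formula -/

/-- The average in terms of real quantities. -/
theorem averageLP_eq (X D : ℝ) : averageLP X D =
    (((∑ d ∈ oddSquarefree D, 2 * smoothSum d * eulerInv ⌊X⌋₊ d) /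
      (oddSquarefree D).card : ℝ) : ℂ) := by
  have h : ∑ d ∈ oddSquarefree D, centralValue d * (eulerPart X d)⁻¹ =
      ((∑ d ∈ oddSquarefree D, 2 * smoothSum d * eulerInv ⌊X⌋₊ d : ℝ) : ℂ) := by
    rw [Complex.ofReal_sum]
    refine Finset.sum_congr rfl fun d hd => ?_
    obtain ⟨_, ho, hsq⟩ := Finset.mem_filter.1 hd
    rw [centralValue_eq ho hsq, (summable_and_eulerPart_inv_eq_tsum X d).2, ← Complex.ofReal_mul]
    rfl
  rw [averageLP, h]
  push_cast
  ring

/-- The average differs from half the model product times `log D` by an explicit error. -/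
theorem exists_abs_average_sub_le {η : ℝ} (hη : 0 < η) (hη4 : η ≤ 1 / 4) : ∃ C : ℝ, 0 < C ∧
    ∀ (N : ℕ) (D : ℝ), 3 ≤ N → 1 ≤ D →
    |(∑ d ∈ oddSquarefree D, 2 * smoothSum d * eulerInv N d) / (oddSquarefree D).card -
      1 / 2 * (modelProduct N * Real.log D)| ≤
      C * (D ^ (-(η / 128)) * Real.exp (100 * (N : ℝ) ^ (1 / 2 + η)) + 1 + Real.log N ^ 17 +
        modelProduct N * ((N : ℝ) ^ (-(1 / 8) : ℝ) * Real.log (8 * D))) := by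
  obtain ⟨C₁, hC₁, h₁⟩ := exists_abs_moment_sub_le hη hη4
  obtain ⟨C₂, hC₂, h₂⟩ := exists_abs_sum_main_sub_le
  refine ⟨8 * (C₁ + C₂), by positivity, fun N D hN hD => ?_⟩
  have hD0 : 0 < D := by linarith
  have hG := modelProduct_pos N
  have hG1 := modelProduct_le_one N
  set G := modelProduct N
  -- the number of discriminants has the order of magnitude `D`
  have hcard : D / 8 ≤ (oddSquarefree D).card := by
    have h1 := card_oddSquarefree_ge D
    have h2 := Nat.lt_floor_add_one D
    have h3 : (1 : ℝ) ≤ ⌊D⌋₊ := by exact_mod_cast Nat.le_floor (by exact_mod_cast hD)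
    linarith
  have hcard0 : (0 : ℝ) < (oddSquarefree D).card := by linarith
  have hlogN : 0 ≤ Real.log N := Real.log_natCast_nonneg N
  have hlog8D : 0 ≤ Real.log (8 * D) := Real.log_nonneg (by linarith)
  set E := D ^ (-(η / 128)) * Real.exp (100 * (N : ℝ) ^ (1 / 2 + η)) with hE
  set F := G * ((N : ℝ) ^ (-(1 / 8) : ℝ) * Real.log (8 * D)) with hF
  have hE0 : 0 ≤ E := by positivity
  have hF0 : 0 ≤ F := by positivity
  have hL0 : 0 ≤ Real.log N ^ 17 := by positivity
  set S := ∑ d ∈ oddSquarefree D, 2 * smoothSum d * eulerInv N d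
  set T := ∑ d ∈ oddSquarefree D, Real.log (8 * d) * (coprimeDensity d * diagProduct N d)
  have h3 : |S - 1 / 2 * T| ≤ C₁ * (D * (E + 1 + Real.log N ^ 17)) := by
    refine (h₁ N D hN hD).trans ?_
    have e1 : D ^ (1 - η / 128) = D * D ^ (-(η / 128)) := by
      rw [sub_eq_add_neg, Real.rpow_add hD0, Real.rpow_one]
    have e2 : D ^ (31 / 32 : ℝ) ≤ D := by
      calc _ ≤ D ^ (1 : ℝ) := Real.rpow_le_rpow_of_exponent_le hD (by norm_num)
        _ = D := Real.rpow_one D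
    rw [e1]
    refine mul_le_mul_of_nonneg_left ?_ hC₁.le
    rw [hE]
    linarith
  have h4 : |T - G * ((oddSquarefree D).card * Real.log D)| ≤ C₂ * (D * (1 + F)) := by
    refine (h₂ N D (by omega) hD).trans ?_
    refine mul_le_mul_of_nonneg_left ?_ hC₂.le
    have : G * D ≤ 1 * D := mul_le_mul_of_nonneg_right hG1 hD0.le
    rw [hF]
    linarith
  have h5 : |S - 1 / 2 * (G * Real.log D) * (oddSquarefree D).card| ≤
      (C₁ + C₂) * (D * (E + 1 + Real.log N ^ 17 + F)) := by
    have e : S - 1 / 2 * (G * Real.log D) * (oddSquarefree D).card = (S - 1 / 2 * T) +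
        1 / 2 * (T - G * ((oddSquarefree D).card * Real.log D)) := by ring
    have h6 : |1 / 2 * (T - G * ((oddSquarefree D).card * Real.log D))| ≤ C₂ * (D * (1 + F)) := by
      rw [abs_mul, abs_of_pos (by norm_num : (0 : ℝ) < 1 / 2)]
      have := abs_nonneg (T - G * ((oddSquarefree D).card * Real.log D))
      linarith
    have h7 : 0 ≤ C₁ * (D * F) := by positivity
    have h8 : 0 ≤ C₂ * (D * (E + Real.log N ^ 17)) := by positivity
    rw [e]
    refine ((abs_add_le _ _).trans (add_le_add h3 h6)).trans ?_
    linarith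
  rw [div_sub' hcard0.ne', abs_div, abs_of_pos hcard0, div_le_iff₀ hcard0,
    mul_comm ((oddSquarefree D).card : ℝ)]
  refine h5.trans ?_
  have h9 : D ≤ 8 * (oddSquarefree D).card := by linarith
  calc _ ≤ (C₁ + C₂) * (8 * (oddSquarefree D).card * (E + 1 + Real.log N ^ 17 + F)) := by gcongr
    _ = _ := by ring

section Limits

variable {ι : Type*} {l : Filter ι} {X D : ι → ℝ}

/-- If `X ≪ (log D) ^ 2`, then powers of `log X` are negligible against `log D`. -/
theorem tendsto_log_pow_div_log (hX : Tendsto X l atTop) (hD : Tendsto D l atTop)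
    (hXD : X =O[l] fun i => Real.log (D i) ^ (2 : ℝ)) (k : ℕ) :
    Tendsto (fun i => Real.log (X i) ^ k / Real.log (D i)) l (nhds 0) := by
  have hlogD : Tendsto (fun i => Real.log (D i)) l atTop := Real.tendsto_log_atTop.comp hD
  have h1 : (fun i => Real.log (X i) ^ k) =o[l] fun i => X i ^ (1 / 2 : ℝ) := by
    have h2 := (isLittleO_log_rpow_rpow_atTop (k : ℝ) (show (0 : ℝ) < 1 / 2 by norm_num)).comp_tendsto hX
    refine h2.congr_left fun i => ?_
    simp only [Function.comp_apply, Real.rpow_natCast]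
  have h2 : (fun i => X i ^ (1 / 2 : ℝ)) =O[l] fun i => Real.log (D i) := by
    have h3 := hXD.rpow (show (0 : ℝ) ≤ 1 / 2 by norm_num)
      ((hlogD.eventually_ge_atTop 0).mono fun i hi => Real.rpow_nonneg hi _)
    refine h3.congr' EventuallyEq.rfl ?_
    filter_upwards [hlogD.eventually_ge_atTop 0] with i hi
    rw [← Real.rpow_mul hi]
    norm_num
  exact (h1.trans_isBigO h2).tendsto_div_nhds_zero

/-- For `X ≪ (log D) ^ (2 - δ)` the exponential in the error term is smaller than a power
of `D`. -/
theorem eventually_rpow_mul_exp_le {δ : ℝ} (hδ : 0 < δ)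
    (hX : Tendsto X l atTop) (hD : Tendsto D l atTop)
    (hXD : X =O[l] fun i => Real.log (D i) ^ (2 - δ)) :
    ∀ᶠ i in l, D i ^ (-(δ / 8 / 128)) * Real.exp (100 * (⌊X i⌋₊ : ℝ) ^ (1 / 2 + δ / 8)) ≤ 1 := by
  have hlogD : Tendsto (fun i => Real.log (D i)) l atTop := Real.tendsto_log_atTop.comp hD
  have h1 : (fun i => X i ^ (1 / 2 + δ / 8)) =o[l] fun i => Real.log (D i) := by
    have h3 := hXD.rpow (show 0 ≤ 1 / 2 + δ / 8 by positivity)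
      ((hlogD.eventually_ge_atTop 0).mono fun i hi => Real.rpow_nonneg hi _)
    refine h3.trans_isLittleO ?_
    -- `(2 - δ) * (1 / 2 + δ / 8) < 1`
    have ha : 0 < 1 - (2 - δ) * (1 / 2 + δ / 8) := by nlinarith
    have h4 : (fun x : ℝ => x ^ ((2 - δ) * (1 / 2 + δ / 8))) =o[atTop] fun x : ℝ => x := by
      refine isLittleO_of_tendsto' ?_ ((tendsto_rpow_neg_atTop ha).congr' ?_)
      · filter_upwards [eventually_gt_atTop 0] with x hx h
        exact absurd h hx.ne'
      · filter_upwards [eventually_gt_atTop 0] with x hx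
        rw [neg_sub, Real.rpow_sub_one hx.ne']
    refine (h4.comp_tendsto hlogD).congr' ?_ EventuallyEq.rfl
    filter_upwards [hlogD.eventually_ge_atTop 0] with i hi
    simp only [Function.comp_apply]
    rw [Real.rpow_mul hi]
  have h2 := h1.bound (show 0 < δ / 8 / 128 / 100 by positivity)
  filter_upwards [h2, hX.eventually_ge_atTop 0, hD.eventually_gt_atTop 0,
    hlogD.eventually_ge_atTop 0] with i hi hXi hDi hlogi
  rw [Real.norm_of_nonneg (by positivity), Real.norm_of_nonneg hlogi] at hi
  rw [Real.rpow_def_of_pos hDi, ← Real.exp_add]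
  refine Real.exp_le_one_iff.2 ?_
  have h3 : (⌊X i⌋₊ : ℝ) ^ (1 / 2 + δ / 8) ≤ X i ^ (1 / 2 + δ / 8) :=
    Real.rpow_le_rpow (Nat.cast_nonneg _) (Nat.floor_le hXi) (by positivity)
  linarith

/-- The quotient of the average by its asymptotic value tends to one, when `δ ≤ 1`. -/
theorem tendsto_average_div {δ : ℝ} (hδ : 0 < δ) (hδ1 : δ ≤ 1)
    (hX : Tendsto X l atTop) (hD : Tendsto D l atTop)
    (hXD : X =O[l] fun i => Real.log (D i) ^ (2 - δ)) :
    Tendsto (fun i => (∑ d ∈ oddSquarefree (D i), 2 * smoothSum d * eulerInv ⌊X i⌋₊ d) /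
      (oddSquarefree (D i)).card / ((1 / Real.sqrt 2) *
        (Real.log (D i) / (Real.exp Real.eulerMascheroniConstant * Real.log (X i))))) l
      (nhds 1) := by
  obtain ⟨C, hC, h⟩ := exists_abs_average_sub_le (show 0 < δ / 8 by positivity) (by linarith)
  have hlogD : Tendsto (fun i => Real.log (D i)) l atTop := Real.tendsto_log_atTop.comp hD
  have hlogX : Tendsto (fun i => Real.log (X i)) l atTop := Real.tendsto_log_atTop.comp hX
  have hXD2 : X =O[l] fun i => Real.log (D i) ^ (2 : ℝ) := by
    refine hXD.trans (IsBigO.of_bound 1 ?_)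
    filter_upwards [hlogD.eventually_ge_atTop 1] with i hi
    rw [one_mul, Real.norm_of_nonneg (by positivity), Real.norm_of_nonneg (by positivity)]
    exact Real.rpow_le_rpow_of_exponent_le hi (by linarith)
  set S : ι → ℝ := fun i => (∑ d ∈ oddSquarefree (D i), 2 * smoothSum d * eulerInv ⌊X i⌋₊ d) /
      (oddSquarefree (D i)).card with hS
  set G : ι → ℝ := fun i => modelProduct ⌊X i⌋₊ with hG
  set c : ℝ := Real.sqrt 2 * Real.exp Real.eulerMascheroniConstant with hc
  have hc0 : 0 < c := by positivity
  have hGlim : Tendsto (fun i => G i * Real.log (X i)) l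
      (nhds (Real.sqrt 2 * Real.exp (-Real.eulerMascheroniConstant))) :=
    tendsto_modelProduct_mul_log.comp hX
  -- the total error, relative to `log D / log X`
  have hκ : Tendsto (fun i => (⌊X i⌋₊ : ℝ) ^ (-(1 / 8) : ℝ)) l (nhds 0) :=
    ((tendsto_rpow_neg_atTop (show (0 : ℝ) < 1 / 8 by norm_num)).comp
      (tendsto_natCast_atTop_atTop.comp tendsto_nat_floor_atTop)).comp hX
  have hratio : Tendsto (fun i => Real.log (8 * D i) / Real.log (D i)) l (nhds 1) := by
    have h1 : Tendsto (fun i => Real.log 8 / Real.log (D i) + 1) l (nhds (0 + 1)) :=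
      (hlogD.const_div_atTop _).add_const 1
    rw [zero_add] at h1
    refine h1.congr' ?_
    filter_upwards [hD.eventually_gt_atTop 1, hlogD.eventually_gt_atTop 0] with i hi hlogi
    rw [Real.log_mul (by norm_num) (by linarith)]
    field_simp
  have herr : Tendsto (fun i => C * c * (3 * (Real.log (X i) ^ 18 / Real.log (D i)) +
      G i * Real.log (X i) * ((⌊X i⌋₊ : ℝ) ^ (-(1 / 8) : ℝ) *
        (Real.log (8 * D i) / Real.log (D i))))) l (nhds 0) := by
    have h1 := (((tendsto_log_pow_div_log hX hD hXD2 18).const_mul 3).add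
      (hGlim.mul (hκ.mul hratio))).const_mul (C * c)
    simpa using h1
  have hdiff : Tendsto (fun i => (S i - 1 / 2 * (G i * Real.log (D i))) *
      (c * Real.log (X i) / Real.log (D i))) l (nhds 0) := by
    refine squeeze_zero_norm' ?_ herr
    filter_upwards [eventually_rpow_mul_exp_le hδ hX hD hXD, hX.eventually_ge_atTop 3,
      hD.eventually_ge_atTop 1, hlogX.eventually_ge_atTop 1, hlogD.eventually_gt_atTop 0] with
      i h1 hXi hDi hlXi hlDi
    have hN : 3 ≤ ⌊X i⌋₊ := Nat.le_floor (by exact_mod_cast hXi)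
    have hN0 : (0 : ℝ) < ⌊X i⌋₊ := by exact_mod_cast (by omega : 0 < ⌊X i⌋₊)
    have h2 := h ⌊X i⌋₊ (D i) hN hDi
    have h3 : Real.log ⌊X i⌋₊ ^ 17 ≤ Real.log (X i) ^ 17 := by
      have := Real.log_natCast_nonneg ⌊X i⌋₊
      have := Real.log_le_log hN0 (Nat.floor_le (by linarith : 0 ≤ X i))
      gcongr
    have h4 : 1 ≤ Real.log (X i) ^ 17 := one_le_pow₀ hlXi
    have hcl : 0 ≤ c * Real.log (X i) / Real.log (D i) := by positivity
    rw [Real.norm_eq_abs, abs_mul, abs_of_nonneg hcl]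
    set F := G i * ((⌊X i⌋₊ : ℝ) ^ (-(1 / 8) : ℝ) * Real.log (8 * D i)) with hF
    have h5 : |S i - 1 / 2 * (G i * Real.log (D i))| ≤ C * (3 * Real.log (X i) ^ 17 + F) := by
      refine h2.trans (mul_le_mul_of_nonneg_left ?_ hC.le)
      linarith
    refine (mul_le_mul_of_nonneg_right h5 hcl).trans (le_of_eq ?_)
    rw [hF]
    field_simp
  -- `½ * √2 * √2 = 1`
  have hmain : Tendsto (fun i => 1 / 2 * c * (G i * Real.log (X i))) l (nhds 1) := by
    have h1 := hGlim.const_mul (1 / 2 * c)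
    have e : 1 / 2 * c * (Real.sqrt 2 * Real.exp (-Real.eulerMascheroniConstant)) = 1 := by
      have h2 : Real.sqrt 2 * Real.sqrt 2 = 2 := Real.mul_self_sqrt (by norm_num)
      have h3 : Real.exp Real.eulerMascheroniConstant *
          Real.exp (-Real.eulerMascheroniConstant) = 1 := by
        rw [← Real.exp_add, add_neg_cancel, Real.exp_zero]
      calc _ = 1 / 2 * (Real.sqrt 2 * Real.sqrt 2) * (Real.exp Real.eulerMascheroniConstant *
            Real.exp (-Real.eulerMascheroniConstant)) := by rw [hc]; ring
        _ = 1 := by rw [h2, h3]; norm_num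
    rwa [e] at h1
  have hsum := hdiff.add hmain
  rw [zero_add] at hsum
  refine hsum.congr' ?_
  filter_upwards [hlogX.eventually_gt_atTop 0, hlogD.eventually_gt_atTop 0] with i hlXi hlDi
  have h2 : (0 : ℝ) < Real.sqrt 2 := by positivity
  have he := Real.exp_pos Real.eulerMascheroniConstant
  rw [hc]
  field_simp
  ring

end Limits

/-- The parameters `X` and `D` tend to infinity along an arbitrary filter, subject only to
`X ≪ (log D)^(2 - δ)`; this includes the joint limit over all such pairs `(X, D)`. -/
theorem theoremS3 (δ : ℝ) (hδ : 0 < δ) {ι : Type*} (l : Filter ι) (X D : ι → ℝ)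
    (hX : Tendsto X l atTop) (hD : Tendsto D l atTop)
    (hXD : X =O[l] fun i => (Real.log (D i)) ^ (2 - δ)) :
    (fun i => averageLP (X i) (D i)) ~[l]
      fun i => (((1 / Real.sqrt 2) *
        (Real.log (D i) / (Real.exp Real.eulerMascheroniConstant * Real.log (X i))) : ℝ) : ℂ) := by
  have hlogD : Tendsto (fun i => Real.log (D i)) l atTop := Real.tendsto_log_atTop.comp hD
  have hlogX : Tendsto (fun i => Real.log (X i)) l atTop := Real.tendsto_log_atTop.comp hX
  -- the hypothesis only becomes weaker when `δ` is replaced by `min δ 1`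
  have hXD' : X =O[l] fun i => Real.log (D i) ^ (2 - min δ 1) := by
    refine hXD.trans (IsBigO.of_bound 1 ?_)
    filter_upwards [hlogD.eventually_ge_atTop 1] with i hi
    rw [one_mul, Real.norm_of_nonneg (by positivity), Real.norm_of_nonneg (by positivity)]
    exact Real.rpow_le_rpow_of_exponent_le hi (by linarith [min_le_left δ 1])
  have h := tendsto_average_div (lt_min hδ one_pos) (min_le_right δ 1) hX hD hXD'
  have hne : ∀ᶠ i in l, (((1 / Real.sqrt 2) * (Real.log (D i) /
      (Real.exp Real.eulerMascheroniConstant * Real.log (X i))) : ℝ) : ℂ) ≠ 0 := by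
    filter_upwards [hlogX.eventually_gt_atTop 0, hlogD.eventually_gt_atTop 0] with i hlXi hlDi
    exact Complex.ofReal_ne_zero.2 (by positivity)
  rw [isEquivalent_iff_tendsto_one hne]
  refine ((Complex.continuous_ofReal.tendsto 1).comp h).congr fun i => ?_
  rw [Function.comp_apply, Pi.div_apply, averageLP_eq, ← Complex.ofReal_div]
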